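/- **Setting.** Let $d=2^n$. An observable $O$ on $n$ qubits is *implemented with at most $F$ gates* if $O=V^\dagger\Lambda V$, where $V$ is a circuit of at most $F$ one- and two-qubit unitary gates and $\Lambda$ is a real diagonal matrix in the computational basis; measuring $O$ means applying $V$, measuring in the computational basis with outcome $b$, and reporting the label $\Lambda_{bb}$. The computational model is a randomized random access machine with natural-number registers, real registers and one $n$-qubit quantum register. Its elementary operations, of unit time, are arithmetic, tests, loop control, indirect addressing, drawing a uniform integer in a given range, rounding a real up to an integer, integer base-2 logarithm, the gates $H$, $S$, CNOT, measuring one qubit, applying one gate of the circuit of a given observable, and reading the length or one label of the given implementations (a read-only input); resetting the quantum register to $|0^n\rangle$ or loading a fresh copy of the unknown state into it takes time $n+1$. Classical space is the number of registers used. **QCQC estimator** for observables $O_1,\dots,O_M$ with $K$ groups of $L$ copies, $N=KL$. For each copy $i\in[N]$ of $\rho$ draw a uniformly random $n$-qubit Clifford unitary $U_i$, apply it, and measure in the computational basis with outcome $b_i$. For each $j\in[M]$, prepare $U_i^\dagger|b_i\rangle$ and measure $O_j$, in $m=2(d+1)$ independent shots; let $X_{i,j}$ be the average of the $m$ outcomes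 and $Y_{i,j}=(d+1)X_{i,j}-\operatorname{tr}(O_j)$. The estimate $\hat o_j$ is the median over the $K$ groups of the group averages of $Y_{i,j}$. **Theorem.** There are a single program for this machine and constants $C,k$ such that the following holds for all $n\ge 0$, $M\ge 1$, $F\ge 1$, $\epsilon>0$, $\delta\in(0,1)$ and all observables $O_1,\dots,O_M$ on $n$ qubits, each implemented with at most $F$ gates, with $\max_j\operatorname{tr}(O_j^2)=B$. On input $n,M,\epsilon,\delta$ and the implementations, and given copies of an unknown state $\rho$, the program outputs $\hat o_1,\dots,\hat o_M$ such that, for every state $\rho$, with probability at least $1-\delta$, $$|\operatorname{tr}(O_j\rho)-\hat o_j|\le\epsilon\quad\text{for all } j\in[M].$$ In every run it uses at most * $C\,\frac{B}{\epsilon^2}\,(1+\log\frac M\delta)$ copies of $\rho$, * total (quantum and classical) time $C\,d\,\max(1,\frac{B}{\epsilon^2})\,F\,M\,(1+\log\frac{dM}{\delta})^k$, * $C\big((1+\log d+\log M)^k+M(1+\log\frac M\delta)\big)$ classical registers, and all natural numbers that it stores are at most $\big(2d\max(1,\frac B{\epsilon^2})FM/\delta\big)^k$. Moreover, if $\epsilon^2<B$,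 then there are $K,L\ge1$, independent of $\rho$, such that the program uses exactly $KL$ copies and $(\hat o_1,\dots,\hat o_M)$ has the law of the QCQC estimator with $K$ groups of $L$ copies. In particular, for fixed $\epsilon,\delta$ and for $M\ge 2$, $B\ge 1$, it uses $O(B\log M)$ copies, $\tilde O(dBFM)$ time and $O(\operatorname{polylog}(d,M)+M\log M)$ classical space. -/

import Mathlib

open scoped ComplexOrder

noncomputable section

/-! ## Linear algebra of `n` qubits

Computational basis states are bit strings `Fin n → Bool` (`false` is `0`), operators are complex
matrices indexed by them, so the dimension is `d = 2 ^ n`. -/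

/-- Bit strings of length `n`. -/
abbrev Bits (n : ℕ) : Type := Fin n → Bool

/-- Operators on `n` qubits. -/
abbrev Op (n : ℕ) : Type := Matrix (Bits n) (Bits n) ℂ

/-- The projector on the computational basis state `b`. -/
def basisProj {n : ℕ} (b : Bits n) : Op n :=
  Matrix.of fun x y => if x = b ∧ y = b then 1 else 0

/-- The operator that acts as `A` on qubit `q` and as the identity on the other qubits. -/
def local1 {n : ℕ} (q : Fin n) (A : Matrix Bool Bool ℂ) : Op n :=
  Matrix.of fun x y => if ∀ i, i ≠ q → x i = y i then A (x q) (y q) else 0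

/-- The operator that acts as `A` on the ordered pair of qubits `(q, r)` and as the identity on the
other qubits. -/
def local2 {n : ℕ} (q r : Fin n) (A : Matrix (Bool × Bool) (Bool × Bool) ℂ) : Op n :=
  Matrix.of fun x y => if ∀ i, i ≠ q → i ≠ r → x i = y i then A (x q, x r) (y q, y r) else 0

/-- Density operators: positive semidefinite of trace one. -/
def IsState {n : ℕ} (ρ : Op n) : Prop := ρ.PosSemidef ∧ ρ.trace = 1

/-! ## Elementary gates, circuits, observables given by circuits -/

def hadamard : Matrix Bool Bool ℂ :=
  Matrix.of fun x y => if x && y then -((Real.sqrt 2 : ℂ)⁻¹) else (Real.sqrt 2 : ℂ)⁻¹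

def phaseGate : Matrix Bool Bool ℂ :=
  Matrix.of fun x y => if x = y then (if x then Complex.I else 1) else 0

/-- The first qubit is the control. -/
def cnot : Matrix (Bool × Bool) (Bool × Bool) ℂ :=
  Matrix.of fun x y => if x = (y.1, xor y.1 y.2) then 1 else 0

/-- A quantum gate: an arbitrary unitary on one qubit or on two distinct qubits. -/
inductive Gate (n : ℕ) : Type
  | one (q : Fin n) (u : Matrix.unitaryGroup Bool ℂ) : Gate n
  | two (q r : Fin n) (hqr : q ≠ r) (u : Matrix.unitaryGroup (Bool × Bool) ℂ) : Gate n

def Gate.toOp {n : ℕ} : Gate n → Op n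
  | .one q u => local1 q u.1
  | .two q r _ u => local2 q r u.1

/-- The unitary of a circuit; the head of the list is applied first. -/
def circuitOp {n : ℕ} : List (Gate n) → Op n
  | [] => 1
  | g :: gs => circuitOp gs * g.toOp

/-- An implementation of an observable: run the circuit, measure in the computational basis, and
report the real number with which the resulting bit string is labelled. -/
structure ObsCircuit (n : ℕ) : Type where
  gates : List (Gate n)
  label : Bits n → ℝ

/-- The observable measured by an implementation is `V† Λ V` with `V` the unitary of the circuit and
`Λ` the diagonal operator of the labels. -/
def ObsCircuit.Implements {n : ℕ} (A : ObsCircuit n) (O : Op n) : Prop :=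
  O = (circuitOp A.gates).conjTranspose *
    Matrix.diagonal (fun b => (A.label b : ℂ)) * circuitOp A.gates

/-! ## Discrete probability -/

/-- The distribution with the given weights. (The alternative branch is never met by weights that
come from the Born rule for a density operator.) -/
def weightsPMF {α : Type} [Fintype α] [Inhabited α] (w : α → ENNReal) : PMF α :=
  open Classical in if h : ∑ a, w a = 1 then PMF.ofFintype w h else PMF.pure default

/-- Born rule: outcome of a measurement of all qubits of `σ` in the computational basis. -/
def born {n : ℕ} (σ : Op n) : PMF (Bits n) :=
  weightsPMF fun b => ENNReal.ofReal (σ b b).re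

/-- Independent samples, the `i`-th one from `p i`. -/
def indep {α : Type} : {k : ℕ} → (Fin k → PMF α) → PMF (Fin k → α)
  | 0, _ => PMF.pure Fin.elim0
  | _ + 1, p => (p 0).bind fun a =>
      (indep fun i => p i.succ).map fun f => (Fin.cons a f : Fin _ → α)

/-! ## The Clifford group -/

/-- The letters `I, X, Y, Z`. -/
abbrev PauliLetter : Type := Fin 4

def PauliLetter.toMatrix : PauliLetter → Matrix Bool Bool ℂ
  | 0 => 1
  | 1 => Matrix.of fun x y => if x = y then 0 else 1
  | 2 => Matrix.of fun x y => if x = y then 0 else if x then Complex.I else -Complex.I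
  | 3 => Matrix.of fun x y => if x = y then (if x then -1 else 1) else 0

/-- The tensor product of single-qubit Pauli operators given by a Pauli string. -/
def pauliOp {n : ℕ} (p : Fin n → PauliLetter) : Op n :=
  Matrix.of fun x y => ∏ i, PauliLetter.toMatrix (p i) (x i) (y i)

/-- Conjugation by the unitary `U` sends each Pauli string `p` to the Pauli string `(f p).2`, with a
minus sign if `(f p).1` is `true`. -/
def ActsOnPaulis {n : ℕ} (U : Matrix.unitaryGroup (Bits n) ℂ)
    (f : (Fin n → PauliLetter) → Bool × (Fin n → PauliLetter)) : Prop :=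
  ∀ p, U.1 * pauliOp p * U.1.conjTranspose =
    (if (f p).1 then (-1 : ℂ) else 1) • pauliOp (f p).2

/-- The Clifford group modulo global phases. The Clifford group consists of the unitaries that
conjugate Pauli strings to Pauli strings up to sign; since the Pauli strings span all operators, the
action on them determines the unitary up to a global phase, and conversely, so that an element of
the group modulo phases is the same as such an action. -/
def Clifford (n : ℕ) : Type :=
  {f : (Fin n → PauliLetter) → Bool × (Fin n → PauliLetter) //
    ∃ U : Matrix.unitaryGroup (Bits n) ℂ, ActsOnPaulis U f}

/-- A unitary that represents the given element (well defined up to a global phase). -/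
def Clifford.toUnitary {n : ℕ} (c : Clifford n) : Op n := (Classical.choose c.2).1

instance (n : ℕ) : Nonempty (Clifford n) :=
  ⟨⟨fun p => (false, p), 1, fun p => by simp⟩⟩

instance (n : ℕ) : Finite (Clifford n) := Subtype.finite

/-- A uniformly random element of the Clifford group (modulo global phases). -/
def randomClifford (n : ℕ) : PMF (Clifford n) :=
  letI := Fintype.ofFinite (Clifford n)
  PMF.uniformOfFintype (Clifford n)

/-! ## The QCQC estimator with Clifford measurements -/

/-- First phase and re-preparation: draw a random Clifford unitary `U`, apply it to a copy of `ρ`,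
measure in the computational basis with outcome `b`, and re-prepare the state `U†|b⟩⟨b|U`. -/
def snapshot {n : ℕ} (ρ : Op n) : PMF (Op n) :=
  (randomClifford n).bind fun c =>
    (born (c.toUnitary * ρ * c.toUnitary.conjTranspose)).map fun b =>
      c.toUnitary.conjTranspose * basisProj b * c.toUnitary

/-- A single measurement of the state `σ` with the observable implemented by `A`. -/
def ObsCircuit.shot {n : ℕ} (A : ObsCircuit n) (σ : Op n) : PMF ℝ :=
  (born (circuitOp A.gates * σ * (circuitOp A.gates).conjTranspose)).map A.label

/-- The rescaled output `Y = (d + 1) X - tr O`, where `X` is the average of `m = 2 (d + 1)` shots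
on the state `σ`. -/
def rescaledOutput {n : ℕ} (A : ObsCircuit n) (O σ : Op n) : PMF ℝ :=
  (indep fun _ : Fin (2 * (2 ^ n + 1)) => A.shot σ).map fun x =>
    ((2 : ℝ) ^ n + 1) * ((∑ l, x l) / (2 * ((2 : ℝ) ^ n + 1))) - O.trace.re

/-- The outputs `(Y_{i,1}, …, Y_{i,M})` obtained from one copy of `ρ`: all observables are measured
on the same snapshot. -/
def outputsOfCopy {n M : ℕ} (A : Fin M → ObsCircuit n) (O : Fin M → Op n) (ρ : Op n) :
    PMF (Fin M → ℝ) :=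
  (snapshot ρ).bind fun σ => indep fun j => rescaledOutput (A j) (O j) σ

/-- The median of `K` real numbers (the mean of the two middle ones if `K` is even). -/
def median {K : ℕ} (x : Fin K → ℝ) : ℝ :=
  let s := (List.ofFn x).insertionSort (· ≤ ·)
  (s.getD ((K - 1) / 2) 0 + s.getD (K / 2) 0) / 2

/-- The law of the estimates: the median of means, with `K` groups of `L` copies each. -/
def qcqcLaw {n M : ℕ} (A : Fin M → ObsCircuit n) (O : Fin M → Op n) (ρ : Op n) (K L : ℕ) :
    PMF (Fin M → ℝ) :=
  (indep fun _ : Fin K => indep fun _ : Fin L => outputsOfCopy A O ρ).map fun y j =>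
    median fun g => (∑ l, y g l j) / (L : ℝ)

/-! ## The machine

A random access machine with natural-number registers, real registers and a quantum register of `n`
qubits. The only access to the unknown state is the instruction that loads a fresh copy of it into
the quantum register. The implementations of the observables are a read-only input. Every
instruction takes one unit of time, except that initializing the `n`-qubit register takes `n + 1`
units. -/

/-- The register with a fixed address, or the one whose address is in a fixed natural-number
register (indirect addressing). -/
inductive Ref : Type
  | dir (a : ℕ) : Ref
  | ind (a : ℕ) : Ref

inductive NatOp : Type
  | add | sub | mul | div | mod

inductive RealOp : Type
  | add | sub | mul | div

def NatOp.eval : NatOp → ℕ → ℕ → ℕ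
  | .add, a, b => a + b
  | .sub, a, b => a - b
  | .mul, a, b => a * b
  | .div, a, b => a / b
  | .mod, a, b => a % b

def RealOp.eval : RealOp → ℝ → ℝ → ℝ
  | .add, a, b => a + b
  | .sub, a, b => a - b
  | .mul, a, b => a * b
  | .div, a, b => a / b

/-- Instructions. The register that is written, if any, comes first. -/
inductive Instr : Type
  /-- write a constant -/
  | natConst (t : Ref) (c : ℕ) : Instr
  | natOp (o : NatOp) (t a b : Ref) : Instr
  /-- position of the leading binary digit -/
  | log2 (t a : Ref) : Instr
  /-- a uniformly random element of `{0, …, a}` -/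
  | rand (t a : Ref) : Instr
  | realConst (t : Ref) (c : ℚ) : Instr
  | realOp (o : RealOp) (t a b : Ref) : Instr
  /-- conversion of a natural-number register -/
  | realOfNat (t a : Ref) : Instr
  /-- natural-number register `t` gets the ceiling of the real register `a` -/
  | ceil (t a : Ref) : Instr
  /-- the number of gates of the implementation of observable `j` -/
  | obsLength (t j : Ref) : Instr
  /-- real register `t` gets the label of the bit string that the binary digits of `b` form, in the
  implementation of observable `j` -/
  | obsLabel (t j b : Ref) : Instr
  /-- apply gate number `k` of the implementation of observable `j` -/
  | obsGate (j k : Ref) : Instr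
  /-- quantum register gets a fresh copy of the unknown state -/
  | loadCopy : Instr
  /-- quantum register gets the all-zero basis state -/
  | loadZero : Instr
  | gateH (q : Ref) : Instr
  | gateS (q : Ref) : Instr
  | gateCNOT (q r : Ref) : Instr
  /-- measure qubit `q` in the computational basis and write the outcome -/
  | measure (t q : Ref) : Instr
  /-- output the real register `a` as the estimate for observable `j` -/
  | output (j a : Ref) : Instr

/-- Programs. In `loop a P`, the body is executed as many times as the natural-number register `a`
says when the loop is entered. -/
inductive Prog : Type
  | instr (i : Instr) : Prog
  | seq (P Q : Prog) : Prog
  | ifNatLt (a b : Ref) (P Q : Prog) : Prog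
  | ifRealLt (a b : Ref) (P Q : Prog) : Prog
  | loop (a : Ref) (P : Prog) : Prog

/-- Configurations of the machine, with counters for the resources used so far: the time, the number
of copies of the unknown state, the number of natural-number and of real registers in use (one more
than the highest address that was ever written), and the largest natural number that was ever
written. -/
structure Config (n : ℕ) : Type where
  natReg : ℕ → ℕ
  realReg : ℕ → ℝ
  out : ℕ → ℝ
  qreg : Op n
  time : ℕ
  copies : ℕ
  natTop : ℕ
  realTop : ℕ
  maxNat : ℕ

namespace Config

variable {n : ℕ}

/-- Number of classical registers used. -/
def space (s : Config n) : ℕ := s.natTop + s.realTop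

def addr (s : Config n) : Ref → ℕ
  | .dir a => a
  | .ind a => s.natReg a

def nat (s : Config n) (a : Ref) : ℕ := s.natReg (s.addr a)

def real (s : Config n) (a : Ref) : ℝ := s.realReg (s.addr a)

def tick (s : Config n) (k : ℕ) : Config n := { s with time := s.time + k }

def setNat (s : Config n) (t : Ref) (v : ℕ) : Config n :=
  { s with
    natReg := Function.update s.natReg (s.addr t) v
    natTop := max s.natTop (s.addr t + 1)
    maxNat := max s.maxNat v }

def setReal (s : Config n) (t : Ref) (v : ℝ) : Config n :=
  { s with
    realReg := Function.update s.realReg (s.addr t) v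
    realTop := max s.realTop (s.addr t + 1) }

def setOut (s : Config n) (j : ℕ) (v : ℝ) : Config n :=
  { s with out := Function.update s.out j v }

/-- Apply an operator `G` to the quantum register. -/
def applyOp (s : Config n) (G : Op n) : Config n :=
  { s with qreg := G * s.qreg * G.conjTranspose }

/-- Measure qubit `q` in the computational basis: outcome `c` has probability
`p = tr (Π σ)`, with `Π` the projector on the basis states with bit `c` at `q`, the state collapses
to `Π σ Π / p`, and `c` is written to `t`. -/
def measure (s : Config n) (t : Ref) (q : Fin n) : PMF (Config n) :=
  (weightsPMF fun c : Bool =>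
    ENNReal.ofReal (∑ x : Bits n, if x q = c then (s.qreg x x).re else 0)).map fun c =>
      { s.setNat t c.toNat with
        qreg := Matrix.of fun x y =>
          if x q = c ∧ y q = c then
            s.qreg x y / ((∑ z : Bits n, if z q = c then (s.qreg z z).re else 0 : ℝ) : ℂ)
          else 0 }

end Config

/-- Effect of an instruction, apart from its time. Instructions that refer to a qubit, an observable
or a gate that does not exist do nothing (or write `0`). -/
def Instr.effect {n M : ℕ} (A : Fin M → ObsCircuit n) (ρ : Op n) (s : Config n) :
    Instr → PMF (Config n)
  | .natConst t c => PMF.pure (s.setNat t c)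
  | .natOp o t a b => PMF.pure (s.setNat t (o.eval (s.nat a) (s.nat b)))
  | .log2 t a => PMF.pure (s.setNat t (Nat.log 2 (s.nat a)))
  | .rand t a =>
      (PMF.uniformOfFintype (Fin (s.nat a + 1))).map fun v => s.setNat t v.val
  | .realConst t c => PMF.pure (s.setReal t (c : ℝ))
  | .realOp o t a b => PMF.pure (s.setReal t (o.eval (s.real a) (s.real b)))
  | .realOfNat t a => PMF.pure (s.setReal t (s.nat a : ℝ))
  | .ceil t a => PMF.pure (s.setNat t ⌈s.real a⌉₊)
  | .obsLength t j => PMF.pure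
      (s.setNat t (if h : s.nat j < M then (A ⟨s.nat j, h⟩).gates.length else 0))
  | .obsLabel t j b => PMF.pure
      (s.setReal t (if h : s.nat j < M then
        (A ⟨s.nat j, h⟩).label (fun i => (s.nat b).testBit i.val) else 0))
  | .obsGate j k => PMF.pure
      (if h : s.nat j < M then
        (match (A ⟨s.nat j, h⟩).gates[s.nat k]? with
          | some g => s.applyOp g.toOp
          | none => s)
      else s)
  | .loadCopy => PMF.pure { s with qreg := ρ, copies := s.copies + 1 }
  | .loadZero => PMF.pure { s with qreg := basisProj fun _ => false }
  | .gateH q => PMF.pure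
      (if h : s.nat q < n then s.applyOp (local1 ⟨s.nat q, h⟩ hadamard) else s)
  | .gateS q => PMF.pure
      (if h : s.nat q < n then s.applyOp (local1 ⟨s.nat q, h⟩ phaseGate) else s)
  | .gateCNOT q r => PMF.pure
      (if h : s.nat q < n ∧ s.nat r < n ∧ s.nat q ≠ s.nat r then
        s.applyOp (local2 ⟨s.nat q, h.1⟩ ⟨s.nat r, h.2.1⟩ cnot) else s)
  | .measure t q =>
      if h : s.nat q < n then s.measure t ⟨s.nat q, h⟩ else PMF.pure (s.setNat t 0)
  | .output j a => PMF.pure (s.setOut (s.nat j) (s.real a))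

/-- Time taken by an instruction on a machine with `n` qubits. -/
def Instr.cost (n : ℕ) : Instr → ℕ
  | .loadCopy => n + 1
  | .loadZero => n + 1
  | _ => 1

/-- `k`-fold repetition of a random transformation. -/
def repeatPMF {α : Type} (f : α → PMF α) : ℕ → α → PMF α
  | 0, s => PMF.pure s
  | k + 1, s => (f s).bind (repeatPMF f k)

/-- Execution of a program: the distribution of the final configuration. Each test and each entry of
a loop or of its body takes one unit of time. -/
def Prog.exec {n M : ℕ} (A : Fin M → ObsCircuit n) (ρ : Op n) : Prog → Config n → PMF (Config n)
  | .instr i, s => i.effect A ρ (s.tick (i.cost n))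
  | .seq P Q, s => (P.exec A ρ s).bind (Q.exec A ρ)
  | .ifNatLt a b P Q, s =>
      if s.nat a < s.nat b then P.exec A ρ (s.tick 1) else Q.exec A ρ (s.tick 1)
  | .ifRealLt a b P Q, s =>
      open Classical in
      if s.real a < s.real b then P.exec A ρ (s.tick 1) else Q.exec A ρ (s.tick 1)
  | .loop a P, s =>
      repeatPMF (fun s' => P.exec A ρ (s'.tick 1)) (s.nat a) (s.tick 1)

/-- Initial configuration: natural-number registers `0` and `1` hold the number `n` of qubits and
the number `M` of observables, real registers `0` and `1` hold the accuracy `ε` and the failure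
probability `δ`. -/
def initialConfig (n M : ℕ) (ε δ : ℝ) : Config n where
  natReg := fun a => if a = 0 then n else if a = 1 then M else 0
  realReg := fun a => if a = 0 then ε else if a = 1 then δ else 0
  out := fun _ => 0
  qreg := basisProj fun _ => false
  time := 0
  copies := 0
  natTop := 2
  realTop := 2
  maxNat := max n M

/-- The distribution of the final configuration of a program on an instance. -/
def Prog.run {n M : ℕ} (P : Prog) (A : Fin M → ObsCircuit n) (ε δ : ℝ) (ρ : Op n) :
    PMF (Config n) :=
  P.exec A ρ (initialConfig n M ε δ)

end

/-! Measuring in the basis `U†|b⟩` of a uniformly random Clifford `U` and re-preparing the outcome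
yields a random pure state `σ` whose first two moments are explicit. In the Pauli expansion, only
the strings in the stabilizer group of the basis (the image of the `I`/`Z` strings: `d` commuting
strings) contribute for a given `U`. So the moments depend only on how many Clifford elements have a
given string, or a given pair of strings, in their stabilizer group. The gates act transitively on
the non-identity strings and on pairs of distinct commuting non-identity strings; double counting
then gives the fractions `1/(d+1)` (`stabCount_self`) and `2/((d+1)(d+2))` (`stabCount_of_ne`),
while anticommuting pairs never occur. Consequently `(d+1) tr(Oσ) - tr O` has mean `tr(Oρ)` and
variance at most `3 tr O²`.

Estimating `tr(Oσ)` from `2(d+1)` shots adds at most `tr O²`, so one copy has variance at most `4 tr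
O²` (`expect_outputsOfCopy`). With `L = ⌈64B/ε²⌉` copies, Chebyshev bounds the failure probability
of a group average by `1/16`. The median of `2t+1` group averages fails only if `t+1` of them fail,
which has probability at most `2^{-(t+1)}`; `t = ⌊log₂⌈M/δ⌉⌋` makes the union bound over the `M`
observables work (`qcqcLaw_accurate`).

A random Clifford unitary is never stored. Only the basis matters, and it is produced by `n` random
sweeps. Consider the elements that map `Z_i`, for `i < k`, to `Z_i` times earlier `Z`s (`flagSet`).
For such an element `c`, the part of `c(Z_k)` from site `k` on is not trivial, and a list of at most
`3n` gates determined by that part reduces it to `Z_k`. This is a bijection between `flagSet n k`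
and pairs of a non-trivial tail and an element of `flagSet n (k+1)`. Hence a uniform element is `n`
independent uniform tails, followed by an element of `flagSet n n`; the latter permutes the
computational basis and does not change the law of the snapshot (`snapshot_eq_sampler`). The
resulting list of `O(n²)` gates is applied to the copy, the outcome is appended to it as bit flips,
and the inverse list prepares the snapshot from `|0…0⟩` for every shot.

The machine holds only this list and one sum of labels for each group and observable. It finds `B`
and the traces by running through the `d` labels of each observable. If `B ≤ ε²`, all labels have
modulus at most `ε`, so the estimate `0` is correct without any copy; this case is needed because
the allowed number of copies tends to `0` with `B/ε²`.

The program is related to the estimator by couplings (`Coupled`): each random step of the machine is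
paired with a step of the mathematical law, and the relation on the pairs carries the register
contents and the resource counters. One coupling of the whole run (`coupled_qcqcProg`) gives both
the exact law of the outputs and bounds that hold in every run; deterministic stretches of code are
handled by the weakest precondition `wp`. -/

noncomputable section

/-! ## Couplings -/

/-- `p` and `q` have a coupling that is supported on the relation `R`. -/
def Coupled {α β : Type} (p : PMF α) (q : PMF β) (R : α → β → Prop) : Prop :=
  ∃ γ : PMF (α × β), γ.map Prod.fst = p ∧ γ.map Prod.snd = q ∧ ∀ x ∈ γ.support, R x.1 x.2

namespace Coupled

variable {α β α' β' : Type}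

/-- The product with a point mass is a coupling; a property of every outcome of `q` thus becomes a
coupling with a trivial law. -/
theorem pure_left {a : α} {q : PMF β} {R : α → β → Prop} (h : ∀ b ∈ q.support, R a b) :
    Coupled (PMF.pure a) q R := by
  refine ⟨q.map fun b => (a, b), ?_, ?_, ?_⟩
  · rw [PMF.map_comp]; exact PMF.map_const q a
  · rw [PMF.map_comp]; exact PMF.map_id q
  · intro x hx
    obtain ⟨b, hb, rfl⟩ := (PMF.mem_support_map_iff _ _ _).1 hx
    exact h b hb

theorem pure_right {p : PMF α} {b : β} {R : α → β → Prop} (h : ∀ a ∈ p.support, R a b) :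
    Coupled p (PMF.pure b) R := by
  refine ⟨p.map fun a => (a, b), ?_, ?_, ?_⟩
  · rw [PMF.map_comp]; exact PMF.map_id p
  · rw [PMF.map_comp]; exact PMF.map_const p b
  · intro x hx
    obtain ⟨a, ha, rfl⟩ := (PMF.mem_support_map_iff _ _ _).1 hx
    exact h a ha

/-- Draw a pair from the given coupling, then draw from a coupling of the two continuations at that
pair; the marginals are the two binds. -/
theorem bind {p : PMF α} {q : PMF β} {R : α → β → Prop} {f : α → PMF α'} {g : β → PMF β'}
    {S : α' → β' → Prop} (h : Coupled p q R)
    (h' : ∀ a b, a ∈ p.support → b ∈ q.support → R a b → Coupled (f a) (g b) S) :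
    Coupled (p.bind f) (q.bind g) S := by
  classical
  obtain ⟨γ, hp, hq, hR⟩ := h
  have hs : ∀ x ∈ γ.support, x.1 ∈ p.support ∧ x.2 ∈ q.support := fun x hx => by
    constructor
    · rw [← hp]; exact (PMF.mem_support_map_iff _ _ _).2 ⟨x, hx, rfl⟩
    · rw [← hq]; exact (PMF.mem_support_map_iff _ _ _).2 ⟨x, hx, rfl⟩
  have key : ∀ x : α × β, ∃ γ' : PMF (α' × β'), x ∈ γ.support →
      γ'.map Prod.fst = f x.1 ∧ γ'.map Prod.snd = g x.2 ∧ ∀ y ∈ γ'.support, S y.1 y.2 := by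
    intro x
    by_cases hx : x ∈ γ.support
    · obtain ⟨γ', h1⟩ := h' x.1 x.2 (hs x hx).1 (hs x hx).2 (hR x hx)
      exact ⟨γ', fun _ => h1⟩
    -- Off the support of `γ` no coupling is given; the independent product is a default whose value
    -- never enters.
    · exact ⟨(f x.1).bind fun a => (g x.2).map fun b => (a, b), fun h => absurd h hx⟩
  choose κ hκ using key
  have hcongr : ∀ {δ : Type} (u v : α × β → PMF δ), (∀ x ∈ γ.support, u x = v x) →
      γ.bind u = γ.bind v := by
    intro δ u v huv
    ext y
    rw [PMF.bind_apply, PMF.bind_apply]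
    refine tsum_congr fun x => ?_
    by_cases hx : x ∈ γ.support
    · rw [huv x hx]
    · rw [PMF.mem_support_iff, not_not] at hx; simp [hx]
  refine ⟨γ.bind κ, ?_, ?_, ?_⟩
  · rw [PMF.map_bind, ← hp, PMF.bind_map]
    exact hcongr _ _ fun x hx => (hκ x hx).1
  · rw [PMF.map_bind, ← hq, PMF.bind_map]
    exact hcongr _ _ fun x hx => (hκ x hx).2.1
  · intro y hy
    obtain ⟨x, hx, hxy⟩ := (PMF.mem_support_bind_iff _ _ _).1 hy
    exact (hκ x hx).2.2 y hxy

theorem mono {p : PMF α} {q : PMF β} {R S : α → β → Prop} (h : Coupled p q R)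
    (h' : ∀ a b, a ∈ p.support → R a b → S a b) : Coupled p q S := by
  obtain ⟨γ, hp, hq, hR⟩ := h
  refine ⟨γ, hp, hq, fun x hx => h' _ _ ?_ (hR x hx)⟩
  rw [← hp]; exact (PMF.mem_support_map_iff _ _ _).2 ⟨x, hx, rfl⟩

theorem map_left {p : PMF α} {q : PMF β} {f : α → α'} {R : α' → β → Prop}
    (h : Coupled p q fun a b => R (f a) b) : Coupled (p.map f) q R := by
  have := h.bind (f := fun a => PMF.pure (f a)) (g := fun b => PMF.pure b) (S := R)
    fun a b _ _ hab => pure_left fun b' hb' => by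
      rw [PMF.mem_support_pure_iff] at hb'; subst hb'; exact hab
  rw [PMF.bind_pure] at this
  exact this

theorem map_right {p : PMF α} {q : PMF β} {g : β → β'} {R : α → β' → Prop}
    (h : Coupled p q fun a b => R a (g b)) : Coupled p (q.map g) R := by
  have := h.bind (f := fun a => PMF.pure a) (g := fun b => PMF.pure (g b)) (S := R)
    fun a b _ _ hab => pure_left fun b' hb' => by
      rw [PMF.mem_support_pure_iff] at hb'; subst hb'; exact hab
  rw [PMF.bind_pure] at this
  exact this

theorem refl (p : PMF α) : Coupled p p fun a b => a = b := by
  refine ⟨p.map fun a => (a, a), ?_, ?_, ?_⟩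
  · rw [PMF.map_comp]; exact PMF.map_id p
  · rw [PMF.map_comp]; exact PMF.map_id p
  · intro x hx
    obtain ⟨a, ha, rfl⟩ := (PMF.mem_support_map_iff _ _ _).1 hx
    rfl

/-- The source of bounds valid in every run: each final configuration has a partner under the law,
so the relation holds for it. -/
theorem exists_of_mem_support {p : PMF α} {q : PMF β} {R : α → β → Prop} (h : Coupled p q R)
    {b : β} (hb : b ∈ q.support) : ∃ a ∈ p.support, R a b := by
  obtain ⟨γ, hp, hq, hR⟩ := h
  rw [← hq] at hb
  obtain ⟨x, hx, rfl⟩ := (PMF.mem_support_map_iff _ _ _).1 hb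
  refine ⟨x.1, ?_, hR x hx⟩
  rw [← hp]; exact (PMF.mem_support_map_iff _ _ _).2 ⟨x, hx, rfl⟩

/-- A coupling supported on the graph of a function identifies an image law; this turns the coupling
of a run into the law of its outputs. -/
theorem map_eq {p : PMF α} {q : PMF β} {f : β → α} (h : Coupled p q fun a b => f b = a) :
    q.map f = p := by
  obtain ⟨γ, hp, hq, hR⟩ := h
  rw [← hp, ← hq, PMF.map_comp]
  change γ.bind _ = γ.bind _
  ext y
  rw [PMF.bind_apply, PMF.bind_apply]
  refine tsum_congr fun x => ?_
  by_cases hx : x ∈ γ.support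
  · simp [hR x hx]
  · rw [PMF.mem_support_iff, not_not] at hx; simp [hx]

/-- Skip a part of the second computation that only has to establish a property. -/
theorem bind_right {p : PMF α} {q : PMF β} {g : β → PMF β'} {S : α → β' → Prop}
    (h : ∀ b ∈ q.support, Coupled p (g b) S) : Coupled p (q.bind g) S := by
  -- The coupling with the one-point law on `()` carries nothing but membership in the support of
  -- `q`.
  have := (pure_left (a := ()) (q := q) (R := fun _ b => b ∈ q.support) fun b hb => hb).bind
    (f := fun _ => p) (g := g) (S := S) fun _ b _ hb _ => h b hb
  rwa [PMF.pure_bind] at this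

end Coupled

/-! ## Program logic -/

section Logic

variable {n M : ℕ} (A : Fin M → ObsCircuit n) (ρ : Op n)

/-- Every final configuration of `P` started in `s` satisfies `Q`. -/
def wp (P : Prog) (Q : Config n → Prop) (s : Config n) : Prop :=
  ∀ s' ∈ (P.exec A ρ s).support, Q s'

variable {A ρ}

theorem wp_seq {P P' : Prog} {Q : Config n → Prop} {s : Config n} :
    wp A ρ (.seq P P') Q s ↔ wp A ρ P (wp A ρ P' Q) s := by
  simp only [wp, Prog.exec, PMF.mem_support_bind_iff]
  constructor
  · intro h s' hs' s'' hs''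
    exact h s'' ⟨s', hs', hs''⟩
  · rintro h s'' ⟨s', hs', hs''⟩
    exact h s' hs' s'' hs''

theorem wp_pure {P : Prog} {Q : Config n → Prop} {s s' : Config n}
    (h : P.exec A ρ s = PMF.pure s') : wp A ρ P Q s ↔ Q s' := by
  simp [wp, h]

section Instructions

variable {Q : Config n → Prop} {s : Config n}

theorem wp_natConst {t : Ref} {c : ℕ} :
    wp A ρ (.instr (.natConst t c)) Q s ↔ Q ((s.tick 1).setNat t c) := wp_pure rfl

theorem wp_natOp {o : NatOp} {t a b : Ref} :
    wp A ρ (.instr (.natOp o t a b)) Q s ↔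
      Q ((s.tick 1).setNat t (o.eval (s.nat a) (s.nat b))) := wp_pure rfl

theorem wp_log2 {t a : Ref} :
    wp A ρ (.instr (.log2 t a)) Q s ↔ Q ((s.tick 1).setNat t (Nat.log 2 (s.nat a))) := wp_pure rfl

theorem wp_realConst {t : Ref} {c : ℚ} :
    wp A ρ (.instr (.realConst t c)) Q s ↔ Q ((s.tick 1).setReal t (c : ℝ)) := wp_pure rfl

theorem wp_realOp {o : RealOp} {t a b : Ref} :
    wp A ρ (.instr (.realOp o t a b)) Q s ↔
      Q ((s.tick 1).setReal t (o.eval (s.real a) (s.real b))) := wp_pure rfl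

theorem wp_realOfNat {t a : Ref} :
    wp A ρ (.instr (.realOfNat t a)) Q s ↔ Q ((s.tick 1).setReal t (s.nat a : ℝ)) := wp_pure rfl

theorem wp_ceil {t a : Ref} :
    wp A ρ (.instr (.ceil t a)) Q s ↔ Q ((s.tick 1).setNat t ⌈s.real a⌉₊) := wp_pure rfl

theorem wp_obsLength {t j : Ref} (h : s.nat j < M) :
    wp A ρ (.instr (.obsLength t j)) Q s ↔
      Q ((s.tick 1).setNat t (A ⟨s.nat j, h⟩).gates.length) :=
  wp_pure (congrArg (fun v => PMF.pure ((s.tick 1).setNat t v)) (dif_pos h))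

theorem wp_obsLabel {t j b : Ref} (h : s.nat j < M) :
    wp A ρ (.instr (.obsLabel t j b)) Q s ↔
      Q ((s.tick 1).setReal t ((A ⟨s.nat j, h⟩).label fun i => (s.nat b).testBit i.val)) :=
  wp_pure (congrArg (fun v => PMF.pure ((s.tick 1).setReal t v)) (dif_pos h))

theorem wp_obsGate {j k : Ref} (h : s.nat j < M)
    (hk : s.nat k < (A ⟨s.nat j, h⟩).gates.length) :
    wp A ρ (.instr (.obsGate j k)) Q s ↔
      Q ((s.tick 1).applyOp ((A ⟨s.nat j, h⟩).gates[s.nat k]'hk).toOp) := by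
  refine wp_pure (congrArg PMF.pure ((dif_pos h).trans ?_))
  have e' : (A ⟨s.nat j, h⟩).gates[s.nat k]? = some ((A ⟨s.nat j, h⟩).gates[s.nat k]'hk) :=
    List.getElem?_eq_getElem hk
  change (match (A ⟨s.nat j, h⟩).gates[s.nat k]? with
    | some g => (s.tick 1).applyOp g.toOp
    | none => s.tick 1) = _
  rw [e']

theorem wp_loadCopy :
    wp A ρ (.instr .loadCopy) Q s ↔
      Q { s.tick (n + 1) with qreg := ρ, copies := s.copies + 1 } := wp_pure rfl

theorem wp_loadZero :
    wp A ρ (.instr .loadZero) Q s ↔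
      Q { s.tick (n + 1) with qreg := basisProj fun _ => false } := wp_pure rfl

theorem wp_output {j a : Ref} :
    wp A ρ (.instr (.output j a)) Q s ↔ Q ((s.tick 1).setOut (s.nat j) (s.real a)) := wp_pure rfl

end Instructions

theorem wp_ifNatLt {a b : Ref} {P P' : Prog} {Q : Config n → Prop} {s : Config n} :
    wp A ρ (.ifNatLt a b P P') Q s ↔
      (s.nat a < s.nat b → wp A ρ P Q (s.tick 1)) ∧
        (¬ s.nat a < s.nat b → wp A ρ P' Q (s.tick 1)) := by
  by_cases h : s.nat a < s.nat b <;> simp [wp, Prog.exec, h]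

theorem wp_ifRealLt {a b : Ref} {P P' : Prog} {Q : Config n → Prop} {s : Config n} :
    wp A ρ (.ifRealLt a b P P') Q s ↔
      (s.real a < s.real b → wp A ρ P Q (s.tick 1)) ∧
        (¬ s.real a < s.real b → wp A ρ P' Q (s.tick 1)) := by
  by_cases h : s.real a < s.real b <;> simp [wp, Prog.exec, h]

/-- Rounds are counted from an arbitrary `i`, so that the induction can pass to the rounds after the
first. -/
theorem repeatPMF_support {α : Type} {f : α → PMF α} (J : ℕ → α → Prop) (k : ℕ) :
    ∀ (i : ℕ) (s : α), J i s →
      (∀ i' s', i ≤ i' → i' < i + k → J i' s' → ∀ s'' ∈ (f s').support, J (i' + 1) s'') →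
      ∀ s' ∈ (repeatPMF f k s).support, J (i + k) s' := by
  induction k with
  | zero =>
    intro i s hs _ s' hs'
    rw [repeatPMF, PMF.mem_support_pure_iff] at hs'
    subst hs'; exact hs
  | succ k ih =>
    intro i s hs hstep s' hs'
    rw [repeatPMF, PMF.mem_support_bind_iff] at hs'
    obtain ⟨t, ht, hs'⟩ := hs'
    have := ih (i + 1) t (hstep i s le_rfl (by omega) hs t ht)
      (fun i' s' h1 h2 => hstep i' s' (by omega) (by omega)) s' hs'
    rwa [show i + 1 + k = i + (k + 1) by omega] at this

theorem wp_loop {a : Ref} {P : Prog} {Q : Config n → Prop} {s : Config n}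
    (J : ℕ → Config n → Prop) (h0 : J 0 (s.tick 1))
    (hstep : ∀ i s', i < s.nat a → J i s' → wp A ρ P (J (i + 1)) (s'.tick 1))
    (hend : ∀ s', J (s.nat a) s' → Q s') : wp A ρ (.loop a P) Q s := by
  intro s' hs'
  have := repeatPMF_support (f := fun s' => P.exec A ρ (s'.tick 1)) J (s.nat a) 0 (s.tick 1) h0
    (fun i s' _ h hJ s'' hs'' => hstep i s' (by omega) hJ s'' hs'') s' hs'
  rw [Nat.zero_add] at this
  exact hend s' this

theorem Coupled.seq {α β : Type} {p : PMF α} {f : α → PMF β} {P P' : Prog} {s : Config n}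
    {R : α → Config n → Prop} {S : β → Config n → Prop} (h : Coupled p (P.exec A ρ s) R)
    (h' : ∀ a s', a ∈ p.support → R a s' → Coupled (f a) (P'.exec A ρ s') S) :
    Coupled (p.bind f) ((Prog.seq P P').exec A ρ s) S :=
  h.bind fun a s' ha _ hR => h' a s' ha hR

theorem Coupled.seq_right {α : Type} {p : PMF α} {P P' : Prog} {s : Config n}
    {S : α → Config n → Prop}
    (h : wp A ρ P (fun s' => Coupled p (P'.exec A ρ s') S) s) :
    Coupled p ((Prog.seq P P').exec A ρ s) S := Coupled.bind_right h

theorem Coupled.seq_left {α : Type} {p : PMF α} {P P' : Prog} {s : Config n}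
    {R S : α → Config n → Prop} (h : Coupled p (P.exec A ρ s) R)
    (h' : ∀ a s', a ∈ p.support → R a s' → wp A ρ P' (S a) s') :
    Coupled p ((Prog.seq P P').exec A ρ s) S := by
  have := h.seq (f := PMF.pure) (P' := P') (S := S)
    fun a s' ha hR => Coupled.pure_left (h' a s' ha hR)
  rwa [PMF.bind_pure] at this

/-- `indep` draws its first sample first, just as a loop executes its first round first, so both are
peeled off together. The invariant depends on the list of samples drawn so far, and the induction
hypothesis is used with the first sample prefixed to that list. -/
theorem Coupled.repeat_indep {α : Type} {f : Config n → PMF (Config n)} {k : ℕ} :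
    ∀ (p : Fin k → PMF α) (J : List α → Config n → Prop) (s : Config n) (_ : J [] s)
      (_ : ∀ (l : List α) (s' : Config n) (h : l.length < k), J l s' →
        Coupled (p ⟨l.length, h⟩) (f s') fun a s'' => J (l ++ [a]) s''),
      Coupled (indep p) (repeatPMF f k s) fun x s' => J (List.ofFn x) s' := by
  induction k with
  | zero =>
    intro p J s h0 _
    exact Coupled.pure_left fun s' hs' => by
      rw [repeatPMF, PMF.mem_support_pure_iff] at hs'
      subst hs'; simpa using h0
  | succ k ih =>
    intro p J s h0 hstep
    refine Coupled.bind (hstep [] s (Nat.succ_pos k) h0) ?_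
    intro a s' _ _ hJ
    refine Coupled.map_left ?_
    refine (ih (fun i => p i.succ) (fun l => J (a :: l)) s' hJ ?_).mono ?_
    · intro l s'' hl hl'
      exact hstep (a :: l) s'' (by simpa using hl) hl'
    · intro x s'' _ hx
      simpa [List.ofFn_succ] using hx

theorem Coupled.loop_indep {α : Type} {k : ℕ} {a : Ref} {P : Prog} {s : Config n}
    (p : Fin k → PMF α) (J : List α → Config n → Prop) (ha : s.nat a = k) (h0 : J [] (s.tick 1))
    (hstep : ∀ (l : List α) (s' : Config n) (h : l.length < k), J l s' →
      Coupled (p ⟨l.length, h⟩) (P.exec A ρ (s'.tick 1)) fun a s'' => J (l ++ [a]) s'') :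
    Coupled (indep p) ((Prog.loop a P).exec A ρ s) fun x s' => J (List.ofFn x) s' := by
  rw [Prog.exec, ha]
  exact Coupled.repeat_indep p J _ h0 hstep

end Logic
end

/-! ### Finite probability: expectations, independence, order statistics. -/

noncomputable section

/-! ## Expectations of finitely supported distributions -/

/-- Expectation of a real function. -/
def expect {α : Type} (p : PMF α) (f : α → ℝ) : ℝ := ∑' a, (p a).toReal * f a

section Expect

variable {α β : Type}

/-- All laws to which this is applied have finite support, so infinite sums and summability
conditions disappear. -/
theorem expect_eq_sum {p : PMF α} {S : Finset α} (hS : ∀ a ∈ p.support, a ∈ S) (f : α → ℝ) :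
    expect p f = ∑ a ∈ S, (p a).toReal * f a := by
  refine tsum_eq_sum fun a ha => ?_
  have : a ∉ p.support := fun h => ha (hS a h)
  rw [PMF.mem_support_iff, not_not] at this
  simp [this]

theorem expect_congr {p : PMF α} {f g : α → ℝ} (h : ∀ a ∈ p.support, f a = g a) :
    expect p f = expect p g := by
  refine tsum_congr fun a => ?_
  by_cases ha : a ∈ p.support
  · rw [h a ha]
  · rw [PMF.mem_support_iff, not_not] at ha; simp [ha]

theorem sum_toReal_eq_one {p : PMF α} {S : Finset α} (hS : ∀ a ∈ p.support, a ∈ S) :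
    ∑ a ∈ S, (p a).toReal = 1 := by
  have h : ∑ a ∈ S, p a = 1 := by
    rw [← p.tsum_coe]
    refine (tsum_eq_sum fun a ha => ?_).symm
    have : a ∉ p.support := fun h => ha (hS a h)
    rwa [PMF.mem_support_iff, not_not] at this
  rw [← ENNReal.toReal_sum fun a _ => p.apply_ne_top a, h, ENNReal.toReal_one]

theorem expect_const {p : PMF α} (hp : p.support.Finite) (c : ℝ) :
    expect p (fun _ => c) = c := by
  rw [expect_eq_sum (S := hp.toFinset) (by simp), ← Finset.sum_mul,
    sum_toReal_eq_one (by simp), one_mul]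

theorem expect_add {p : PMF α} (hp : p.support.Finite) (f g : α → ℝ) :
    expect p (fun a => f a + g a) = expect p f + expect p g := by
  simp only [expect_eq_sum (S := hp.toFinset) (p := p) (by simp), mul_add, Finset.sum_add_distrib]

theorem expect_mul_left (p : PMF α) (c : ℝ) (f : α → ℝ) :
    expect p (fun a => c * f a) = c * expect p f := by
  simp only [expect, ← tsum_mul_left]
  exact tsum_congr fun a => by ring

theorem expect_sum {p : PMF α} (hp : p.support.Finite) {ι : Type} (s : Finset ι)
    (f : ι → α → ℝ) :
    expect p (fun a => ∑ i ∈ s, f i a) = ∑ i ∈ s, expect p (f i) := by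
  simp only [expect_eq_sum (S := hp.toFinset) (p := p) (by simp), Finset.mul_sum]
  exact Finset.sum_comm

theorem expect_mono {p : PMF α} (hp : p.support.Finite) {f g : α → ℝ}
    (h : ∀ a ∈ p.support, f a ≤ g a) : expect p f ≤ expect p g := by
  simp only [expect_eq_sum (S := hp.toFinset) (p := p) (by simp)]
  refine Finset.sum_le_sum fun a ha => ?_
  exact mul_le_mul_of_nonneg_left (h a (by simpa using ha)) ENNReal.toReal_nonneg

theorem expect_pure (a : α) (f : α → ℝ) : expect (PMF.pure a) f = f a := by
  classical
  rw [expect_eq_sum (S := {a}) (by simp)]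
  simp

theorem finite_support_bind {p : PMF α} {q : α → PMF β} (hp : p.support.Finite)
    (hq : ∀ a, (q a).support.Finite) : (p.bind q).support.Finite := by
  have : (p.bind q).support = ⋃ a ∈ p.support, (q a).support := by
    ext b; simp
  rw [this]
  exact hp.biUnion fun a _ => hq a

theorem finite_support_map {p : PMF α} (hp : p.support.Finite) (f : α → β) :
    (p.map f).support.Finite := by
  rw [PMF.support_map]; exact hp.image f

theorem finite_support_of_finite [Finite α] (p : PMF α) : p.support.Finite := Set.toFinite _

theorem expect_bind {p : PMF α} {q : α → PMF β} (hp : p.support.Finite)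
    (hq : ∀ a, (q a).support.Finite) (f : β → ℝ) :
    expect (p.bind q) f = expect p fun a => expect (q a) f := by
  classical
  set S := hp.toFinset
  set X := (finite_support_bind hp hq).toFinset
  have hX : ∀ a ∈ S, ∀ b ∈ (q a).support, b ∈ X := by
    intro a ha b hb
    simp only [X, Set.Finite.mem_toFinset, PMF.mem_support_bind_iff]
    exact ⟨a, by simpa [S] using ha, hb⟩
  have hbind : ∀ b, (p.bind q b).toReal = ∑ a ∈ S, (p a).toReal * (q a b).toReal := by
    intro b
    rw [PMF.bind_apply, tsum_eq_sum (s := S)]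
    · rw [ENNReal.toReal_sum]
      · simp
      · exact fun a _ => ENNReal.mul_ne_top (p.apply_ne_top a) ((q a).apply_ne_top b)
    · intro a ha
      have : a ∉ p.support := by simpa [S] using ha
      rw [PMF.mem_support_iff, not_not] at this
      simp [this]
  rw [expect_eq_sum (S := X) (by simp [X]), expect_eq_sum (S := S) (by simp [S])]
  simp only [hbind, Finset.sum_mul]
  rw [Finset.sum_comm]
  refine Finset.sum_congr rfl fun a ha => ?_
  rw [expect_eq_sum (hX a ha), Finset.mul_sum]
  exact Finset.sum_congr rfl fun b _ => by ring

theorem expect_map {p : PMF α} (hp : p.support.Finite) (g : α → β) (f : β → ℝ) :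
    expect (p.map g) f = expect p fun a => f (g a) := by
  change expect (p.bind (PMF.pure ∘ g)) f = _
  rw [expect_bind hp fun a => by simp]
  simp [expect_pure]

/-- Probabilities as expectations. -/
theorem ofReal_le_toOuterMeasure {p : PMF α} (hp : p.support.Finite) {s : Set α} {f : α → ℝ}
    {c : ℝ} (hf : ∀ a, f a ≤ s.indicator 1 a) (h : c ≤ expect p f) :
    ENNReal.ofReal c ≤ p.toOuterMeasure s := by
  classical
  rw [PMF.toOuterMeasure_apply]
  have h1 : expect p f ≤ ∑ a ∈ hp.toFinset, (s.indicator p a).toReal := by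
    rw [expect_eq_sum (S := hp.toFinset) (by simp)]
    refine Finset.sum_le_sum fun a _ => ?_
    refine (mul_le_mul_of_nonneg_left (hf a) ENNReal.toReal_nonneg).trans ?_
    by_cases ha : a ∈ s <;> simp [ha]
  have h2 : ∑ a ∈ hp.toFinset, (s.indicator p a).toReal =
      (∑ a ∈ hp.toFinset, s.indicator p a).toReal := by
    rw [ENNReal.toReal_sum]
    intro a _
    by_cases ha : a ∈ s <;> simp [ha, p.apply_ne_top]
  refine (ENNReal.ofReal_le_ofReal (h.trans (h1.trans_eq h2))).trans ?_
  exact ENNReal.ofReal_toReal_le.trans (ENNReal.sum_le_tsum _)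

end Expect

/-! ## Independent samples -/

section Indep

variable {α : Type}

theorem finite_support_indep {k : ℕ} {p : Fin k → PMF α} (hp : ∀ i, (p i).support.Finite) :
    (indep p).support.Finite := by
  induction k with
  | zero => simp [indep]
  | succ k ih =>
    exact finite_support_bind (hp 0) fun a => finite_support_map (ih fun i => hp i.succ) _

theorem expect_indep_succ {k : ℕ} {p : Fin (k + 1) → PMF α} (hp : ∀ i, (p i).support.Finite)
    (f : (Fin (k + 1) → α) → ℝ) :
    expect (indep p) f = expect (p 0) fun a => expect (indep fun i => p i.succ) fun x =>
      f (Fin.cons a x : Fin (k + 1) → α) := by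
  rw [indep, expect_bind (hp 0) fun a =>
    finite_support_map (finite_support_indep fun i => hp i.succ) _]
  refine expect_congr fun a _ => ?_
  rw [expect_map (finite_support_indep fun i => hp i.succ)]

theorem expect_indep_prod {k : ℕ} {p : Fin k → PMF α} (hp : ∀ i, (p i).support.Finite)
    (f : Fin k → α → ℝ) :
    expect (indep p) (fun x => ∏ i, f i (x i)) = ∏ i, expect (p i) (f i) := by
  induction k with
  | zero => simp [indep, expect_pure]
  | succ k ih =>
    rw [expect_indep_succ hp, Fin.prod_univ_succ]
    simp only [Fin.prod_univ_succ, Fin.cons_zero, Fin.cons_succ, expect_mul_left,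
      ih (fun i => hp i.succ) fun i => f i.succ]
    simp only [mul_comm _ (∏ i : Fin k, expect (p i.succ) (f i.succ)), expect_mul_left]

/-- The product formula with the constant factor `1` at all other coordinates. -/
theorem expect_indep_apply {k : ℕ} {p : Fin k → PMF α} (hp : ∀ i, (p i).support.Finite)
    (j : Fin k) (f : α → ℝ) : expect (indep p) (fun x => f (x j)) = expect (p j) f := by
  classical
  have := expect_indep_prod hp fun i a => if i = j then f a else 1
  simp only [Finset.prod_ite_eq', Finset.mem_univ, if_true] at this
  rw [this, Finset.prod_eq_single j]
  · simp
  · intro i _ hi; simp [hi, expect_const (hp i)]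
  · simp

/-- Second moment of a sum of independent variables about its mean. -/
theorem expect_indep_sum_sq {k : ℕ} {p : Fin k → PMF α} (hp : ∀ i, (p i).support.Finite)
    (f : Fin k → α → ℝ) (h0 : ∀ i, expect (p i) (f i) = 0) :
    expect (indep p) (fun x => ∑ i, f i (x i)) = 0 ∧
      expect (indep p) (fun x => (∑ i, f i (x i)) ^ 2) =
        ∑ i, expect (p i) fun a => f i a ^ 2 := by
  induction k with
  | zero => simp [indep, expect_pure]
  | succ k ih =>
    obtain ⟨h1, h2⟩ := ih (fun i => hp i.succ) (fun i => f i.succ) fun i => h0 i.succ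
    have hf := finite_support_indep fun i : Fin k => hp i.succ
    constructor
    · rw [expect_indep_succ hp]
      simp only [Fin.sum_univ_succ, Fin.cons_zero, Fin.cons_succ, expect_add hf, h1,
        expect_const hf, add_zero, h0]
    · rw [expect_indep_succ hp]
      -- The cross term is killed by the vanishing mean `h1` of the remaining sum, so only squares
      -- survive.
      have : ∀ (a : α) (x : Fin k → α),
          (∑ i, f i ((Fin.cons a x : Fin (k + 1) → α) i)) ^ 2 =
            f 0 a ^ 2 + 2 * f 0 a * (∑ i : Fin k, f i.succ (x i)) +
              (∑ i : Fin k, f i.succ (x i)) ^ 2 := by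
        intro a x
        simp only [Fin.sum_univ_succ, Fin.cons_zero, Fin.cons_succ]; ring
      simp only [this, expect_add hf, expect_mul_left, h1, h2, expect_const hf, mul_zero,
        add_zero, expect_add (hp 0), expect_const (hp 0)]
      rw [Fin.sum_univ_succ]

end Indep

/-! ## Medians -/

/-- The median of an odd number of reals is the order statistic in the middle. -/
theorem median_spec {t : ℕ} (x : Fin (2 * t + 1) → ℝ) :
    (Finset.univ.filter fun i => x i < median x).card ≤ t ∧
      t < (Finset.univ.filter fun i => x i ≤ median x).card ∧ ∃ i, x i = median x := by
  set s := (List.ofFn x).insertionSort (· ≤ ·) with hs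
  have hlen : s.length = 2 * t + 1 := by
    rw [hs, List.length_insertionSort, List.length_ofFn]
  have ht : t < s.length := by omega
  have hmed : median x = s[t] := by
    simp only [median, ← hs]
    have h1 : (2 * t + 1 - 1) / 2 = t := by omega
    have h2 : (2 * t + 1) / 2 = t := by omega
    rw [h1, h2, List.getD_eq_getElem _ _ ht]
    ring
  have hsorted : s.Pairwise (· ≤ ·) := List.pairwise_insertionSort _ _
  have hperm : s.Perm (List.ofFn x) := List.perm_insertionSort _ _
  -- Numbers of indices with a property are counts in the list, and these do not change when the
  -- list is sorted.
  have hcount : ∀ q : ℝ → Prop, ∀ [DecidablePred q],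
      (Finset.univ.filter fun i => q (x i)).card = s.countP (fun a => decide (q a)) := by
    intro q _
    rw [hperm.countP_eq, List.countP_eq_length_filter, List.ofFn_eq_map, List.filter_map,
      List.length_map, ← List.countP_eq_length_filter, Finset.card_def, Finset.filter_val]
    simp [List.countP_eq_length_filter, Fin.univ_def]
    rfl
  have hsplit : s = s.take t ++ s[t] :: s.drop (t + 1) := by simp
  rw [hmed]
  refine ⟨?_, ?_, ?_⟩
  · rw [hcount fun a => a < s[t]]
    -- Entries from position `t` on are at least `s[t]`, so only the first `t` can be smaller.
    have h0 : (s.drop t).countP (fun a => decide (a < s[t])) = 0 := by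
      rw [List.countP_eq_zero]
      intro a ha
      obtain ⟨i, hi, rfl⟩ := List.getElem_of_mem ha
      simp only [List.getElem_drop, decide_eq_true_eq, not_lt]
      rcases Nat.eq_zero_or_pos i with h | h
      · simp [h]
      · exact List.pairwise_iff_getElem.1 hsorted _ _ _ _ (by omega)
    calc s.countP (fun a => decide (a < s[t]))
        = (s.take t ++ s.drop t).countP (fun a => decide (a < s[t])) := by
          rw [List.take_append_drop]
      _ ≤ t := by
          rw [List.countP_append, h0, add_zero]
          exact List.countP_le_length.trans (by simp)
  · rw [hcount fun a => a ≤ s[t]]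
    have h0 : (s.take (t + 1)).countP (fun a => decide (a ≤ s[t])) = (s.take (t + 1)).length := by
      rw [List.countP_eq_length]
      intro a ha
      obtain ⟨i, hi, rfl⟩ := List.getElem_of_mem ha
      simp only [List.getElem_take, decide_eq_true_eq]
      have hi' : i < t + 1 := by simp at hi; omega
      rcases Nat.lt_or_ge i t with h | h
      · exact List.pairwise_iff_getElem.1 hsorted _ _ _ _ h
      · have : i = t := by omega
        simp [this]
    calc t < (s.take (t + 1)).countP (fun a => decide (a ≤ s[t])) := by
          rw [h0, List.length_take]; omega
      _ ≤ (s.take (t + 1) ++ s.drop (t + 1)).countP (fun a => decide (a ≤ s[t])) := by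
          rw [List.countP_append]; exact Nat.le_add_right _ _
      _ = _ := by rw [List.take_append_drop]
  · have := hperm.mem_iff.1 (List.getElem_mem ht)
    exact (List.mem_ofFn' _ _).1 this

/-- If `v` were below the median, all entries `≤ v` would be `<` the median, and there would be both
more than `t` and at most `t` of them; the other case is symmetric. This is the test that the
program applies to each cell. -/
theorem median_unique {t : ℕ} (x : Fin (2 * t + 1) → ℝ) {v : ℝ}
    (h1 : (Finset.univ.filter fun i => x i < v).card ≤ t)
    (h2 : t < (Finset.univ.filter fun i => x i ≤ v).card) : v = median x := by
  obtain ⟨m1, m2, _⟩ := median_spec x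
  rcases lt_trichotomy v (median x) with h | h | h
  · have : (Finset.univ.filter fun i => x i ≤ v) ⊆ Finset.univ.filter fun i => x i < median x :=
      fun i hi => by simp at hi ⊢; linarith
    have := Finset.card_le_card this; omega
  · exact h
  · have : (Finset.univ.filter fun i => x i ≤ median x) ⊆ Finset.univ.filter fun i => x i < v :=
      fun i hi => by simp at hi ⊢; linarith
    have := Finset.card_le_card this; omega

/-- An increasing affine map preserves the two counts that characterize the median. This lets the
program take the median of raw label sums and rescale only afterwards. -/
theorem median_affine {t : ℕ} (x : Fin (2 * t + 1) → ℝ) {a : ℝ} (ha : 0 < a) (c : ℝ) :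
    median (fun i => a * x i + c) = a * median x + c := by
  symm
  obtain ⟨m1, m2, _⟩ := median_spec x
  refine median_unique _ ?_ ?_
  · simpa [mul_lt_mul_iff_right₀ ha] using m1
  · simpa [mul_le_mul_iff_right₀ ha] using m2

/-- If the median is far from `μ`, then more than half of the numbers are. -/
theorem lt_card_of_median_far {t : ℕ} (x : Fin (2 * t + 1) → ℝ) {μ ε : ℝ}
    (h : ε < |μ - median x|) : t < (Finset.univ.filter fun i => ε < |μ - x i|).card := by
  obtain ⟨m1, m2, _⟩ := median_spec x
  -- More than `t` entries lie on the side of the median that faces away from `μ`, and these are at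
  -- least as far from `μ` as the median.
  rcases lt_abs.1 h with h | h
  · refine m2.trans_le (Finset.card_le_card fun i hi => ?_)
    simp only [Finset.mem_filter, Finset.mem_univ, true_and] at hi ⊢
    exact lt_abs.2 (Or.inl (by linarith))
  · have hc := Finset.card_filter_add_card_filter_not (s := Finset.univ)
      (fun i => x i < median x)
    rw [Finset.card_univ, Fintype.card_fin] at hc
    have : t < (Finset.univ.filter fun i => ¬ x i < median x).card := by omega
    refine this.trans_le (Finset.card_le_card fun i hi => ?_)
    simp only [Finset.mem_filter, Finset.mem_univ, true_and] at hi ⊢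
    exact lt_abs.2 (Or.inr (by linarith))
end

/-! ### Pauli strings and the Clifford group. -/

noncomputable section

/-! ## Tensor products of one-qubit matrices -/

/-- Pauli strings. -/
abbrev Str (n : ℕ) : Type := Fin n → PauliLetter

section Tensor

variable {n : ℕ}

/-- The tensor product of one-qubit matrices. -/
def tens (A : Fin n → Matrix Bool Bool ℂ) : Op n := Matrix.of fun x y => ∏ i, A i (x i) (y i)

theorem pauliOp_eq_tens (p : Str n) : pauliOp p = tens fun i => (p i).toMatrix := rfl

/-- Expanding a product over sites of sums over bits gives a sum over bit strings. -/
theorem tens_mul (A B : Fin n → Matrix Bool Bool ℂ) :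
    tens A * tens B = tens fun i => A i * B i := by
  ext x y
  simp only [tens, Matrix.mul_apply, Matrix.of_apply, ← Finset.prod_mul_distrib]
  exact (Fintype.prod_sum fun i b => A i (x i) b * B i b (y i)).symm

theorem tens_conjTranspose (A : Fin n → Matrix Bool Bool ℂ) :
    (tens A).conjTranspose = tens fun i => (A i).conjTranspose := by
  ext x y
  simp [tens, Matrix.conjTranspose_apply]

theorem tens_trace (A : Fin n → Matrix Bool Bool ℂ) : (tens A).trace = ∏ i, (A i).trace := by
  simp only [Matrix.trace, tens, Matrix.diag_apply, Matrix.of_apply]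
  exact (Fintype.prod_sum fun i b => A i b b).symm

theorem tens_one : tens (fun _ : Fin n => 1) = 1 := by
  ext x y
  by_cases h : x = y
  · subst h; simp [tens]
  · obtain ⟨i, hi⟩ := Function.ne_iff.1 h
    rw [Matrix.one_apply_ne h]
    exact Finset.prod_eq_zero (Finset.mem_univ i) (by simp [Matrix.one_apply_ne hi])

theorem tens_smul (c : Fin n → ℂ) (A : Fin n → Matrix Bool Bool ℂ) :
    tens (fun i => c i • A i) = (∏ i, c i) • tens A := by
  ext x y
  simp [tens, Finset.prod_mul_distrib]

theorem local1_eq_tens (q : Fin n) (A : Matrix Bool Bool ℂ) :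
    local1 q A = tens (Function.update (fun _ => 1) q A) := by
  ext x y
  simp only [local1, tens, Matrix.of_apply]
  rw [← Finset.mul_prod_erase _ _ (Finset.mem_univ q), Function.update_self]
  split_ifs with h
  · rw [Finset.prod_eq_one, mul_one]
    intro i hi
    have hi := Finset.ne_of_mem_erase hi
    rw [Function.update_of_ne hi, h i hi, Matrix.one_apply_eq]
  · push Not at h
    obtain ⟨i, hi, hne⟩ := h
    rw [Finset.prod_eq_zero (i := i) (by simp [hi]), mul_zero]
    rw [Function.update_of_ne hi, Matrix.one_apply_ne hne]

end Tensor

/-! ## Pauli strings -/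

namespace PauliLetter

theorem toMatrix_mul_self (a : PauliLetter) : a.toMatrix * a.toMatrix = 1 := by
  fin_cases a <;> ext x y <;> cases x <;> cases y <;>
    simp [toMatrix, Matrix.mul_apply]

theorem toMatrix_conjTranspose (a : PauliLetter) : a.toMatrix.conjTranspose = a.toMatrix := by
  fin_cases a <;> ext x y <;> cases x <;> cases y <;>
    simp [toMatrix, Matrix.conjTranspose_apply]

theorem trace_toMatrix_mul (a b : PauliLetter) :
    (a.toMatrix * b.toMatrix).trace = if a = b then 2 else 0 := by
  fin_cases a <;> fin_cases b <;>
    simp [toMatrix, Matrix.mul_apply, Matrix.trace] <;> norm_num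

/-- Completeness of the four letters in the space of `2 × 2` matrices: the sum of `a ⊗ a` is twice
the swap. -/
theorem sum_toMatrix (x y z w : Bool) :
    ∑ a : PauliLetter, a.toMatrix x y * a.toMatrix z w = if x = w ∧ y = z then 2 else 0 := by
  cases x <;> cases y <;> cases z <;> cases w <;>
    simp [Fin.sum_univ_four, toMatrix] <;> norm_num

/-- The sign with which two letters commute. -/
def commSign (a b : PauliLetter) : ℂ := if a = 0 ∨ b = 0 ∨ a = b then 1 else -1

theorem toMatrix_mul_comm (a b : PauliLetter) :
    a.toMatrix * b.toMatrix = commSign a b • (b.toMatrix * a.toMatrix) := by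
  fin_cases a <;> fin_cases b <;> ext x y <;> cases x <;> cases y <;>
    simp [toMatrix, commSign, Matrix.mul_apply]

theorem commSign_comm (a b : PauliLetter) : commSign a b = commSign b a := by
  unfold commSign; congr 1; simp only [eq_iff_iff]; tauto

end PauliLetter

section Pauli

variable {n : ℕ}

/-- The sign with which two Pauli strings commute. -/
def commSign (p q : Str n) : ℂ := ∏ i, PauliLetter.commSign (p i) (q i)

theorem commSign_comm (p q : Str n) : commSign p q = commSign q p :=
  Finset.prod_congr rfl fun _ _ => PauliLetter.commSign_comm _ _

theorem prod_sign {ι : Type} (s : Finset ι) (f : ι → ℂ) (h : ∀ i ∈ s, f i = 1 ∨ f i = -1) :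
    ∏ i ∈ s, f i = 1 ∨ ∏ i ∈ s, f i = -1 := by
  refine Finset.prod_induction f (fun c => c = 1 ∨ c = -1) ?_ (Or.inl rfl) h
  rintro a b (rfl | rfl) (rfl | rfl) <;> simp

theorem commSign_eq (p q : Str n) : commSign p q = 1 ∨ commSign p q = -1 :=
  prod_sign _ _ fun i _ => by unfold PauliLetter.commSign; split_ifs <;> simp

theorem pauliOp_mul_comm (p q : Str n) :
    pauliOp p * pauliOp q = commSign p q • (pauliOp q * pauliOp p) := by
  simp only [pauliOp_eq_tens, tens_mul, commSign, ← tens_smul, ← PauliLetter.toMatrix_mul_comm]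

theorem pauliOp_mul_self (p : Str n) : pauliOp p * pauliOp p = 1 := by
  simp only [pauliOp_eq_tens, tens_mul, PauliLetter.toMatrix_mul_self, tens_one]

theorem trace_pauliOp_mul (p q : Str n) :
    (pauliOp p * pauliOp q).trace = if p = q then 2 ^ n else 0 := by
  simp only [pauliOp_eq_tens, tens_mul, tens_trace, PauliLetter.trace_toMatrix_mul]
  split_ifs with h
  · subst h; simp
  · obtain ⟨i, hi⟩ := Function.ne_iff.1 h
    exact Finset.prod_eq_zero (Finset.mem_univ i) (by simp [hi])

theorem pauliOp_zero : pauliOp (0 : Str n) = 1 := tens_one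

/-- The Pauli strings are an orthogonal basis. -/
theorem sum_trace_smul_pauliOp (X : Op n) :
    ∑ p : Str n, (X * pauliOp p).trace • pauliOp p = (2 ^ n : ℂ) • X := by
  -- The `n`-fold tensor power of the completeness relation for letters.
  have key : ∀ x y z w : Bits n, ∑ p : Str n, pauliOp p x y * pauliOp p z w =
      if x = w ∧ y = z then 2 ^ n else 0 := by
    intro x y z w
    simp only [pauliOp, Matrix.of_apply, ← Finset.prod_mul_distrib]
    rw [← Fintype.prod_sum fun i (a : PauliLetter) =>
      a.toMatrix (x i) (y i) * a.toMatrix (z i) (w i)]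
    simp only [PauliLetter.sum_toMatrix]
    split_ifs with h
    · obtain ⟨rfl, rfl⟩ := h; simp
    · rw [not_and_or] at h
      rcases h with h | h
      · obtain ⟨i, hi⟩ := Function.ne_iff.1 h
        exact Finset.prod_eq_zero (Finset.mem_univ i) (by simp [hi])
      · obtain ⟨i, hi⟩ := Function.ne_iff.1 h
        exact Finset.prod_eq_zero (Finset.mem_univ i) (by simp [hi])
  ext z w
  simp only [Matrix.sum_apply, Matrix.smul_apply, smul_eq_mul, Matrix.trace, Matrix.diag_apply,
    Matrix.mul_apply, Finset.sum_mul]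
  rw [Finset.sum_comm]
  have : ∀ u v : Bits n, ∑ p : Str n, X u v * pauliOp p v u * pauliOp p z w =
      if v = w ∧ u = z then X u v * 2 ^ n else 0 := by
    intro u v
    simp only [mul_assoc, ← Finset.mul_sum, key, mul_ite, mul_zero]
  calc _ = ∑ u : Bits n, ∑ v : Bits n, ∑ p : Str n, X u v * pauliOp p v u * pauliOp p z w :=
        Finset.sum_congr rfl fun u _ => Finset.sum_comm
    _ = _ := by
      simp only [this, ite_and]
      simp [mul_comm]

/-- Pair both sides with `pauliOp p` in the trace inner product, in which the strings are
orthogonal. -/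
theorem smul_pauliOp_inj {p q : Str n} {s t : ℂ} (hs : s ≠ 0)
    (h : s • pauliOp p = t • pauliOp q) : p = q ∧ s = t := by
  have h1 := congrArg (fun X => (X * pauliOp p).trace) h
  simp only [Matrix.smul_mul, Matrix.trace_smul, trace_pauliOp_mul, if_true, smul_eq_mul] at h1
  have h2 : (2 : ℂ) ^ n ≠ 0 := by positivity
  by_cases hpq : q = p
  · rw [if_pos hpq] at h1
    exact ⟨hpq.symm, mul_right_cancel₀ h2 h1⟩
  · rw [if_neg hpq, mul_zero] at h1
    exact absurd h1 (mul_ne_zero hs h2)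

end Pauli

/-! ## Unitaries that permute the Pauli strings up to sign -/

section Acts

variable {n : ℕ}

/-- `U` is unitary, and conjugation by it permutes the Pauli strings by `f`, up to signs. -/
structure ActsBy (U : Op n) (f : Str n → Str n) : Prop where
  mul_star : U * U.conjTranspose = 1
  -- Only the existence of a sign is recorded: signs cancel in the moments, and where an element of
  -- the Clifford group is built they are recovered by choice.
  act : ∀ p, ∃ s : ℂ, (s = 1 ∨ s = -1) ∧ U * pauliOp p * U.conjTranspose = s • pauliOp (f p)

namespace ActsBy

theorem star_mul {U : Op n} {f : Str n → Str n} (h : ActsBy U f) : U.conjTranspose * U = 1 :=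
  mul_eq_one_comm.1 h.mul_star

theorem one : ActsBy (1 : Op n) id :=
  ⟨by simp, fun p => ⟨1, Or.inl rfl, by simp⟩⟩

theorem mul {U W : Op n} {f g : Str n → Str n} (hU : ActsBy U f) (hW : ActsBy W g) :
    ActsBy (U * W) (f ∘ g) := by
  constructor
  · rw [Matrix.conjTranspose_mul, Matrix.mul_assoc, ← Matrix.mul_assoc W, hW.mul_star,
      Matrix.one_mul, hU.mul_star]
  · intro p
    obtain ⟨s, hs, h1⟩ := hW.act p
    obtain ⟨t, ht, h2⟩ := hU.act (g p)
    refine ⟨s * t, by rcases hs with rfl | rfl <;> rcases ht with rfl | rfl <;> simp, ?_⟩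
    calc U * W * pauliOp p * (U * W).conjTranspose
        = U * (W * pauliOp p * W.conjTranspose) * U.conjTranspose := by
          rw [Matrix.conjTranspose_mul]; simp only [Matrix.mul_assoc]
      _ = _ := by
          rw [h1, Matrix.mul_smul, Matrix.smul_mul, h2, smul_smul, Function.comp]

theorem conj_mul {U : Op n} {f : Str n → Str n} (h : ActsBy U f) (X Y : Op n) :
    U * (X * Y) * U.conjTranspose =
      (U * X * U.conjTranspose) * (U * Y * U.conjTranspose) := by
  calc U * (X * Y) * U.conjTranspose
      = U * X * (U.conjTranspose * U) * Y * U.conjTranspose := by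
        rw [h.star_mul]; simp only [Matrix.mul_assoc, Matrix.one_mul]
    _ = _ := by simp only [Matrix.mul_assoc]

theorem conj_inj {U : Op n} {f : Str n → Str n} (h : ActsBy U f) {X Y : Op n}
    (hXY : U * X * U.conjTranspose = U * Y * U.conjTranspose) : X = Y := by
  have := congrArg (fun Z => U.conjTranspose * Z * U) hXY
  have e : ∀ Z : Op n, U.conjTranspose * (U * Z * U.conjTranspose) * U = Z := by
    intro Z
    calc _ = (U.conjTranspose * U) * Z * (U.conjTranspose * U) := by simp only [Matrix.mul_assoc]
      _ = Z := by rw [h.star_mul, Matrix.one_mul, Matrix.mul_one]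
  simpa only [e] using this

theorem injective {U : Op n} {f : Str n → Str n} (h : ActsBy U f) : Function.Injective f := by
  intro p q hpq
  obtain ⟨s, hs, h1⟩ := h.act p
  obtain ⟨t, ht, h2⟩ := h.act q
  have hs0 : s ≠ 0 := by rcases hs with rfl | rfl <;> simp
  have ht0 : t ≠ 0 := by rcases ht with rfl | rfl <;> simp
  rw [hpq] at h1
  refine (smul_pauliOp_inj ht0 (s := t) (t := s) (h.conj_inj ?_)).1
  rw [Matrix.mul_smul, Matrix.smul_mul, Matrix.mul_smul, Matrix.smul_mul, h1, h2, smul_smul,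
    smul_smul, mul_comm]

/-- Conjugation is multiplicative, so it preserves commutation relations. The two scalars are
compared by multiplying with the inverse product of strings and taking the trace. -/
theorem commSign_map {U : Op n} {f : Str n → Str n} (h : ActsBy U f) (p q : Str n) :
    commSign (f p) (f q) = commSign p q := by
  obtain ⟨s, hs, h1⟩ := h.act p
  obtain ⟨t, ht, h2⟩ := h.act q
  have hs0 : s ≠ 0 := by rcases hs with rfl | rfl <;> simp
  have ht0 : t ≠ 0 := by rcases ht with rfl | rfl <;> simp
  have e := congrArg (fun Z => U * Z * U.conjTranspose) (pauliOp_mul_comm p q)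
  simp only [Matrix.mul_smul, Matrix.smul_mul, h.conj_mul, h1, h2, smul_smul] at e
  rw [pauliOp_mul_comm (f p), smul_smul] at e
  have e2 := congrArg (fun Z => (Z * (pauliOp (f p) * pauliOp (f q))).trace) e
  have e3 : (pauliOp (f q) * pauliOp (f p)) * (pauliOp (f p) * pauliOp (f q)) = 1 := by
    rw [Matrix.mul_assoc, ← Matrix.mul_assoc (pauliOp (f p)), pauliOp_mul_self, Matrix.one_mul,
      pauliOp_mul_self]
  simp only [Matrix.smul_mul, e3, Matrix.trace_smul, smul_eq_mul, Matrix.trace_one] at e2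
  have h2 : ((Fintype.card (Bits n) : ℕ) : ℂ) ≠ 0 := by
    simp
  have e4 := mul_right_cancel₀ h2 e2
  have hst : s * t ≠ 0 := mul_ne_zero hs0 ht0
  refine mul_left_cancel₀ hst ?_
  linear_combination e4

/-- An injective self-map of the finite set of strings is bijective, and `U†` acts by its inverse
with the same signs. -/
theorem star {U : Op n} {f : Str n → Str n} (h : ActsBy U f) :
    ∃ g, ActsBy U.conjTranspose g ∧ (∀ p, f (g p) = p) ∧ ∀ p, g (f p) = p := by
  let e := Equiv.ofBijective f (Finite.injective_iff_bijective.1 h.injective)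
  refine ⟨e.symm, ⟨by rw [Matrix.conjTranspose_conjTranspose, h.star_mul], fun p => ?_⟩,
    e.apply_symm_apply, e.symm_apply_apply⟩
  obtain ⟨s, hs, h1⟩ := h.act (e.symm p)
  rw [show f (e.symm p) = p from e.apply_symm_apply p] at h1
  refine ⟨s, hs, h.conj_inj ?_⟩
  rw [Matrix.conjTranspose_conjTranspose, Matrix.mul_smul, Matrix.smul_mul, h1, smul_smul]
  have : s * s = 1 := by rcases hs with rfl | rfl <;> simp
  rw [this, one_smul]
  calc _ = (U * U.conjTranspose) * pauliOp p * (U * U.conjTranspose) := by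
        simp only [Matrix.mul_assoc]
    _ = _ := by rw [h.mul_star, Matrix.one_mul, Matrix.mul_one]

end ActsBy

/-- Conjugations that agree on the Pauli strings agree. -/
theorem conj_ext {U W : Op n}
    (h : ∀ p, U * pauliOp p * U.conjTranspose = W * pauliOp p * W.conjTranspose) (X : Op n) :
    U * X * U.conjTranspose = W * X * W.conjTranspose := by
  have h2 : (2 : ℂ) ^ n ≠ 0 := by positivity
  have : X = ∑ p : Str n, ((2 ^ n : ℂ)⁻¹ * (X * pauliOp p).trace) • pauliOp p := by
    have e := congrArg (fun Y => (2 ^ n : ℂ)⁻¹ • Y) (sum_trace_smul_pauliOp X)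
    simp only [smul_smul, inv_mul_cancel₀ h2, one_smul, Finset.smul_sum] at e
    exact e.symm
  rw [this]
  simp only [Finset.mul_sum, Finset.sum_mul, Matrix.mul_smul, Matrix.smul_mul, h]

end Acts

/-! ## Clifford elements -/

instance (n : ℕ) : Fintype (Clifford n) := Fintype.ofFinite _

namespace Clifford

variable {n : ℕ}

/-- The action on unsigned Pauli strings. -/
def act (c : Clifford n) (p : Str n) : Str n := (c.1 p).2

theorem toUnitary_spec (c : Clifford n) (p : Str n) :
    c.toUnitary * pauliOp p * c.toUnitary.conjTranspose =
      (if (c.1 p).1 then (-1 : ℂ) else 1) • pauliOp (c.act p) :=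
  Classical.choose_spec c.2 p

theorem actsBy (c : Clifford n) : ActsBy c.toUnitary c.act := by
  refine ⟨?_, fun p => ⟨_, ?_, c.toUnitary_spec p⟩⟩
  · exact (Matrix.mem_unitaryGroup_iff).1 (Classical.choose c.2).2
  · split_ifs <;> simp

/-- The chosen representative of an element may differ from `U` by a phase. Hence the agreement is
stated for conjugations, and this is how elements are compared throughout. -/
theorem exists_of_actsBy {U : Op n} {f : Str n → Str n} (h : ActsBy U f) :
    ∃ c : Clifford n, c.act = f ∧
      ∀ X, c.toUnitary * X * c.toUnitary.conjTranspose = U * X * U.conjTranspose := by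
  classical
  choose s hs hU using h.act
  let g : Str n → Bool × Str n := fun p => (decide (s p = -1), f p)
  have hg : ActsOnPaulis ⟨U, Matrix.mem_unitaryGroup_iff.2 h.mul_star⟩ g := by
    intro p
    change U * pauliOp p * U.conjTranspose = _
    rw [hU p]
    rcases hs p with h | h
    · have : (1 : ℂ) ≠ -1 := by norm_num
      simp [g, h, this]
    · simp [g, h]
  let c : Clifford n := ⟨g, _, hg⟩
  exact ⟨c, rfl, conj_ext fun p => (c.toUnitary_spec p).trans (hg p).symm⟩

theorem ext_conj {c c' : Clifford n} (h : ∀ X, c.toUnitary * X * c.toUnitary.conjTranspose =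
    c'.toUnitary * X * c'.toUnitary.conjTranspose) : c = c' := by
  refine Subtype.ext (funext fun p => ?_)
  have h1 := h (pauliOp p)
  rw [toUnitary_spec, toUnitary_spec] at h1
  obtain ⟨h2, h3⟩ := smul_pauliOp_inj (by split_ifs <;> simp) h1
  refine Prod.ext ?_ h2
  have : (1 : ℂ) ≠ -1 := by norm_num
  revert h3
  cases (c.1 p).1 <;> cases (c'.1 p).1 <;> simp [this, this.symm]

/-- Multiplication from the left by a unitary of the Clifford group. -/
def leftMul {U : Op n} {f : Str n → Str n} (h : ActsBy U f) (c : Clifford n) : Clifford n :=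
  Classical.choose (exists_of_actsBy (h.mul c.actsBy))

theorem leftMul_act {U : Op n} {f : Str n → Str n} (h : ActsBy U f) (c : Clifford n) (p : Str n) :
    (leftMul h c).act p = f (c.act p) :=
  congrFun (Classical.choose_spec (exists_of_actsBy (h.mul c.actsBy))).1 p

theorem leftMul_conj {U : Op n} {f : Str n → Str n} (h : ActsBy U f) (c : Clifford n) (X : Op n) :
    (leftMul h c).toUnitary * X * (leftMul h c).toUnitary.conjTranspose =
      U * (c.toUnitary * X * c.toUnitary.conjTranspose) * U.conjTranspose := by
  rw [leftMul, (Classical.choose_spec (exists_of_actsBy (h.mul c.actsBy))).2,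
    Matrix.conjTranspose_mul]
  simp only [Matrix.mul_assoc]

theorem leftMul_injective {U : Op n} {f : Str n → Str n} (h : ActsBy U f) :
    Function.Injective (leftMul h) := by
  intro c c' hcc
  refine ext_conj fun X => h.conj_inj ?_
  rw [← leftMul_conj h, ← leftMul_conj h, hcc]

theorem leftMul_bijective {U : Op n} {f : Str n → Str n} (h : ActsBy U f) :
    Function.Bijective (leftMul h) := Finite.injective_iff_bijective.1 (leftMul_injective h)

theorem exists_inv (c : Clifford n) : ∃ c' : Clifford n,
    ∀ X, c'.toUnitary * X * c'.toUnitary.conjTranspose = c.toUnitary.conjTranspose * X * c.toUnitary := by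
  obtain ⟨g, hg, _⟩ := c.actsBy.star
  obtain ⟨c', _, h⟩ := exists_of_actsBy hg
  exact ⟨c', fun X => by rw [h, Matrix.conjTranspose_conjTranspose]⟩

/-- Inverses in the Clifford group. -/
def inverse (c : Clifford n) : Clifford n := Classical.choose c.exists_inv

theorem inverse_conj (c : Clifford n) (X : Op n) :
    c.inverse.toUnitary * X * c.inverse.toUnitary.conjTranspose =
      c.toUnitary.conjTranspose * X * c.toUnitary := Classical.choose_spec c.exists_inv X

theorem conj_conj_star (c : Clifford n) (X : Op n) :
    c.toUnitary * (c.toUnitary.conjTranspose * X * c.toUnitary) * c.toUnitary.conjTranspose = X := by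
  calc _ = (c.toUnitary * c.toUnitary.conjTranspose) * X *
        (c.toUnitary * c.toUnitary.conjTranspose) := by simp only [Matrix.mul_assoc]
    _ = X := by rw [c.actsBy.mul_star, Matrix.one_mul, Matrix.mul_one]

theorem inverse_conj_star (c : Clifford n) (X : Op n) :
    c.inverse.toUnitary.conjTranspose * X * c.inverse.toUnitary =
      c.toUnitary * X * c.toUnitary.conjTranspose := by
  refine c.inverse.actsBy.conj_inj ?_
  rw [conj_conj_star, inverse_conj]
  calc X = (c.toUnitary.conjTranspose * c.toUnitary) * X *
        (c.toUnitary.conjTranspose * c.toUnitary) := by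
        rw [c.actsBy.star_mul, Matrix.one_mul, Matrix.mul_one]
    _ = _ := by simp only [Matrix.mul_assoc]

/-- Conjugation by the inverse determines the conjugation, hence the element. It makes the uniform
distribution invariant under inversion. -/
theorem inverse_bijective : Function.Bijective (inverse : Clifford n → Clifford n) := by
  refine Finite.injective_iff_bijective.1 fun c c' h => ext_conj fun X => ?_
  rw [← inverse_conj_star, ← inverse_conj_star, h]

end Clifford
end

/-! ### Gate lists and their action on Pauli strings. -/

noncomputable section

/-! ## The gates `H`, `S` and `CNOT` act on Pauli strings -/

section Gates

variable {n : ℕ}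

theorem actsBy_local1 (q : Fin n) {A : Matrix Bool Bool ℂ} {φ : PauliLetter → PauliLetter}
    (hA : A * A.conjTranspose = 1)
    (h : ∀ a : PauliLetter, ∃ s : ℂ, (s = 1 ∨ s = -1) ∧
      A * a.toMatrix * A.conjTranspose = s • (φ a).toMatrix) :
    ActsBy (local1 q A) fun p => Function.update p q (φ (p q)) := by
  constructor
  · rw [local1_eq_tens, tens_conjTranspose, tens_mul, ← tens_one]
    congr 1
    ext1 i
    by_cases hi : i = q
    · subst hi; simp [hA]
    · simp [hi]
  · intro p
    obtain ⟨s, hs, hsA⟩ := h (p q)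
    refine ⟨s, hs, ?_⟩
    -- The sign is put into the factor at site `q`, so that it can be moved inside the tensor
    -- product.
    have e : s = ∏ i : Fin n, if i = q then s else 1 := by simp
    rw [local1_eq_tens, tens_conjTranspose, pauliOp_eq_tens, pauliOp_eq_tens, tens_mul, tens_mul]
    conv_rhs => rw [e]
    rw [← tens_smul]
    congr 1
    ext1 i
    by_cases hi : i = q
    · subst hi; simp [hsA]
    · simp [hi]

theorem sqrt_two_inv_mul_self : ((Real.sqrt 2 : ℝ) : ℂ)⁻¹ * ((Real.sqrt 2 : ℝ) : ℂ)⁻¹ = 1 / 2 := by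
  rw [← mul_inv, ← Complex.ofReal_mul, Real.mul_self_sqrt (by norm_num)]; norm_num

theorem hadamard_conjTranspose : hadamard.conjTranspose = hadamard := by
  ext x y
  cases x <;> cases y <;> simp [hadamard, Matrix.conjTranspose_apply, Complex.conj_ofReal]

theorem hadamard_mul_self : hadamard * hadamard = 1 := by
  have h := sqrt_two_inv_mul_self
  ext x y
  cases x <;> cases y <;> (simp [hadamard, Matrix.mul_apply, h]; try norm_num)

theorem phaseGate_mul_conjTranspose : phaseGate * phaseGate.conjTranspose = 1 := by
  ext x y
  cases x <;> cases y <;> simp [phaseGate, Matrix.mul_apply, Matrix.conjTranspose_apply]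

theorem phaseGate_cube : phaseGate * phaseGate * phaseGate = phaseGate.conjTranspose := by
  ext x y
  cases x <;> cases y <;> simp [phaseGate, Matrix.mul_apply, Matrix.conjTranspose_apply]

/-- Action of `H` on letters. -/
def hadLetter : PauliLetter → PauliLetter := ![0, 3, 2, 1]

/-- Action of `S` on letters. -/
def phaseLetter : PauliLetter → PauliLetter := ![0, 2, 1, 3]

/-- The new letter at the control of a `CNOT`. -/
def ctrlLetter (a b : PauliLetter) : PauliLetter := if b = 2 ∨ b = 3 then ![3, 2, 1, 0] a else a

/-- The new letter at the target of a `CNOT`. -/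
def tgtLetter (a b : PauliLetter) : PauliLetter := if a = 1 ∨ a = 2 then ![1, 0, 3, 2] b else b

theorem actsBy_hadamard (q : Fin n) :
    ActsBy (local1 q hadamard) fun p => Function.update p q (hadLetter (p q)) := by
  refine actsBy_local1 q (by rw [hadamard_conjTranspose, hadamard_mul_self]) fun a => ?_
  have h := sqrt_two_inv_mul_self
  refine ⟨if a = 2 then -1 else 1, by split_ifs <;> simp, ?_⟩
  rw [hadamard_conjTranspose]
  fin_cases a <;> ext x y <;> cases x <;> cases y <;>
    (simp [hadamard, hadLetter, PauliLetter.toMatrix, Matrix.mul_apply]) <;>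
    -- The remaining entries amount to `±2` or `±2i` times `(1/√2)² = 1/2`.
    (try linear_combination (2 : ℂ) * h) <;> (try linear_combination (-2 : ℂ) * h) <;>
    (try linear_combination (2 * Complex.I : ℂ) * h) <;>
    linear_combination (-2 * Complex.I : ℂ) * h

theorem actsBy_phaseGate (q : Fin n) :
    ActsBy (local1 q phaseGate) fun p => Function.update p q (phaseLetter (p q)) := by
  refine actsBy_local1 q phaseGate_mul_conjTranspose fun a => ?_
  refine ⟨if a = 2 then -1 else 1, by split_ifs <;> simp, ?_⟩
  fin_cases a <;> ext x y <;> cases x <;> cases y <;>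
    simp [phaseGate, phaseLetter, PauliLetter.toMatrix, Matrix.mul_apply,
      Matrix.conjTranspose_apply]

/-- The permutation of basis states of a `CNOT`. -/
def cnotMap (q r : Fin n) (x : Bits n) : Bits n := Function.update x r (xor (x q) (x r))

theorem cnotMap_cnotMap {q r : Fin n} (h : q ≠ r) (x : Bits n) :
    cnotMap q r (cnotMap q r x) = x := by
  ext1 i
  by_cases hi : i = r
  · subst hi; simp [cnotMap, h]
  · simp [cnotMap, hi]

theorem local2_cnot {q r : Fin n} (h : q ≠ r) (x y : Bits n) :
    local2 q r cnot x y = if x = cnotMap q r y then 1 else 0 := by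
  simp only [local2, cnot, Matrix.of_apply, Prod.mk.injEq]
  rw [← ite_and]
  congr 1
  simp only [eq_iff_iff, funext_iff]
  constructor
  · rintro ⟨h1, h2, h3⟩ i
    by_cases hi : i = r
    · subst hi; simp [cnotMap, h3]
    · by_cases hq : i = q
      · subst hq; simp [cnotMap, hi, h2]
      · simp [cnotMap, hi, h1 i hq hi]
  · intro h1
    refine ⟨fun i hq hr => by simpa [cnotMap, hr] using h1 i, by simpa [cnotMap, h] using h1 q,
      by simpa [cnotMap] using h1 r⟩

/-- Conjugation by `CNOT` relabels matrix entries by adding the control bit to the target bit, so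
the action on two letters is a finite check. The sign is `-1` exactly for `X ⊗ Z` and `Y ⊗ Y`. -/
theorem cnot_letters (a b : PauliLetter) (x y z w : Bool) :
    a.toMatrix x y * b.toMatrix (xor x z) (xor y w) =
      (if a = 1 ∧ b = 3 ∨ a = 2 ∧ b = 2 then (-1 : ℂ) else 1) *
        ((ctrlLetter a b).toMatrix x y * (tgtLetter a b).toMatrix z w) := by
  fin_cases a <;> fin_cases b <;> cases x <;> cases y <;> cases z <;> cases w <;>
    simp [ctrlLetter, tgtLetter, PauliLetter.toMatrix, Matrix.one_apply]

theorem cnot_conj {q r : Fin n} (h : q ≠ r) (X : Op n) (x y : Bits n) :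
    (local2 q r cnot * X * (local2 q r cnot).conjTranspose) x y =
      X (cnotMap q r x) (cnotMap q r y) := by
  have e : ∀ u v : Bits n, u = cnotMap q r v ↔ v = cnotMap q r u := fun u v =>
    ⟨fun h' => by rw [h', cnotMap_cnotMap h], fun h' => by rw [h', cnotMap_cnotMap h]⟩
  simp only [Matrix.mul_apply, Matrix.conjTranspose_apply, local2_cnot h, e x, e y]
  simp

theorem actsBy_cnot {q r : Fin n} (h : q ≠ r) :
    ActsBy (local2 q r cnot) fun p =>
      Function.update (Function.update p q (ctrlLetter (p q) (p r))) r
        (tgtLetter (p q) (p r)) := by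
  constructor
  · ext x y
    have := cnot_conj h 1 x y
    rw [Matrix.mul_one] at this
    rw [this]
    by_cases hxy : x = y
    · subst hxy; rw [Matrix.one_apply_eq, Matrix.one_apply_eq]
    · rw [Matrix.one_apply_ne hxy, Matrix.one_apply_ne]
      intro h'
      apply hxy
      rw [← cnotMap_cnotMap h x, h', cnotMap_cnotMap h]
  · intro p
    refine ⟨if p q = 1 ∧ p r = 3 ∨ p q = 2 ∧ p r = 2 then -1 else 1, by split_ifs <;> simp, ?_⟩
    ext x y
    rw [cnot_conj h]
    have hr : r ∈ Finset.univ.erase q := Finset.mem_erase.2 ⟨h.symm, Finset.mem_univ r⟩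
    simp only [pauliOp, Matrix.of_apply, Matrix.smul_apply, smul_eq_mul]
    -- The factors at `q` and `r` are split off on both sides; all others are unaffected by the
    -- relabelling.
    rw [← Finset.mul_prod_erase _ _ (Finset.mem_univ q), ← Finset.mul_prod_erase _ _ hr]
    rw [← Finset.mul_prod_erase _ (fun i => PauliLetter.toMatrix _ _ _) (Finset.mem_univ q),
      ← Finset.mul_prod_erase _ (fun i => PauliLetter.toMatrix _ _ _) hr]
    have e : ∀ z : Bits n, cnotMap q r z q = z q ∧ cnotMap q r z r = xor (z q) (z r) := by
      intro z; simp [cnotMap, h]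
    simp only [e, Function.update_self, Function.update_of_ne h]
    rw [← mul_assoc, cnot_letters, mul_assoc, mul_assoc]
    congr 3
    refine Finset.prod_congr rfl fun i hi => ?_
    have h1 := Finset.ne_of_mem_erase hi
    have h2 := Finset.ne_of_mem_erase (Finset.mem_of_mem_erase hi)
    simp [cnotMap, h1, h2]

end Gates

/-! ## Gate codes

A number `e` stands for the gate of kind `e % 4` at qubit `q = e / 4`: `H`, `S`, the `CNOT` from `q`
to `q + 1`, and the `CNOT` from `q + 1` to `q`. -/

section Codes

variable {n : ℕ}

/-- The operator of a gate code. -/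
def codeOp (n e : ℕ) : Op n :=
  -- The cascade of `<` tests is the one that the machine program performs. A code for an absent
  -- qubit is the identity, as for the gate instructions of the machine.
  if e % 4 < 1 then (if h : e / 4 < n then local1 ⟨e / 4, h⟩ hadamard else 1)
  else if e % 4 < 2 then (if h : e / 4 < n then local1 ⟨e / 4, h⟩ phaseGate else 1)
  else if e % 4 < 3 then
    (if h : e / 4 + 1 < n then local2 ⟨e / 4, Nat.lt_of_succ_lt h⟩ ⟨e / 4 + 1, h⟩ cnot else 1)
  else
    (if h : e / 4 + 1 < n then local2 ⟨e / 4 + 1, h⟩ ⟨e / 4, Nat.lt_of_succ_lt h⟩ cnot else 1)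

/-- The action of a gate code on Pauli strings. -/
def codeAct (e : ℕ) (p : Str n) : Str n :=
  if e % 4 < 1 then
    (if h : e / 4 < n then Function.update p ⟨e / 4, h⟩ (hadLetter (p ⟨e / 4, h⟩)) else p)
  else if e % 4 < 2 then
    (if h : e / 4 < n then Function.update p ⟨e / 4, h⟩ (phaseLetter (p ⟨e / 4, h⟩)) else p)
  else if e % 4 < 3 then
    (if h : e / 4 + 1 < n then
      Function.update (Function.update p ⟨e / 4, Nat.lt_of_succ_lt h⟩
        (ctrlLetter (p ⟨e / 4, Nat.lt_of_succ_lt h⟩) (p ⟨e / 4 + 1, h⟩))) ⟨e / 4 + 1, h⟩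
          (tgtLetter (p ⟨e / 4, Nat.lt_of_succ_lt h⟩) (p ⟨e / 4 + 1, h⟩)) else p)
  else
    (if h : e / 4 + 1 < n then
      Function.update (Function.update p ⟨e / 4 + 1, h⟩
        (ctrlLetter (p ⟨e / 4 + 1, h⟩) (p ⟨e / 4, Nat.lt_of_succ_lt h⟩)))
          ⟨e / 4, Nat.lt_of_succ_lt h⟩
            (tgtLetter (p ⟨e / 4 + 1, h⟩) (p ⟨e / 4, Nat.lt_of_succ_lt h⟩)) else p)

theorem actsBy_codeOp (e : ℕ) : ActsBy (codeOp n e) (codeAct e) := by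
  unfold codeOp codeAct
  split_ifs
  · exact actsBy_hadamard _
  · exact ActsBy.one
  · exact actsBy_phaseGate _
  · exact ActsBy.one
  · exact actsBy_cnot (by simp)
  · exact ActsBy.one
  · exact actsBy_cnot (by simp)
  · exact ActsBy.one

/-- The operator of a list of gate codes; the head is applied first. -/
def listOp (n : ℕ) : List ℕ → Op n
  | [] => 1
  | e :: l => listOp n l * codeOp n e

/-- The action of a list of gate codes on Pauli strings. -/
def listAct : List ℕ → Str n → Str n
  | [], p => p
  | e :: l, p => listAct l (codeAct e p)

theorem listOp_append (l l' : List ℕ) : listOp n (l ++ l') = listOp n l' * listOp n l := by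
  induction l with
  | nil => simp [listOp]
  | cons e l ih => simp [listOp, ih, Matrix.mul_assoc]

theorem listAct_append (l l' : List ℕ) (p : Str n) :
    listAct (l ++ l') p = listAct l' (listAct l p) := by
  induction l generalizing p with
  | nil => rfl
  | cons e l ih => exact ih _

theorem actsBy_listOp (l : List ℕ) : ActsBy (listOp n l) (listAct l) := by
  induction l with
  | nil => exact ActsBy.one
  | cons e l ih => exact ih.mul (actsBy_codeOp e)

/-- All letter maps fix `I`. This is why a sweep from site `k` on does not disturb the images of
`Z_i` that earlier sweeps have already reduced. -/
theorem codeAct_of_tail_zero {e k : ℕ} (he : k ≤ e / 4) {p : Str n}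
    (hp : ∀ j : Fin n, k ≤ j.val → p j = 0) : codeAct e p = p := by
  unfold codeAct
  split_ifs with h1 h2 h3 h2 h4 h h
  · rw [hp ⟨e / 4, h2⟩ he, Function.update_eq_self_iff, hp ⟨e / 4, h2⟩ he]; rfl
  · rfl
  · rw [hp ⟨e / 4, h2⟩ he, Function.update_eq_self_iff, hp ⟨e / 4, h2⟩ he]; rfl
  · rfl
  all_goals try rfl
  all_goals
    rw [hp ⟨e / 4, by omega⟩ he, hp ⟨e / 4 + 1, h⟩ (by simp; omega)]
    ext1 j
    simp only [Function.update_apply]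
    split_ifs with h5 h6
    · subst h5; rw [hp _ (by simp; omega)]; rfl
    · subst h6; rw [hp _ (by simp; omega)]; rfl
    · rfl

theorem listAct_of_tail_zero {l : List ℕ} {k : ℕ} (hl : ∀ e ∈ l, k ≤ e / 4) {p : Str n}
    (hp : ∀ j : Fin n, k ≤ j.val → p j = 0) : listAct l p = p := by
  induction l with
  | nil => rfl
  | cons e l ih =>
    rw [listAct, codeAct_of_tail_zero (hl e (by simp)) hp]
    exact ih fun e' he' => hl e' (by simp [he'])

theorem codeAct_of_lt {e : ℕ} {p : Str n} {j : Fin n} (hj : j.val < e / 4) :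
    codeAct e p j = p j := by
  have h1 : ∀ h : e / 4 < n, j ≠ ⟨e / 4, h⟩ := fun h h' => by simp [h'] at hj
  have h2 : ∀ h : e / 4 + 1 < n, j ≠ ⟨e / 4 + 1, h⟩ := fun h h' => by simp [h'] at hj
  unfold codeAct
  split_ifs <;> simp [h1, h2]

theorem listAct_of_lt {l : List ℕ} {k : ℕ} (hl : ∀ e ∈ l, k ≤ e / 4) {p : Str n} {j : Fin n}
    (hj : j.val < k) : listAct l p j = p j := by
  induction l generalizing p with
  | nil => rfl
  | cons e l ih =>
    rw [listAct, ih fun e' he' => hl e' (by simp [he'])]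
    exact codeAct_of_lt (hj.trans_le (hl e (by simp)))

end Codes

/-! ## Sweeping a Pauli string to a single `Z` -/

/-- The gates that turn the letter `l` at site `i` into `I` or `Z`, and then clear a letter `Z` at
site `i + 1`, if there is one (`c = 1`). -/
def siteCodes (i l c : ℕ) : List ℕ :=
  -- With letter `I` and a `Z` above, the two `CNOT`s act as `IZ → ZZ → ZI`. Otherwise `H` turns `X`
  -- into `Z`, `S` then `H` turns `Y` into `Z`, and the `CNOT` from the upper site clears `ZZ` to
  -- `ZI`.
  if l < 1 then (if c < 1 then [] else [4 * i + 2, 4 * i + 3])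
  else (if l < 2 then [4 * i] else if l < 3 then [4 * i + 1, 4 * i] else []) ++
    (if c < 1 then [] else [4 * i + 3])

/-- Whether there is a letter `Z` at the site after `siteCodes`. -/
def nextCarry (l c : ℕ) : ℕ := if l < 1 then c else 1

/-- The gates for the `t` sites below `i`, whose letters are the base-4 digits of `r`. -/
def sweepCodes : (t i r c : ℕ) → List ℕ
  | 0, _, _, _ => []
  | t + 1, i, r, c =>
    siteCodes (i - 1) (r % 4) c ++ sweepCodes t (i - 1) (r / 4) (nextCarry (r % 4) c)

theorem siteCodes_site {i l c e : ℕ} (he : e ∈ siteCodes i l c) : e / 4 = i := by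
  unfold siteCodes at he
  split_ifs at he <;> simp at he <;> omega

theorem siteCodes_length (i l c : ℕ) : (siteCodes i l c).length ≤ 3 := by
  unfold siteCodes
  split_ifs <;> simp

theorem sweepCodes_site {t i r c e : ℕ} (ht : t ≤ i) (he : e ∈ sweepCodes t i r c) :
    i - t ≤ e / 4 ∧ e / 4 < i := by
  induction t generalizing i r c with
  | zero => simp [sweepCodes] at he
  | succ t ih =>
    rw [sweepCodes, List.mem_append] at he
    rcases he with he | he
    · have := siteCodes_site he; omega
    · have := ih (by omega) he; omega

theorem sweepCodes_length (t i r c : ℕ) : (sweepCodes t i r c).length ≤ 3 * t := by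
  induction t generalizing i r c with
  | zero => simp [sweepCodes]
  | succ t ih =>
    rw [sweepCodes, List.length_append]
    have := siteCodes_length (i - 1) (r % 4) c
    have := ih (i - 1) (r / 4) (nextCarry (r % 4) c)
    omega

section Sweep

variable {n : ℕ}

/-- The letter at a site, as a number. -/
def letterAt (p : Str n) (i : ℕ) : ℕ := if h : i < n then (p ⟨i, h⟩).val else 0

/-- The letters at the `t` sites below `i` as base-4 digits. -/
def tailNum (p : Str n) : (t i : ℕ) → ℕ
  | 0, _ => 0
  | t + 1, i => letterAt p (i - 1) + 4 * tailNum p t (i - 1)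

theorem letterAt_lt (p : Str n) (i : ℕ) : letterAt p i < 4 := by
  unfold letterAt; split_ifs with h
  · exact (p ⟨i, h⟩).isLt
  · norm_num

theorem tailNum_lt (p : Str n) (t i : ℕ) : tailNum p t i < 4 ^ t := by
  induction t generalizing i with
  | zero => simp [tailNum]
  | succ t ih =>
    have := ih (i - 1); have := letterAt_lt p (i - 1)
    rw [tailNum, pow_succ]; omega

theorem tailNum_congr {p q : Str n} {t i : ℕ} (h : ∀ j, j < i → letterAt p j = letterAt q j)
    (ht : t ≤ i) : tailNum p t i = tailNum q t i := by
  induction t generalizing i with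
  | zero => rfl
  | succ t ih =>
    rw [tailNum, tailNum, h (i - 1) (by omega), ih (fun j hj => h j (by omega)) (by omega)]

theorem tailNum_eq_zero {p : Str n} {t i : ℕ} (hi : i ≤ n) (ht : t ≤ i) (h : tailNum p t i = 0)
    (j : Fin n) (hj : i - t ≤ j.val) (hj' : j.val < i) : p j = 0 := by
  induction t generalizing i with
  | zero => omega
  | succ t ih =>
    rw [tailNum] at h
    by_cases hji : j.val = i - 1
    · have : letterAt p (i - 1) = 0 := by omega
      rw [letterAt, dif_pos (by omega)] at this
      have e : j = ⟨i - 1, by omega⟩ := Fin.ext hji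
      rw [e]; exact Fin.ext this
    · exact ih (i := i - 1) (by omega) (by omega) (by omega) (by omega) (by omega)

/-- Read off the base-4 digits of `r`. The last site is the lowest digit, so site `j` has position
`n - 1 - j`. -/
theorem exists_tailNum (q : Str n) {k r : ℕ} (hk : k ≤ n) (hr : r < 4 ^ (n - k)) :
    ∃ p : Str n, (∀ j : Fin n, j.val < k → p j = q j) ∧ tailNum p (n - k) n = r := by
  let p : Str n := fun j => if j.val < k then q j else
    ⟨r / 4 ^ (n - 1 - j.val) % 4, Nat.mod_lt _ (by norm_num)⟩
  refine ⟨p, fun j hj => by simp [p, hj], ?_⟩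
  have key : ∀ t i, i ≤ n → t + k ≤ i → tailNum p t i = r / 4 ^ (n - i) % 4 ^ t := by
    intro t
    induction t with
    | zero => intro i _ _; simp [tailNum, Nat.mod_one]
    | succ t ih =>
      intro i hi ht
      rw [tailNum, ih (i - 1) (by omega) (by omega), letterAt, dif_pos (by omega)]
      have h1 : ¬ i - 1 < k := by omega
      have h2 : n - 1 - (i - 1) = n - i := by omega
      have h3 : n - (i - 1) = n - i + 1 := by omega
      simp only [p, h1, if_false, h2, h3]
      rw [pow_succ 4 (n - i), ← Nat.div_div_eq_div_mul, pow_succ' 4 t, Nat.mod_mul]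
  rw [key _ _ le_rfl (by omega), Nat.sub_self, pow_zero, Nat.div_one, Nat.mod_eq_of_lt hr]

/-- The sites from `i` on carry at most a letter `Z` at site `i`. -/
def Swept (i c : ℕ) (p : Str n) : Prop :=
  ∀ j : Fin n, i ≤ j.val → p j = if j.val = i ∧ c = 1 then 3 else 0

/-- A finite check over the letter and the carry; a carry presupposes that site `i + 1` exists. -/
theorem swept_siteCodes {i c : ℕ} {p : Str n} (hi : i < n) (hc : c = 0 ∨ c = 1 ∧ i + 1 < n)
    (hp : Swept (i + 1) c p) :
    Swept i (nextCarry (letterAt p i) c) (listAct (siteCodes i (letterAt p i) c) p) := by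
  have a0 : 4 * i / 4 = i := by omega
  have a1 : (4 * i + 1) / 4 = i := by omega
  have a2 : (4 * i + 2) / 4 = i := by omega
  have a3 : (4 * i + 3) / 4 = i := by omega
  have b0 : 4 * i % 4 = 0 := by omega
  have b1 : (4 * i + 1) % 4 = 1 := by omega
  have b2 : (4 * i + 2) % 4 = 2 := by omega
  have b3 : (4 * i + 3) % 4 = 3 := by omega
  have hl : letterAt p i = (p ⟨i, hi⟩).val := dif_pos hi
  rw [hl]
  have hne : ∀ h : i + 1 < n, (⟨i, hi⟩ : Fin n) ≠ ⟨i + 1, h⟩ := by intro h; simp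
  have hcase : p ⟨i, hi⟩ = 0 ∨ p ⟨i, hi⟩ = 1 ∨ p ⟨i, hi⟩ = 2 ∨ p ⟨i, hi⟩ = 3 := by
    generalize p ⟨i, hi⟩ = a; revert a; decide
  intro j hj
  rcases hc with rfl | ⟨rfl, hi1⟩
  · rcases Nat.eq_or_lt_of_le hj with hji | hji
    · obtain rfl : j = ⟨i, hi⟩ := Fin.ext hji.symm
      rcases hcase with h | h | h | h <;>
        simp [h, siteCodes, nextCarry, listAct, codeAct, a0, a1, b0, b1, hi, hadLetter,
          phaseLetter]
    · have hjn : j ≠ ⟨i, hi⟩ := fun h => by simp [h] at hji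
      have := hp j hji
      have hne' : j.val ≠ i := by omega
      simp only [zero_ne_one, and_false, if_false] at this
      rcases hcase with h | h | h | h <;>
        simp [h, siteCodes, nextCarry, listAct, codeAct, a0, a1, b0, b1, hi, hjn, this, hne']
  · have h3 : p ⟨i + 1, hi1⟩ = 3 := by simpa using hp ⟨i + 1, hi1⟩ le_rfl
    rcases Nat.eq_or_lt_of_le hj with hji | hji
    · obtain rfl : j = ⟨i, hi⟩ := Fin.ext hji.symm
      rcases hcase with h | h | h | h <;>
        simp [h, h3, siteCodes, nextCarry, listAct, codeAct, a0, a1, a2, a3, b0, b1, b2, b3, hi,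
          hi1, hadLetter, phaseLetter, ctrlLetter, tgtLetter, hne]
    · have hjn : j ≠ ⟨i, hi⟩ := fun h => by simp [h] at hji
      have hne' : j.val ≠ i := by omega
      have := hp j hji
      by_cases hj1 : j.val = i + 1
      · obtain rfl : j = ⟨i + 1, hi1⟩ := Fin.ext hj1
        rcases hcase with h | h | h | h <;>
          simp [h, h3, siteCodes, nextCarry, listAct, codeAct, a0, a1, a2, a3, b0, b1, b2, b3, hi,
            hi1, hadLetter, phaseLetter, ctrlLetter, tgtLetter, hne]
      · have hjn1 : j ≠ ⟨i + 1, hi1⟩ := fun h => by simp [h] at hj1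
        simp only [hj1, false_and, if_false] at this
        rcases hcase with h | h | h | h <;>
          simp [h, siteCodes, nextCarry, listAct, codeAct, a0, a1, a2, a3, b0, b1, b2, b3, hi,
            hi1, hjn, hjn1, hne', this]

theorem swept_sweepCodes {t i c : ℕ} {p : Str n} (hi : i ≤ n) (ht : t ≤ i)
    (hc : c = 0 ∨ c = 1 ∧ i < n) (hp : Swept i c p) :
    Swept (i - t) (if c = 1 ∨ tailNum p t i ≠ 0 then 1 else 0)
      (listAct (sweepCodes t i (tailNum p t i) c) p) := by
  induction t generalizing i c p with
  | zero =>
    simp only [sweepCodes, listAct, tailNum, ne_eq, not_true_eq_false, or_false, Nat.sub_zero]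
    rcases hc with rfl | ⟨rfl, -⟩ <;> simpa using hp
  | succ t ih =>
    obtain ⟨i, rfl⟩ : ∃ i', i = i' + 1 := ⟨i - 1, by omega⟩
    have e1 : tailNum p (t + 1) (i + 1) % 4 = letterAt p i := by
      have := letterAt_lt p i
      rw [tailNum, Nat.add_sub_cancel]; omega
    have e2 : tailNum p (t + 1) (i + 1) / 4 = tailNum p t i := by
      have := letterAt_lt p i
      rw [tailNum, Nat.add_sub_cancel]; omega
    rw [sweepCodes, listAct_append, e1, e2, Nat.add_sub_cancel]
    set p' := listAct (siteCodes i (letterAt p i) c) p with hp'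
    have h1 : Swept i (nextCarry (letterAt p i) c) p' :=
      swept_siteCodes (by omega) hc hp
    -- The gates at site `i` leave lower sites alone, so the digits still to be read are those of
    -- the original string. This allows the whole sweep to be driven by one number fixed in advance.
    have h2 : tailNum p t i = tailNum p' t i := by
      refine tailNum_congr (fun j hj => ?_) (by omega)
      unfold letterAt
      split_ifs with hjn
      · rw [hp', listAct_of_lt (k := i) (fun e he => (siteCodes_site he).ge) hj]
      · rfl
    have h3 := ih (i := i) (c := nextCarry (letterAt p i) c) (p := p') (by omega) (by omega)
      (by unfold nextCarry; split_ifs <;> omega) h1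
    rw [h2, show i + 1 - (t + 1) = i - t by omega]
    convert h3 using 2
    rw [tailNum, Nat.add_sub_cancel, h2]
    unfold nextCarry
    by_cases hl : letterAt p i < 1
    · have : letterAt p i = 0 := by omega
      simp [this]
    · rw [if_neg hl]
      have : letterAt p i ≠ 0 := by omega
      simp [this]

/-- The string with a single letter `Z`. -/
def zAt (i : Fin n) : Str n := fun j => if j = i then 3 else 0

/-- The sweep moves the part of the string from site `k` on to a single `Z` at site `k`. -/
theorem listAct_sweep {k : Fin n} {p : Str n} (h : tailNum p (n - k) n ≠ 0) (j : Fin n) :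
    listAct (sweepCodes (n - k) n (tailNum p (n - k) n) 0) p j =
      if j < k then p j else zAt k j := by
  have hk := k.isLt
  split_ifs with hj
  · refine listAct_of_lt (k := k) (fun e he => ?_) hj
    have := sweepCodes_site (by omega) he; omega
  · have := swept_sweepCodes (p := p) (t := n - k) (i := n) (c := 0) le_rfl (by omega)
      (Or.inl rfl) (fun j hj => absurd j.isLt (by omega)) j (by have := Fin.not_lt.1 hj; omega)
    rw [this, if_pos (Or.inr h), zAt]
    congr 1
    have : n - (n - k.val) = k.val := by omega
    simp only [this, and_true, Fin.ext_iff]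

theorem sweep_site {k : Fin n} {r e : ℕ} (he : e ∈ sweepCodes (n - k) n r 0) : k.val ≤ e / 4 := by
  have := sweepCodes_site (by omega) he; omega

end Sweep
end

/-! ### Born weights, and sampling a random stabilizer basis. -/

noncomputable section

/-! ## Born weights -/

section Born

variable {n : ℕ}

/-- The diagonal of `σ` is a probability distribution. -/
def DiagProb (σ : Op n) : Prop := (∀ b, 0 ≤ (σ b b).re) ∧ ∑ b, (σ b b).re = 1

theorem weightsPMF_apply {α : Type} [Fintype α] [Inhabited α] {w : α → ENNReal}
    (h : ∑ a, w a = 1) (a : α) : weightsPMF w a = w a := by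
  rw [weightsPMF, dif_pos h]; rfl

theorem sum_ofReal_eq_one {α : Type} [Fintype α] {f : α → ℝ} (h0 : ∀ a, 0 ≤ f a)
    (h1 : ∑ a, f a = 1) : ∑ a, ENNReal.ofReal (f a) = 1 := by
  rw [← ENNReal.ofReal_sum_of_nonneg fun a _ => h0 a, h1, ENNReal.ofReal_one]

theorem born_apply {σ : Op n} (h : DiagProb σ) (b : Bits n) :
    born σ b = ENNReal.ofReal (σ b b).re :=
  weightsPMF_apply (sum_ofReal_eq_one h.1 h.2) b

theorem IsState.conj {ρ U : Op n} (h : IsState ρ) (hU : U.conjTranspose * U = 1) :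
    IsState (U * ρ * U.conjTranspose) := by
  refine ⟨h.1.mul_mul_conjTranspose_same U, ?_⟩
  rw [Matrix.trace_mul_comm, ← Matrix.mul_assoc, hU, Matrix.one_mul, h.2]

theorem IsState.diagProb {ρ : Op n} (h : IsState ρ) : DiagProb ρ := by
  refine ⟨fun b => ?_, ?_⟩
  · have := h.1.diag_nonneg (i := b)
    exact (Complex.le_def.1 this).1
  · have := congrArg Complex.re h.2
    simpa [Matrix.trace] using this

theorem basisProj_mul_apply (b : Bits n) (X : Op n) (x y : Bits n) :
    (basisProj b * X) x y = if x = b then X b y else 0 := by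
  rw [Matrix.mul_apply, Finset.sum_eq_single b]
  · simp [basisProj]
  · intro z _ hz; simp [basisProj, hz]
  · simp

theorem trace_basisProj_mul (b : Bits n) (X : Op n) : (basisProj b * X).trace = X b b := by
  rw [Matrix.trace, Finset.sum_eq_single b]
  · rw [Matrix.diag_apply, basisProj_mul_apply, if_pos rfl]
  · intro x _ hx; rw [Matrix.diag_apply, basisProj_mul_apply, if_neg hx]
  · simp

theorem basisProj_isState (b : Bits n) : IsState (basisProj b) := by
  constructor
  · have : basisProj b = Matrix.diagonal (fun x => if x = b then (1 : ℂ) else 0) := by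
      ext x y
      by_cases h : x = y
      · subst h; simp [basisProj]
      · rw [Matrix.diagonal_apply_ne _ h]
        simp only [basisProj, Matrix.of_apply]
        rw [if_neg]; rintro ⟨rfl, rfl⟩; exact h rfl
    rw [this]
    refine Matrix.PosSemidef.diagonal fun x => ?_
    by_cases h : x = b <;> simp [h]
  · have := trace_basisProj_mul b 1
    rwa [Matrix.mul_one, Matrix.one_apply_eq] at this

theorem basisProj_injective : Function.Injective (basisProj : Bits n → Op n) := by
  intro b b' h
  have := congrFun (congrFun h b) b
  by_contra hne
  simp [basisProj, hne] at this

end Born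

/-! ## Measuring in a rotated basis -/

section BasisLaw

variable {n : ℕ}

/-- Measure `ρ` in the basis `U†|b⟩`; the outcome is the projector. -/
def basisLaw (ρ U : Op n) : PMF (Op n) :=
  (born (U * ρ * U.conjTranspose)).map fun b => U.conjTranspose * basisProj b * U

theorem snapshot_eq (ρ : Op n) :
    snapshot ρ = (randomClifford n).bind fun c => basisLaw ρ c.toUnitary := rfl

theorem basisLaw_congr {ρ U W : Op n}
    (h : ∀ X, U * X * U.conjTranspose = W * X * W.conjTranspose)
    (h' : ∀ X, U.conjTranspose * X * U = W.conjTranspose * X * W) :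
    basisLaw ρ U = basisLaw ρ W := by
  simp only [basisLaw, h, h']

theorem uniform_map_bijective {α : Type} [Fintype α] [Nonempty α] {f : α → α}
    (hf : Function.Bijective f) :
    (PMF.uniformOfFintype α).map f = PMF.uniformOfFintype α := by
  classical
  ext a
  obtain ⟨b, rfl⟩ := hf.2 a
  rw [PMF.map_apply, tsum_eq_single b]
  · simp
  · intro b' hb'
    rw [if_neg]
    intro h; exact hb' (hf.1 h).symm

/-- Inversion is a bijection of the finite group, so a uniform element may be replaced by its
inverse. In this form a sweep of `c` from the left splits off from `c†` as gates that act on the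
state first. -/
theorem snapshot_eq_star (ρ : Op n) :
    snapshot ρ = (randomClifford n).bind fun c => basisLaw ρ c.toUnitary.conjTranspose := by
  have h1 : (randomClifford n).map Clifford.inverse = randomClifford n :=
    uniform_map_bijective Clifford.inverse_bijective
  have h2 := PMF.bind_map (randomClifford n) Clifford.inverse fun c => basisLaw ρ c.toUnitary
  rw [h1] at h2
  rw [snapshot_eq, h2]
  refine congrArg _ (funext fun c => ?_)
  refine basisLaw_congr (fun X => ?_) fun X => ?_
  · rw [c.inverse_conj, Matrix.conjTranspose_conjTranspose]
  · rw [c.inverse_conj_star, Matrix.conjTranspose_conjTranspose]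

/-- Distributions with the same weights, up to a relabelling. -/
theorem weightsPMF_map_bijective {α : Type} [Fintype α] [Inhabited α] {w : α → ENNReal}
    (hw : ∑ a, w a = 1) {e : α → α} (he : Function.Bijective e) :
    (weightsPMF fun a => w (e a)).map e = weightsPMF w := by
  classical
  have hw' : ∑ a, w (e a) = 1 := by rw [← hw]; exact he.sum_comp w
  ext a
  obtain ⟨b, rfl⟩ := he.2 a
  rw [PMF.map_apply, tsum_eq_single b, weightsPMF_apply hw', weightsPMF_apply hw, if_pos rfl]
  intro b' hb'
  rw [if_neg]
  intro h; exact hb' (he.1 h).symm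

/-- A change of basis that permutes the projectors does not matter. -/
theorem basisLaw_mul_of_permutes {ρ U V : Op n} (hρ : IsState ρ) (hU : U.conjTranspose * U = 1)
    (hV : V.conjTranspose * V = 1)
    (h : ∀ b, ∃ b', V * basisProj b * V.conjTranspose = basisProj b') :
    basisLaw ρ (V.conjTranspose * U) = basisLaw ρ U := by
  choose π hπ using h
  have hVinj : ∀ X Y : Op n, V * X * V.conjTranspose = V * Y * V.conjTranspose → X = Y := by
    intro X Y hXY
    have := congrArg (fun Z => V.conjTranspose * Z * V) hXY
    have e : ∀ Z : Op n, V.conjTranspose * (V * Z * V.conjTranspose) * V = Z := by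
      intro Z
      calc _ = (V.conjTranspose * V) * Z * (V.conjTranspose * V) := by
            simp only [Matrix.mul_assoc]
        _ = Z := by rw [hV, Matrix.one_mul, Matrix.mul_one]
    simpa only [e] using this
  have hbij : Function.Bijective π := by
    refine Finite.injective_iff_bijective.1 fun b b' hbb => basisProj_injective (hVinj _ _ ?_)
    rw [hπ, hπ, hbb]
  have hst := (hρ.conj hU).diagProb
  -- Cyclicity of the trace moves `V` onto the projector, where it acts as the permutation `π`.
  have hw : ∀ b, (V.conjTranspose * U * ρ * (V.conjTranspose * U).conjTranspose) b b =
      (U * ρ * U.conjTranspose) (π b) (π b) := by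
    intro b
    calc _ = (basisProj b * (V.conjTranspose * U * ρ *
          (V.conjTranspose * U).conjTranspose)).trace := (trace_basisProj_mul _ _).symm
      _ = (basisProj b * V.conjTranspose * (U * ρ * U.conjTranspose) * V).trace := by
          simp only [Matrix.conjTranspose_mul, Matrix.conjTranspose_conjTranspose,
            Matrix.mul_assoc]
      _ = (basisProj (π b) * (U * ρ * U.conjTranspose)).trace := by
          rw [Matrix.trace_mul_comm, ← hπ]; simp only [Matrix.mul_assoc]
      _ = _ := trace_basisProj_mul _ _
  have h1 : born (V.conjTranspose * U * ρ * (V.conjTranspose * U).conjTranspose) =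
      weightsPMF fun b => ENNReal.ofReal ((U * ρ * U.conjTranspose) (π b) (π b)).re := by
    simp only [born, hw]
  have h2 : (fun b => (V.conjTranspose * U).conjTranspose * basisProj b * (V.conjTranspose * U)) =
      (fun b => U.conjTranspose * basisProj b * U) ∘ π := by
    ext1 b
    simp only [Function.comp, ← hπ, Matrix.conjTranspose_mul, Matrix.conjTranspose_conjTranspose,
      Matrix.mul_assoc]
  rw [basisLaw, basisLaw, h2, ← PMF.map_comp, h1, born]
  congr 1
  exact weightsPMF_map_bijective (w := fun b => ENNReal.ofReal ((U * ρ * U.conjTranspose) b b).re)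
    (sum_ofReal_eq_one hst.1 hst.2) hbij

end BasisLaw

/-! ## Sampling a random basis by sweeps -/

section Sampler

variable {n : ℕ}

/-- The Clifford elements that map `Z_i`, for `i < k`, to `Z_i` times a product of earlier `Z`s. -/
def flagSet (n k : ℕ) : Finset (Clifford n) :=
  open Classical in Finset.univ.filter fun c => ∀ i : Fin n, i.val < k →
    c.act (zAt i) i = 3 ∧ ∀ j, (i < j → c.act (zAt i) j = 0) ∧
      (j < i → c.act (zAt i) j = 0 ∨ c.act (zAt i) j = 3)

theorem mem_flagSet {k : ℕ} {c : Clifford n} : c ∈ flagSet n k ↔ ∀ i : Fin n, i.val < k →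
    c.act (zAt i) i = 3 ∧ ∀ j, (i < j → c.act (zAt i) j = 0) ∧
      (j < i → c.act (zAt i) j = 0 ∨ c.act (zAt i) j = 3) := by
  simp [flagSet]

theorem flagSet_nonempty (n k : ℕ) : (flagSet n k).Nonempty := by
  obtain ⟨c, hc, -⟩ := Clifford.exists_of_actsBy (ActsBy.one (n := n))
  refine ⟨c, mem_flagSet.2 fun i _ => ?_⟩
  rw [hc]
  refine ⟨by simp [zAt], fun j => ⟨fun h => by simp [zAt, h.ne'], fun h => by simp [zAt, h.ne]⟩⟩

theorem letter_commSign_iff (a : PauliLetter) :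
    PauliLetter.commSign a 3 = 1 → a = 0 ∨ a = 3 := by
  have : (-1 : ℂ) ≠ 1 := by norm_num
  fin_cases a <;> simp [PauliLetter.commSign, this]

theorem letter_commSign_of_mem {a b : PauliLetter} (ha : a = 0 ∨ a = 3) (hb : b = 0 ∨ b = 3) :
    PauliLetter.commSign a b = 1 := by
  rcases ha with rfl | rfl <;> rcases hb with rfl | rfl <;> simp [PauliLetter.commSign]

/-- Strings that commute with `Z_i` for `i < k` are mapped to strings with letters `I`, `Z` there. -/
theorem act_head {k : ℕ} {c : Clifford n} (hc : c ∈ flagSet n k) {q : Str n}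
    (hq : ∀ i : Fin n, i.val < k → commSign q (zAt i) = 1) (j : Fin n) (hj : j.val < k) :
    c.act q j = 0 ∨ c.act q j = 3 := by
  induction hm : j.val using Nat.strong_induction_on generalizing j with
  | _ m ih =>
    subst hm
    -- The images of `q` and `Z_j` commute. The letters of the image of `Z_j` after site `j` are
    -- `I`; before `j` both images have letters `I` and `Z` only, by induction. So the letter of the
    -- image of `q` at `j` itself commutes with `Z`.
    have h1 := c.actsBy.commSign_map q (zAt j)
    rw [hq j hj, commSign, Finset.prod_eq_single j] at h1
    · rw [(mem_flagSet.1 hc j hj).1] at h1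
      exact letter_commSign_iff _ h1
    · intro i _ hij
      rcases lt_or_gt_of_ne hij with h | h
      · exact letter_commSign_of_mem (ih i.val h i (lt_trans h hj) rfl)
          (((mem_flagSet.1 hc j hj).2 i).2 h)
      · rw [((mem_flagSet.1 hc j hj).2 i).1 h]; simp [PauliLetter.commSign]
    · simp

theorem commSign_zAt_of_ne {q : Str n} {i : Fin n} (h : q i = 0) : commSign q (zAt i) = 1 := by
  refine Finset.prod_eq_one fun j _ => ?_
  by_cases hj : j = i
  · subst hj; simp [PauliLetter.commSign, h]
  · simp [PauliLetter.commSign, zAt, hj]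

/-- `X_k` and `Z_k` anticommute, and both commute with `Z_i` for `i < k`, so their images have only
letters `I`, `Z` below site `k`. If the image of `Z_k` were trivial from `k` on, the two images
would commute. -/
theorem act_tail_ne_zero {k : Fin n} {c : Clifford n} (hc : c ∈ flagSet n k) :
    tailNum (c.act (zAt k)) (n - k) n ≠ 0 := by
  intro h0
  have hk := k.isLt
  have htail : ∀ j : Fin n, k ≤ j → c.act (zAt k) j = 0 := fun j hj =>
    tailNum_eq_zero le_rfl (by omega) h0 j (by have : k.val ≤ j.val := hj; omega) j.isLt
  let x : Str n := fun j => if j = k then 1 else 0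
  have hne : ∀ i : Fin n, i.val < k → i ≠ k := fun i hi h => by rw [h] at hi; omega
  have hx := act_head hc (q := x) fun i hi => commSign_zAt_of_ne (by simp [x, hne i hi])
  have hz := act_head hc (q := zAt k) fun i hi => commSign_zAt_of_ne (by simp [zAt, hne i hi])
  have h1 : commSign (c.act x) (c.act (zAt k)) = 1 := by
    refine Finset.prod_eq_one fun j _ => ?_
    rcases lt_or_ge j k with h | h
    · exact letter_commSign_of_mem (hx j h) (hz j h)
    · rw [htail j h]; simp [PauliLetter.commSign]
  rw [c.actsBy.commSign_map, commSign, Finset.prod_eq_single k] at h1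
  · have : (-1 : ℂ) ≠ 1 := by norm_num
    simp [x, zAt, PauliLetter.commSign, this] at h1
  · intro j _ hj; simp [x, hj, PauliLetter.commSign]
  · simp

/-- The sweep of the tail number `r` from site `k` on. -/
abbrev sweep (n k r : ℕ) : List ℕ := sweepCodes (n - k) n r 0

theorem actsBy_listOp_star (l : List ℕ) : ∃ g, ActsBy (listOp n l).conjTranspose g ∧
    (∀ p, listAct l (g p) = p) ∧ ∀ p, g (listAct l p) = p := (actsBy_listOp l).star

/-- Conjugation by the inverse of a list of gates. -/
def unlist (l : List ℕ) (c : Clifford n) : Clifford n :=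
  Clifford.leftMul (Classical.choose_spec (actsBy_listOp_star l)).1 c

theorem listAct_unlist (l : List ℕ) (c : Clifford n) (p : Str n) :
    listAct l ((unlist l c).act p) = c.act p := by
  rw [unlist, Clifford.leftMul_act]
  exact (Classical.choose_spec (actsBy_listOp_star l)).2.1 _

theorem leftMul_unlist (l : List ℕ) (c : Clifford n) :
    Clifford.leftMul (actsBy_listOp l) (unlist l c) = c := by
  refine Clifford.ext_conj fun X => ?_
  rw [Clifford.leftMul_conj, unlist, Clifford.leftMul_conj]
  set Y := c.toUnitary * X * c.toUnitary.conjTranspose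
  calc _ = (listOp n l * (listOp n l).conjTranspose) * Y *
        (listOp n l * (listOp n l).conjTranspose) := by
        rw [Matrix.conjTranspose_conjTranspose]; simp only [Matrix.mul_assoc]
    _ = Y := by rw [(actsBy_listOp l).mul_star, Matrix.one_mul, Matrix.mul_one]

theorem unlist_leftMul (l : List ℕ) (c : Clifford n) :
    unlist l (Clifford.leftMul (actsBy_listOp l) c) = c :=
  Clifford.leftMul_injective (actsBy_listOp l) (leftMul_unlist l _)

/-- For `i < k` the image of `Z_i` is trivial from site `k` on, and the sweep fixes it. The sweep
turns the tail of the image of `Z_k` into `Z_k`, and its head has letters `I`, `Z` by `act_head`. -/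
theorem leftMul_mem_flagSet {k : Fin n} {c : Clifford n} (hc : c ∈ flagSet n k) :
    Clifford.leftMul (actsBy_listOp (sweep n k (tailNum (c.act (zAt k)) (n - k) n))) c ∈
      flagSet n (k + 1) := by
  refine mem_flagSet.2 fun i hi => ?_
  simp only [Clifford.leftMul_act]
  have hne : ∀ i : Fin n, i.val < k → i ≠ k := fun i hi h => by rw [h] at hi; omega
  rcases Nat.lt_succ_iff_lt_or_eq.1 hi with hi | hi
  · rw [listAct_of_tail_zero (k := k) (fun e he => sweep_site he)]
    · exact mem_flagSet.1 hc i hi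
    · intro j hj
      exact ((mem_flagSet.1 hc i hi).2 j).1 (show i.val < j.val by omega)
  · obtain rfl : i = k := Fin.ext hi
    simp only [listAct_sweep (act_tail_ne_zero hc)]
    refine ⟨by simp [zAt], fun j => ⟨fun h => ?_, fun h => ?_⟩⟩
    · rw [if_neg (not_lt.2 h.le)]; simp [zAt, h.ne']
    · rw [if_pos h]
      exact act_head hc (fun i' hi' => commSign_zAt_of_ne (by simp [zAt, hne i' hi'])) j h

/-- The string with the head of `c(Z_k)` and tail number `r` is swept to `c(Z_k)`; by injectivity it
is the image of `Z_k` after the sweep is undone. -/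
theorem unlist_mem_flagSet {k : Fin n} {c : Clifford n} (hc : c ∈ flagSet n (k + 1)) {r : ℕ}
    (hr : r < 4 ^ (n - k.val)) (hr0 : r ≠ 0) :
    unlist (sweep n k r) c ∈ flagSet n k ∧
      tailNum ((unlist (sweep n k r) c).act (zAt k)) (n - k) n = r := by
  have hk := k.isLt
  have hinj := (actsBy_listOp (n := n) (sweep n k r)).injective
  constructor
  · refine mem_flagSet.2 fun i hi => ?_
    have h1 := mem_flagSet.1 hc i (by omega)
    have h2 : (unlist (sweep n k r) c).act (zAt i) = c.act (zAt i) := by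
      apply hinj
      rw [listAct_unlist, listAct_of_tail_zero (k := k) (fun e he => sweep_site he)]
      intro j hj
      exact (h1.2 j).1 (show i.val < j.val by omega)
    rw [h2]; exact h1
  · obtain ⟨p, hp, hpr⟩ := exists_tailNum (c.act (zAt k)) hk.le hr
    have : (unlist (sweep n k r) c).act (zAt k) = p := by
      apply hinj
      rw [listAct_unlist]
      ext1 j
      have h1 := mem_flagSet.1 hc k (by omega)
      have h2 := listAct_sweep (k := k) (p := p) (by rw [hpr]; exact hr0) j
      rw [hpr] at h2
      rw [h2]
      split_ifs with hj
      · exact (hp j hj).symm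
      · rcases lt_or_eq_of_le (not_lt.1 hj) with h | h
        · rw [(h1.2 j).1 h]; simp [zAt, h.ne']
        · rw [← h, h1.1]; simp [zAt]
    rw [this, hpr]

/-- Reduction of a uniform choice along a bijection with a product. -/
theorem uniformOfFinset_bind_eq {α β ν : Type} {H H' : Finset α} {V : Finset ν}
    (hH : H.Nonempty) (hH' : H'.Nonempty) (hV : V.Nonempty) (φ : ν → α → α) (F : α → PMF β)
    (f : α → ν) (g : α → α)
    (h1 : ∀ v ∈ V, ∀ a ∈ H', φ v a ∈ H ∧ f (φ v a) = v ∧ g (φ v a) = a)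
    (h2 : ∀ a ∈ H, f a ∈ V ∧ g a ∈ H' ∧ φ (f a) (g a) = a) :
    (PMF.uniformOfFinset H hH).bind F = (PMF.uniformOfFinset V hV).bind fun v =>
      (PMF.uniformOfFinset H' hH').bind fun a => F (φ v a) := by
  have hsum : ∀ {γ δ : Type} (S : Finset γ) (hS : S.Nonempty) (G : γ → PMF δ) (x : δ),
      (PMF.uniformOfFinset S hS).bind G x = (S.card : ENNReal)⁻¹ * ∑ a ∈ S, G a x := by
    intro γ δ S hS G x
    rw [PMF.bind_apply, tsum_eq_sum (s := S), Finset.mul_sum]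
    · exact Finset.sum_congr rfl fun a ha => by rw [PMF.uniformOfFinset_apply_of_mem hS ha]
    · intro a ha; rw [PMF.uniformOfFinset_apply_of_notMem hS ha, zero_mul]
  have hbij : ∀ G : α → ENNReal, ∑ a ∈ H, G a = ∑ v ∈ V, ∑ a ∈ H', G (φ v a) := by
    intro G
    rw [← Finset.sum_product']
    symm
    refine Finset.sum_bij' (fun x _ => φ x.1 x.2) (fun a _ => (f a, g a)) ?_ ?_ ?_ ?_ ?_
    · intro x hx; rw [Finset.mem_product] at hx; exact (h1 _ hx.1 _ hx.2).1
    · intro a ha; exact Finset.mem_product.2 ⟨(h2 a ha).1, (h2 a ha).2.1⟩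
    · intro x hx; rw [Finset.mem_product] at hx
      exact Prod.ext (h1 _ hx.1 _ hx.2).2.1 (h1 _ hx.1 _ hx.2).2.2
    · intro a ha; exact (h2 a ha).2.2
    · intro x _; rfl
  -- The bijection applied to the constant `1` gives the factorization of the normalizing constants.
  have hcard : (H.card : ENNReal) = V.card * H'.card := by
    have := hbij fun _ => 1
    simpa using this
  ext x
  rw [hsum, hsum, hbij, hcard]
  simp only [hsum, ← Finset.mul_sum]
  rw [← mul_assoc, ENNReal.mul_inv]
  · left; simpa using hV.ne_empty
  · left; simp

/-- The random gate list produced by `t` further sweeps, after the list `l`; the sweeps start at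
site `n - t`. -/
def sampler (n : ℕ) : ℕ → List ℕ → PMF (List ℕ)
  | 0, l => PMF.pure l
  -- There are `4^(t+1) - 1` non-zero tail numbers, and `v + 1` runs through them. The type is
  -- written as `Fin (a + 1)` with `a = 4^(t+1) - 2` to match the `rand` instruction.
  | t + 1, l => (PMF.uniformOfFintype (Fin (4 ^ (t + 1) - 2 + 1))).bind fun v =>
      sampler n t (l ++ sweepCodes (t + 1) n (v.val + 1) 0)

theorem pauliOp_diag {p : Str n} (hp : ∀ i, p i = 0 ∨ p i = 3) (x y : Bits n) :
    pauliOp p x y = if x = y then ∏ i, (if p i = 3 ∧ x i then (-1 : ℂ) else 1) else 0 := by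
  simp only [pauliOp, Matrix.of_apply]
  split_ifs with h
  · subst h
    refine Finset.prod_congr rfl fun i _ => ?_
    rcases hp i with h | h <;> rw [h] <;> cases x i <;> simp [PauliLetter.toMatrix]
  · obtain ⟨i, hi⟩ := Function.ne_iff.1 h
    refine Finset.prod_eq_zero (Finset.mem_univ i) ?_
    rcases hp i with h | h <;> rw [h] <;> simp [PauliLetter.toMatrix, hi]

theorem zAt_letters (i j : Fin n) : zAt i j = 0 ∨ zAt i j = 3 := by
  unfold zAt; split_ifs <;> simp

theorem pauliOp_diag_mul_apply {p : Str n} (hp : ∀ i, p i = 0 ∨ p i = 3) (X : Op n)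
    (x y : Bits n) : (pauliOp p * X) x y =
      (∏ i, (if p i = 3 ∧ x i then (-1 : ℂ) else 1)) * X x y := by
  rw [Matrix.mul_apply, Finset.sum_eq_single x]
  · rw [pauliOp_diag hp, if_pos rfl]
  · intro z _ hz; rw [pauliOp_diag hp, if_neg hz.symm, zero_mul]
  · simp

theorem mul_pauliOp_diag_apply {p : Str n} (hp : ∀ i, p i = 0 ∨ p i = 3) (X : Op n)
    (x y : Bits n) : (X * pauliOp p) x y =
      X x y * ∏ i, (if p i = 3 ∧ y i then (-1 : ℂ) else 1) := by
  rw [Matrix.mul_apply, Finset.sum_eq_single y]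
  · rw [pauliOp_diag hp, if_pos rfl]
  · intro z _ hz; rw [pauliOp_diag hp, if_neg hz, mul_zero]
  · simp

theorem zAt_mul_basisProj (i : Fin n) (b : Bits n) :
    pauliOp (zAt i) * basisProj b = (if b i then (-1 : ℂ) else 1) • basisProj b ∧
      basisProj b * pauliOp (zAt i) = (if b i then (-1 : ℂ) else 1) • basisProj b := by
  have key : ∀ x : Bits n, (∏ j, (if zAt i j = 3 ∧ x j then (-1 : ℂ) else 1)) =
      if x i then (-1 : ℂ) else 1 := by
    intro x
    rw [Finset.prod_eq_single i]
    · simp [zAt]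
    · intro j _ hj; simp [zAt, hj]
    · simp
  constructor
  · ext x y
    rw [pauliOp_diag_mul_apply (zAt_letters i), key, Matrix.smul_apply, smul_eq_mul]
    by_cases h : x = b
    · rw [h]
    · simp [basisProj, h]
  · ext x y
    rw [mul_pauliOp_diag_apply (zAt_letters i), key, Matrix.smul_apply, smul_eq_mul, mul_comm]
    by_cases h : y = b
    · rw [h]
    · simp [basisProj, h]

/-- The elements of the last flag set permute the computational basis. -/
theorem flagSet_permutes {c : Clifford n} (hc : c ∈ flagSet n n) (b : Bits n) :
    ∃ b', c.toUnitary * basisProj b * c.toUnitary.conjTranspose = basisProj b' := by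
  set D := c.toUnitary * basisProj b * c.toUnitary.conjTranspose with hD
  -- The eigenvalue, up to sign, of the image of `Z_i` at the basis state `x`.
  let θ : Fin n → Bits n → ℂ := fun i x => ∏ j, (if c.act (zAt i) j = 3 ∧ x j then (-1 : ℂ) else 1)
  have hlet : ∀ i j, c.act (zAt i) j = 0 ∨ c.act (zAt i) j = 3 := by
    intro i j
    obtain ⟨h1, h2⟩ := mem_flagSet.1 hc i i.isLt
    rcases lt_trichotomy i j with h | h | h
    · exact Or.inl ((h2 j).1 h)
    · rw [← h]; exact Or.inr h1
    · exact (h2 j).2 h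
  -- Each `Z_i` multiplies `basisProj b` by a sign from either side, hence so does its diagonal
  -- image with `D`. So `D` is supported where this eigenvalue has one fixed value.
  have hstab : ∀ i, ∃ s : ℂ, ∀ x y, D x y ≠ 0 → θ i x = s ∧ θ i y = s := by
    intro i
    obtain ⟨s, hs, hact⟩ := c.actsBy.act (zAt i)
    obtain ⟨e1, e2⟩ := zAt_mul_basisProj i b
    have f1 := congrArg (fun X => c.toUnitary * X * c.toUnitary.conjTranspose) e1
    have f2 := congrArg (fun X => c.toUnitary * X * c.toUnitary.conjTranspose) e2
    simp only [c.actsBy.conj_mul, hact, Matrix.mul_smul, Matrix.smul_mul, ← hD] at f1 f2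
    have hss : s * s = 1 := by rcases hs with rfl | rfl <;> simp
    refine ⟨s * (if b i then (-1 : ℂ) else 1), fun x y hxy => ⟨?_, ?_⟩⟩
    · have := congrFun (congrFun f1 x) y
      rw [Matrix.smul_apply, Matrix.smul_apply, pauliOp_diag_mul_apply (hlet i), smul_eq_mul,
        smul_eq_mul, ← mul_assoc] at this
      have := mul_right_cancel₀ hxy this
      linear_combination s * this - θ i x * hss
    · have := congrFun (congrFun f2 x) y
      rw [Matrix.smul_apply, Matrix.smul_apply, mul_pauliOp_diag_apply (hlet i), smul_eq_mul,
        smul_eq_mul, mul_comm (D x y), ← mul_assoc] at this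
      have := mul_right_cancel₀ hxy this
      linear_combination s * this - θ i y * hss
  -- The images of the `Z_i` are triangular with `Z` on the diagonal, so their eigenvalues determine
  -- the bits one after the other.
  have hsep : ∀ x y : Bits n, (∀ i, θ i x = θ i y) → x = y := by
    intro x y h
    have : ∀ m : ℕ, ∀ i : Fin n, i.val = m → x i = y i := by
      intro m
      induction m using Nat.strong_induction_on with
      | _ m ih =>
        rintro i rfl
        have hi := h i
        simp only [θ] at hi
        rw [← Finset.mul_prod_erase _ _ (Finset.mem_univ i),
          ← Finset.mul_prod_erase _ (fun j => if c.act (zAt i) j = 3 ∧ y j then (-1 : ℂ) else 1)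
            (Finset.mem_univ i)] at hi
        have heq : ∏ j ∈ Finset.univ.erase i, (if c.act (zAt i) j = 3 ∧ x j then (-1 : ℂ) else 1) =
            ∏ j ∈ Finset.univ.erase i, (if c.act (zAt i) j = 3 ∧ y j then (-1 : ℂ) else 1) := by
          refine Finset.prod_congr rfl fun j hj => ?_
          rcases lt_or_gt_of_ne (Finset.ne_of_mem_erase hj) with h | h
          · rw [ih j.val h j rfl]
          · rw [((mem_flagSet.1 hc i i.isLt).2 j).1 h]; simp
        have hne : ∏ j ∈ Finset.univ.erase i,
            (if c.act (zAt i) j = 3 ∧ y j then (-1 : ℂ) else 1) ≠ 0 :=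
          Finset.prod_ne_zero_iff.2 fun j _ => by split_ifs <;> simp
        rw [heq] at hi
        have := mul_right_cancel₀ hne hi
        rw [(mem_flagSet.1 hc i i.isLt).1] at this
        have h1 : (-1 : ℂ) ≠ 1 := by norm_num
        cases hx : x i <;> cases hy : y i <;> simp [hx, hy, h1, h1.symm] at this ⊢
    exact funext fun i => this i.val i rfl
  choose s hs using hstab
  -- Trace one provides a non-zero diagonal entry; by separation it is the only non-zero entry, and
  -- it equals `1`.
  have htr : D.trace = 1 := ((basisProj_isState b).conj c.actsBy.star_mul).2
  obtain ⟨b', hb'⟩ : ∃ b', D b' b' ≠ 0 := by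
    by_contra h
    push Not at h
    rw [Matrix.trace] at htr
    simp [h] at htr
  have huniq : ∀ x y, D x y ≠ 0 → x = b' ∧ y = b' := fun x y hxy =>
    ⟨hsep _ _ fun i => (hs i x y hxy).1.trans (hs i b' b' hb').1.symm,
      hsep _ _ fun i => (hs i x y hxy).2.trans (hs i b' b' hb').1.symm⟩
  have hone : D b' b' = 1 := by
    rw [← htr, Matrix.trace, Finset.sum_eq_single b']
    · rfl
    · intro x _ hx
      by_contra h
      exact hx (huniq x x h).1
    · simp
  refine ⟨b', ?_⟩
  ext x y
  by_cases h : D x y = 0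
  · rw [h]
    simp only [basisProj, Matrix.of_apply]
    rw [if_neg]
    rintro ⟨rfl, rfl⟩
    exact hb' h
  · obtain ⟨rfl, rfl⟩ := huniq x y h
    simp [hone, basisProj]

theorem conj_star_of_conj {U W : Op n} (hU : U * U.conjTranspose = 1)
    (hW : W.conjTranspose * W = 1)
    (h : ∀ X, U * X * U.conjTranspose = W * X * W.conjTranspose) (X : Op n) :
    U.conjTranspose * X * U = W.conjTranspose * X * W := by
  have h1 := h (U.conjTranspose * X * U)
  have e1 : U * (U.conjTranspose * X * U) * U.conjTranspose = X := by
    calc _ = (U * U.conjTranspose) * X * (U * U.conjTranspose) := by simp only [Matrix.mul_assoc]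
      _ = X := by rw [hU, Matrix.one_mul, Matrix.mul_one]
  rw [e1] at h1
  set Y := U.conjTranspose * X * U
  calc Y = (W.conjTranspose * W) * Y * (W.conjTranspose * W) := by
        rw [hW, Matrix.one_mul, Matrix.mul_one]
    _ = W.conjTranspose * (W * Y * W.conjTranspose) * W := by simp only [Matrix.mul_assoc]
    _ = _ := by rw [← h1]

theorem basisLaw_star_mul_congr {ρ U V W : Op n}
    (h1 : ∀ X, U * X * U.conjTranspose = V * X * V.conjTranspose)
    (h2 : ∀ X, U.conjTranspose * X * U = V.conjTranspose * X * V) :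
    basisLaw ρ (U.conjTranspose * W) = basisLaw ρ (V.conjTranspose * W) := by
  have e1 : ∀ U X : Op n, U.conjTranspose * W * X * (U.conjTranspose * W).conjTranspose =
      U.conjTranspose * (W * X * W.conjTranspose) * U := fun U X => by
    simp only [Matrix.conjTranspose_mul, Matrix.conjTranspose_conjTranspose, Matrix.mul_assoc]
  have e2 : ∀ U X : Op n, (U.conjTranspose * W).conjTranspose * X * (U.conjTranspose * W) =
      W.conjTranspose * (U * X * U.conjTranspose) * W := fun U X => by
    simp only [Matrix.conjTranspose_mul, Matrix.conjTranspose_conjTranspose, Matrix.mul_assoc]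
  exact basisLaw_congr (fun X => by rw [e1, e1, h2]) fun X => by rw [e2, e2, h1]

/-- `unlist l c` is `(listOp n l)† c` up to a phase, so its adjoint is `c†` after the gates of `l`.
-/
theorem basisLaw_unlist (ρ W : Op n) (l : List ℕ) (c : Clifford n) :
    basisLaw ρ ((unlist l c).toUnitary.conjTranspose * W) =
      basisLaw ρ (c.toUnitary.conjTranspose * (listOp n l * W)) := by
  set U := (unlist l c).toUnitary with hU
  set V := (listOp n l).conjTranspose * c.toUnitary with hV
  have h1 : ∀ X, U * X * U.conjTranspose = V * X * V.conjTranspose := by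
    intro X
    rw [hU, unlist, Clifford.leftMul_conj, hV, Matrix.conjTranspose_mul]
    simp only [Matrix.mul_assoc]
  have hVV : V.conjTranspose * V = 1 := by
    calc _ = c.toUnitary.conjTranspose * (listOp n l * (listOp n l).conjTranspose) *
          c.toUnitary := by
          rw [hV, Matrix.conjTranspose_mul, Matrix.conjTranspose_conjTranspose]
          simp only [Matrix.mul_assoc]
      _ = 1 := by rw [(actsBy_listOp l).mul_star, Matrix.mul_one, c.actsBy.star_mul]
  have h2 := conj_star_of_conj (unlist l c).actsBy.mul_star hVV h1
  have h3 : c.toUnitary.conjTranspose * (listOp n l * W) = V.conjTranspose * W := by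
    rw [hV, Matrix.conjTranspose_mul, Matrix.conjTranspose_conjTranspose, Matrix.mul_assoc]
  rw [h3]
  exact basisLaw_star_mul_congr h1 h2

/-- An element of `flagSet n k` is the same as a non-zero tail number (that of its image of `Z_k`)
together with an element of `flagSet n (k + 1)` (the swept element). -/
theorem flagSet_bind_step {β : Type} (k : Fin n) {m : ℕ} (hm : m + 2 = 4 ^ (n - k.val))
    (F : Clifford n → PMF β) :
    (PMF.uniformOfFinset (flagSet n k) (flagSet_nonempty n k)).bind F =
      (PMF.uniformOfFintype (Fin (m + 1))).bind fun v =>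
        (PMF.uniformOfFinset (flagSet n (k + 1)) (flagSet_nonempty n (k + 1))).bind fun c =>
          F (unlist (sweep n k (v.val + 1)) c) := by
  refine uniformOfFinset_bind_eq (flagSet_nonempty n k) (flagSet_nonempty n (k + 1))
    (V := (Finset.univ : Finset (Fin (m + 1)))) Finset.univ_nonempty
    (fun v c => unlist (sweep n k (v.val + 1)) c) F
    -- The reduction mod `m + 1` only makes the map total; for elements of the flag set it changes
    -- nothing.
    (fun c => ⟨(tailNum (c.act (zAt k)) (n - k) n - 1) % (m + 1), Nat.mod_lt _ (by omega)⟩)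
    (fun c => Clifford.leftMul (actsBy_listOp
      (sweep n k (tailNum (c.act (zAt k)) (n - k) n))) c) ?_ ?_
  · intro v _ c hc
    have hv := v.isLt
    have := unlist_mem_flagSet (k := k) hc (r := v.val + 1) (by omega) (by omega)
    refine ⟨this.1, ?_, ?_⟩
    · simp only [this.2, Nat.add_sub_cancel]
      exact Fin.ext (Nat.mod_eq_of_lt hv)
    · simp only [this.2]
      exact leftMul_unlist _ _
  · intro c hc
    have h1 := act_tail_ne_zero (k := k) hc
    have h2 := leftMul_mem_flagSet (k := k) hc
    have h3 := tailNum_lt (c.act (zAt k)) (n - k) n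
    refine ⟨Finset.mem_univ _, h2, ?_⟩
    have e : (tailNum (c.act (zAt k)) (n - k) n - 1) % (m + 1) + 1 =
        tailNum (c.act (zAt k)) (n - k) n := by
      rw [Nat.mod_eq_of_lt (by omega)]; omega
    simp only [e]
    exact unlist_leftMul _ _

/-- Each step trades one site for one random sweep. After the last site the remaining element
permutes the computational basis and drops out by `basisLaw_mul_of_permutes`. -/
theorem flagSet_bind_eq_sampler {ρ : Op n} (hρ : IsState ρ) (t k : ℕ) (ht : k + t = n)
    (l : List ℕ) :
    ((PMF.uniformOfFinset (flagSet n k) (flagSet_nonempty n k)).bind fun c =>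
      basisLaw ρ (c.toUnitary.conjTranspose * listOp n l)) =
    (sampler n t l).bind fun l' => basisLaw ρ (listOp n l') := by
  induction t generalizing l k with
  | zero =>
    obtain rfl : k = n := ht
    rw [sampler, PMF.pure_bind]
    ext x
    rw [PMF.bind_apply]
    have : ∀ c, (PMF.uniformOfFinset (flagSet k k) (flagSet_nonempty k k)) c *
        basisLaw ρ (c.toUnitary.conjTranspose * listOp k l) x =
        (PMF.uniformOfFinset (flagSet k k) (flagSet_nonempty k k)) c *
          basisLaw ρ (listOp k l) x := by
      intro c
      by_cases hc : c ∈ flagSet k k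
      · rw [basisLaw_mul_of_permutes hρ (actsBy_listOp l).star_mul c.actsBy.star_mul
          (flagSet_permutes hc)]
      · rw [PMF.uniformOfFinset_apply_of_notMem _ hc, zero_mul, zero_mul]
    simp only [this]
    rw [ENNReal.tsum_mul_right, PMF.tsum_coe, one_mul]
  | succ t ih =>
    have hkn : n - k = t + 1 := by omega
    have h4 : 4 ≤ 4 ^ (t + 1) := by
      calc 4 = 4 ^ 1 := by norm_num
        _ ≤ _ := Nat.pow_le_pow_right (by norm_num) (by omega)
    have hm : 4 ^ (t + 1) - 2 + 2 = 4 ^ (n - k) := by rw [hkn]; omega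
    have step := flagSet_bind_step (⟨k, by omega⟩ : Fin n) hm
      fun c => basisLaw ρ (c.toUnitary.conjTranspose * listOp n l)
    rw [sampler, PMF.bind_bind]
    refine step.trans (congrArg _ (funext fun v => ?_))
    rw [← ih (k + 1) (by omega)]
    refine congrArg _ (funext fun c => ?_)
    rw [basisLaw_unlist, listOp_append]
    simp only [sweep, hkn]

/-- The snapshots of a uniformly random Clifford unitary can be produced by sweeps. -/
theorem snapshot_eq_sampler {ρ : Op n} (hρ : IsState ρ) :
    snapshot ρ = (sampler n n []).bind fun l => basisLaw ρ (listOp n l) := by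
  rw [← flagSet_bind_eq_sampler hρ n 0 (by omega), snapshot_eq_star]
  have h : flagSet n 0 = Finset.univ := by
    ext c; simp [mem_flagSet]
  have h2 : randomClifford n = PMF.uniformOfFinset (flagSet n 0) (flagSet_nonempty n 0) := by
    simp only [h]; rfl
  rw [h2]
  simp only [listOp, Matrix.mul_one]

end Sampler
end

/-! ### Stabilizer groups and how often they contain given strings. -/

noncomputable section

/-! ## Moments of snapshots -/

section Diagonal

variable {n : ℕ}

/-- The Pauli strings with letters `I` and `Z`. -/
def zStrings (n : ℕ) : Finset (Str n) := Fintype.piFinset fun _ => {0, 3}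

theorem mem_zStrings {p : Str n} : p ∈ zStrings n ↔ ∀ i, p i = 0 ∨ p i = 3 := by
  simp [zStrings]

theorem card_zStrings : (zStrings n).card = 2 ^ n := by
  rw [zStrings, Fintype.card_piFinset]
  simp

/-- Dephasing keeps exactly the Pauli components with letters `I` and `Z`. -/
theorem diagonal_eq_sum (Y : Op n) :
    Matrix.diagonal (fun b => Y b b) =
      (2 ^ n : ℂ)⁻¹ • ∑ p ∈ zStrings n, (Y * pauliOp p).trace • pauliOp p := by
  have h2 : (2 : ℂ) ^ n ≠ 0 := by positivity
  have key := sum_trace_smul_pauliOp (Matrix.diagonal fun b => Y b b)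
  have h0 : ∀ p : Str n, p ∉ zStrings n → (Matrix.diagonal (fun b => Y b b) * pauliOp p).trace = 0 := by
    intro p hp
    rw [mem_zStrings] at hp
    push Not at hp
    obtain ⟨i, hi⟩ := hp
    simp only [Matrix.trace, Matrix.diag_apply, Matrix.diagonal_mul]
    refine Finset.sum_eq_zero fun b _ => ?_
    rw [pauliOp, Matrix.of_apply, Finset.prod_eq_zero (Finset.mem_univ i), mul_zero]
    revert hi
    generalize p i = a
    fin_cases a <;> simp [PauliLetter.toMatrix]
  have h1 : ∀ p ∈ zStrings n, (Matrix.diagonal (fun b => Y b b) * pauliOp p).trace =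
      (Y * pauliOp p).trace := by
    intro p hp
    simp only [Matrix.trace, Matrix.diag_apply, mul_pauliOp_diag_apply (mem_zStrings.1 hp)]
    refine Finset.sum_congr rfl fun b _ => ?_
    rw [Matrix.diagonal_apply_eq]
  rw [← Finset.sum_subset (Finset.subset_univ (zStrings n))
    (fun p _ hp => by rw [h0 p hp, zero_smul])] at key
  rw [Finset.sum_congr rfl fun p hp => by rw [h1 p hp]] at key
  rw [key, smul_smul, inv_mul_cancel₀ h2, one_smul]

theorem sum_diag_mul (X Y : Op n) : ∑ b, X b b * Y b b =
    (2 ^ n : ℂ)⁻¹ * ∑ p ∈ zStrings n, (X * pauliOp p).trace * (Y * pauliOp p).trace := by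
  calc ∑ b, X b b * Y b b = (X * Matrix.diagonal fun b => Y b b).trace := by
        simp [Matrix.trace, Matrix.mul_diagonal]
    _ = _ := by
        rw [diagonal_eq_sum, Matrix.mul_smul, Matrix.trace_smul, Finset.mul_sum, Matrix.trace_sum,
          smul_eq_mul]
        congr 1
        refine Finset.sum_congr rfl fun p _ => ?_
        rw [Matrix.mul_smul, Matrix.trace_smul, smul_eq_mul, mul_comm]

theorem sum_diag_mul_sq (X Y : Op n) : ∑ b, X b b * Y b b ^ 2 =
    ((2 ^ n : ℂ) ^ 2)⁻¹ * ∑ p ∈ zStrings n, ∑ q ∈ zStrings n,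
      (X * (pauliOp p * pauliOp q)).trace * (Y * pauliOp p).trace * (Y * pauliOp q).trace := by
  calc ∑ b, X b b * Y b b ^ 2 =
        (X * ((Matrix.diagonal fun b => Y b b) * Matrix.diagonal fun b => Y b b)).trace := by
        simp only [Matrix.diagonal_mul_diagonal, Matrix.trace, Matrix.diag_apply,
          Matrix.mul_diagonal, sq]
    _ = _ := by
        rw [diagonal_eq_sum]
        simp only [Matrix.smul_mul, Matrix.mul_smul, Finset.mul_sum, Finset.sum_mul,
          Matrix.trace_smul, Matrix.trace_sum, smul_eq_mul, Finset.smul_sum]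
        rw [Finset.sum_comm]
        refine Finset.sum_congr rfl fun p _ => Finset.sum_congr rfl fun q _ => ?_
        rw [sq, mul_inv]; ring

end Diagonal

/-! ### Stabilizer groups of random Clifford elements -/

section Lagrangian

variable {n : ℕ}

theorem ActsBy.map_zero {U : Op n} {f : Str n → Str n} (h : ActsBy U f) : f 0 = 0 := by
  obtain ⟨s, hs, h1⟩ := h.act 0
  rw [pauliOp_zero, Matrix.mul_one, h.mul_star, ← pauliOp_zero] at h1
  exact ((smul_pauliOp_inj (s := 1) one_ne_zero (by rw [one_smul]; exact h1)).1).symm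

/-- The image of the strings with letters `I` and `Z`. -/
def Clifford.stab (c : Clifford n) : Finset (Str n) := (zStrings n).image c.act

theorem Clifford.card_stab (c : Clifford n) : c.stab.card = 2 ^ n := by
  rw [stab, Finset.card_image_of_injective _ c.actsBy.injective, card_zStrings]

theorem Clifford.zero_mem_stab (c : Clifford n) : (0 : Str n) ∈ c.stab :=
  Finset.mem_image.2 ⟨0, mem_zStrings.2 fun _ => Or.inl rfl, c.actsBy.map_zero⟩

theorem Clifford.commSign_stab (c : Clifford n) {p q : Str n} (hp : p ∈ c.stab)
    (hq : q ∈ c.stab) : commSign p q = 1 := by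
  obtain ⟨p', hp', rfl⟩ := Finset.mem_image.1 hp
  obtain ⟨q', hq', rfl⟩ := Finset.mem_image.1 hq
  rw [c.actsBy.commSign_map]
  exact Finset.prod_eq_one fun i _ =>
    letter_commSign_of_mem (mem_zStrings.1 hp' i) (mem_zStrings.1 hq' i)

/-- The number of Clifford elements whose stabilizer group contains both strings. -/
def stabCount (p q : Str n) : ℕ := (Finset.univ.filter fun c : Clifford n => p ∈ c.stab ∧ q ∈ c.stab).card

/-- Left multiplication by the gates is a bijection of the group and moves stabilizer groups by
`listAct`. -/
theorem stabCount_listAct (l : List ℕ) (p q : Str n) :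
    stabCount (listAct l p) (listAct l q) = stabCount p q := by
  have hinj := (actsBy_listOp (n := n) l).injective
  have hmem : ∀ (c : Clifford n) (p : Str n),
      listAct l p ∈ (Clifford.leftMul (actsBy_listOp l) c).stab ↔ p ∈ c.stab := by
    intro c p
    simp only [Clifford.stab, Finset.mem_image, Clifford.leftMul_act]
    exact ⟨fun ⟨z, hz, h⟩ => ⟨z, hz, hinj h⟩, fun ⟨z, hz, h⟩ => ⟨z, hz, by rw [h]⟩⟩
  symm
  refine Finset.card_bij (fun c _ => Clifford.leftMul (actsBy_listOp l) c) ?_ ?_ ?_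
  · intro c hc
    simpa only [Finset.mem_filter, Finset.mem_univ, true_and, hmem] using hc
  · intro c _ c' _ h
    exact Clifford.leftMul_injective _ h
  · intro c hc
    obtain ⟨c', rfl⟩ := (Clifford.leftMul_bijective (actsBy_listOp (n := n) l)).2 c
    refine ⟨c', ?_, rfl⟩
    simpa only [Finset.mem_filter, Finset.mem_univ, true_and, hmem] using hc

/-- Transitivity on the non-identity strings: one sweep from site `0` suffices. -/
theorem exists_listAct_eq_zAt {k : Fin n} (h0 : k.val = 0) {p : Str n} (hp : p ≠ 0) :
    ∃ l, listAct l p = zAt k := by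
  have hne : tailNum p (n - k) n ≠ 0 := by
    intro h
    apply hp
    ext1 j
    exact tailNum_eq_zero le_rfl (by omega) h j (by omega) j.isLt
  refine ⟨_, funext fun j => (listAct_sweep hne j).trans ?_⟩
  rw [if_neg]
  intro h
  have : j.val < k.val := h
  omega

theorem commSign_zAt (q : Str n) (i : Fin n) :
    commSign q (zAt i) = PauliLetter.commSign (q i) 3 := by
  rw [commSign, Finset.prod_eq_single i]
  · simp [zAt]
  · intro j _ hj; simp [zAt, hj, PauliLetter.commSign]
  · simp

/-- The gates act transitively on pairs of distinct commuting strings other than the identity. -/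
theorem exists_listAct_pair {p q : Str n} (hp : p ≠ 0) (hq : q ≠ 0) (hpq : p ≠ q)
    (hc : commSign p q = 1) :
    ∃ (h : 1 < n) (l : List ℕ), listAct l p = zAt ⟨0, by omega⟩ ∧ listAct l q = zAt ⟨1, h⟩ := by
  have hn : 0 < n := by
    rcases Nat.eq_zero_or_pos n with rfl | h
    · exact absurd (Subsingleton.elim p 0) hp
    · exact h
  obtain ⟨l, hl⟩ := exists_listAct_eq_zAt (k := ⟨0, hn⟩) rfl hp
  have hU := actsBy_listOp (n := n) l
  set q' := listAct l q with hq'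
  have hq0 : q' ≠ 0 := fun h => hq (hU.injective (by rw [hU.map_zero]; exact h))
  have hqz : q' ≠ zAt ⟨0, hn⟩ := fun h => hpq (hU.injective (by rw [hl, ← h]))
  have hcs : commSign q' (zAt ⟨0, hn⟩) = 1 := by
    rw [← hl, hU.commSign_map, commSign_comm, hc]
  -- With `p` moved to `Z_0`, commutation forces `I` or `Z` at site `0`.
  have hlet : q' ⟨0, hn⟩ = 0 ∨ q' ⟨0, hn⟩ = 3 := by
    rw [commSign_zAt] at hcs; exact letter_commSign_iff _ hcs
  -- `q'` is neither the identity nor `Z_0`, so it has a letter beyond site `0`; a second sweep from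
  -- site `1`, which fixes `Z_0`, can act on it.
  obtain ⟨j, hj0, hj⟩ : ∃ j : Fin n, j ≠ ⟨0, hn⟩ ∧ q' j ≠ 0 := by
    by_contra h
    push Not at h
    rcases hlet with h0 | h0
    · exact hq0 (funext fun j => if e : j = ⟨0, hn⟩ then by rw [e]; exact h0 else h j e)
    · refine hqz (funext fun j => ?_)
      by_cases e : j = ⟨0, hn⟩
      · rw [e, h0]; simp [zAt]
      · rw [h j e]; simp [zAt, e]
  have hj1 : 1 ≤ j.val := by
    have : j.val ≠ 0 := fun h => hj0 (Fin.ext h)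
    omega
  have hn1 : 1 < n := lt_of_le_of_lt hj1 j.isLt
  refine ⟨hn1, ?_⟩
  have hne : tailNum q' (n - (⟨1, hn1⟩ : Fin n)) n ≠ 0 := fun h =>
    hj (tailNum_eq_zero le_rfl (by omega) h j (by simp only; omega) j.isLt)
  set l' := sweepCodes (n - (⟨1, hn1⟩ : Fin n)) n (tailNum q' (n - (⟨1, hn1⟩ : Fin n)) n) 0 with hl'
  have hz0 : listAct l' (zAt ⟨0, hn⟩) = (zAt ⟨0, hn⟩ : Str n) := by
    refine listAct_of_tail_zero (k := 1) (fun e he => sweep_site (k := ⟨1, hn1⟩) he) fun j hj => ?_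
    have : j ≠ ⟨0, hn⟩ := fun h => by rw [h] at hj; simp at hj
    simp [zAt, this]
  have hq1 := listAct_sweep (k := ⟨1, hn1⟩) hne
  rw [← hl'] at hq1
  rcases hlet with h0 | h0
  · refine ⟨l ++ l', by rw [listAct_append, hl, hz0], ?_⟩
    rw [listAct_append]
    ext1 j
    rw [← hq', hq1 j]
    split_ifs with h
    · have : j = ⟨0, hn⟩ := Fin.ext (by have : j.val < 1 := h; simp only; omega)
      rw [this, h0]; simp [zAt]
    · rfl
  -- Here the sweep ends with `Z_0 Z_1`. Code `2`, the `CNOT` from site `0` to site `1`, maps it to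
  -- `Z_1` and fixes `Z_0`.
  · refine ⟨l ++ (l' ++ [2]), ?_, ?_⟩
    · rw [listAct_append, listAct_append, hl, hz0]
      ext1 j
      by_cases e0 : j = ⟨0, hn⟩
      · subst e0
        simp [listAct, codeAct, hn1, zAt, ctrlLetter]
      · by_cases e1 : j = ⟨1, hn1⟩
        · subst e1
          simp [listAct, codeAct, hn1, zAt, tgtLetter]
        · simp [listAct, codeAct, hn1, e0, e1]
    · rw [listAct_append, listAct_append, ← hq']
      have a0 : listAct l' q' ⟨0, hn⟩ = 3 := by
        rw [hq1, if_pos (by simp [Fin.lt_def]), h0]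
      have a1 : listAct l' q' ⟨1, hn1⟩ = 3 := by
        rw [hq1, if_neg (by simp)]; simp [zAt]
      ext1 j
      by_cases e0 : j = ⟨0, hn⟩
      · subst e0
        simp [listAct, codeAct, hn1, zAt, ctrlLetter, a0, a1]
      · by_cases e1 : j = ⟨1, hn1⟩
        · subst e1
          simp [listAct, codeAct, hn1, zAt, tgtLetter, a0, a1]
        · have : ¬ j < ⟨1, hn1⟩ := by
            intro h
            have h' : j.val < 1 := h
            exact e0 (Fin.ext (by simp only; omega))
          simp [listAct, codeAct, hn1, e0, e1, hq1, this]

/-- The number of Clifford elements. -/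
def cliffordCard (n : ℕ) : ℕ := Fintype.card (Clifford n)

theorem sum_stab {F : Str n → ℂ} :
    ∑ c : Clifford n, ∑ p ∈ c.stab, F p = ∑ p, (stabCount p p : ℂ) * F p := by
  classical
  have : ∀ c : Clifford n, ∑ p ∈ c.stab, F p = ∑ p, if p ∈ c.stab then F p else 0 := fun c => by
    rw [← Finset.sum_filter]; congr 1; ext p; simp
  simp only [this]
  rw [Finset.sum_comm]
  refine Finset.sum_congr rfl fun p _ => ?_
  rw [← Finset.sum_filter, Finset.sum_const, nsmul_eq_mul, stabCount]
  simp only [and_self]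

theorem sum_stab_pair {F : Str n → Str n → ℂ} :
    ∑ c : Clifford n, ∑ p ∈ c.stab, ∑ q ∈ c.stab, F p q =
      ∑ p, ∑ q, (stabCount p q : ℂ) * F p q := by
  classical
  have : ∀ c : Clifford n, ∑ p ∈ c.stab, ∑ q ∈ c.stab, F p q =
      ∑ p, ∑ q, if p ∈ c.stab ∧ q ∈ c.stab then F p q else 0 := fun c => by
    have e : ∀ G : Str n → ℂ, ∑ p ∈ c.stab, G p = ∑ p, if p ∈ c.stab then G p else 0 := fun G => by
      rw [← Finset.sum_filter]; congr 1; ext p; simp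
    rw [e]
    refine Finset.sum_congr rfl fun p _ => ?_
    by_cases hp : p ∈ c.stab
    · rw [if_pos hp, e]; simp only [hp, true_and]
    · simp [hp]
  simp only [this]
  rw [Finset.sum_comm]
  refine Finset.sum_congr rfl fun p _ => ?_
  rw [Finset.sum_comm]
  refine Finset.sum_congr rfl fun q _ => ?_
  rw [← Finset.sum_filter, Finset.sum_const, nsmul_eq_mul, stabCount]

theorem stabCount_zero_right (p : Str n) : stabCount p 0 = stabCount p p := by
  simp [stabCount, Clifford.zero_mem_stab]

theorem stabCount_zero : stabCount (0 : Str n) 0 = cliffordCard n := by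
  simp only [stabCount, Clifford.zero_mem_stab, and_self, Finset.filter_true, cliffordCard]
  rfl

theorem card_str : (Fintype.card (Str n) : ℂ) = (2 ^ n) ^ 2 := by
  rw [Fintype.card_fun, Fintype.card_fin, Fintype.card_fin]
  push_cast
  rw [← pow_mul, mul_comm, pow_mul]
  norm_num

theorem two_pow_sub_one_ne_zero (hn : 0 < n) : (2 : ℂ) ^ n - 1 ≠ 0 := by
  have h : 2 ^ 1 ≤ 2 ^ n := Nat.pow_le_pow_right (by norm_num) hn
  rw [sub_ne_zero]
  have : (2 ^ n : ℕ) ≠ 1 := by omega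
  exact_mod_cast this

/-- Each stabilizer group has `d - 1` non-identity strings, and by transitivity all `d² - 1` such
strings occur equally often. -/
theorem stabCount_self {p : Str n} (hp : p ≠ 0) :
    ((2 : ℂ) ^ n + 1) * stabCount p p = cliffordCard n := by
  have hn : 0 < n := by
    rcases Nat.eq_zero_or_pos n with rfl | h
    · exact absurd (Subsingleton.elim p 0) hp
    · exact h
  have hconst : ∀ q : Str n, q ≠ 0 → stabCount q q = stabCount p p := by
    intro q hq
    obtain ⟨l, hl⟩ := exists_listAct_eq_zAt (k := ⟨0, hn⟩) rfl hp
    obtain ⟨l', hl'⟩ := exists_listAct_eq_zAt (k := ⟨0, hn⟩) rfl hq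
    rw [← stabCount_listAct l p p, ← stabCount_listAct l' q q, hl, hl']
  have h1 := sum_stab (n := n) (F := fun _ => 1)
  simp only [Finset.sum_const, Clifford.card_stab, nsmul_eq_mul, mul_one, Finset.card_univ] at h1
  rw [← Finset.add_sum_erase _ _ (Finset.mem_univ (0 : Str n)), stabCount_zero,
    Finset.sum_congr rfl fun q hq => by rw [hconst q (Finset.ne_of_mem_erase hq)],
    Finset.sum_const, Finset.card_erase_of_mem (Finset.mem_univ _), Finset.card_univ,
    nsmul_eq_mul, Nat.cast_sub Fintype.card_pos, card_str] at h1
  change (cliffordCard n : ℂ) * _ = _ at h1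
  push_cast at h1
  refine mul_left_cancel₀ (two_pow_sub_one_ne_zero hn) ?_
  linear_combination -h1

/-- The sum factorizes over sites, and at a site with a letter other than `I` two of the four
letters commute and two anticommute. -/
theorem sum_commSign {p : Str n} (hp : p ≠ 0) : ∑ q, commSign p q = 0 := by
  obtain ⟨i, hi⟩ := Function.ne_iff.1 hp
  simp only [commSign]
  rw [← Fintype.prod_sum fun i (a : PauliLetter) => PauliLetter.commSign (p i) a]
  refine Finset.prod_eq_zero (Finset.mem_univ i) ?_
  revert hi
  generalize p i = a
  fin_cases a <;> simp [Fin.sum_univ_four, PauliLetter.commSign]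

/-- Strings of one stabilizer group commute, so anticommuting pairs count zero. By transitivity on
pairs all other partners of `p` have the same count. There are `d²/2 - 2` of them, and they share
the `d - 2` places beside the identity and `p` in every group that contains `p`. -/
theorem stabCount_of_ne {p q : Str n} (hp : p ≠ 0) (hq : q ≠ 0) (hpq : p ≠ q) :
    ((2 : ℂ) ^ n + 1) * ((2 : ℂ) ^ n + 2) * stabCount p q =
      cliffordCard n * (1 + commSign p q) := by
  rcases commSign_eq p q with hc | hc
  swap
  · have : stabCount p q = 0 := by
      rw [stabCount, Finset.card_eq_zero, Finset.filter_eq_empty_iff]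
      rintro c - ⟨h1, h2⟩
      have := c.commSign_stab h1 h2
      rw [hc] at this
      norm_num at this
    rw [this, hc]; simp
  obtain ⟨hn, l, hl1, hl2⟩ := exists_listAct_pair hp hq hpq hc
  -- The factor `(1 + commSign p r) / 2` is the indicator of commutation.
  have hconst : ∀ r : Str n, r ≠ 0 → r ≠ p →
      (stabCount p r : ℂ) = stabCount p q * ((1 + commSign p r) / 2) := by
    intro r hr hrp
    rcases commSign_eq p r with hr' | hr'
    · obtain ⟨_, l', hl1', hl2'⟩ := exists_listAct_pair hp hr hrp.symm hr'
      rw [← stabCount_listAct l p q, ← stabCount_listAct l' p r, hl1, hl2, hl1', hl2', hr']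
      norm_num
    · have : stabCount p r = 0 := by
        rw [stabCount, Finset.card_eq_zero, Finset.filter_eq_empty_iff]
        rintro c - ⟨h1, h2⟩
        have := c.commSign_stab h1 h2
        rw [hr'] at this
        norm_num at this
      rw [this, hr']; simp
  have h1 : ∑ r, (stabCount p r : ℂ) = stabCount p p * 2 ^ n := by
    have e : ∀ r, (stabCount p r : ℂ) =
        ∑ c ∈ Finset.univ.filter (fun c : Clifford n => p ∈ c.stab), if r ∈ c.stab then 1 else 0 := by
      intro r
      rw [Finset.sum_boole, Finset.filter_filter, stabCount]
    rw [Finset.sum_congr rfl fun r _ => e r, Finset.sum_comm]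
    simp only [Finset.sum_boole, Finset.filter_mem_eq_inter, Finset.univ_inter, Clifford.card_stab]
    rw [Finset.sum_const, nsmul_eq_mul, stabCount]
    simp only [and_self]
    push_cast
    rfl
  have hpe : p ∈ Finset.univ.erase (0 : Str n) := by simp [hp]
  have hcs0 : commSign p 0 = 1 := Finset.prod_eq_one fun i _ => by simp [PauliLetter.commSign]
  have hcsp : commSign p p = 1 := Finset.prod_eq_one fun i _ => by simp [PauliLetter.commSign]
  have h2 := sum_commSign hp
  rw [← Finset.add_sum_erase _ _ (Finset.mem_univ (0 : Str n)), ← Finset.add_sum_erase _ _ hpe,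
    hcs0, hcsp] at h2
  rw [← Finset.add_sum_erase _ _ (Finset.mem_univ (0 : Str n)), ← Finset.add_sum_erase _ _ hpe,
    stabCount_zero_right, Finset.sum_congr rfl fun r hr => hconst r
      (Finset.ne_of_mem_erase (Finset.mem_of_mem_erase hr)) (Finset.ne_of_mem_erase hr),
    ← Finset.mul_sum, ← Finset.sum_div, Finset.sum_add_distrib, Finset.sum_const,
    Finset.card_erase_of_mem hpe, Finset.card_erase_of_mem (Finset.mem_univ _), Finset.card_univ,
    nsmul_eq_mul, mul_one] at h1
  have hcard : ((Fintype.card (Str n) - 1 - 1 : ℕ) : ℂ) = (2 ^ n) ^ 2 - 2 := by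
    have hge : 2 ≤ Fintype.card (Str n) := by
      rw [Fintype.card_fun, Fintype.card_fin, Fintype.card_fin]
      calc 2 ≤ 4 ^ 1 := by norm_num
        _ ≤ 4 ^ n := Nat.pow_le_pow_right (by norm_num) (by omega)
    rw [Nat.sub_sub, Nat.cast_sub hge, card_str]; norm_num
  rw [hcard] at h1
  have h3 := stabCount_self hp
  -- Two distinct commuting non-identity strings require at least two qubits, so one may divide by
  -- `d - 2`.
  have hd : (2 : ℂ) ^ n - 2 ≠ 0 := by
    have h : 2 ^ 2 ≤ 2 ^ n := Nat.pow_le_pow_right (by norm_num) hn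
    rw [sub_ne_zero]
    have : (2 ^ n : ℕ) ≠ 2 := by omega
    exact_mod_cast this
  rw [hc]
  refine mul_left_cancel₀ hd ?_
  linear_combination (2 * ((2 : ℂ) ^ n + 1)) * h1 + (2 * ((2 : ℂ) ^ n - 2)) * h3 -
    (stabCount p q * ((2 : ℂ) ^ n + 1)) * h2

end Lagrangian
end

/-! ### First and second moments of a snapshot. -/

noncomputable section

section SnapshotMoments

variable {n : ℕ}

theorem expect_uniformOfFintype {α : Type} [Fintype α] [Nonempty α] (f : α → ℝ) :
    expect (PMF.uniformOfFintype α) f = (Fintype.card α : ℝ)⁻¹ * ∑ a, f a := by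
  rw [expect_eq_sum (S := Finset.univ) (by simp), Finset.mul_sum]
  simp

theorem expect_born {σ : Op n} (h : DiagProb σ) (f : Bits n → ℝ) :
    expect (born σ) f = ∑ b, (σ b b).re * f b := by
  rw [expect_eq_sum (S := Finset.univ) (by simp)]
  refine Finset.sum_congr rfl fun b _ => ?_
  rw [born_apply h, ENNReal.toReal_ofReal (h.1 b)]

theorem finite_support_basisLaw (ρ U : Op n) : (basisLaw ρ U).support.Finite :=
  finite_support_map (finite_support_of_finite _) _

theorem finite_support_snapshot (ρ : Op n) : (snapshot ρ).support.Finite :=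
  finite_support_bind (finite_support_of_finite _) fun c => finite_support_basisLaw ρ c.toUnitary

/-- Conjugation by the inverse of a Clifford element. -/
def Clifford.pull (c : Clifford n) (X : Op n) : Op n := c.toUnitary.conjTranspose * X * c.toUnitary

theorem Clifford.pull_isState (c : Clifford n) {ρ : Op n} (hρ : IsState ρ) :
    IsState (c.pull ρ) := by
  have := hρ.conj (U := c.toUnitary.conjTranspose)
    (by rw [Matrix.conjTranspose_conjTranspose, c.actsBy.mul_star])
  rwa [Matrix.conjTranspose_conjTranspose] at this

theorem expect_snapshot {ρ : Op n} (hρ : IsState ρ) (g : Op n → ℝ) :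
    expect (snapshot ρ) g = (cliffordCard n : ℝ)⁻¹ * ∑ c : Clifford n, ∑ b,
      (c.pull ρ b b).re * g (c.toUnitary * basisProj b * c.toUnitary.conjTranspose) := by
  rw [snapshot_eq_star, expect_bind (finite_support_of_finite _) fun c =>
    finite_support_basisLaw ρ _]
  change expect (PMF.uniformOfFintype (Clifford n)) _ = _
  rw [expect_uniformOfFintype]
  congr 1
  refine Finset.sum_congr rfl fun c _ => ?_
  rw [basisLaw, expect_map (finite_support_of_finite _)]
  simp only [Matrix.conjTranspose_conjTranspose]
  exact expect_born (c.pull_isState hρ).diagProb _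

theorem Clifford.trace_mul_conj (c : Clifford n) (X Y : Op n) :
    (X * (c.toUnitary * Y * c.toUnitary.conjTranspose)).trace = (c.pull X * Y).trace := by
  calc _ = (X * c.toUnitary * Y * c.toUnitary.conjTranspose).trace := by
        simp only [Matrix.mul_assoc]
    _ = _ := by rw [Matrix.trace_mul_comm]; simp only [pull, Matrix.mul_assoc]

theorem Clifford.trace_mul_basis (c : Clifford n) (X : Op n) (b : Bits n) :
    (X * (c.toUnitary * basisProj b * c.toUnitary.conjTranspose)).trace = c.pull X b b := by
  rw [c.trace_mul_conj, Matrix.trace_mul_comm, trace_basisProj_mul]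

theorem Clifford.sum_stab_eq (c : Clifford n) (G : Str n → ℂ) :
    ∑ p ∈ c.stab, G p = ∑ p ∈ zStrings n, G (c.act p) :=
  Finset.sum_image fun _ _ _ _ h => c.actsBy.injective h

/-- Under `c` the `I`/`Z` strings become the strings of the stabilizer group. Each sign occurs in
both traces and cancels. -/
theorem Clifford.sum_pull_diag (c : Clifford n) (X Y : Op n) :
    ∑ b, c.pull X b b * c.pull Y b b =
      (2 ^ n : ℂ)⁻¹ * ∑ p ∈ c.stab, (X * pauliOp p).trace * (Y * pauliOp p).trace := by
  rw [sum_diag_mul, c.sum_stab_eq]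
  refine congrArg _ (Finset.sum_congr rfl fun p _ => ?_)
  obtain ⟨s, hs, h⟩ := c.actsBy.act p
  rw [← c.trace_mul_conj, ← c.trace_mul_conj, h]
  simp only [Matrix.mul_smul, Matrix.trace_smul, smul_eq_mul]
  have : s * s = 1 := by rcases hs with rfl | rfl <;> simp
  linear_combination (X * pauliOp (c.act p)).trace * (Y * pauliOp (c.act p)).trace * this

theorem Clifford.sum_pull_diag_sq (c : Clifford n) (X Y : Op n) :
    ∑ b, c.pull X b b * c.pull Y b b ^ 2 =
      ((2 ^ n : ℂ) ^ 2)⁻¹ * ∑ p ∈ c.stab, ∑ q ∈ c.stab,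
        (X * (pauliOp p * pauliOp q)).trace * (Y * pauliOp p).trace * (Y * pauliOp q).trace := by
  rw [sum_diag_mul_sq, c.sum_stab_eq]
  refine congrArg _ (Finset.sum_congr rfl fun p _ => ?_)
  rw [c.sum_stab_eq]
  refine Finset.sum_congr rfl fun q _ => ?_
  obtain ⟨s, hs, h⟩ := c.actsBy.act p
  obtain ⟨t, ht, h'⟩ := c.actsBy.act q
  rw [← c.trace_mul_conj, ← c.trace_mul_conj, ← c.trace_mul_conj, c.actsBy.conj_mul, h, h']
  simp only [Matrix.mul_smul, Matrix.smul_mul, Matrix.trace_smul, smul_eq_mul]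
  have h1 : s * s = 1 := by rcases hs with rfl | rfl <;> simp
  have h2 : t * t = 1 := by rcases ht with rfl | rfl <;> simp
  set a := (X * (pauliOp (c.act p) * pauliOp (c.act q))).trace
  set b := (Y * pauliOp (c.act p)).trace
  set d := (Y * pauliOp (c.act q)).trace
  linear_combination a * b * d * (t * t) * h1 + a * b * d * h2

theorem two_pow_ne_zero' : (2 : ℂ) ^ n ≠ 0 := by positivity

/-- Parseval's identity for the Pauli basis. -/
theorem sum_trace_mul_trace (X Y : Op n) :
    ∑ p : Str n, (X * pauliOp p).trace * (Y * pauliOp p).trace = 2 ^ n * (X * Y).trace := by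
  have h := congrArg (fun Z => (X * Z).trace) (sum_trace_smul_pauliOp Y)
  simp only [Finset.mul_sum, Matrix.trace_sum, Matrix.mul_smul, Matrix.trace_smul,
    smul_eq_mul] at h
  rw [← h]
  exact Finset.sum_congr rfl fun p _ => mul_comm _ _

/-- First moment of a uniformly random stabilizer basis. -/
theorem sum_clifford_diag (X Y : Op n) :
    ((2 : ℂ) ^ n + 1) * ∑ c : Clifford n, ∑ b, c.pull X b b * c.pull Y b b =
      cliffordCard n * (X.trace * Y.trace + (X * Y).trace) := by
  simp only [Clifford.sum_pull_diag, ← Finset.mul_sum]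
  rw [sum_stab]
  set F : Str n → ℂ := fun p => (X * pauliOp p).trace * (Y * pauliOp p).trace with hF
  have h0 : F 0 = X.trace * Y.trace := by simp [hF, pauliOp_zero]
  have h1 : ∑ p, F p = 2 ^ n * (X * Y).trace := sum_trace_mul_trace X Y
  -- A non-identity string has weight `1/(d+1)` and the identity has weight `1 = (1 + d)/(d+1)`,
  -- whence the extra term `d · F 0`.
  have h2 : ((2 : ℂ) ^ n + 1) * ∑ p, (stabCount p p : ℂ) * F p =
      cliffordCard n * (2 ^ n * F 0 + ∑ p, F p) := by
    rw [← Finset.add_sum_erase _ _ (Finset.mem_univ (0 : Str n)),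
      ← Finset.add_sum_erase _ F (Finset.mem_univ (0 : Str n)), stabCount_zero, mul_add,
      Finset.mul_sum]
    rw [Finset.sum_congr rfl fun p hp => by
      rw [← mul_assoc, stabCount_self (Finset.ne_of_mem_erase hp)], ← Finset.mul_sum]
    ring
  have h3 := two_pow_ne_zero' (n := n)
  calc _ = (2 ^ n : ℂ)⁻¹ * (((2 : ℂ) ^ n + 1) * ∑ p, (stabCount p p : ℂ) * F p) := by ring
    _ = _ := by rw [h2, h0, h1]; field_simp

/-- Second moment of a uniformly random stabilizer basis, for a traceless operator. -/
theorem sum_clifford_diag_sq (X Y : Op n) (hX : X.trace = 1) (hY : Y.trace = 0) :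
    ((2 : ℂ) ^ n + 1) * ((2 : ℂ) ^ n + 2) *
        ∑ c : Clifford n, ∑ b, c.pull X b b * c.pull Y b b ^ 2 =
      cliffordCard n * ((Y * Y).trace + 2 * (X * (Y * Y)).trace) := by
  simp only [Clifford.sum_pull_diag_sq, ← Finset.mul_sum]
  rw [sum_stab_pair]
  set y : Str n → ℂ := fun p => (Y * pauliOp p).trace with hy
  set F : Str n → Str n → ℂ := fun p q =>
    (X * (pauliOp p * pauliOp q)).trace * y p * y q with hF
  -- Tracelessness removes the identity string from all pairs, so the counts for non-identity
  -- strings suffice.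
  have hy0 : y 0 = 0 := by simp [hy, pauliOp_zero, hY]
  have hdiag : ∑ p, F p p = 2 ^ n * (Y * Y).trace := by
    rw [← sum_trace_mul_trace]
    refine Finset.sum_congr rfl fun p _ => ?_
    simp [hF, pauliOp_mul_self, hX, hy]
  have hYs : ∑ p : Str n, y p • pauliOp p = (2 ^ n : ℂ) • Y := sum_trace_smul_pauliOp Y
  have hall : ∑ p, ∑ q, F p q = (2 ^ n) ^ 2 * (X * (Y * Y)).trace := by
    have h : (X * ((∑ p : Str n, y p • pauliOp p) * ∑ q : Str n, y q • pauliOp q)).trace =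
        (2 ^ n) ^ 2 * (X * (Y * Y)).trace := by
      rw [hYs]
      simp only [Matrix.mul_smul, Matrix.smul_mul, Matrix.trace_smul, smul_eq_mul]
      ring
    rw [← h]
    simp only [Finset.sum_mul, Finset.mul_sum, Matrix.mul_smul, Matrix.smul_mul,
      Matrix.trace_sum, Matrix.trace_smul, smul_eq_mul]
    rw [Finset.sum_comm]
    exact Finset.sum_congr rfl fun p _ => Finset.sum_congr rfl fun q _ => by ring
  -- Exchanging `p` and `q` in the sum reverses the product of the two strings, which produces
  -- exactly this sign.
  have hcomm : ∑ p, ∑ q, commSign p q * F p q = ∑ p, ∑ q, F p q := by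
    rw [Finset.sum_comm]
    refine Finset.sum_congr rfl fun p _ => Finset.sum_congr rfl fun q _ => ?_
    simp only [hF]
    rw [pauliOp_mul_comm p q, commSign_comm q p, Matrix.mul_smul, Matrix.trace_smul, smul_eq_mul]
    ring
  -- On the diagonal the count is `1/(d+1) = (2 + d)/((d+1)(d+2))` of the group, so it exceeds the
  -- commuting off-diagonal value by the term with `d`.
  have hterm : ∀ p q, ((2 : ℂ) ^ n + 1) * ((2 : ℂ) ^ n + 2) * (stabCount p q * F p q) =
      cliffordCard n * (F p q + commSign p q * F p q +
        if p = q then 2 ^ n * F p q else 0) := by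
    intro p q
    by_cases hp : p = 0
    · simp [hF, hp, hy0]
    by_cases hq : q = 0
    · simp [hF, hq, hy0]
    by_cases hpq : p = q
    · subst hpq
      have hcsp : commSign p p = 1 :=
        Finset.prod_eq_one fun i _ => by simp [PauliLetter.commSign]
      rw [hcsp, if_pos rfl]
      linear_combination ((2 : ℂ) ^ n + 2) * F p p * stabCount_self hp
    · rw [if_neg hpq]
      linear_combination F p q * stabCount_of_ne hp hq hpq
  have hsum : ((2 : ℂ) ^ n + 1) * ((2 : ℂ) ^ n + 2) * ∑ p, ∑ q, (stabCount p q : ℂ) * F p q =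
      cliffordCard n * (2 * ((2 ^ n) ^ 2 * (X * (Y * Y)).trace) +
        2 ^ n * (2 ^ n * (Y * Y).trace)) := by
    simp only [Finset.mul_sum, hterm]
    simp only [← Finset.mul_sum, Finset.sum_add_distrib, hcomm, hall, Finset.sum_ite_eq,
      Finset.mem_univ, if_true, hdiag]
    ring
  have h3 := two_pow_ne_zero' (n := n)
  calc _ = ((2 ^ n : ℂ) ^ 2)⁻¹ * (((2 : ℂ) ^ n + 1) * ((2 : ℂ) ^ n + 2) *
        ∑ p, ∑ q, (stabCount p q : ℂ) * F p q) := by ring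
    _ = _ := by rw [hsum]; field_simp; ring

theorem IsState.diag_im {ρ : Op n} (h : IsState ρ) (b : Bits n) : (ρ b b).im = 0 := by
  have := h.1.diag_nonneg (i := b)
  exact (Complex.le_def.1 this).2.symm

theorem diag_im_of_isHermitian {X : Op n} (h : X.IsHermitian) (b : Bits n) : (X b b).im = 0 := by
  have := h.apply b b
  exact Complex.conj_eq_iff_im.1 this

/-- Expectation of a linear function of a snapshot. -/
theorem expect_snapshot_trace {ρ : Op n} (hρ : IsState ρ) (Y : Op n) :
    ((2 : ℝ) ^ n + 1) * expect (snapshot ρ) (fun σ => (Y * σ).trace.re) =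
      Y.trace.re + (Y * ρ).trace.re := by
  rw [expect_snapshot hρ]
  simp only [Clifford.trace_mul_basis]
  have h1 := congrArg Complex.re (sum_clifford_diag ρ Y)
  have h2 : ∀ c : Clifford n, ∀ b, (c.pull ρ b b).re * (c.pull Y b b).re =
      (c.pull ρ b b * c.pull Y b b).re := fun c b => by
    rw [Complex.mul_re, (c.pull_isState hρ).diag_im b]; ring
  have e1 : ((2 : ℂ) ^ n + 1) = ((((2 : ℝ) ^ n + 1 : ℝ)) : ℂ) := by push_cast; rfl
  have e2 : (cliffordCard n : ℂ) = ((cliffordCard n : ℝ) : ℂ) := by push_cast; rfl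
  rw [hρ.2, one_mul, e1, e2, Complex.re_ofReal_mul, Complex.re_ofReal_mul,
    Matrix.trace_mul_comm ρ Y, Complex.add_re] at h1
  simp only [h2, ← Complex.re_sum]
  have h3 : (cliffordCard n : ℝ) ≠ 0 := by
    have : cliffordCard n ≠ 0 := Fintype.card_ne_zero
    exact_mod_cast this
  rw [mul_left_comm, h1, inv_mul_cancel_left₀ h3]

/-- Second moment of a traceless observable in a snapshot. -/
theorem expect_snapshot_trace_sq {ρ : Op n} (hρ : IsState ρ) {Y : Op n} (hY : Y.IsHermitian)
    (hY0 : Y.trace = 0) :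
    ((2 : ℝ) ^ n + 1) * ((2 : ℝ) ^ n + 2) *
        expect (snapshot ρ) (fun σ => (Y * σ).trace.re ^ 2) =
      (Y * Y).trace.re + 2 * (Y * Y * ρ).trace.re := by
  rw [expect_snapshot hρ]
  simp only [Clifford.trace_mul_basis]
  have h1 := congrArg Complex.re (sum_clifford_diag_sq ρ Y hρ.2 hY0)
  have hpull : ∀ c : Clifford n, (c.pull Y).IsHermitian := fun c => by
    change (c.pull Y).conjTranspose = c.pull Y
    simp only [Clifford.pull, Matrix.conjTranspose_mul, Matrix.conjTranspose_conjTranspose, hY.eq,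
      Matrix.mul_assoc]
  have h2 : ∀ c : Clifford n, ∀ b, (c.pull ρ b b).re * (c.pull Y b b).re ^ 2 =
      (c.pull ρ b b * c.pull Y b b ^ 2).re := fun c b => by
    rw [sq, sq, Complex.mul_re, Complex.mul_re, Complex.mul_im, (c.pull_isState hρ).diag_im b,
      diag_im_of_isHermitian (hpull c) b]; ring
  have e1 : ((2 : ℂ) ^ n + 1) * ((2 : ℂ) ^ n + 2) =
      (((((2 : ℝ) ^ n + 1) * ((2 : ℝ) ^ n + 2) : ℝ)) : ℂ) := by push_cast; rfl
  have e2 : (cliffordCard n : ℂ) = ((cliffordCard n : ℝ) : ℂ) := by push_cast; rfl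
  have e3 : (2 : ℂ) * (ρ * (Y * Y)).trace = ((2 : ℝ) : ℂ) * (Y * Y * ρ).trace := by
    rw [Matrix.trace_mul_comm]; norm_num
  rw [e1, e2, e3, Complex.re_ofReal_mul, Complex.re_ofReal_mul, Complex.add_re,
    Complex.re_ofReal_mul] at h1
  simp only [h2, ← Complex.re_sum]
  have h3 : (cliffordCard n : ℝ) ≠ 0 := by
    have : cliffordCard n ≠ 0 := Fintype.card_ne_zero
    exact_mod_cast this
  rw [mul_left_comm, h1, inv_mul_cancel_left₀ h3]

end SnapshotMoments
end

/-! ### Accuracy of the estimator. -/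

noncomputable section

/-! ## Circuits are unitary -/

section Circuits

variable {n : ℕ}

theorem local1_mul (q : Fin n) (A B : Matrix Bool Bool ℂ) :
    local1 q A * local1 q B = local1 q (A * B) := by
  rw [local1_eq_tens, local1_eq_tens, local1_eq_tens, tens_mul]
  congr 1
  ext1 i
  by_cases hi : i = q
  · subst hi; simp
  · simp [hi]

theorem local1_one (q : Fin n) : local1 q 1 = 1 := by
  rw [local1_eq_tens, ← tens_one]
  congr 1
  ext1 i
  by_cases hi : i = q
  · subst hi; simp
  · simp [hi]

theorem local1_conjTranspose (q : Fin n) (A : Matrix Bool Bool ℂ) :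
    (local1 q A).conjTranspose = local1 q A.conjTranspose := by
  rw [local1_eq_tens, local1_eq_tens, tens_conjTranspose]
  congr 1
  ext1 i
  by_cases hi : i = q
  · subst hi; simp
  · simp [hi]

theorem local2_mul {q r : Fin n} (h : q ≠ r) (A B : Matrix (Bool × Bool) (Bool × Bool) ℂ) :
    local2 q r A * local2 q r B = local2 q r (A * B) := by
  ext x y
  -- Only intermediate strings that agree with `x` off `q` and `r` contribute to the product; `φ`
  -- enumerates them.
  let φ : Bool × Bool → Bits n := fun ab => Function.update (Function.update x q ab.1) r ab.2
  have hφq : ∀ ab, φ ab q = ab.1 := fun ab => by simp [φ, h]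
  have hφr : ∀ ab, φ ab r = ab.2 := fun ab => by simp [φ]
  have hφi : ∀ ab i, i ≠ q → i ≠ r → φ ab i = x i := fun ab i h1 h2 => by simp [φ, h1, h2]
  have hinj : Function.Injective φ := fun a b hab => by
    refine Prod.ext ?_ ?_
    · rw [← hφq a, ← hφq b, hab]
    · rw [← hφr a, ← hφr b, hab]
  rw [Matrix.mul_apply]
  have hsub : ∑ z, local2 q r A x z * local2 q r B z y =
      ∑ z ∈ Finset.univ.image φ, local2 q r A x z * local2 q r B z y := by
    symm
    refine Finset.sum_subset (Finset.subset_univ _) fun z _ hz => ?_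
    have : ¬ ∀ i, i ≠ q → i ≠ r → x i = z i := by
      intro hxz
      apply hz
      refine Finset.mem_image.2 ⟨(z q, z r), Finset.mem_univ _, ?_⟩
      ext1 i
      by_cases hr : i = r
      · subst hr; rw [hφr]
      · by_cases hq : i = q
        · subst hq; rw [hφq]
        · rw [hφi _ _ hq hr, hxz i hq hr]
    simp only [local2, Matrix.of_apply]
    rw [if_neg this, zero_mul]
  rw [hsub, Finset.sum_image fun a _ b _ hab => hinj hab]
  simp only [local2, Matrix.of_apply, hφq, hφr, Matrix.mul_apply]
  have h1 : ∀ ab, ∀ i, i ≠ q → i ≠ r → x i = φ ab i := fun ab i h1 h2 => (hφi ab i h1 h2).symm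
  have h2 : ∀ ab, (∀ i, i ≠ q → i ≠ r → φ ab i = y i) ↔ ∀ i, i ≠ q → i ≠ r → x i = y i := by
    intro ab
    refine forall_congr' fun i => ?_
    refine forall_congr' fun h1 => forall_congr' fun h2 => ?_
    rw [hφi ab i h1 h2]
  simp only [h2, if_pos (h1 _)]
  split_ifs
  · rfl
  · simp

theorem local2_one (q r : Fin n) : local2 q r 1 = 1 := by
  ext x y
  by_cases h : x = y
  · subst h; simp [local2]
  · rw [Matrix.one_apply_ne h]
    simp only [local2, Matrix.of_apply, ite_eq_right_iff]
    intro h1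
    refine Matrix.one_apply_ne fun h2 => h ?_
    rw [Prod.mk.injEq] at h2
    ext1 i
    by_cases hq : i = q
    · subst hq; exact h2.1
    · by_cases hr : i = r
      · subst hr; exact h2.2
      · exact h1 i hq hr

theorem local2_conjTranspose (q r : Fin n) (A : Matrix (Bool × Bool) (Bool × Bool) ℂ) :
    (local2 q r A).conjTranspose = local2 q r A.conjTranspose := by
  ext x y
  simp only [local2, Matrix.conjTranspose_apply, Matrix.of_apply]
  simp only [eq_comm (a := y _) (b := x _)]
  split_ifs <;> simp

theorem Gate.toOp_star_mul (g : Gate n) : g.toOp.conjTranspose * g.toOp = 1 := by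
  cases g with
  | one q u =>
    have hu : u.1.conjTranspose * u.1 = 1 := Matrix.mem_unitaryGroup_iff'.1 u.2
    rw [Gate.toOp, local1_conjTranspose, local1_mul, hu, local1_one]
  | two q r hqr u =>
    have hu : u.1.conjTranspose * u.1 = 1 := Matrix.mem_unitaryGroup_iff'.1 u.2
    rw [Gate.toOp, local2_conjTranspose, local2_mul hqr, hu, local2_one]

theorem circuitOp_star_mul (gs : List (Gate n)) :
    (circuitOp gs).conjTranspose * circuitOp gs = 1 := by
  induction gs with
  | nil => simp [circuitOp]
  | cons g gs ih =>
    rw [circuitOp, Matrix.conjTranspose_mul, Matrix.mul_assoc,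
      ← Matrix.mul_assoc (circuitOp gs).conjTranspose, ih, Matrix.one_mul, g.toOp_star_mul]

theorem circuitOp_mul_star (gs : List (Gate n)) :
    circuitOp gs * (circuitOp gs).conjTranspose = 1 := mul_eq_one_comm.1 (circuitOp_star_mul gs)

end Circuits

/-! ## Observables -/

namespace ObsCircuit

variable {n : ℕ} {A : ObsCircuit n} {O : Op n}

theorem Implements.trace_mul (h : A.Implements O) (σ : Op n) : (O * σ).trace =
    ∑ b, (A.label b : ℂ) * (circuitOp A.gates * σ * (circuitOp A.gates).conjTranspose) b b := by
  rw [h]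
  calc _ = ((circuitOp A.gates).conjTranspose * (Matrix.diagonal (fun b => (A.label b : ℂ)) *
        circuitOp A.gates * σ)).trace := by simp only [Matrix.mul_assoc]
    _ = (Matrix.diagonal (fun b => (A.label b : ℂ)) *
        (circuitOp A.gates * σ * (circuitOp A.gates).conjTranspose)).trace := by
        rw [Matrix.trace_mul_comm]; simp only [Matrix.mul_assoc]
    _ = _ := by simp [Matrix.trace, Matrix.diagonal_mul]

theorem Implements.trace_mul_re (h : A.Implements O) (σ : Op n) : (O * σ).trace.re =
    ∑ b, ((circuitOp A.gates * σ * (circuitOp A.gates).conjTranspose) b b).re * A.label b := by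
  rw [h.trace_mul, Complex.re_sum]
  exact Finset.sum_congr rfl fun b _ => by rw [Complex.re_ofReal_mul, mul_comm]

theorem Implements.trace_re (h : A.Implements O) : O.trace.re = ∑ b, A.label b := by
  have := h.trace_mul_re 1
  simpa [circuitOp_mul_star] using this

theorem Implements.isHermitian (h : A.Implements O) : O.IsHermitian := by
  change O.conjTranspose = O
  rw [h]
  simp only [Matrix.conjTranspose_mul, Matrix.conjTranspose_conjTranspose,
    Matrix.diagonal_conjTranspose, Matrix.mul_assoc]
  congr 3
  ext b
  simp

/-- The square of an observable is implemented by squaring the labels. -/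
theorem Implements.sq (h : A.Implements O) :
    Implements ⟨A.gates, fun b => A.label b ^ 2⟩ (O * O) := by
  unfold Implements at h ⊢
  rw [h]
  have e : Matrix.diagonal (fun b => ((A.label b ^ 2 : ℝ) : ℂ)) =
      Matrix.diagonal (fun b => (A.label b : ℂ)) * Matrix.diagonal (fun b => (A.label b : ℂ)) := by
    rw [Matrix.diagonal_mul_diagonal]
    congr 1; ext b; push_cast; ring
  simp only [e]
  set V := circuitOp A.gates with hV
  set D := Matrix.diagonal fun b => (A.label b : ℂ)
  calc V.conjTranspose * D * V * (V.conjTranspose * D * V)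
      = V.conjTranspose * D * (V * V.conjTranspose) * D * V := by simp only [Matrix.mul_assoc]
    _ = _ := by rw [hV, circuitOp_mul_star, Matrix.mul_one]; simp only [Matrix.mul_assoc]

/-- Shifting an observable by a multiple of the identity shifts the labels. -/
theorem Implements.sub_const (h : A.Implements O) (c : ℝ) :
    Implements ⟨A.gates, fun b => A.label b - c⟩ (O - (c : ℂ) • 1) := by
  unfold Implements at h ⊢
  rw [h]
  have e : Matrix.diagonal (fun b => ((A.label b - c : ℝ) : ℂ)) =
      Matrix.diagonal (fun b => (A.label b : ℂ)) - (c : ℂ) • (1 : Op n) := by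
    ext x y
    by_cases hxy : x = y
    · subst hxy; simp
    · simp [hxy]
  simp only [e, Matrix.mul_sub, Matrix.sub_mul, Matrix.mul_smul, Matrix.smul_mul, Matrix.mul_one,
    circuitOp_star_mul]

theorem Implements.trace_sq (h : A.Implements O) : (O * O).trace.re = ∑ b, A.label b ^ 2 :=
  h.sq.trace_re

/-- The left side averages squared labels with probabilities, each at most `1`; the right side is
their plain sum. -/
theorem Implements.trace_sq_mul_le (h : A.Implements O) {σ : Op n} (hσ : IsState σ) :
    (O * O * σ).trace.re ≤ (O * O).trace.re := by
  have hp := (hσ.conj (circuitOp_star_mul A.gates)).diagProb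
  rw [h.sq.trace_mul_re, h.trace_sq]
  refine Finset.sum_le_sum fun b _ => ?_
  have h1 := Finset.single_le_sum (fun b _ => hp.1 b) (Finset.mem_univ b)
  rw [hp.2] at h1
  exact mul_le_of_le_one_left (sq_nonneg _) h1

/-- No squared label exceeds `tr O²`, so all labels, and their averages, have modulus at most `ε`.
This justifies the constant estimate `0` when `B ≤ ε²`. -/
theorem Implements.abs_trace_mul_le (h : A.Implements O) {σ : Op n} (hσ : IsState σ) {ε : ℝ}
    (hε : 0 ≤ ε) (hB : (O * O).trace.re ≤ ε ^ 2) : |(O * σ).trace.re| ≤ ε := by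
  have hp := (hσ.conj (circuitOp_star_mul A.gates)).diagProb
  have hlabel : ∀ b, |A.label b| ≤ ε := fun b => by
    refine abs_le_of_sq_le_sq ?_ hε
    refine le_trans ?_ hB
    rw [h.trace_sq]
    exact Finset.single_le_sum (f := fun b => A.label b ^ 2) (fun b _ => sq_nonneg _)
      (Finset.mem_univ b)
  rw [h.trace_mul_re]
  refine (Finset.abs_sum_le_sum_abs _ _).trans ?_
  calc _ ≤ ∑ b, ((circuitOp A.gates * σ * (circuitOp A.gates).conjTranspose) b b).re * ε := by
        refine Finset.sum_le_sum fun b _ => ?_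
        rw [abs_mul, abs_of_nonneg (hp.1 b)]
        exact mul_le_mul_of_nonneg_left (hlabel b) (hp.1 b)
    _ = ε := by rw [← Finset.sum_mul, hp.2, one_mul]

theorem finite_support_shot (A : ObsCircuit n) (σ : Op n) : (A.shot σ).support.Finite :=
  finite_support_map (finite_support_of_finite _) _

theorem expect_shot (A : ObsCircuit n) {σ : Op n} (hσ : IsState σ) (f : ℝ → ℝ) :
    expect (A.shot σ) f = ∑ b,
      ((circuitOp A.gates * σ * (circuitOp A.gates).conjTranspose) b b).re * f (A.label b) := by
  rw [shot, expect_map (finite_support_of_finite _),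
    expect_born (hσ.conj (circuitOp_star_mul A.gates)).diagProb]

end ObsCircuit

/-! ## Variance of the rescaled outputs -/

section Variance

variable {n : ℕ} {A : ObsCircuit n} {O : Op n}

theorem finite_support_rescaledOutput (A : ObsCircuit n) (O σ : Op n) :
    (rescaledOutput A O σ).support.Finite :=
  finite_support_map (finite_support_indep fun _ => A.finite_support_shot σ) _

/-- Given `σ`, the output is half the sum of `2(d+1)` independent shots, up to a constant. So its
variance is `(d+1)/2` times that of one shot, which is at most `tr(O²σ)`; the other term is the
squared bias. -/
theorem expect_rescaledOutput (h : A.Implements O) {σ : Op n} (hσ : IsState σ) (μ : ℝ) :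
    expect (rescaledOutput A O σ) (fun y => y - μ) =
        ((2 : ℝ) ^ n + 1) * (O * σ).trace.re - O.trace.re - μ ∧
      expect (rescaledOutput A O σ) (fun y => (y - μ) ^ 2) ≤
        ((2 : ℝ) ^ n + 1) / 2 * (O * O * σ).trace.re +
          (((2 : ℝ) ^ n + 1) * (O * σ).trace.re - O.trace.re - μ) ^ 2 := by
  set e := (O * σ).trace.re with he
  set D : ℝ := (2 : ℝ) ^ n + 1 with hD
  have hD0 : 0 < D := by positivity
  have hfin := A.finite_support_shot σ
  have hfin' := finite_support_indep (k := 2 * (2 ^ n + 1)) fun _ => hfin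
  have hm1 : expect (A.shot σ) (fun x => x) = e := by
    rw [A.expect_shot hσ, he, h.trace_mul_re]
  have hm2 : expect (A.shot σ) (fun x => x ^ 2) = (O * O * σ).trace.re := by
    rw [A.expect_shot hσ, h.sq.trace_mul_re]
  have hc : expect (A.shot σ) (fun x => x - e) = 0 := by
    simp only [sub_eq_add_neg, expect_add hfin, expect_const hfin, hm1, add_neg_cancel]
  have hv : expect (A.shot σ) (fun x => (x - e) ^ 2) ≤ (O * O * σ).trace.re := by
    have e1 : expect (A.shot σ) (fun x => (-2 * e) * x) = (-2 * e) * e := by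
      rw [expect_mul_left (A.shot σ) (-2 * e) fun x => x, hm1]
    have e2 : (fun x : ℝ => (x - e) ^ 2) = fun x => x ^ 2 + ((-2 * e) * x + e ^ 2) := by
      ext x; ring
    rw [e2, expect_add hfin (fun x => x ^ 2) fun x => (-2 * e) * x + e ^ 2,
      expect_add hfin (fun x => (-2 * e) * x) fun _ => e ^ 2, e1, expect_const hfin, hm2]
    nlinarith [sq_nonneg e]
  obtain ⟨h1, h2⟩ := expect_indep_sum_sq (k := 2 * (2 ^ n + 1)) (fun _ => hfin)
    (fun _ x => x - e) fun _ => hc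
  have hcard : ((2 * (2 ^ n + 1) : ℕ) : ℝ) = 2 * D := by push_cast; rw [hD]
  have hy : ∀ x : Fin (2 * (2 ^ n + 1)) → ℝ, D * ((∑ l, x l) / (2 * D)) - O.trace.re - μ =
      1 / 2 * (∑ l, (x l - e)) + (D * e - O.trace.re - μ) := by
    intro x
    rw [Finset.sum_sub_distrib, Finset.sum_const, Finset.card_univ, Fintype.card_fin, nsmul_eq_mul,
      hcard]
    field_simp
    ring
  constructor
  · rw [rescaledOutput, expect_map hfin']
    simp only [← hD, hy, expect_add hfin', expect_mul_left, h1, expect_const hfin']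
    ring
  · rw [rescaledOutput, expect_map hfin']
    have hsq : ∀ x : Fin (2 * (2 ^ n + 1)) → ℝ,
        (D * ((∑ l, x l) / (2 * D)) - O.trace.re - μ) ^ 2 =
          1 / 4 * (∑ l, (x l - e)) ^ 2 + ((D * e - O.trace.re - μ) * (∑ l, (x l - e)) +
            (D * e - O.trace.re - μ) ^ 2) := by
      intro x; rw [hy]; ring
    simp only [← hD, hsq, expect_add hfin', expect_mul_left, h1, h2, expect_const hfin',
      Finset.sum_const, Finset.card_univ, Fintype.card_fin, nsmul_eq_mul, hcard]
    nlinarith [mul_le_mul_of_nonneg_left hv hD0.le]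

theorem isState_of_mem_snapshot {ρ σ : Op n} (hσ : σ ∈ (snapshot ρ).support) : IsState σ := by
  rw [snapshot_eq, PMF.mem_support_bind_iff] at hσ
  obtain ⟨c, -, hσ⟩ := hσ
  obtain ⟨b, -, rfl⟩ := (PMF.mem_support_map_iff _ _ _).1 hσ
  exact c.pull_isState (basisProj_isState b)

/-- Subtracting the trace part of `O` leaves a traceless `Y`, and the centred quantity becomes
`(d+1) tr(Yσ) - tr(Yρ)`. Its second moment is at most `(d+1)² E[tr(Yσ)²] ≤ tr Y² + 2 tr(Y²ρ) ≤ 3 tr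
Y²`, and `tr Y² ≤ tr O²`. -/
theorem expect_snapshot_centered (h : A.Implements O) {ρ : Op n} (hρ : IsState ρ) :
    expect (snapshot ρ) (fun σ => (((2 : ℝ) ^ n + 1) * (O * σ).trace.re - O.trace.re -
      (O * ρ).trace.re) ^ 2) ≤ 3 * (O * O).trace.re := by
  have hfin := finite_support_snapshot ρ
  set d : ℝ := (2 : ℝ) ^ n with hd
  have hd0 : 0 < d := by positivity
  set τ : ℝ := O.trace.re with hτ
  set Y : Op n := O - ((τ / d : ℝ) : ℂ) • 1 with hYdef
  have hY := h.sub_const (τ / d)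
  rw [← hYdef] at hY
  have hcard : ((Fintype.card (Bits n) : ℕ) : ℝ) = d := by simp [hd]
  have hYtr : Y.trace = 0 := by
    have him : Y.trace.im = 0 := by
      rw [Matrix.trace, Complex.im_sum]
      exact Finset.sum_eq_zero fun b _ => diag_im_of_isHermitian hY.isHermitian b
    refine Complex.ext ?_ him
    rw [hY.trace_re, Finset.sum_sub_distrib, ← h.trace_re, Finset.sum_const, Finset.card_univ,
      nsmul_eq_mul, hcard]
    field_simp
    simp [hτ]
  have hYsq : (Y * Y).trace.re ≤ (O * O).trace.re := by
    rw [hY.trace_sq, h.trace_sq]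
    have : ∀ b, (A.label b - τ / d) ^ 2 = A.label b ^ 2 - 2 * (τ / d) * A.label b + (τ / d) ^ 2 :=
      fun b => by ring
    simp only [this, Finset.sum_add_distrib, Finset.sum_sub_distrib, ← Finset.mul_sum,
      ← h.trace_re, Finset.sum_const, Finset.card_univ, nsmul_eq_mul, hcard]
    have : d * (τ / d) ^ 2 = τ / d * τ := by field_simp
    have h0 : 0 ≤ τ / d * τ := by
      rw [div_mul_eq_mul_div]; exact div_nonneg (mul_self_nonneg _) hd0.le
    nlinarith
  have htr : ∀ σ : Op n, IsState σ → (O * σ).trace.re = (Y * σ).trace.re + τ / d := by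
    intro σ hσ
    rw [hYdef, Matrix.sub_mul, Matrix.trace_sub, Complex.sub_re, Matrix.smul_mul, Matrix.one_mul,
      Matrix.trace_smul, hσ.2]
    simp
  have hcongr : expect (snapshot ρ) (fun σ => ((d + 1) * (O * σ).trace.re - τ -
      (O * ρ).trace.re) ^ 2) = expect (snapshot ρ) (fun σ => (d + 1) ^ 2 * (Y * σ).trace.re ^ 2 +
        ((-2 * (Y * ρ).trace.re) * ((d + 1) * (Y * σ).trace.re) + (Y * ρ).trace.re ^ 2)) := by
    refine expect_congr fun σ hσ => ?_
    rw [htr σ (isState_of_mem_snapshot hσ), htr ρ hρ]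
    field_simp
    ring
  rw [hcongr]
  simp only [expect_add hfin, expect_mul_left, expect_const hfin]
  have h1 := expect_snapshot_trace hρ Y
  rw [hYtr, Complex.zero_re, zero_add, ← hd] at h1
  have h2 := expect_snapshot_trace_sq hρ hY.isHermitian hYtr
  rw [← hd] at h2
  have h3 := hY.trace_sq_mul_le hρ
  rw [h1]
  set E := expect (snapshot ρ) fun σ => (Y * σ).trace.re ^ 2 with hE
  have hE0 : 0 ≤ E := by
    rw [hE, ← expect_const hfin (0 : ℝ)]
    exact expect_mono hfin fun σ _ => sq_nonneg _
  have h4 : (d + 1) ^ 2 * E ≤ (d + 1) * (d + 2) * E := by nlinarith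
  nlinarith [sq_nonneg (Y * ρ).trace.re]

end Variance

/-! ## Median of means -/

section MedianOfMeans

variable {n M : ℕ} {A : Fin M → ObsCircuit n} {O : Fin M → Op n}

theorem finite_support_outputsOfCopy (A : Fin M → ObsCircuit n) (O : Fin M → Op n) (ρ : Op n) :
    (outputsOfCopy A O ρ).support.Finite :=
  finite_support_bind (finite_support_snapshot ρ) fun _ =>
    finite_support_indep fun _ => finite_support_rescaledOutput _ _ _

/-- Total variance: the snapshot contributes at most `3 tr O²`, and the shot noise averages to `(tr
O² + tr(O²ρ))/2 ≤ tr O²`. -/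
theorem expect_outputsOfCopy (hA : ∀ j, (A j).Implements (O j)) {ρ : Op n} (hρ : IsState ρ)
    (j : Fin M) :
    expect (outputsOfCopy A O ρ) (fun y => y j - (O j * ρ).trace.re) = 0 ∧
      expect (outputsOfCopy A O ρ) (fun y => (y j - (O j * ρ).trace.re) ^ 2) ≤
        4 * (O j * O j).trace.re := by
  have hfin := finite_support_snapshot ρ
  have hfin' : ∀ σ, ∀ i, (rescaledOutput (A i) (O i) σ).support.Finite := fun σ i =>
    finite_support_rescaledOutput _ _ _
  set μ := (O j * ρ).trace.re with hμ
  constructor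
  · rw [outputsOfCopy, expect_bind hfin fun σ => finite_support_indep (hfin' σ)]
    have : expect (snapshot ρ) (fun σ => expect (indep fun i => rescaledOutput (A i) (O i) σ)
        fun y => y j - μ) = expect (snapshot ρ) fun σ =>
          ((2 : ℝ) ^ n + 1) * (O j * σ).trace.re + (-(O j).trace.re - μ) := by
      refine expect_congr fun σ hσ => ?_
      rw [expect_indep_apply (hfin' σ) j fun a => a - μ,
        (expect_rescaledOutput (hA j) (isState_of_mem_snapshot hσ) μ).1]
      ring
    rw [this, expect_add hfin, expect_const hfin, expect_mul_left, expect_snapshot_trace hρ]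
    ring
  · rw [outputsOfCopy, expect_bind hfin fun σ => finite_support_indep (hfin' σ)]
    have h1 : expect (snapshot ρ) (fun σ => expect (indep fun i => rescaledOutput (A i) (O i) σ)
        fun y => (y j - μ) ^ 2) ≤ expect (snapshot ρ) fun σ =>
          1 / 2 * (((2 : ℝ) ^ n + 1) * (O j * O j * σ).trace.re) +
            (((2 : ℝ) ^ n + 1) * (O j * σ).trace.re - (O j).trace.re - μ) ^ 2 := by
      refine expect_mono hfin fun σ hσ => ?_
      rw [expect_indep_apply (hfin' σ) j fun a => (a - μ) ^ 2]
      refine (expect_rescaledOutput (hA j) (isState_of_mem_snapshot hσ) μ).2.trans_eq ?_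
      ring
    refine h1.trans ?_
    rw [expect_add hfin, expect_mul_left, expect_mul_left, expect_snapshot_trace hρ]
    have h2 := expect_snapshot_centered (hA j) hρ
    have h3 := (hA j).trace_sq_mul_le hρ
    linarith

/-- A group average is rarely far from the mean. -/
theorem expect_group_le (hA : ∀ j, (A j).Implements (O j)) {ρ : Op n} (hρ : IsState ρ)
    (j : Fin M) {ε B : ℝ} (hε : 0 < ε) (hB : (O j * O j).trace.re ≤ B) {L : ℕ} (hL0 : 0 < L)
    (hL : 64 * B / ε ^ 2 ≤ L) :
    expect (indep fun _ : Fin L => outputsOfCopy A O ρ)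
      (fun y => if ε < |(O j * ρ).trace.re - (∑ l, y l j) / (L : ℝ)| then (16 : ℝ) else 1) ≤ 2 := by
  have hfin := finite_support_outputsOfCopy A O ρ
  have hfin' := finite_support_indep fun _ : Fin L => hfin
  set μ := (O j * ρ).trace.re with hμ
  obtain ⟨m1, m2⟩ := expect_outputsOfCopy hA hρ j
  have hL' : (0 : ℝ) < L := by exact_mod_cast hL0
  obtain ⟨-, h2⟩ := expect_indep_sum_sq (fun _ : Fin L => hfin) (fun _ y => y j - μ) fun _ => m1
  rw [Finset.sum_const, Finset.card_univ, Fintype.card_fin, nsmul_eq_mul] at h2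
  -- Chebyshev for the weight `16` of a bad group and `1` of a good one: the excess over `1` is at
  -- most `15 · 4B/(ε²L) ≤ 60/64`.
  have hpt : ∀ y : Fin L → Fin M → ℝ,
      (if ε < |μ - (∑ l, y l j) / (L : ℝ)| then (16 : ℝ) else 1) ≤
        15 / (ε ^ 2 * L ^ 2) * (∑ l, (y l j - μ)) ^ 2 + 1 := by
    intro y
    split_ifs with h
    · have e : ∑ l, (y l j - μ) = -(L * (μ - (∑ l, y l j) / (L : ℝ))) := by
        rw [Finset.sum_sub_distrib, Finset.sum_const, Finset.card_univ, Fintype.card_fin,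
          nsmul_eq_mul]
        field_simp
        ring
      rw [e]
      have h3 : ε ^ 2 ≤ (μ - (∑ l, y l j) / (L : ℝ)) ^ 2 := by
        rw [← sq_abs (μ - _)]
        exact pow_le_pow_left₀ hε.le h.le 2
      have : 15 / (ε ^ 2 * (L : ℝ) ^ 2) * (-(L * (μ - (∑ l, y l j) / (L : ℝ)))) ^ 2 =
          15 * ((μ - (∑ l, y l j) / (L : ℝ)) ^ 2 / ε ^ 2) := by
        field_simp
      rw [this]
      have : 1 ≤ (μ - (∑ l, y l j) / (L : ℝ)) ^ 2 / ε ^ 2 := by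
        rw [one_le_div (by positivity)]; exact h3
      linarith
    · have : 0 ≤ 15 / (ε ^ 2 * (L : ℝ) ^ 2) * (∑ l, (y l j - μ)) ^ 2 := by positivity
      linarith
  refine (expect_mono hfin' fun y _ => hpt y).trans ?_
  rw [expect_add hfin', expect_mul_left, expect_const hfin', h2]
  rw [div_le_iff₀ (by positivity)] at hL
  have h4 : (L : ℝ) * expect (outputsOfCopy A O ρ) (fun y => (y j - μ) ^ 2) ≤ L * (4 * B) :=
    mul_le_mul_of_nonneg_left (m2.trans (by linarith)) hL'.le
  have h5 : 15 / (ε ^ 2 * (L : ℝ) ^ 2) *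
      ((L : ℝ) * expect (outputsOfCopy A O ρ) fun y => (y j - μ) ^ 2) ≤ 1 := by
    rw [div_mul_eq_mul_div, div_le_one (by positivity)]
    nlinarith
  linarith

theorem finite_support_qcqcLaw (A : Fin M → ObsCircuit n) (O : Fin M → Op n) (ρ : Op n)
    (K L : ℕ) : (qcqcLaw A O ρ K L).support.Finite :=
  finite_support_map (finite_support_indep fun _ =>
    finite_support_indep fun _ => finite_support_outputsOfCopy A O ρ) _

/-- The estimator is accurate for all observables with high probability. -/
theorem qcqcLaw_accurate (hA : ∀ j, (A j).Implements (O j)) {ρ : Op n} (hρ : IsState ρ)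
    {ε δ B : ℝ} (hε : 0 < ε) (hδ : 0 < δ) (hB : ∀ j, (O j * O j).trace.re ≤ B) {t L : ℕ}
    (hL0 : 0 < L) (hL : 64 * B / ε ^ 2 ≤ L) (ht : (M : ℝ) / δ ≤ 2 ^ (t + 1)) :
    ENNReal.ofReal (1 - δ) ≤ (qcqcLaw A O ρ (2 * t + 1) L).toOuterMeasure
      {o | ∀ j, |(O j * ρ).trace.re - o j| ≤ ε} := by
  classical
  have hfin := finite_support_qcqcLaw A O ρ (2 * t + 1) L
  have hfin2 : (indep fun _ : Fin L => outputsOfCopy A O ρ).support.Finite :=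
    finite_support_indep fun _ => finite_support_outputsOfCopy A O ρ
  have hfin1 := finite_support_indep fun _ : Fin (2 * t + 1) => hfin2
  refine ofReal_le_toOuterMeasure hfin
    -- Union bound in the form of a lower bound for the indicator of success.
    (f := fun o => 1 + (-1) * ∑ j, if ε < |(O j * ρ).trace.re - o j| then (1 : ℝ) else 0) ?_ ?_
  · intro o
    by_cases h : ∀ j, |(O j * ρ).trace.re - o j| ≤ ε
    · have : o ∈ {o : Fin M → ℝ | ∀ j, |(O j * ρ).trace.re - o j| ≤ ε} := h
      rw [Set.indicator_of_mem this, Finset.sum_eq_zero fun j _ => if_neg (not_lt.2 (h j))]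
      simp
    · have h' : o ∉ {o : Fin M → ℝ | ∀ j, |(O j * ρ).trace.re - o j| ≤ ε} := h
      rw [Set.indicator_of_notMem h']
      push Not at h
      obtain ⟨j, hj⟩ := h
      have := Finset.single_le_sum (f := fun j => if ε < |(O j * ρ).trace.re - o j| then (1 : ℝ)
        else 0) (fun j _ => by split_ifs <;> norm_num) (Finset.mem_univ j)
      simp only [if_pos hj] at this
      linarith
  · rw [expect_add hfin, expect_const hfin, expect_mul_left, expect_sum hfin]
    have hj : ∀ j, expect (qcqcLaw A O ρ (2 * t + 1) L)
        (fun o => if ε < |(O j * ρ).trace.re - o j| then (1 : ℝ) else 0) ≤ (2 ^ (t + 1))⁻¹ := by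
      intro j
      rw [qcqcLaw, expect_map hfin1]
      set bad : (Fin L → Fin M → ℝ) → Prop := fun y =>
        ε < |(O j * ρ).trace.re - (∑ l, y l j) / (L : ℝ)| with hbad
      -- A far median forces `t + 1` bad groups, so the product of the weights is at least
      -- `16^(t+1)`: a Markov bound that needs only the mean weight of a group.
      have hpt : ∀ y : Fin (2 * t + 1) → Fin L → Fin M → ℝ,
          (if ε < |(O j * ρ).trace.re - median fun g => (∑ l, y g l j) / (L : ℝ)| then (1 : ℝ)
            else 0) ≤ (16 ^ (t + 1) : ℝ)⁻¹ * ∏ g, (if bad (y g) then (16 : ℝ) else 1) := by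
        intro y
        have hprod : ∏ g, (if bad (y g) then (16 : ℝ) else 1) =
            16 ^ (Finset.univ.filter fun g => bad (y g)).card := by
          rw [Finset.prod_ite]; simp
        split_ifs with h
        · have h1 := lt_card_of_median_far _ h
          rw [hprod, ← div_eq_inv_mul, one_le_div (by positivity)]
          exact pow_le_pow_right₀ (by norm_num) h1
        · rw [hprod]; positivity
      refine (expect_mono hfin1 fun y _ => hpt y).trans ?_
      rw [expect_mul_left, expect_indep_prod (fun _ => hfin2)
        fun _ y => if bad y then (16 : ℝ) else 1]
      have hg := expect_group_le hA hρ j hε (hB j) hL0 hL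
      have hg0 : 0 ≤ expect (indep fun _ : Fin L => outputsOfCopy A O ρ)
          (fun y => if bad y then (16 : ℝ) else 1) := by
        rw [← expect_const hfin2 (0 : ℝ)]
        exact expect_mono hfin2 fun y _ => by split_ifs <;> norm_num
      rw [Finset.prod_const, Finset.card_univ, Fintype.card_fin]
      -- A mean weight of at most `2` per group gives `2^(2t+1) / 16^(t+1)`, which is below
      -- `2^{-(t+1)}`.
      calc _ ≤ (16 ^ (t + 1) : ℝ)⁻¹ * 2 ^ (2 * t + 1) :=
            mul_le_mul_of_nonneg_left (pow_le_pow_left₀ hg0 hg _) (by positivity)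
        _ ≤ (2 ^ (t + 1))⁻¹ := by
            rw [inv_mul_le_iff₀ (by positivity), ← div_eq_mul_inv, le_div_iff₀ (by positivity),
              ← pow_add]
            calc (2 : ℝ) ^ (2 * t + 1 + (t + 1)) ≤ 2 ^ (4 * (t + 1)) :=
                  pow_le_pow_right₀ (by norm_num) (by omega)
              _ = 16 ^ (t + 1) := by rw [pow_mul]; norm_num
    have hsum := Finset.sum_le_sum fun j (_ : j ∈ (Finset.univ : Finset (Fin M))) => hj j
    rw [Finset.sum_const, Finset.card_univ, Fintype.card_fin, nsmul_eq_mul] at hsum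
    have : (M : ℝ) * (2 ^ (t + 1))⁻¹ ≤ δ := by
      rw [div_le_iff₀ hδ] at ht
      rw [← div_eq_mul_inv, div_le_iff₀ (by positivity)]
      linarith
    linarith

end MedianOfMeans
end

/-! ### Register conventions, and the code that writes gate lists. -/

noncomputable section

/-! ## Tools for straight-line code -/

infixr:65 ";;" => Prog.seq

section Tools

variable {n : ℕ}

namespace Config

@[simp] theorem nat_dir (s : Config n) (a : ℕ) : s.nat (.dir a) = s.natReg a := rfl
@[simp] theorem nat_ind (s : Config n) (a : ℕ) : s.nat (.ind a) = s.natReg (s.natReg a) := rfl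
@[simp] theorem real_dir (s : Config n) (a : ℕ) : s.real (.dir a) = s.realReg a := rfl
@[simp] theorem real_ind (s : Config n) (a : ℕ) : s.real (.ind a) = s.realReg (s.natReg a) := rfl

@[simp] theorem tick_natReg (s : Config n) (k : ℕ) : (s.tick k).natReg = s.natReg := rfl
@[simp] theorem tick_realReg (s : Config n) (k : ℕ) : (s.tick k).realReg = s.realReg := rfl
@[simp] theorem tick_out (s : Config n) (k : ℕ) : (s.tick k).out = s.out := rfl
@[simp] theorem tick_qreg (s : Config n) (k : ℕ) : (s.tick k).qreg = s.qreg := rfl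
@[simp] theorem tick_copies (s : Config n) (k : ℕ) : (s.tick k).copies = s.copies := rfl
@[simp] theorem tick_time (s : Config n) (k : ℕ) : (s.tick k).time = s.time + k := rfl

@[simp] theorem setNat_natReg (s : Config n) (a v : ℕ) :
    (s.setNat (.dir a) v).natReg = Function.update s.natReg a v := rfl
@[simp] theorem setNat_realReg (s : Config n) (t : Ref) (v : ℕ) :
    (s.setNat t v).realReg = s.realReg := rfl
@[simp] theorem setNat_out (s : Config n) (t : Ref) (v : ℕ) : (s.setNat t v).out = s.out := rfl
@[simp] theorem setNat_qreg (s : Config n) (t : Ref) (v : ℕ) : (s.setNat t v).qreg = s.qreg := rfl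
@[simp] theorem setNat_copies (s : Config n) (t : Ref) (v : ℕ) :
    (s.setNat t v).copies = s.copies := rfl
@[simp] theorem setNat_time (s : Config n) (t : Ref) (v : ℕ) : (s.setNat t v).time = s.time := rfl

@[simp] theorem applyOp_natReg (s : Config n) (G : Op n) : (s.applyOp G).natReg = s.natReg := rfl
@[simp] theorem applyOp_qreg (s : Config n) (G : Op n) :
    (s.applyOp G).qreg = G * s.qreg * G.conjTranspose := rfl

/-- Append a gate code to the list of gates. -/
def push (s : Config n) (e : ℕ) : Config n :=
  { s with
    natReg := Function.update (Function.update s.natReg (s.natReg 10) e) 10 (s.natReg 10 + 1)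
    time := s.time + 2
    natTop := max (max s.natTop (s.natReg 10 + 1)) 11
    maxNat := max (max s.maxNat e) (s.natReg 10 + 1) }

@[simp] theorem push_time (s : Config n) (e : ℕ) : (s.push e).time = s.time + 2 := rfl

end Config

/-- The gate list is stored from address `40` on, and register `10` points behind it. -/
def Gates (s : Config n) (l : List ℕ) : Prop :=
  s.natReg 10 = 40 + l.length ∧ ∀ t (h : t < l.length), s.natReg (40 + t) = l[t]

theorem gates_setNat (s : Config n) {a : ℕ} (v : ℕ) (l : List ℕ) (ha : a < 40) (ha' : a ≠ 10) :
    Gates (s.setNat (.dir a) v) l ↔ Gates s l := by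
  unfold Gates
  simp only [Config.setNat_natReg, Function.update_of_ne ha'.symm]
  refine and_congr Iff.rfl (forall_congr' fun t => forall_congr' fun ht => ?_)
  rw [Function.update_of_ne (by omega)]

theorem Gates.push {s : Config n} {l : List ℕ} (h : Gates s l) (e : ℕ) :
    Gates (s.push e) (l ++ [e]) := by
  constructor
  · simp [Config.push, h.1]; omega
  · intro t ht
    have ht' : t < l.length + 1 := by simpa using ht
    simp only [Config.push]
    rw [Function.update_of_ne (by omega), h.1]
    rcases Nat.lt_succ_iff_lt_or_eq.1 ht' with h1 | h1
    · rw [Function.update_of_ne (by omega), h.2 t h1, List.getElem_append_left h1]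
    · subst h1; simp

theorem push_natReg {s : Config n} (e a : ℕ) (h : 40 ≤ s.natReg 10) (ha : a < 40) (ha' : a ≠ 10) :
    (s.push e).natReg a = s.natReg a := by
  simp only [Config.push]
  rw [Function.update_of_ne ha', Function.update_of_ne (by omega)]

/-- Registers and counters that scratch computations do not change. -/
structure Keep (s s' : Config n) : Prop where
  nat : ∀ a, a < 20 → a ≠ 10 → s'.natReg a = s.natReg a
  real : s'.realReg = s.realReg
  out : s'.out = s.out
  copies : s'.copies = s.copies

theorem Keep.refl (s : Config n) : Keep s s := ⟨fun _ _ _ => rfl, rfl, rfl, rfl⟩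

theorem Keep.tick {s s' : Config n} (h : Keep s s') (k : ℕ) : Keep s (s'.tick k) :=
  ⟨h.nat, h.real, h.out, h.copies⟩

theorem Keep.setNat {s s' : Config n} (h : Keep s s') {a : ℕ} (v : ℕ) (ha : 20 ≤ a ∨ a = 10) :
    Keep s (s'.setNat (.dir a) v) := by
  refine ⟨fun b h1 h2 => ?_, h.real, h.out, h.copies⟩
  rw [Config.setNat_natReg, Function.update_of_ne (by omega), h.nat b h1 h2]

theorem Keep.push {s s' : Config n} (h : Keep s s') (e : ℕ) (h40 : 40 ≤ s'.natReg 10) :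
    Keep s (s'.push e) := by
  refine ⟨fun b h1 h2 => ?_, h.real, h.out, h.copies⟩
  rw [push_natReg e b h40 (by omega) h2, h.nat b h1 h2]

/-- Bounds on the number of registers and on the stored numbers. -/
structure Bdd (S R X : ℕ) (s : Config n) : Prop where
  nat : s.natTop ≤ S
  real : s.realTop ≤ R
  max : s.maxNat ≤ X

variable {S R X : ℕ}

theorem Bdd.tick {s : Config n} (h : Bdd S R X s) (k : ℕ) : Bdd S R X (s.tick k) :=
  ⟨h.nat, h.real, h.max⟩

theorem Bdd.setNat {s : Config n} (h : Bdd S R X s) {a v : ℕ} (ha : a < S) (hv : v ≤ X) :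
    Bdd S R X (s.setNat (.dir a) v) :=
  ⟨max_le h.nat ha, h.real, max_le h.max hv⟩

theorem Bdd.setReal {s : Config n} (h : Bdd S R X s) {t : Ref} {v : ℝ} (ha : s.addr t < R) :
    Bdd S R X (s.setReal t v) :=
  ⟨h.nat, max_le h.real ha, h.max⟩

theorem Bdd.push {s : Config n} (h : Bdd S R X s) {e : ℕ} (h10 : 10 < S) (hp : s.natReg 10 < S)
    (hSX : S ≤ X) (he : e ≤ X) : Bdd S R X (s.push e) :=
  ⟨max_le (max_le h.nat hp) h10, h.real, max_le (max_le h.max he) (by omega)⟩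

/-- The registers that hold constants and the input. -/
structure Consts (n M : ℕ) (s : Config n) : Prop where
  -- Layout of the natural-number registers: `0`–`5` and `15`–`17` hold input and constants; `6`–`9`
  -- the numbers of groups and of copies, `t`, and the number of shots; `11`–`13` a cell pointer,
  -- the observable index and the group pointer; `20`–`39` are scratch; the gate list starts at
  -- `40`.
  num : s.natReg 0 = n
  obs : s.natReg 1 = M
  d : s.natReg 2 = 2 ^ n
  one : s.natReg 3 = 1
  four : s.natReg 4 = 4
  forty : s.natReg 5 = 40
  twenty : s.natReg 15 = 20
  two : s.natReg 16 = 2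
  three : s.natReg 17 = 3

theorem Consts.of_keep {M : ℕ} {s s' : Config n} (h : Consts n M s) (k : Keep s s') :
    Consts n M s' := by
  have e := fun a h1 h2 => k.nat a h1 h2
  exact ⟨(e 0 (by omega) (by omega)).trans h.num, (e 1 (by omega) (by omega)).trans h.obs,
    (e 2 (by omega) (by omega)).trans h.d, (e 3 (by omega) (by omega)).trans h.one,
    (e 4 (by omega) (by omega)).trans h.four, (e 5 (by omega) (by omega)).trans h.forty,
    (e 15 (by omega) (by omega)).trans h.twenty, (e 16 (by omega) (by omega)).trans h.two,
    (e 17 (by omega) (by omega)).trans h.three⟩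

/-- The state during a scratch computation that started in `s0`. -/
structure Scratch (M S R X : ℕ) (s0 s : Config n) (l : List ℕ) (τ : ℕ) : Prop where
  keep : Keep s0 s
  consts : Consts n M s
  gates : Gates s l
  bdd : Bdd S R X s
  time : s.time ≤ s0.time + τ
  codes : ∀ e ∈ l, e ≤ X
  base : 40 ≤ S
  top : S ≤ X

namespace Scratch

variable {M : ℕ} {s0 s : Config n} {l : List ℕ} {τ : ℕ}

theorem tick (h : Scratch M S R X s0 s l τ) (k : ℕ) : Scratch M S R X s0 (s.tick k) l (τ + k) :=
  ⟨h.keep.tick k, h.consts.of_keep ((Keep.refl s).tick k), h.gates, h.bdd.tick k, by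
    have := h.time; simp; omega, h.codes, h.base, h.top⟩

theorem setQreg (h : Scratch M S R X s0 s l τ) (σ : Op n) :
    Scratch M S R X s0 { s with qreg := σ } l τ :=
  ⟨⟨h.keep.nat, h.keep.real, h.keep.out, h.keep.copies⟩,
    h.consts.of_keep ⟨fun _ _ _ => rfl, rfl, rfl, rfl⟩, h.gates,
    ⟨h.bdd.nat, h.bdd.real, h.bdd.max⟩, h.time, h.codes, h.base, h.top⟩

theorem applyOp (h : Scratch M S R X s0 s l τ) (G : Op n) :
    Scratch M S R X s0 (s.applyOp G) l τ := h.setQreg _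

theorem setNat (h : Scratch M S R X s0 s l τ) {a v : ℕ} (ha : 20 ≤ a) (ha' : a < 40)
    (hv : v ≤ X) : Scratch M S R X s0 (s.setNat (.dir a) v) l τ :=
  ⟨h.keep.setNat v (Or.inl ha), h.consts.of_keep ((Keep.refl s).setNat v (Or.inl ha)),
    (gates_setNat s v l ha' (by omega)).2 h.gates,
    h.bdd.setNat (by have := h.base; omega) hv, h.time, h.codes, h.base, h.top⟩

theorem push (h : Scratch M S R X s0 s l τ) {e : ℕ} (hS : 40 + l.length < S)
    (he : e ≤ X) : Scratch M S R X s0 (s.push e) (l ++ [e]) (τ + 2) := by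
  have h10 := h.gates.1
  refine ⟨h.keep.push e (by omega), h.consts.of_keep ((Keep.refl s).push e (by omega)),
    h.gates.push e, h.bdd.push (by omega) (by omega) h.top he, by have := h.time; simp; omega,
    fun e' he' => ?_, h.base, h.top⟩
  rcases List.mem_append.1 he' with h' | h'
  · exact h.codes e' h'
  · rw [List.mem_singleton.1 h']; exact he

theorem mono (h : Scratch M S R X s0 s l τ) {τ' : ℕ} (hτ : τ ≤ τ') :
    Scratch M S R X s0 s l τ' :=
  ⟨h.keep, h.consts, h.gates, h.bdd, by have := h.time; omega, h.codes, h.base, h.top⟩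

theorem restart (h : Scratch M S R X s0 s l τ) : Scratch M S R X s s l 0 :=
  ⟨Keep.refl s, h.consts, h.gates, h.bdd, by omega, h.codes, h.base, h.top⟩

end Scratch

end Tools

/-! ## The program: gate lists -/

section Programs

/-- A dummy instruction. -/
def nopProg : Prog := .instr (.natConst (.dir 39) 0)

/-- `t := a o b` for registers with fixed addresses. -/
def opProg (o : NatOp) (t a b : ℕ) : Prog := .instr (.natOp o (.dir t) (.dir a) (.dir b))

/-- Append the code in register `r` to the gate list. -/
def pushProg (r : ℕ) : Prog :=
  -- There is no move instruction; multiplying by register `3`, which holds `1`, copies a number.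
  .instr (.natOp .mul (.ind 10) (.dir r) (.dir 3)) ;; opProg .add 10 10 3

/-- Append the gates of `siteCodes` for site `i`, letter `l` and carry `c` in registers `20`, `21`,
`22`, and update the carry. -/
def siteProg : Prog :=
  opProg .mul 23 4 20 ;;
  .ifNatLt (.dir 21) (.dir 3)
    (.ifNatLt (.dir 22) (.dir 3) nopProg
      (opProg .add 24 23 16 ;; pushProg 24 ;; opProg .add 24 23 17 ;; pushProg 24))
    (.ifNatLt (.dir 21) (.dir 16) (pushProg 23)
        (.ifNatLt (.dir 21) (.dir 17)
          (opProg .add 24 23 3 ;; pushProg 24 ;; pushProg 23) nopProg) ;;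
      .ifNatLt (.dir 22) (.dir 3) nopProg (opProg .add 24 23 17 ;; pushProg 24) ;;
      .instr (.natConst (.dir 22) 1))

/-- One step of a sweep: read the next base-4 digit of register `27`. -/
def sweepStep : Prog :=
  opProg .sub 20 20 3 ;; opProg .mod 21 27 4 ;; opProg .div 27 27 4 ;; siteProg

/-- One random sweep; registers `25` and `26` hold `4 ^ t` and `t`. -/
def sampleStep : Prog :=
  -- The random draw is grouped separately: it is coupled with the uniform law, and the rest of the
  -- round is deterministic.
  (opProg .sub 28 25 16 ;; .instr (.rand (.dir 27) (.dir 28))) ;;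
  opProg .add 27 27 3 ;; opProg .mul 20 0 3 ;; .instr (.natConst (.dir 22) 0) ;;
  .loop (.dir 26) sweepStep ;;
  opProg .div 25 25 4 ;; opProg .sub 26 26 3

/-- Write a random gate list. -/
def sampleProg : Prog :=
  .instr (.natConst (.dir 10) 40) ;; opProg .mul 25 2 2 ;; opProg .mul 26 0 3 ;;
  .loop (.dir 0) sampleStep

end Programs

section Verify

variable {n M : ℕ} {A : Fin M → ObsCircuit n} {ρ : Op n} {Q : Config n → Prop} {s s0 : Config n}
  {S R X τ : ℕ} {l : List ℕ}

theorem wp_opProg {o : NatOp} {t a b : ℕ} : wp A ρ (opProg o t a b) Q s ↔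
    Q ((s.tick 1).setNat (.dir t) (o.eval (s.natReg a) (s.natReg b))) := wp_natOp

theorem wp_nopProg : wp A ρ nopProg Q s ↔ Q ((s.tick 1).setNat (.dir 39) 0) := wp_natConst

theorem wp_pushProg {r : ℕ} (h3 : s.natReg 3 = 1) (h10 : 40 ≤ s.natReg 10) :
    wp A ρ (pushProg r) Q s ↔ Q (s.push (s.natReg r)) := by
  rw [pushProg, wp_seq, wp_natOp, wp_opProg]
  have e : (((s.tick 1).setNat (.ind 10) (NatOp.mul.eval (s.nat (.dir r)) (s.nat (.dir 3)))).tick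
      1).setNat (.dir 10) (NatOp.add.eval
        (((s.tick 1).setNat (.ind 10) (NatOp.mul.eval (s.nat (.dir r)) (s.nat (.dir 3)))).natReg 10)
        (((s.tick 1).setNat (.ind 10) (NatOp.mul.eval (s.nat (.dir r)) (s.nat (.dir 3)))).natReg 3))
      = s.push (s.natReg r) := by
    have e1 : ((s.tick 1).setNat (.ind 10) (NatOp.mul.eval (s.nat (.dir r)) (s.nat (.dir 3)))).natReg
        = Function.update s.natReg (s.natReg 10) (s.natReg r) := by
      change Function.update s.natReg (s.natReg 10) (s.natReg r * s.natReg 3) = _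
      rw [h3, mul_one]
    rw [e1, Function.update_of_ne (by omega), Function.update_of_ne (by omega), h3]
    unfold Config.push Config.setNat Config.tick
    simp only [NatOp.eval, Config.nat, Config.addr, h3, mul_one]
  rw [e]

/-- Execution of one instruction that writes a scratch register. -/
theorem wp_scratch_op {o : NatOp} {t a b : ℕ} (h : Scratch M S R X s0 s l τ) (ht : 20 ≤ t)
    (ht' : t < 40) (hv : o.eval (s.natReg a) (s.natReg b) ≤ X)
    (hQ : ∀ s', Scratch M S R X s0 s' l (τ + 1) →
      s'.natReg = Function.update s.natReg t (o.eval (s.natReg a) (s.natReg b)) →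
      s'.qreg = s.qreg → Q s') : wp A ρ (opProg o t a b) Q s :=
  wp_opProg.2 (hQ _ ((h.tick 1).setNat ht ht' hv) rfl rfl)

theorem wp_scratch_const {t c : ℕ} (h : Scratch M S R X s0 s l τ) (ht : 20 ≤ t)
    (ht' : t < 40) (hv : c ≤ X)
    (hQ : ∀ s', Scratch M S R X s0 s' l (τ + 1) → s'.natReg = Function.update s.natReg t c →
      s'.qreg = s.qreg → Q s') : wp A ρ (.instr (.natConst (.dir t) c)) Q s :=
  wp_natConst.2 (hQ _ ((h.tick 1).setNat ht ht' hv) rfl rfl)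

theorem wp_scratch_push {r : ℕ} (h : Scratch M S R X s0 s l τ) (hS : 40 + l.length < S)
    (hv : s.natReg r ≤ X)
    (hQ : ∀ s', Scratch M S R X s0 s' (l ++ [s.natReg r]) (τ + 2) →
      (∀ b, b < 40 → b ≠ 10 → s'.natReg b = s.natReg b) → s'.qreg = s.qreg → Q s') :
    wp A ρ (pushProg r) Q s := by
  have h10 := h.gates.1
  rw [wp_pushProg h.consts.one (by omega)]
  exact hQ _ (h.push hS hv) (fun b hb hb' => push_natReg _ b (by omega) hb hb') rfl

/-- The branches of the program are those of `siteCodes`; `20` bounds the time of every branch. -/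
theorem wp_siteProg (h : Scratch M S R X s0 s l τ) (hS : 40 + l.length + 3 ≤ S)
    {i a c : ℕ} (hi : s.natReg 20 = i) (ha : s.natReg 21 = a) (hc : s.natReg 22 = c)
    (hiX : 4 * i + 3 ≤ X)
    (hQ : ∀ s', Scratch M S R X s0 s' (l ++ siteCodes i a c) (τ + 20) →
      s'.natReg 22 = nextCarry a c → (∀ b, 20 ≤ b → b < 30 → b ≠ 22 → b ≠ 23 → b ≠ 24 →
        s'.natReg b = s.natReg b) → Q s') :
    wp A ρ siteProg Q s := by
  have hSX := h.top
  have hX1 : 1 ≤ X := by omega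
  have c3 := h.consts.one
  have c4 := h.consts.four
  have c16 := h.consts.two
  have c17 := h.consts.three
  have g10 := h.gates.1
  unfold siteProg
  rw [wp_seq, wp_opProg, wp_ifNatLt]
  set s1 := (s.tick 1).setNat (.dir 23) (NatOp.mul.eval (s.natReg 4) (s.natReg 20)) with hs1
  have e23 : s1.natReg 23 = 4 * i := by simp [hs1, NatOp.eval, c4, hi]
  have hr1 : ∀ b, b < 40 → b ≠ 23 → s1.natReg b = s.natReg b := fun b _ hb => by simp [hs1, hb]
  have H1 : Scratch M S R X s0 s1 l (τ + 1) :=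
    (h.tick 1).setNat (by omega) (by omega) (by simp [NatOp.eval, c4, hi]; omega)
  clear_value s1
  have k1 : ∀ b, 20 ≤ b → b < 30 → b ≠ 22 → b ≠ 23 → b ≠ 24 → s1.natReg b = s.natReg b :=
    fun b _ _ _ h2 _ => hr1 b (by omega) h2
  have d3 := H1.consts.one
  have d16 := H1.consts.two
  have d17 := H1.consts.three
  have e21 : s1.natReg 21 = a := by rw [hr1 21 (by omega) (by omega), ha]
  have e22 : s1.natReg 22 = c := by rw [hr1 22 (by omega) (by omega), hc]
  have wpush : ∀ (s' : Config n) (l' : List ℕ) (τ' r : ℕ) (Q' : Config n → Prop),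
      Scratch M S R X s0 s' l' τ' → (wp A ρ (pushProg r) Q' s' ↔ Q' (s'.push (s'.natReg r))) :=
    fun s' l' τ' r Q' h' => wp_pushProg h'.consts.one (by have := h'.gates.1; omega)
  have kpush : ∀ (s' : Config n) (l' : List ℕ) (τ' e b : ℕ), Scratch M S R X s0 s' l' τ' →
      b < 40 → b ≠ 10 → (s'.push e).natReg b = s'.natReg b :=
    fun s' l' τ' e b h' hb hb' => push_natReg e b (by have := h'.gates.1; omega) hb hb'
  simp only [Config.nat_dir, e21, d3]
  constructor
  · intro ha1
    rw [wp_ifNatLt]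
    simp only [Config.nat_dir, Config.tick_natReg, e22, d3]
    constructor
    · intro hc1
      rw [wp_nopProg]
      refine hQ _ ?_ ?_ ?_
      · simp only [siteCodes, if_pos ha1, if_pos hc1, List.append_nil]
        exact ((((H1.tick 1).tick 1).tick 1).setNat (by omega) (by omega) (by omega)).mono
          (by omega)
      · simp [nextCarry, ha1, e22]
      · intro b h1 h2 h3 h4 h5
        simp [show b ≠ 39 by omega, k1 b h1 h2 h3 h4 h5]
    · intro hc1
      rw [wp_seq, wp_opProg, wp_seq]
      set s2 := (((s1.tick 1).tick 1).tick 1).setNat (.dir 24)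
        (NatOp.add.eval (((s1.tick 1).tick 1).natReg 23) (((s1.tick 1).tick 1).natReg 16)) with hs2
      have H2 : Scratch M S R X s0 s2 l (τ + 4) :=
        (((H1.tick 1).tick 1).tick 1).setNat (by omega) (by omega)
          (by simp [NatOp.eval, e23, d16]; omega)
      have f24 : s2.natReg 24 = 4 * i + 2 := by simp [hs2, NatOp.eval, e23, d16]
      have hr2 : ∀ b, b ≠ 24 → s2.natReg b = s1.natReg b := fun b hb => by simp [hs2, hb]
      clear_value s2
      rw [wpush s2 _ _ _ _ H2, f24, wp_seq, wp_opProg]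
      have H3 := H2.push (e := 4 * i + 2) (by omega) (by omega)
      have hr3 := fun b => kpush s2 _ _ (4 * i + 2) b H2
      set s3 := s2.push (4 * i + 2)
      clear_value s3
      set s4 := (s3.tick 1).setNat (.dir 24) (NatOp.add.eval (s3.natReg 23) (s3.natReg 17)) with hs4
      have v23 : s3.natReg 23 = 4 * i := by
        rw [hr3 23 (by omega) (by omega), hr2 23 (by omega), e23]
      have v17 : s3.natReg 17 = 3 := H3.consts.three
      have H4 : Scratch M S R X s0 s4 (l ++ [4 * i + 2]) (τ + 4 + 2 + 1) :=
        (H3.tick 1).setNat (by omega) (by omega) (by simp [NatOp.eval, v23, v17]; omega)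
      have g24 : s4.natReg 24 = 4 * i + 3 := by simp [hs4, NatOp.eval, v23, v17]
      have hr4 : ∀ b, b ≠ 24 → s4.natReg b = s3.natReg b := fun b hb => by simp [hs4, hb]
      clear_value s4
      rw [wpush s4 _ _ _ _ H4, g24]
      have H5 := H4.push (e := 4 * i + 3) (by simp; omega) (by omega)
      have hr5 := fun b => kpush s4 _ _ (4 * i + 3) b H4
      refine hQ _ ?_ ?_ ?_
      · simp only [siteCodes, if_pos ha1, if_neg hc1]
        rw [List.append_assoc] at H5
        exact H5.mono (by omega)
      · rw [hr5 22 (by omega) (by omega), hr4 22 (by omega), hr3 22 (by omega) (by omega),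
          hr2 22 (by omega), e22, nextCarry, if_pos ha1]
      · intro b h1 h2 h3 h4 h5
        rw [hr5 b (by omega) (by omega), hr4 b (by omega), hr3 b (by omega) (by omega),
          hr2 b (by omega), k1 b h1 h2 h3 h4 h5]
  · intro ha1
    rw [wp_seq]
    -- Turning the letter into `Z` does not depend on the carry, so this code is specified once,
    -- before the case distinction on the carry.
    have hfirst : ∀ Q' : Config n → Prop, (∀ s2, Scratch M S R X s0 s2
        (l ++ (if a < 2 then [4 * i] else if a < 3 then [4 * i + 1, 4 * i] else [])) (τ + 10) →
        (∀ b, b < 39 → b ≠ 10 → b ≠ 24 → s2.natReg b = s1.natReg b) → Q' s2) →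
        wp A ρ (.ifNatLt (.dir 21) (.dir 16) (pushProg 23)
          (.ifNatLt (.dir 21) (.dir 17)
            (opProg .add 24 23 3 ;; pushProg 24 ;; pushProg 23) nopProg)) Q' (s1.tick 1) := by
      intro Q' hQ'
      rw [wp_ifNatLt]
      simp only [Config.nat_dir, Config.tick_natReg, e21, d16]
      constructor
      · intro ha2
        have H2 := (H1.tick 1).tick 1
        rw [wpush _ _ _ _ _ H2]
        simp only [Config.tick_natReg, e23]
        refine hQ' _ ?_ ?_
        · rw [if_pos ha2]
          exact (H2.push (e := 4 * i) (by omega) (by omega)).mono (by omega)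
        · intro b h1 h2 h3
          rw [kpush _ _ _ (4 * i) b H2 (by omega) h2]; rfl
      · intro ha2
        rw [wp_ifNatLt]
        simp only [Config.nat_dir, Config.tick_natReg, e21, d17]
        constructor
        · intro ha3
          rw [wp_seq, wp_opProg, wp_seq]
          set s2 := ((((s1.tick 1).tick 1).tick 1).tick 1).setNat (.dir 24) (NatOp.add.eval
            ((((s1.tick 1).tick 1).tick 1).natReg 23) ((((s1.tick 1).tick 1).tick 1).natReg 3))
            with hs2
          have H2 : Scratch M S R X s0 s2 l (τ + 5) :=
            ((((H1.tick 1).tick 1).tick 1).tick 1).setNat (by omega) (by omega)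
              (by simp [NatOp.eval, e23, d3]; omega)
          have f24 : s2.natReg 24 = 4 * i + 1 := by simp [hs2, NatOp.eval, e23, d3]
          have hr2 : ∀ b, b ≠ 24 → s2.natReg b = s1.natReg b := fun b hb => by simp [hs2, hb]
          clear_value s2
          rw [wpush s2 _ _ _ _ H2, f24]
          have H3 := H2.push (e := 4 * i + 1) (by omega) (by omega)
          have hr3 := fun b => kpush s2 _ _ (4 * i + 1) b H2
          rw [wpush _ _ _ _ _ H3, hr3 23 (by omega) (by omega), hr2 23 (by omega), e23]
          have H4 := H3.push (e := 4 * i) (by simp; omega) (by omega)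
          refine hQ' _ ?_ ?_
          · rw [if_neg ha2, if_pos ha3]
            rw [List.append_assoc] at H4
            exact H4.mono (by omega)
          · intro b h1 h2 h3
            rw [kpush _ _ _ (4 * i) b H3 (by omega) h2, hr3 b (by omega) h2, hr2 b h3]
        · intro ha3
          rw [wp_nopProg]
          refine hQ' _ ?_ ?_
          · rw [if_neg ha2, if_neg ha3, List.append_nil]
            exact (((((H1.tick 1).tick 1).tick 1).tick 1).setNat (by omega) (by omega)
              (by omega)).mono (by omega)
          · intro b h1 h2 h3
            simp [show b ≠ 39 by omega]
    refine hfirst _ fun s2 H2 hr2 => ?_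
    rw [wp_seq, wp_ifNatLt]
    set l2 := l ++ (if a < 2 then [4 * i] else if a < 3 then [4 * i + 1, 4 * i] else []) with hl2
    have hlen2 : l2.length ≤ l.length + 2 := by
      rw [hl2]; split_ifs <;> simp
    have e22' : s2.natReg 22 = c := by rw [hr2 22 (by omega) (by omega) (by omega), e22]
    have e23' : s2.natReg 23 = 4 * i := by rw [hr2 23 (by omega) (by omega) (by omega), e23]
    simp only [Config.nat_dir, e22', H2.consts.one]
    constructor
    · intro hc1
      rw [wp_nopProg, wp_natConst]
      refine hQ _ ?_ ?_ ?_
      · simp only [siteCodes, if_neg ha1, if_pos hc1, List.append_nil]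
        exact (((((H2.tick 1).tick 1).setNat (a := 39) (v := 0) (by omega) (by omega)
          (by omega)).tick 1).setNat (by omega) (by omega) (by omega)).mono (by omega)
      · simp [nextCarry, ha1]
      · intro b h1 h2 h3 h4 h5
        simp [show b ≠ 39 by omega, h3, hr2 b (by omega) (by omega) h5, k1 b h1 h2 h3 h4 h5]
    · intro hc1
      rw [wp_seq, wp_opProg]
      set s3 := ((s2.tick 1).tick 1).setNat (.dir 24)
        (NatOp.add.eval ((s2.tick 1).natReg 23) ((s2.tick 1).natReg 17)) with hs3
      have v17 : s2.natReg 17 = 3 := H2.consts.three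
      have H3 : Scratch M S R X s0 s3 l2 (τ + 10 + 1 + 1) :=
        ((H2.tick 1).tick 1).setNat (by omega) (by omega)
          (by simp [NatOp.eval, e23', v17]; omega)
      have f24 : s3.natReg 24 = 4 * i + 3 := by simp [hs3, NatOp.eval, e23', v17]
      have hr3 : ∀ b, b ≠ 24 → s3.natReg b = s2.natReg b := fun b hb => by simp [hs3, hb]
      clear_value s3
      rw [wpush s3 _ _ _ _ H3, f24, wp_natConst]
      have H4 := H3.push (e := 4 * i + 3) (by omega) (by omega)
      refine hQ _ ?_ ?_ ?_
      · simp only [siteCodes, if_neg ha1, if_neg hc1]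
        rw [hl2, List.append_assoc] at H4
        exact ((H4.tick 1).setNat (by omega) (by omega) hX1).mono (by omega)
      · simp [nextCarry, ha1]
      · intro b h1 h2 h3 h4 h5
        simp only [Config.setNat_natReg, Config.tick_natReg, Function.update_of_ne h3]
        rw [kpush s3 _ _ (4 * i + 3) b H3 (by omega) (by omega), hr3 b h5,
          hr2 b (by omega) (by omega) h5, k1 b h1 h2 h3 h4 h5]

end Verify
end

/-! ### Random sweeps on the machine. -/

noncomputable section

section Sampling

variable {n M : ℕ} {A : Fin M → ObsCircuit n} {ρ : Op n} {Q : Config n → Prop} {s s0 : Config n}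
  {S R X τ : ℕ} {l : List ℕ}

theorem wp_sweepStep (h : Scratch M S R X s0 s l τ) (hS : 40 + l.length + 3 ≤ S)
    {i r c : ℕ} (hi : s.natReg 20 = i) (hr : s.natReg 27 = r) (hc : s.natReg 22 = c)
    (hiX : 4 * i + 3 ≤ X) (hrX : r ≤ X)
    (hQ : ∀ s', Scratch M S R X s0 s' (l ++ siteCodes (i - 1) (r % 4) c) (τ + 23) →
      s'.natReg 20 = i - 1 → s'.natReg 27 = r / 4 → s'.natReg 22 = nextCarry (r % 4) c →
      s'.natReg 25 = s.natReg 25 → s'.natReg 26 = s.natReg 26 → Q s') :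
    wp A ρ sweepStep Q s := by
  have c3 := h.consts.one
  have c4 := h.consts.four
  have hX := h.top
  unfold sweepStep
  refine wp_seq.2 (wp_scratch_op h (by omega) (by omega) ?_ fun s1 h1 e1 _ => ?_)
  · simp [NatOp.eval, hi]; omega
  refine wp_seq.2 (wp_scratch_op h1 (by omega) (by omega) ?_ fun s2 h2 e2 _ => ?_)
  · simp [NatOp.eval, e1, hr, c4]; omega
  refine wp_seq.2 (wp_scratch_op h2 (by omega) (by omega) ?_ fun s3 h3 e3 _ => ?_)
  · simp [NatOp.eval, e1, e2, hr, c4]; omega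
  refine wp_siteProg h3 hS (i := i - 1) (a := r % 4) (c := c) ?_ ?_ ?_ (by omega) ?_
  · simp [e3, e2, e1, NatOp.eval, hi, c3]
  · simp [e3, e2, e1, NatOp.eval, hr, c4]
  · simp [e3, e2, e1, hc]
  · intro s' h' e22 hk
    refine hQ s' (h'.mono (by omega)) ?_ ?_ e22 ?_ ?_
    · rw [hk 20 (by omega) (by omega) (by omega) (by omega) (by omega)]
      simp [e3, e2, e1, NatOp.eval, hi, c3]
    · rw [hk 27 (by omega) (by omega) (by omega) (by omega) (by omega)]
      simp [e3, e2, e1, NatOp.eval, hr, c4]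
    · rw [hk 25 (by omega) (by omega) (by omega) (by omega) (by omega)]
      simp [e3, e2, e1]
    · rw [hk 26 (by omega) (by omega) (by omega) (by omega) (by omega)]
      simp [e3, e2, e1]

/-- The invariant: the codes already written, followed by those still due for the current site,
digits and carry, form the final list. -/
theorem wp_sweep {t : ℕ} (h : Scratch M S R X s0 s l τ) (hS : 40 + l.length + 3 * t ≤ S)
    {i r c : ℕ} (hi : s.natReg 20 = i) (hr : s.natReg 27 = r) (hc : s.natReg 22 = c)
    (ht : s.natReg 26 = t) (hiX : 4 * i + 3 ≤ X) (hrX : r ≤ X)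
    (hQ : ∀ s', Scratch M S R X s0 s' (l ++ sweepCodes t i r c) (τ + 24 * t + 1) →
      s'.natReg 25 = s.natReg 25 → s'.natReg 26 = t → Q s') :
    wp A ρ (.loop (.dir 26) sweepStep) Q s := by
  refine wp_loop (fun k s' => ∃ l' i' r' c', Scratch M S R X s0 s' l' (τ + 24 * k + 1) ∧
    l' ++ sweepCodes (t - k) i' r' c' = l ++ sweepCodes t i r c ∧ l'.length ≤ l.length + 3 * k ∧
    s'.natReg 20 = i' ∧ s'.natReg 27 = r' ∧ s'.natReg 22 = c' ∧ i' ≤ i ∧ r' ≤ r ∧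
    s'.natReg 25 = s.natReg 25 ∧ s'.natReg 26 = t) ?_ ?_ ?_
  · exact ⟨l, i, r, c, h.tick 1, rfl, by omega, hi, hr, hc, le_rfl, le_rfl, rfl, ht⟩
  · rintro k s' hk ⟨l', i', r', c', h', hl, hlen, e20, e27, e22, hi', hr', e25, e26⟩
    have hk' : k < t := by rw [← ht]; exact hk
    refine wp_sweepStep (h'.tick 1) (by omega) e20 e27 e22 (by omega) (by omega) ?_
    intro s'' h'' f20 f27 f22 f25 f26
    refine ⟨_, _, _, _, h''.mono (by omega), ?_, ?_, f20, f27, f22, by omega,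
      (Nat.div_le_self _ _).trans hr', f25.trans e25, f26.trans e26⟩
    · rw [← hl, List.append_assoc, show t - k = t - (k + 1) + 1 by omega, sweepCodes]
    · rw [List.length_append]
      have := siteCodes_length (i' - 1) (r' % 4) c'
      omega
  · rintro s' ⟨l', i', r', c', h', hl, _, _, _, _, _, _, e25, e26⟩
    have ht' : s.nat (.dir 26) = t := ht
    rw [ht'] at h' hl
    rw [Nat.sub_self, sweepCodes, List.append_nil] at hl
    subst hl
    exact hQ s' h' e25 e26

theorem coupled_rand {k : ℕ} {t a : Ref} (h : s.nat a = k) :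
    Coupled (PMF.uniformOfFintype (Fin (k + 1))) ((Prog.instr (.rand t a)).exec A ρ s)
      fun v s' => s' = (s.tick 1).setNat t v.val := by
  subst h
  exact ((Coupled.refl _).mono fun v w _ h => by rw [h]; rfl).map_right

/-- The recursion of `sampler` is followed with `t` as the number of sweeps that remain, and
registers `25` and `26` hold `4^t` and `t`. The drawn number determines the rest of the round. -/
theorem coupled_samples (hX : 4 ^ n + 3 ≤ X) (hnX : 4 * n + 3 ≤ X) {t : ℕ} (ht : t ≤ n) :
    ∀ (s : Config n) (l : List ℕ) (τ : ℕ), Scratch M S R X s0 s l τ →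
      40 + l.length + 3 * n * t ≤ S → s.natReg 25 = 4 ^ t → s.natReg 26 = t →
      Coupled (sampler n t l)
        (repeatPMF (fun s' => sampleStep.exec A ρ (s'.tick 1)) t s)
        fun l' s' => Scratch M S R X s0 s' l' (τ + (24 * n + 9) * t) ∧
          l'.length ≤ l.length + 3 * n * t := by
  induction t with
  | zero =>
    intro s l τ h _ _ _
    refine Coupled.pure_left fun s' hs' => ?_
    rw [repeatPMF, PMF.mem_support_pure_iff] at hs'
    subst hs'
    exact ⟨h, by omega⟩
  | succ t ih =>
    intro s l τ h hS e25 e26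
    have hpow : (4 : ℕ) ^ (t + 1) ≤ 4 ^ n := Nat.pow_le_pow_right (by norm_num) ht
    have hpos : 4 ≤ (4 : ℕ) ^ (t + 1) := by
      rw [pow_succ]; have := Nat.one_le_pow t 4 (by norm_num); omega
    have hmul : 3 * n * (t + 1) = 3 * n * t + 3 * n := by ring
    have hmul' : (24 * n + 9) * (t + 1) = (24 * n + 9) * t + 24 * n + 9 := by ring
    have hXS := h.top
    have hbase := h.base
    have step : Coupled (PMF.uniformOfFintype (Fin (4 ^ (t + 1) - 2 + 1)))
        (sampleStep.exec A ρ (s.tick 1)) fun v s' =>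
          Scratch M S R X s0 s' (l ++ sweepCodes (t + 1) n (v.val + 1) 0) (τ + 24 * n + 9) ∧
          s'.natReg 25 = 4 ^ t ∧ s'.natReg 26 = t := by
      unfold sampleStep
      refine Coupled.seq_left (R := fun v s' => Scratch M S R X s0 s' l (τ + 3) ∧
        s'.natReg 27 = v.val ∧ s'.natReg 25 = 4 ^ (t + 1) ∧ s'.natReg 26 = t + 1) ?_ ?_
      · refine Coupled.seq_right (wp_scratch_op (h.tick 1) (by omega) (by omega) ?_
          fun s1 h1 e1 _ => ?_)
        · simp [NatOp.eval, e25]; omega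
        · refine (coupled_rand (k := 4 ^ (t + 1) - 2) ?_).mono ?_
          · simp [e1, NatOp.eval, e25, h.consts.two]
          · rintro v s' _ rfl
            refine ⟨(h1.tick 1).setNat (by omega) (by omega) (by have := v.2; omega), by simp,
              by simp [e1, e25], by simp [e1, e26]⟩
      · rintro v s2 _ ⟨h2, f27, f25, f26⟩
        have hv := v.2
        have c3 := h2.consts.one
        have c0 := h2.consts.num
        refine wp_seq.2 (wp_scratch_op h2 (by omega) (by omega) ?_ fun s3 h3 e3 _ => ?_)
        · simp only [NatOp.eval, f27, c3]; omega
        refine wp_seq.2 (wp_scratch_op h3 (by omega) (by omega) ?_ fun s4 h4 e4 _ => ?_)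
        · simp [NatOp.eval, e3, c0, c3]; omega
        refine wp_seq.2 (wp_scratch_const h4 (by omega) (by omega) (by omega) fun s5 h5 e5 _ => ?_)
        refine wp_seq.2 (wp_sweep (t := t + 1) (i := n) (r := v.val + 1) (c := 0) h5 ?_ ?_ ?_ ?_ ?_
          (by omega) (by omega) fun s6 h6 e25' e26' => ?_)
        · omega
        · simp [e5, e4, e3, NatOp.eval, c0, c3]
        · simp [e5, e4, e3, NatOp.eval, f27, c3]
        · simp [e5]
        · simp [e5, e4, e3, f26]
        have g25 : s6.natReg 25 = 4 ^ (t + 1) := by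
          rw [e25']; simp [e5, e4, e3, f25]
        have d4 := h6.consts.four
        have d3 := h6.consts.one
        refine wp_seq.2 (wp_scratch_op h6 (by omega) (by omega) ?_ fun s7 h7 e7 _ => ?_)
        · simp only [NatOp.eval, g25, d4]; omega
        refine wp_scratch_op h7 (by omega) (by omega) ?_ fun s8 h8 e8 _ => ?_
        · simp [NatOp.eval, e7, e26']; omega
        refine ⟨h8.mono (by omega), ?_, ?_⟩
        · simp [e8, e7, NatOp.eval, g25, d4, pow_succ]
        · simp [e8, e7, NatOp.eval, e26', d3]
    refine step.bind ?_
    rintro v s' _ _ ⟨h', f25, f26⟩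
    have hlen := sweepCodes_length (t + 1) n (v.val + 1) 0
    have hll : (l ++ sweepCodes (t + 1) n (v.val + 1) 0).length ≤ l.length + 3 * n := by
      rw [List.length_append]; omega
    refine (ih (by omega) s' _ _ h' (by omega) f25 f26).mono ?_
    rintro l' s'' _ ⟨h'', hl''⟩
    exact ⟨h''.mono (by omega), by omega⟩

theorem coupled_sampleProg (h : Scratch M S R X s0 s l τ) (hX : 4 ^ n + 3 ≤ X)
    (hnX : 4 * n + 3 ≤ X) (hS : 40 + 3 * n * n ≤ S) :
    Coupled (sampler n n []) (sampleProg.exec A ρ s) fun l' s' =>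
      Scratch M S R X s0 s' l' (τ + (24 * n + 9) * n + 4) ∧ l'.length ≤ 3 * n * n := by
  have hbase := h.base
  -- The program obtains `4^n` as the square of the dimension.
  have hd : 2 ^ n * 2 ^ n = 4 ^ n := by rw [← mul_pow]; norm_num
  unfold sampleProg
  refine Coupled.seq_right (wp_natConst.2 ?_)
  set s1 := (s.tick 1).setNat (.dir 10) 40 with hs1
  have h1 : Scratch M S R X s0 s1 [] (τ + 1) := by
    have h' := h.tick 1
    exact ⟨h'.keep.setNat 40 (Or.inr rfl), h'.consts.of_keep ((Keep.refl _).setNat 40 (Or.inr rfl)),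
      ⟨by simp [hs1], fun t ht => absurd ht (by simp)⟩,
      h'.bdd.setNat (by omega) (by have := h.top; omega), h'.time, by simp, h.base, h.top⟩
  clear_value s1
  refine Coupled.seq_right (wp_scratch_op h1 (by omega) (by omega) ?_ fun s2 h2 e2 _ => ?_)
  · simp only [NatOp.eval, h1.consts.d]; omega
  refine Coupled.seq_right (wp_scratch_op h2 (by omega) (by omega) ?_ fun s3 h3 e3 _ => ?_)
  · simp only [NatOp.eval, h2.consts.num, h2.consts.one]; omega
  rw [Prog.exec, show s3.nat (.dir 0) = n from h3.consts.num]
  refine (coupled_samples hX hnX le_rfl _ _ _ (h3.tick 1) (by simpa using hS) ?_ ?_).mono ?_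
  · simp [e3, e2, NatOp.eval, h1.consts.d, hd]
  · simp [e3, NatOp.eval, h2.consts.num, h2.consts.one]
  · rintro l' s' _ ⟨h', hl⟩
    exact ⟨h'.mono (by omega), by simpa using hl⟩

end Sampling
end

/-! ### Applying stored gate lists and their inverses. -/

noncomputable section

/-! ## The program: applying stored gates -/

/-- The phase gate on the qubit in register `36`, or its inverse. -/
def phaseProg : Bool → Prog
  | false => .instr (.gateS (.dir 36))
  | true => .instr (.gateS (.dir 36)) ;; .instr (.gateS (.dir 36)) ;; .instr (.gateS (.dir 36))

/-- Apply the gate (or its inverse) whose code is in the cell to which register `34` points. -/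
def codeProg (inv : Bool) : Prog :=
  .instr (.natOp .mul (.dir 36) (.ind 34) (.dir 3)) ;; opProg .mod 37 36 4 ;;
  opProg .div 36 36 4 ;; opProg .add 38 36 3 ;;
  .ifNatLt (.dir 37) (.dir 3) (.instr (.gateH (.dir 36)))
    (.ifNatLt (.dir 37) (.dir 16) (phaseProg inv)
      (.ifNatLt (.dir 37) (.dir 17) (.instr (.gateCNOT (.dir 36) (.dir 38)))
        (.instr (.gateCNOT (.dir 38) (.dir 36)))))

/-- Apply the stored gate list. -/
def applyProg : Prog :=
  opProg .mul 34 5 3 ;; opProg .sub 35 10 5 ;;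
  .loop (.dir 35) (codeProg false ;; opProg .add 34 34 3)

/-- Apply the inverse of the stored gate list. -/
def unapplyProg : Prog :=
  opProg .mul 34 10 3 ;; opProg .sub 35 10 5 ;;
  .loop (.dir 35) (opProg .sub 34 34 3 ;; codeProg true)

section Apply

variable {n M : ℕ} {A : Fin M → ObsCircuit n} {ρ : Op n} {Q : Config n → Prop} {s s0 : Config n}
  {S R X τ : ℕ} {l : List ℕ}

/-- `s'` is `s` after the operator `G` was applied. -/
structure Evolves (G : Op n) (s s' : Config n) : Prop where
  natReg : s'.natReg = s.natReg
  qreg : s'.qreg = G * s.qreg * G.conjTranspose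

theorem Evolves.mul {G G' : Op n} {s s' s'' : Config n} (h : Evolves G s s')
    (h' : Evolves G' s' s'') : Evolves (G' * G) s s'' :=
  ⟨h'.natReg.trans h.natReg, by
    rw [h'.qreg, h.qreg, Matrix.conjTranspose_mul]; simp only [Matrix.mul_assoc]⟩

theorem wp_gateH {q : ℕ} (h : Scratch M S R X s0 s l τ)
    (hQ : ∀ s', Scratch M S R X s0 s' l (τ + 1) →
      Evolves (if h : s.natReg q < n then local1 ⟨s.natReg q, h⟩ hadamard else 1) s s' → Q s') :
    wp A ρ (.instr (.gateH (.dir q))) Q s := by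
  by_cases hq : s.natReg q < n
  · rw [dif_pos hq] at hQ
    refine (wp_pure (s' := (s.tick 1).applyOp (local1 ⟨s.natReg q, hq⟩ hadamard))
      (by exact congrArg PMF.pure (dif_pos hq))).2 ?_
    exact hQ _ ((h.tick 1).applyOp _) ⟨rfl, rfl⟩
  · rw [dif_neg hq] at hQ
    refine (wp_pure (s' := s.tick 1) (by exact congrArg PMF.pure (dif_neg hq))).2 ?_
    exact hQ _ (h.tick 1) ⟨rfl, by simp⟩

theorem wp_gateS {q : ℕ} (h : Scratch M S R X s0 s l τ)
    (hQ : ∀ s', Scratch M S R X s0 s' l (τ + 1) →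
      Evolves (if h : s.natReg q < n then local1 ⟨s.natReg q, h⟩ phaseGate else 1) s s' → Q s') :
    wp A ρ (.instr (.gateS (.dir q))) Q s := by
  by_cases hq : s.natReg q < n
  · rw [dif_pos hq] at hQ
    refine (wp_pure (s' := (s.tick 1).applyOp (local1 ⟨s.natReg q, hq⟩ phaseGate))
      (by exact congrArg PMF.pure (dif_pos hq))).2 ?_
    exact hQ _ ((h.tick 1).applyOp _) ⟨rfl, rfl⟩
  · rw [dif_neg hq] at hQ
    refine (wp_pure (s' := s.tick 1) (by exact congrArg PMF.pure (dif_neg hq))).2 ?_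
    exact hQ _ (h.tick 1) ⟨rfl, by simp⟩

theorem wp_gateCNOT {q r : ℕ} (h : Scratch M S R X s0 s l τ)
    (hQ : ∀ s', Scratch M S R X s0 s' l (τ + 1) →
      Evolves (if h : s.natReg q < n ∧ s.natReg r < n ∧ s.natReg q ≠ s.natReg r then
        local2 ⟨s.natReg q, h.1⟩ ⟨s.natReg r, h.2.1⟩ cnot else 1) s s' → Q s') :
    wp A ρ (.instr (.gateCNOT (.dir q) (.dir r))) Q s := by
  by_cases hq : s.natReg q < n ∧ s.natReg r < n ∧ s.natReg q ≠ s.natReg r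
  · rw [dif_pos hq] at hQ
    refine (wp_pure (s' := (s.tick 1).applyOp (local2 ⟨s.natReg q, hq.1⟩ ⟨s.natReg r, hq.2.1⟩ cnot))
      (by exact congrArg PMF.pure (dif_pos hq))).2 ?_
    exact hQ _ ((h.tick 1).applyOp _) ⟨rfl, rfl⟩
  · rw [dif_neg hq] at hQ
    refine (wp_pure (s' := s.tick 1) (by exact congrArg PMF.pure (dif_neg hq))).2 ?_
    exact hQ _ (h.tick 1) ⟨rfl, by simp⟩

theorem cnot_conjTranspose : cnot.conjTranspose = cnot := by
  ext ⟨x, y⟩ ⟨z, w⟩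
  cases x <;> cases y <;> cases z <;> cases w <;> simp [cnot, Matrix.conjTranspose_apply]

/-- The operator of a gate code or its inverse. -/
def signedOp (n : ℕ) (inv : Bool) (e : ℕ) : Op n :=
  if inv then (codeOp n e).conjTranspose else codeOp n e

/-- `S³ = S†`. The phase gate is the only kind for which the inverse needs different code: `H` and
`CNOT` are Hermitian. -/
theorem wp_phaseProg {inv : Bool} (h : Scratch M S R X s0 s l τ) {e : ℕ}
    (he : s.natReg 36 = e / 4) (h1 : ¬ e % 4 < 1) (h2 : e % 4 < 2)
    (hQ : ∀ s', Scratch M S R X s0 s' l (τ + 3) → Evolves (signedOp n inv e) s s' → Q s') :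
    wp A ρ (phaseProg inv) Q s := by
  have hop : codeOp n e = if h : e / 4 < n then local1 ⟨e / 4, h⟩ phaseGate else 1 := by
    rw [codeOp, if_neg h1, if_pos h2]
  rw [← he] at hop
  cases inv with
  | false =>
    refine wp_gateS h fun s' h' ev => hQ s' (h'.mono (by omega)) ?_
    rw [← hop] at ev
    exact ev
  | true =>
    refine wp_seq.2 (wp_gateS h fun s1 t1 v1 => wp_seq.2 (wp_gateS t1 fun s2 t2 v2 =>
      wp_gateS t2 fun s3 t3 v3 => hQ s3 t3 ?_))
    rw [v2.natReg] at v3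
    rw [v1.natReg] at v2 v3
    have hsig : signedOp n true e = (if h : s.natReg 36 < n then local1 ⟨s.natReg 36, h⟩ phaseGate
        else 1) * ((if h : s.natReg 36 < n then local1 ⟨s.natReg 36, h⟩ phaseGate else 1) *
          (if h : s.natReg 36 < n then local1 ⟨s.natReg 36, h⟩ phaseGate else 1)) := by
      simp only [signedOp, if_true]
      rw [hop]
      by_cases hq : s.natReg 36 < n
      · simp only [dif_pos hq]
        rw [local1_mul, local1_mul, local1_conjTranspose, ← phaseGate_cube, Matrix.mul_assoc]
      · simp only [dif_neg hq]; simp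
    rw [hsig]
    exact (v1.mul v2).mul v3

theorem wp_codeProg {inv : Bool} {e p : ℕ} (h : Scratch M S R X s0 s l τ)
    (h34 : s.natReg 34 = p) (hp : s.natReg p = e) (he : e ≤ X)
    (hQ : ∀ s', Scratch M S R X s0 s' l (τ + 10) → s'.natReg 34 = p →
      s'.natReg 35 = s.natReg 35 →
      s'.qreg = signedOp n inv e * s.qreg * (signedOp n inv e).conjTranspose → Q s') :
    wp A ρ (codeProg inv) Q s := by
  have c3 := h.consts.one
  have c4 := h.consts.four
  have hX := h.top
  have hb := h.base
  unfold codeProg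
  have hv : NatOp.mul.eval (s.nat (.ind 34)) (s.nat (.dir 3)) = e := by
    simp [NatOp.eval, h34, hp, c3]
  rw [wp_seq, wp_natOp, hv]
  have h1 : Scratch M S R X s0 ((s.tick 1).setNat (.dir 36) e) l (τ + 1) :=
    (h.tick 1).setNat (by omega) (by omega) he
  have e1 : ((s.tick 1).setNat (.dir 36) e).natReg = Function.update s.natReg 36 e := rfl
  have q1 : ((s.tick 1).setNat (.dir 36) e).qreg = s.qreg := rfl
  generalize (s.tick 1).setNat (.dir 36) e = s1 at h1 e1 q1
  refine wp_seq.2 (wp_scratch_op h1 (by omega) (by omega) ?_ fun s2 h2 e2 q2 => ?_)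
  · simp [NatOp.eval, e1, c4]; omega
  refine wp_seq.2 (wp_scratch_op h2 (by omega) (by omega) ?_ fun s3 h3 e3 q3 => ?_)
  · simp [NatOp.eval, e2, e1, c4]; omega
  refine wp_seq.2 (wp_scratch_op h3 (by omega) (by omega) ?_ fun s4 h4 e4 q4 => ?_)
  · simp [NatOp.eval, e3, e2, e1, c4, c3]; omega
  have f36 : s4.natReg 36 = e / 4 := by simp [NatOp.eval, e4, e3, e2, e1, c4]
  have f37 : s4.natReg 37 = e % 4 := by simp [NatOp.eval, e4, e3, e2, e1, c4]
  have f38 : s4.natReg 38 = e / 4 + 1 := by simp [NatOp.eval, e4, e3, e2, e1, c4, c3]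
  have f34 : s4.natReg 34 = p := by simp [e4, e3, e2, e1, h34]
  have f35 : s4.natReg 35 = s.natReg 35 := by simp [e4, e3, e2, e1]
  have q : s4.qreg = s.qreg := by rw [q4, q3, q2, q1]
  have fin : ∀ s5 τ', Scratch M S R X s0 s5 l τ' → τ' ≤ τ + 10 → Evolves (signedOp n inv e) s4 s5 →
      Q s5 := fun s5 τ' h5 hτ ev =>
    hQ s5 (h5.mono hτ) (by rw [ev.natReg, f34]) (by rw [ev.natReg, f35]) (by rw [ev.qreg, q])
  clear hQ
  rw [wp_ifNatLt]
  simp only [Config.nat_dir, f37, h4.consts.one]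
  refine ⟨fun hk => ?_, fun hk => ?_⟩
  · refine wp_gateH (h4.tick 1) fun s5 h5 ev => fin s5 _ h5 (by omega) ?_
    have hsig : signedOp n inv e = codeOp n e := by
      cases inv
      · rfl
      · simp only [signedOp, if_true, codeOp, if_pos hk]
        split_ifs
        · rw [local1_conjTranspose, hadamard_conjTranspose]
        · simp
    rw [hsig, codeOp, if_pos hk]
    simp only [Config.tick_natReg, f36] at ev
    exact ⟨ev.natReg, ev.qreg⟩
  rw [wp_ifNatLt]
  simp only [Config.nat_dir, Config.tick_natReg, f37, h4.consts.two]
  refine ⟨fun hk2 => ?_, fun hk2 => ?_⟩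
  · exact wp_phaseProg ((h4.tick 1).tick 1) f36 hk hk2 fun s5 h5 ev => fin s5 _ h5 (by omega)
      ⟨ev.natReg, ev.qreg⟩
  rw [wp_ifNatLt]
  simp only [Config.nat_dir, Config.tick_natReg, f37, h4.consts.three]
  have hsig : signedOp n inv e = codeOp n e := by
    cases inv
    · rfl
    · simp only [signedOp, if_true, codeOp, if_neg hk, if_neg hk2]
      split_ifs <;> simp [local2_conjTranspose, cnot_conjTranspose]
  refine ⟨fun hk3 => ?_, fun hk3 => ?_⟩
  · refine wp_gateCNOT (((h4.tick 1).tick 1).tick 1) fun s5 h5 ev => fin s5 _ h5 (by omega) ?_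
    rw [hsig, codeOp, if_neg hk, if_neg hk2, if_pos hk3]
    simp only [Config.tick_natReg, f36, f38] at ev
    refine ⟨ev.natReg, ev.qreg.trans ?_⟩
    by_cases hn : e / 4 + 1 < n
    · rw [dif_pos ⟨by omega, hn, by omega⟩, dif_pos hn]; rfl
    · rw [dif_neg (fun h => hn h.2.1), dif_neg hn]; rfl
  · refine wp_gateCNOT (((h4.tick 1).tick 1).tick 1) fun s5 h5 ev => fin s5 _ h5 (by omega) ?_
    rw [hsig, codeOp, if_neg hk, if_neg hk2, if_neg hk3]
    simp only [Config.tick_natReg, f36, f38] at ev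
    refine ⟨ev.natReg, ev.qreg.trans ?_⟩
    by_cases hn : e / 4 + 1 < n
    · rw [dif_pos ⟨hn, by omega, by omega⟩, dif_pos hn]; rfl
    · rw [dif_neg (fun h => hn h.1), dif_neg hn]; rfl

theorem wp_applyProg (h : Scratch M S R X s0 s l τ) (hS : 40 + l.length + 1 ≤ S)
    (hQ : ∀ s', Scratch M S R X s0 s' l (τ + 12 * l.length + 3) →
      s'.qreg = listOp n l * s.qreg * (listOp n l).conjTranspose → Q s') :
    wp A ρ applyProg Q s := by
  have hX := h.top
  have c10 := h.gates.1
  unfold applyProg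
  refine wp_seq.2 (wp_scratch_op h (by omega) (by omega) ?_ fun s1 h1 e1 q1 => ?_)
  · simp [NatOp.eval, h.consts.forty, h.consts.one]; omega
  refine wp_seq.2 (wp_scratch_op h1 (by omega) (by omega) ?_ fun s2 h2 e2 q2 => ?_)
  · simp [NatOp.eval, e1, c10, h.consts.forty]; omega
  have f35 : s2.natReg 35 = l.length := by
    simp [NatOp.eval, e2, e1, c10, h.consts.forty]
  have f34 : s2.natReg 34 = 40 := by
    simp [NatOp.eval, e2, e1, h.consts.one, h.consts.forty]
  refine wp_loop (fun k s' => Scratch M S R X s0 s' l (τ + 12 * k + 3) ∧ s'.natReg 34 = 40 + k ∧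
    s'.qreg = listOp n (l.take k) * s.qreg * (listOp n (l.take k)).conjTranspose) ?_ ?_ ?_
  · exact ⟨h2.tick 1, f34, by simp [listOp, q1, q2]⟩
  · rintro k s' hk ⟨h', e34, hq⟩
    have hk' : k < l.length := by rw [← f35]; exact hk
    refine wp_seq.2 (wp_codeProg (h'.tick 1) e34 (h'.gates.2 k hk')
      (h'.codes _ (List.getElem_mem hk')) fun s3 h3 g34 _ g => ?_)
    refine wp_scratch_op h3 (by omega) (by omega) ?_ fun s4 h4 e4 q4 => ?_
    · simp [NatOp.eval, g34, h3.consts.one]; omega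
    refine ⟨h4.mono (by omega), ?_, ?_⟩
    · simp [NatOp.eval, e4, g34, h3.consts.one]; omega
    · rw [q4, g, Config.tick_qreg, hq, ← List.take_append_getElem hk', listOp_append]
      simp only [signedOp, listOp, Matrix.conjTranspose_mul, Matrix.one_mul, Matrix.mul_assoc]
      rfl
  · rintro s' ⟨h', _, hq⟩
    rw [show s2.nat (.dir 35) = l.length from f35] at h' hq
    rw [List.take_length] at hq
    exact hQ s' h' hq

/-- The pointer runs down from the end of the list, so after `k` rounds the inverse of the last `k`
gates has been applied. -/
theorem wp_unapplyProg (h : Scratch M S R X s0 s l τ) (hS : 40 + l.length + 1 ≤ S)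
    (hQ : ∀ s', Scratch M S R X s0 s' l (τ + 12 * l.length + 3) →
      s'.qreg = (listOp n l).conjTranspose * s.qreg * listOp n l → Q s') :
    wp A ρ unapplyProg Q s := by
  have hX := h.top
  have c10 := h.gates.1
  unfold unapplyProg
  refine wp_seq.2 (wp_scratch_op h (by omega) (by omega) ?_ fun s1 h1 e1 q1 => ?_)
  · simp [NatOp.eval, c10, h.consts.one]; omega
  refine wp_seq.2 (wp_scratch_op h1 (by omega) (by omega) ?_ fun s2 h2 e2 q2 => ?_)
  · simp [NatOp.eval, e1, c10, h.consts.forty]; omega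
  have f35 : s2.natReg 35 = l.length := by
    simp [NatOp.eval, e2, e1, c10, h.consts.forty]
  have f34 : s2.natReg 34 = 40 + l.length := by
    simp [NatOp.eval, e2, e1, h.consts.one, c10]
  refine wp_loop (fun k s' => Scratch M S R X s0 s' l (τ + 12 * k + 3) ∧
    s'.natReg 34 = 40 + l.length - k ∧
    s'.qreg = (listOp n (l.drop (l.length - k))).conjTranspose * s.qreg *
      listOp n (l.drop (l.length - k))) ?_ ?_ ?_
  · exact ⟨h2.tick 1, f34, by simp [listOp, q1, q2]⟩
  · rintro k s' hk ⟨h', e34, hq⟩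
    have hk' : k < l.length := by rw [← f35]; exact hk
    have hlt : l.length - (k + 1) < l.length := by omega
    refine wp_seq.2 (wp_scratch_op (h'.tick 1) (by omega) (by omega) ?_ fun s3 h3 e3 q3 => ?_)
    · simp [NatOp.eval, e34, h'.consts.one]; omega
    refine wp_codeProg h3 (p := 40 + (l.length - (k + 1))) ?_ (h3.gates.2 _ hlt)
      (h'.codes _ (List.getElem_mem hlt)) fun s4 h4 g34 _ g => ?_
    · simp [NatOp.eval, e3, e34, h'.consts.one]; omega
    refine ⟨h4.mono (by omega), by omega, ?_⟩
    · rw [g, q3, Config.tick_qreg, hq, List.drop_eq_getElem_cons hlt,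
        show l.length - (k + 1) + 1 = l.length - k by omega]
      simp only [signedOp, listOp, Matrix.conjTranspose_mul, Matrix.mul_assoc, if_true,
        Matrix.conjTranspose_conjTranspose]
  · rintro s' ⟨h', _, hq⟩
    rw [show s2.nat (.dir 35) = l.length from f35] at h' hq
    rw [Nat.sub_self, List.drop_zero] at hq
    exact hQ s' h' hq

end Apply
end

/-! ### Measurement of all qubits, and re-preparation of the outcome. -/

noncomputable section

/-! ## Measuring qubit by qubit -/

section Collapse

variable {n : ℕ}

/-- Probability of outcome `c` for a measurement of qubit `q`. -/
def bitWeight (σ : Op n) (q : Fin n) (c : Bool) : ℝ :=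
  ∑ x : Bits n, if x q = c then (σ x x).re else 0

/-- State after the outcome `c` of a measurement of qubit `q`. -/
def collapse (σ : Op n) (q : Fin n) (c : Bool) : Op n :=
  Matrix.of fun x y => if x q = c ∧ y q = c then σ x y / ((bitWeight σ q c : ℝ) : ℂ) else 0

/-- Outcome of a measurement of qubit `q`. -/
def bitLaw (σ : Op n) (q : Fin n) : PMF Bool :=
  weightsPMF fun c => ENNReal.ofReal (bitWeight σ q c)

theorem bitWeight_nonneg {σ : Op n} (h : DiagProb σ) (q : Fin n) (c : Bool) :
    0 ≤ bitWeight σ q c :=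
  Finset.sum_nonneg fun x _ => by split_ifs; exacts [h.1 x, le_rfl]

theorem sum_bitWeight {σ : Op n} (h : DiagProb σ) (q : Fin n) : ∑ c, bitWeight σ q c = 1 := by
  unfold bitWeight
  rw [Finset.sum_comm, ← h.2]
  exact Finset.sum_congr rfl fun x _ => by rw [Finset.sum_ite_eq]; simp

theorem bitLaw_apply {σ : Op n} (h : DiagProb σ) (q : Fin n) (c : Bool) :
    bitLaw σ q c = ENNReal.ofReal (bitWeight σ q c) :=
  weightsPMF_apply (sum_ofReal_eq_one (bitWeight_nonneg h q) (sum_bitWeight h q)) c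

theorem collapse_diag (σ : Op n) (q : Fin n) (c : Bool) (b : Bits n) :
    (collapse σ q c b b).re = if b q = c then (σ b b).re / bitWeight σ q c else 0 := by
  simp only [collapse, Matrix.of_apply, and_self]
  split_ifs
  · rw [Complex.div_ofReal_re]
  · rfl

/-- Later computational-basis measurements see only the diagonal, so `DiagProb` can replace
`IsState` here, and no positivity of the collapsed operator is needed. -/
theorem DiagProb.collapse {σ : Op n} (h : DiagProb σ) {q : Fin n} {c : Bool}
    (hc : bitWeight σ q c ≠ 0) : DiagProb (collapse σ q c) := by
  refine ⟨fun b => ?_, ?_⟩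
  · rw [collapse_diag]
    split_ifs
    exacts [div_nonneg (h.1 b) (bitWeight_nonneg h q c), le_rfl]
  · simp only [collapse_diag]
    rw [← div_self hc]
    conv_rhs => rw [bitWeight, Finset.sum_div]
    exact Finset.sum_congr rfl fun b _ => by split_ifs <;> simp [bitWeight]

/-- The chain rule: only `c = b q` contributes, with conditional weight `σ b b` over the weight of
the bit. If that weight is zero the collapsed operator is meaningless, but then both sides vanish.
-/
theorem born_eq_bind_collapse {σ : Op n} (h : DiagProb σ) (q : Fin n) :
    born σ = (bitLaw σ q).bind fun c => born (collapse σ q c) := by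
  ext b
  rw [PMF.bind_apply, tsum_fintype, born_apply h, Finset.sum_eq_single (b q)]
  · rw [bitLaw_apply h]
    by_cases hc : bitWeight σ q (b q) = 0
    · have : (σ b b).re ≤ bitWeight σ q (b q) := by
        have := Finset.single_le_sum (f := fun x : Bits n => if x q = b q then (σ x x).re else 0)
          (fun x _ => by
            show 0 ≤ if x q = b q then (σ x x).re else 0
            split_ifs; exacts [h.1 x, le_rfl]) (Finset.mem_univ b)
        rw [bitWeight]
        simpa using this
      rw [hc, ENNReal.ofReal_zero, zero_mul, ENNReal.ofReal_eq_zero, ← hc]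
      exact this
    · rw [born_apply (h.collapse hc), collapse_diag, if_pos rfl,
        ← ENNReal.ofReal_mul (bitWeight_nonneg h q _), mul_div_cancel₀ _ hc]
  · intro c _ hcb
    by_cases hc : bitWeight σ q c = 0
    · rw [bitLaw_apply h, hc, ENNReal.ofReal_zero, zero_mul]
    · rw [born_apply (h.collapse hc), collapse_diag, if_neg (Ne.symm hcb), ENNReal.ofReal_zero,
        mul_zero]
  · simp

end Collapse

/-- Measure qubit number `32`, whose weight is in register `31`, and add to the outcome in
register `30`. -/
def measureStep : Prog :=
  .instr (.measure (.dir 33) (.dir 32)) ;; opProg .mul 33 33 31 ;; opProg .add 30 30 33 ;;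
  opProg .add 31 31 31 ;; opProg .add 32 32 3

/-- Measure all qubits, with the outcome in register `30`. -/
def measureProg : Prog :=
  .instr (.natConst (.dir 30) 0) ;; .instr (.natConst (.dir 31) 1) ;;
  .instr (.natConst (.dir 32) 0) ;; .loop (.dir 0) measureStep

section Measure

variable {n M : ℕ} {A : Fin M → ObsCircuit n} {ρ : Op n} {Q : Config n → Prop} {s s0 : Config n}
  {S R X τ : ℕ} {l : List ℕ}

/-- The binary digits of `a` form the bit string `b`. -/
def IsCode (a : ℕ) (b : Bits n) : Prop := a < 2 ^ n ∧ ∀ i : Fin n, a.testBit i = b i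

theorem coupled_measure {t q : ℕ} (h : s.natReg q < n) :
    Coupled (bitLaw s.qreg ⟨s.natReg q, h⟩)
      ((Prog.instr (.measure (.dir t) (.dir q))).exec A ρ s)
      fun c s' => s' = { (s.tick 1).setNat (.dir t) c.toNat with
        qreg := collapse s.qreg ⟨s.natReg q, h⟩ c } := by
  have e : (Prog.instr (.measure (.dir t) (.dir q))).exec A ρ s =
      (s.tick 1).measure (.dir t) ⟨s.natReg q, h⟩ := dif_pos h
  rw [e]
  exact ((Coupled.refl _).mono fun v w _ h => by rw [h]; rfl).map_right

theorem testBit_add_mul_two_pow {a i : ℕ} (ha : a < 2 ^ i) (c : Bool) (j : ℕ) (hj : j ≤ i) :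
    (a + c.toNat * 2 ^ i).testBit j = if j = i then c else a.testBit j := by
  rw [add_comm, mul_comm, Nat.testBit_two_pow_mul_add _ ha]
  by_cases h : j < i
  · rw [if_pos h, if_neg h.ne]
  · obtain rfl : j = i := by omega
    cases c <;> simp

/-- The string is drawn from the Born law of the current state. The invariant says that all basis
states of non-zero weight share the bits recorded so far, so after the last qubit the drawn string
is the recorded number. -/
theorem coupled_measureSteps (hX : 2 ^ n ≤ X) {k : ℕ} :
    ∀ (i : ℕ) (s : Config n) (τ : ℕ), i + k = n → Scratch M S R X s0 s l τ → DiagProb s.qreg →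
      s.natReg 31 = 2 ^ i → s.natReg 32 = i → s.natReg 30 < 2 ^ i →
      (∀ b : Bits n, (s.qreg b b).re ≠ 0 → ∀ j : Fin n, j.val < i →
        (s.natReg 30).testBit j = b j) →
      Coupled (born s.qreg) (repeatPMF (fun s' => measureStep.exec A ρ (s'.tick 1)) k s)
        fun b s' => Scratch M S R X s0 s' l (τ + 6 * k) ∧ IsCode (s'.natReg 30) b := by
  induction k with
  | zero =>
    intro i s τ hi h hq _ _ h30 hb
    obtain rfl : i = n := by omega
    refine Coupled.pure_right fun b hb' => ⟨h, h30, fun j => hb b ?_ j j.2⟩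
    rw [PMF.mem_support_iff, born_apply hq] at hb'
    intro h0
    rw [h0] at hb'
    simp at hb'
  | succ k ih =>
    intro i s τ hi h hq h31 h32 h30 hb
    have hin : i < n := by omega
    have htop := h.top
    have hbase := h.base
    have h2 : 2 ^ (i + 1) ≤ 2 ^ n := Nat.pow_le_pow_right (by norm_num) (by omega)
    have h2' : 2 ^ (i + 1) = 2 ^ i + 2 ^ i := by ring
    have hnX : n ≤ X := (Nat.lt_two_pow_self).le.trans hX
    have step : Coupled (bitLaw s.qreg ⟨i, hin⟩) (measureStep.exec A ρ (s.tick 1)) fun c s' =>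
        Scratch M S R X s0 s' l (τ + 6) ∧ s'.qreg = collapse s.qreg ⟨i, hin⟩ c ∧
        s'.natReg 31 = 2 ^ (i + 1) ∧ s'.natReg 32 = i + 1 ∧
        s'.natReg 30 = s.natReg 30 + c.toNat * 2 ^ i := by
      have hcm := coupled_measure (A := A) (ρ := ρ) (s := s.tick 1) (t := 33) (q := 32)
        (by rw [Config.tick_natReg, h32]; exact hin)
      simp only [Config.tick_natReg, h32, Config.tick_qreg] at hcm
      refine hcm.seq_left ?_
      rintro c s1 _ rfl
      have hc1 : c.toNat ≤ 1 := by cases c <;> simp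
      have h1 : Scratch M S R X s0 { ((s.tick 1).tick 1).setNat (.dir 33) c.toNat with
          qreg := collapse s.qreg ⟨i, hin⟩ c } l (τ + 2) :=
        (((h.tick 1).tick 1).setNat (by omega) (by omega) (by omega)).setQreg _
      have e1 : (Config.natReg { ((s.tick 1).tick 1).setNat (.dir 33) c.toNat with
          qreg := collapse s.qreg ⟨i, hin⟩ c }) = Function.update s.natReg 33 c.toNat := rfl
      have q1 : (Config.qreg { ((s.tick 1).tick 1).setNat (.dir 33) c.toNat with
          qreg := collapse s.qreg ⟨i, hin⟩ c }) = collapse s.qreg ⟨i, hin⟩ c := rfl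
      generalize ({ ((s.tick 1).tick 1).setNat (.dir 33) c.toNat with
          qreg := collapse s.qreg ⟨i, hin⟩ c } : Config n) = s1 at h1 e1 q1
      have hc2 : c.toNat * 2 ^ i ≤ 2 ^ i := by
        calc c.toNat * 2 ^ i ≤ 1 * 2 ^ i := Nat.mul_le_mul_right _ hc1
          _ = 2 ^ i := one_mul _
      refine wp_seq.2 (wp_scratch_op h1 (by omega) (by omega) ?_ fun s2 t2 e2 q2 => ?_)
      · simp [NatOp.eval, e1, h31]; omega
      refine wp_seq.2 (wp_scratch_op t2 (by omega) (by omega) ?_ fun s3 t3 e3 q3 => ?_)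
      · simp [NatOp.eval, e2, e1, h31]; omega
      refine wp_seq.2 (wp_scratch_op t3 (by omega) (by omega) ?_ fun s4 t4 e4 q4 => ?_)
      · simp [NatOp.eval, e3, e2, e1, h31]; omega
      refine wp_scratch_op t4 (by omega) (by omega) ?_ fun s5 t5 e5 q5 => ?_
      · simp [NatOp.eval, e4, e3, e2, e1, h32, h.consts.one]; omega
      refine ⟨t5.mono (by omega), by rw [q5, q4, q3, q2, q1], ?_, ?_, ?_⟩
      · simp [NatOp.eval, e5, e4, e3, e2, e1, h31]; omega
      · simp [NatOp.eval, e5, e4, e3, e2, e1, h32, h.consts.one]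
      · simp [NatOp.eval, e5, e4, e3, e2, e1, h31]
    rw [born_eq_bind_collapse hq ⟨i, hin⟩]
    refine step.bind ?_
    rintro c s' hcs _ ⟨h', q', f31, f32, f30⟩
    rw [PMF.mem_support_iff, bitLaw_apply hq] at hcs
    have hc : bitWeight s.qreg ⟨i, hin⟩ c ≠ 0 := by
      intro h0; rw [h0] at hcs; simp at hcs
    rw [← q']
    refine (ih (i + 1) s' _ (by omega) h' (by rw [q']; exact hq.collapse hc) f31 f32 ?_ ?_).mono ?_
    · rw [f30]
      cases c <;> simp <;> omega
    · intro b hb' j hj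
      rw [q', collapse_diag] at hb'
      have hbc : b ⟨i, hin⟩ = c := by
        by_contra hne; rw [if_neg hne] at hb'; exact hb' rfl
      rw [if_pos hbc] at hb'
      rw [f30, testBit_add_mul_two_pow h30 c j (by omega)]
      split_ifs with hji
      · rw [← hbc]; congr 1; exact Fin.ext hji.symm
      · exact hb b (fun h0 => hb' (by rw [h0, zero_div])) j (by omega)
    · rintro b s'' _ ⟨h'', hcode⟩
      exact ⟨h''.mono (by omega), hcode⟩

theorem coupled_measureProg (h : Scratch M S R X s0 s l τ) (hX : 2 ^ n ≤ X)
    (hq : DiagProb s.qreg) :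
    Coupled (born s.qreg) (measureProg.exec A ρ s) fun b s' =>
      Scratch M S R X s0 s' l (τ + 6 * n + 4) ∧ IsCode (s'.natReg 30) b := by
  have htop := h.top
  have hbase := h.base
  unfold measureProg
  refine Coupled.seq_right (wp_scratch_const h (by omega) (by omega) (by omega)
    fun s1 h1 e1 q1 => ?_)
  refine Coupled.seq_right (wp_scratch_const h1 (by omega) (by omega) (by omega)
    fun s2 h2 e2 q2 => ?_)
  refine Coupled.seq_right (wp_scratch_const h2 (by omega) (by omega) (by omega)
    fun s3 h3 e3 q3 => ?_)
  rw [Prog.exec, show s3.nat (.dir 0) = n from h3.consts.num]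
  have q : (s3.tick 1).qreg = s.qreg := by rw [Config.tick_qreg, q3, q2, q1]
  rw [← q]
  refine (coupled_measureSteps hX 0 (s3.tick 1) _ (by omega) (h3.tick 1) (by rw [q]; exact hq)
    ?_ ?_ ?_ ?_).mono ?_
  · simp [e3, e2]
  · simp [e3]
  · simp [e3, e2, e1]
  · intro b _ j hj; omega
  · rintro b s' _ ⟨h', hc⟩
    exact ⟨h'.mono (by omega), hc⟩

end Measure

/-! ## Preparing basis states -/

/-- Gates that flip the qubits from `i` on at which the binary number `a` has a digit `1`. -/
def flipCodes : (k i a : ℕ) → List ℕ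
  | 0, _, _ => []
  | k + 1, i, a =>
    (if a % 2 < 1 then [] else [4 * i, 4 * i + 1, 4 * i + 1, 4 * i]) ++ flipCodes k (i + 1) (a / 2)

section Flip

variable {n : ℕ}

/-- `H S S H = H Z H = X`, so a bit flip is available in terms of gate codes. -/
theorem listOp_flip (q : Fin n) :
    listOp n [4 * q.val, 4 * q.val + 1, 4 * q.val + 1, 4 * q.val] =
      local1 q (PauliLetter.toMatrix 1) := by
  have h0 : codeOp n (4 * q.val) = local1 q hadamard := by
    have e : 4 * q.val / 4 = q.val := by omega
    rw [codeOp, if_pos (by omega), dif_pos (by omega)]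
    congr 1; exact Fin.ext e
  have h1 : codeOp n (4 * q.val + 1) = local1 q phaseGate := by
    have e : (4 * q.val + 1) / 4 = q.val := by omega
    rw [codeOp, if_neg (by omega), if_pos (by omega), dif_pos (by omega)]
    congr 1; exact Fin.ext e
  have h2 : hadamard * phaseGate * phaseGate * hadamard = PauliLetter.toMatrix 1 := by
    have h := sqrt_two_inv_mul_self
    have h' : ((Real.sqrt 2 : ℝ) : ℂ)⁻¹ * Complex.I * Complex.I * ((Real.sqrt 2 : ℝ) : ℂ)⁻¹ =
        -(1 / 2) := by
      linear_combination Complex.I * Complex.I * h + (1 / 2) * Complex.I_mul_I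
    ext x y
    cases x <;> cases y <;>
      (simp [hadamard, phaseGate, PauliLetter.toMatrix, Matrix.mul_apply, h, h']; try norm_num)
  simp only [listOp, h0, h1, Matrix.one_mul]
  rw [local1_mul, local1_mul, local1_mul, h2]

theorem conj_flip (q : Fin n) (b : Bits n) :
    (local1 q (PauliLetter.toMatrix 1)).conjTranspose * basisProj b *
      local1 q (PauliLetter.toMatrix 1) = basisProj (Function.update b q (!b q)) := by
  have key : ∀ x y : Bits n, local1 q (PauliLetter.toMatrix 1) x y =
      if y = Function.update x q (!x q) then 1 else 0 := by
    intro x y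
    simp only [local1, Matrix.of_apply, PauliLetter.toMatrix]
    by_cases h : y = Function.update x q (!x q)
    · subst h
      rw [if_pos (fun i hi => by rw [Function.update_of_ne hi]), if_pos rfl]
      simp
    · rw [if_neg h]
      split_ifs with h1 h2
      · rfl
      · refine absurd (funext fun i => ?_) h
        by_cases hi : i = q
        · subst hi
          rw [Function.update_self]
          cases hx : x i <;> cases hy : y i <;> simp_all
        · rw [Function.update_of_ne hi, h1 i hi]
      · rfl
  have inv : ∀ x : Bits n, Function.update (Function.update x q (!x q)) q
      (!(Function.update x q (!x q)) q) = x := by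
    intro x; simp
  rw [local1_conjTranspose, PauliLetter.toMatrix_conjTranspose]
  ext x y
  rw [Matrix.mul_apply, Finset.sum_eq_single b]
  · rw [Matrix.mul_apply, Finset.sum_eq_single b]
    · rw [key, key]
      simp only [basisProj, Matrix.of_apply, and_self, if_true, mul_one]
      by_cases hy : y = Function.update b q (!b q)
      · by_cases hx : x = Function.update b q (!b q)
        · subst hy; subst hx; simp
        · have hb : ¬ b = Function.update x q (!x q) := fun h => hx (by rw [h, inv])
          rw [if_neg hb, zero_mul, if_neg (fun h => hx h.1)]
      · rw [if_neg hy, mul_zero, if_neg (fun h => hy h.2)]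
    · intro z _ hz; simp [basisProj, hz]
    · simp
  · intro z _ hz
    rw [Matrix.mul_apply]
    simp [basisProj, hz]
  · simp

theorem listOp_flipCodes (k i a : ℕ) (hk : i + k ≤ n) (b : Bits n) :
    (listOp n (flipCodes k i a)).conjTranspose * basisProj b * listOp n (flipCodes k i a) =
      basisProj fun j => if i ≤ j.val ∧ j.val < i + k then xor (b j) (a.testBit (j - i))
        else b j := by
  induction k generalizing i a b with
  | zero =>
    simp only [flipCodes, listOp]
    rw [Matrix.conjTranspose_one, Matrix.one_mul, Matrix.mul_one]
    congr 1; funext j; rw [if_neg (by omega)]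
  | succ k ih =>
    rw [flipCodes, listOp_append, Matrix.conjTranspose_mul]
    have assoc : ∀ U V P : Op n, V.conjTranspose * U.conjTranspose * P * (U * V) =
        V.conjTranspose * (U.conjTranspose * P * U) * V := fun U V P => by
      simp only [Matrix.mul_assoc]
    rw [assoc, ih (i + 1) (a / 2) (by omega)]
    have tb : ∀ j, i + 1 ≤ j → (a / 2).testBit (j - (i + 1)) = a.testBit (j - i) := by
      intro j hj
      rw [Nat.testBit_div_two]; congr 1; omega
    have hi : i < n := by omega
    split_ifs with ha
    · simp only [listOp]
      rw [Matrix.conjTranspose_one, Matrix.one_mul, Matrix.mul_one]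
      congr 1; funext j
      by_cases hj : j.val = i
      · have : a.testBit 0 = false := by rw [Nat.testBit_zero]; simp; omega
        rw [if_neg (by omega), if_pos (by omega), hj, Nat.sub_self, this, Bool.xor_false]
      · by_cases h1 : i + 1 ≤ j.val ∧ j.val < i + 1 + k
        · rw [if_pos h1, if_pos (by omega), tb _ h1.1]
        · rw [if_neg h1, if_neg (by omega)]
    · have := listOp_flip (n := n) ⟨i, hi⟩
      simp only at this
      rw [this, conj_flip]
      congr 1; funext j
      by_cases hj : j = ⟨i, hi⟩
      · subst hj
        have : a.testBit 0 = true := by rw [Nat.testBit_zero]; simp; omega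
        rw [Function.update_self, if_neg (by simp), if_pos (by simp)]
        simp only [Nat.sub_self, this, Bool.xor_true]
      · have hj' : j.val ≠ i := fun h => hj (Fin.ext h)
        rw [Function.update_of_ne hj]
        by_cases h1 : i + 1 ≤ j.val ∧ j.val < i + 1 + k
        · rw [if_pos h1, if_pos (by omega), tb _ h1.1]
        · rw [if_neg h1, if_neg (by omega)]

/-- The measured outcome is absorbed into the gate list: the inverse of the longer list first takes
`|0…0⟩` to `|b⟩` and then undoes the sweeps. All shots can therefore use the same preparation code.
-/
theorem listOp_append_flipCodes {a : ℕ} {b : Bits n} (h : IsCode a b) (l : List ℕ) :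
    (listOp n (l ++ flipCodes n 0 a)).conjTranspose * basisProj (fun _ => false) *
      listOp n (l ++ flipCodes n 0 a) =
    (listOp n l).conjTranspose * basisProj b * listOp n l := by
  have := listOp_flipCodes n 0 a (by omega) (fun _ : Fin n => false)
  rw [listOp_append, Matrix.conjTranspose_mul]
  have assoc : ∀ U V P : Op n, V.conjTranspose * U.conjTranspose * P * (U * V) =
      V.conjTranspose * (U.conjTranspose * P * U) * V := fun U V P => by
    simp only [Matrix.mul_assoc]
  rw [assoc, this]
  congr 3
  funext j
  rw [if_pos (by have := j.2; omega)]
  simp [h.2 j]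

end Flip

/-- Append the gates of `flipCodes` for the number in register `30`. -/
def flipProg : Prog :=
  .instr (.natConst (.dir 32) 0) ;;
  .loop (.dir 0) (opProg .mod 33 30 16 ;; opProg .div 30 30 16 ;;
    .ifNatLt (.dir 33) (.dir 3) nopProg
      (opProg .mul 23 4 32 ;; opProg .add 24 23 3 ;; pushProg 23 ;; pushProg 24 ;; pushProg 24 ;;
        pushProg 23) ;;
    opProg .add 32 32 3)

/-- Apply the circuit of the observable with the number in register `12`. -/
def circuitProg : Prog :=
  .instr (.obsLength (.dir 34) (.dir 12)) ;; .instr (.natConst (.dir 35) 0) ;;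
  .loop (.dir 34) (.instr (.obsGate (.dir 12) (.dir 35)) ;; opProg .add 35 35 3)

section FlipProg

variable {n M : ℕ} {A : Fin M → ObsCircuit n} {ρ : Op n} {Q : Config n → Prop} {s s0 : Config n}
  {S R X τ : ℕ} {l : List ℕ}

/-- As for sweeps, the codes written followed by the codes due are constant; each round consumes one
binary digit of the outcome. -/
theorem wp_flipProg (h : Scratch M S R X s0 s l τ) (hS : 40 + l.length + 4 * n ≤ S)
    (hnX : 4 * n + 3 ≤ X) {a : ℕ} (ha : s.natReg 30 = a) (haX : a ≤ X)
    (hQ : ∀ s', Scratch M S R X s0 s' (l ++ flipCodes n 0 a) (τ + 15 * n + 2) →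
      (l ++ flipCodes n 0 a).length ≤ l.length + 4 * n → Q s') : wp A ρ flipProg Q s := by
  have htop := h.top
  have hbase := h.base
  unfold flipProg
  refine wp_seq.2 (wp_scratch_const h (by omega) (by omega) (by omega) fun s1 h1 e1 _ => ?_)
  have c0 : s1.nat (.dir 0) = n := h1.consts.num
  refine wp_loop (fun k s' => ∃ l' a', Scratch M S R X s0 s' l' (τ + 15 * k + 2) ∧
    l' ++ flipCodes (n - k) k a' = l ++ flipCodes n 0 a ∧ l'.length ≤ l.length + 4 * k ∧
    s'.natReg 30 = a' ∧ a' ≤ a ∧ s'.natReg 32 = k) ?_ ?_ ?_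
  · exact ⟨l, a, h1.tick 1, rfl, by omega, by simp [e1, ha], le_rfl, by simp [e1]⟩
  · rintro k s' hk ⟨l', a', h', hl, hlen, f30, ha', f32⟩
    rw [c0] at hk
    have c3 := h'.consts.one
    have c4 := h'.consts.four
    have c16 := h'.consts.two
    refine wp_seq.2 (wp_scratch_op (h'.tick 1) (by omega) (by omega) ?_ fun s2 h2 e2 _ => ?_)
    · simp [NatOp.eval, f30, c16]; omega
    refine wp_seq.2 (wp_scratch_op h2 (by omega) (by omega) ?_ fun s3 h3 e3 _ => ?_)
    · simp [NatOp.eval, e2, f30, c16]; omega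
    have g30 : s3.natReg 30 = a' / 2 := by simp [NatOp.eval, e3, e2, f30, c16]
    have g33 : s3.natReg 33 = a' % 2 := by simp [NatOp.eval, e3, e2, f30, c16]
    have g32 : s3.natReg 32 = k := by simp [e3, e2, f32]
    have fin : ∀ s4 l4, Scratch M S R X s0 s4 l4 (τ + 15 * k + 2 + 14) →
        l4 ++ flipCodes (n - (k + 1)) (k + 1) (a' / 2) = l ++ flipCodes n 0 a →
        l4.length ≤ l'.length + 4 → s4.natReg 30 = a' / 2 → s4.natReg 32 = k →
        wp A ρ (opProg .add 32 32 3) (fun s' => ∃ l' a',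
          Scratch M S R X s0 s' l' (τ + 15 * (k + 1) + 2) ∧
          l' ++ flipCodes (n - (k + 1)) (k + 1) a' = l ++ flipCodes n 0 a ∧
          l'.length ≤ l.length + 4 * (k + 1) ∧
          s'.natReg 30 = a' ∧ a' ≤ a ∧ s'.natReg 32 = k + 1) s4 := by
      intro s4 l4 h4 hl4 hlen4 i30 i32
      refine wp_scratch_op h4 (by omega) (by omega) ?_ fun s5 h5 e5 _ => ?_
      · simp [NatOp.eval, i32, h4.consts.one]; omega
      · exact ⟨l4, a' / 2, h5.mono (by omega), hl4, by omega, by simp [e5, i30], by omega,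
          by simp [NatOp.eval, e5, i32, h4.consts.one]⟩
    have hflip : flipCodes (n - k) k a' =
        (if a' % 2 < 1 then [] else [4 * k, 4 * k + 1, 4 * k + 1, 4 * k]) ++
          flipCodes (n - (k + 1)) (k + 1) (a' / 2) := by
      rw [show n - k = n - (k + 1) + 1 by omega, flipCodes]
    rw [hflip] at hl
    refine wp_seq.2 (wp_ifNatLt.2 ⟨fun hlt => ?_, fun hlt => ?_⟩)
    · simp only [Config.nat_dir, g33, h3.consts.one] at hlt
      rw [if_pos hlt, List.nil_append] at hl
      refine wp_nopProg.2 (fin _ l' ?_ hl (by omega) (by simp [g30]) (by simp [g32]))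
      exact (((h3.tick 1).tick 1).setNat (by omega) (by omega) (by omega)).mono (by omega)
    · simp only [Config.nat_dir, g33, h3.consts.one] at hlt
      rw [if_neg hlt] at hl
      have d3 := h3.consts.one
      have d4 := h3.consts.four
      refine wp_seq.2 (wp_scratch_op (h3.tick 1) (by omega) (by omega) ?_ fun s4 h4 e4 _ => ?_)
      · simp [NatOp.eval, g32, d4]; omega
      refine wp_seq.2 (wp_scratch_op h4 (by omega) (by omega) ?_ fun s5 h5 e5 _ => ?_)
      · simp [NatOp.eval, e4, g32, d4, d3]; omega
      have i23 : s5.natReg 23 = 4 * k := by simp [NatOp.eval, e5, e4, g32, d4]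
      have i24 : s5.natReg 24 = 4 * k + 1 := by simp [NatOp.eval, e5, e4, g32, d4, d3]
      have i30 : s5.natReg 30 = a' / 2 := by simp [e5, e4, g30]
      have i32 : s5.natReg 32 = k := by simp [e5, e4, g32]
      refine wp_seq.2 (wp_scratch_push h5 (by omega) (by omega) fun s6 h6 e6 _ => ?_)
      have j23 := e6 23 (by omega) (by omega)
      have j24 := e6 24 (by omega) (by omega)
      refine wp_seq.2 (wp_scratch_push h6 (by simp; omega) (by omega) fun s7 h7 e7 _ => ?_)
      have k23 := e7 23 (by omega) (by omega)
      have k24 := e7 24 (by omega) (by omega)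
      refine wp_seq.2 (wp_scratch_push h7 (by simp; omega) (by omega) fun s8 h8 e8 _ => ?_)
      have l23 := e8 23 (by omega) (by omega)
      refine wp_scratch_push h8 (by simp; omega) (by omega) fun s9 h9 e9 _ => ?_
      rw [l23, k24, k23, j24, j23, i23, i24] at h9
      refine fin s9 _ (h9.mono (by omega)) ?_ (by simp) ?_ ?_
      · rw [← hl]; simp
      · rw [e9 30 (by omega) (by omega), e8 30 (by omega) (by omega), e7 30 (by omega) (by omega),
          e6 30 (by omega) (by omega), i30]
      · rw [e9 32 (by omega) (by omega), e8 32 (by omega) (by omega), e7 32 (by omega) (by omega),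
          e6 32 (by omega) (by omega), i32]
  · rintro s' ⟨l', a', h', hl, hlen, _⟩
    rw [c0] at h' hl hlen
    rw [Nat.sub_self, flipCodes, List.append_nil] at hl
    subst hl
    exact hQ s' h' hlen

theorem circuitOp_append (gs gs' : List (Gate n)) :
    circuitOp (gs ++ gs') = circuitOp gs' * circuitOp gs := by
  induction gs with
  | nil => simp [circuitOp]
  | cons g gs ih => simp [circuitOp, ih, Matrix.mul_assoc]

theorem wp_circuitProg {F : ℕ} (h : Scratch M S R X s0 s l τ) {j : Fin M}
    (hj : s.natReg 12 = j.val) (hF : (A j).gates.length ≤ F) (hFX : F ≤ X)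
    (hQ : ∀ s', Scratch M S R X s0 s' l (τ + 3 * F + 3) →
      s'.qreg = circuitOp (A j).gates * s.qreg * (circuitOp (A j).gates).conjTranspose → Q s') :
    wp A ρ circuitProg Q s := by
  have htop := h.top
  have hbase := h.base
  unfold circuitProg
  have hjM : s.nat (.dir 12) < M := by rw [Config.nat_dir, hj]; exact j.2
  have hjeq : ∀ h', (⟨s.nat (.dir 12), h'⟩ : Fin M) = j := fun h' => Fin.ext hj
  rw [wp_seq, wp_obsLength hjM]
  rw [hjeq]
  have h1 := (h.tick 1).setNat (a := 34) (v := (A j).gates.length) (by omega) (by omega) (by omega)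
  have e1 : ((s.tick 1).setNat (.dir 34) (A j).gates.length).natReg =
    Function.update s.natReg 34 (A j).gates.length := rfl
  have q1 : ((s.tick 1).setNat (.dir 34) (A j).gates.length).qreg = s.qreg := rfl
  generalize (s.tick 1).setNat (.dir 34) (A j).gates.length = s1 at h1 e1 q1
  refine wp_seq.2 (wp_scratch_const h1 (by omega) (by omega) (by omega) fun s2 h2 e2 q2 => ?_)
  have f34 : s2.nat (.dir 34) = (A j).gates.length := by simp [e2, e1]
  refine wp_loop (fun k s' => Scratch M S R X s0 s' l (τ + 3 * k + 3) ∧ s'.natReg 35 = k ∧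
    s'.natReg 12 = j.val ∧ s'.qreg = circuitOp ((A j).gates.take k) * s.qreg *
      (circuitOp ((A j).gates.take k)).conjTranspose) ?_ ?_ ?_
  · exact ⟨h2.tick 1, by simp [e2], by simp [e2, e1, hj], by simp [circuitOp, q2, q1]⟩
  · rintro k s' hk ⟨h', g35, g12, gq⟩
    rw [f34] at hk
    have hjM' : (s'.tick 1).nat (.dir 12) < M := by
      rw [Config.nat_dir, Config.tick_natReg, g12]; exact j.2
    have hjeq' : (⟨(s'.tick 1).nat (.dir 12), hjM'⟩ : Fin M) = j := Fin.ext g12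
    have hkl : (s'.tick 1).nat (.dir 35) < (A ⟨(s'.tick 1).nat (.dir 12), hjM'⟩).gates.length := by
      rw [hjeq', Config.nat_dir, Config.tick_natReg, g35]; exact hk
    rw [wp_seq, wp_obsGate hjM' hkl]
    have hget : (A ⟨(s'.tick 1).nat (.dir 12), hjM'⟩).gates[(s'.tick 1).nat (.dir 35)]'hkl =
        (A j).gates[k] := by
      have : ∀ (i : Fin M) (m : ℕ) (hm : m < (A i).gates.length), i = j → m = k →
          (A i).gates[m] = (A j).gates[k] := by
        rintro i m hm rfl rfl; rfl
      exact this _ _ hkl hjeq' g35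
    rw [hget]
    refine wp_scratch_op (((h'.tick 1).tick 1).applyOp _) (by omega) (by omega) ?_
      fun s3 h3 e3 q3 => ?_
    · simp [NatOp.eval, g35, h'.consts.one]; omega
    refine ⟨h3.mono (by omega), ?_, ?_, ?_⟩
    · simp [NatOp.eval, e3, g35, h'.consts.one]
    · simp [e3, g12]
    · rw [q3, Config.applyOp_qreg, Config.tick_qreg, Config.tick_qreg, gq,
        ← List.take_append_getElem hk, circuitOp_append]
      simp only [circuitOp, Matrix.conjTranspose_mul, Matrix.one_mul, Matrix.mul_assoc]
  · rintro s' ⟨h', _, _, gq⟩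
    rw [f34] at h' gq
    rw [List.take_length] at gq
    exact hQ s' (h'.mono (by omega)) gq

end FlipProg
end

/-! ### From single shots to one copy of the state. -/

noncomputable section

/-! ## Computations with real registers -/

section Work

variable {n M : ℕ} {A : Fin M → ObsCircuit n} {ρ : Op n} {Q : Config n → Prop}
  {s s0 s1 : Config n} {S R X τ c : ℕ} {l : List ℕ} {W V U : ℕ → Prop}

/-- The state `s` of a computation that started in `s0`, used `c` copies and `τ` units of time, and
wrote at most natural-number registers below `20` in `W`, real registers in `V` and outputs in `U`.
The gate list is now `l`. -/
structure Work (M S R X : ℕ) (W V U : ℕ → Prop) (s0 s : Config n) (l : List ℕ) (c τ : ℕ) :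
    Prop where
  nat : ∀ a, a < 20 → a ≠ 10 → ¬ W a → s.natReg a = s0.natReg a
  real : ∀ a, ¬ V a → s.realReg a = s0.realReg a
  out : ∀ a, ¬ U a → s.out a = s0.out a
  copies : s.copies = s0.copies + c
  time : s.time ≤ s0.time + τ
  ready : Scratch M S R X s s l 0

namespace Work

theorem start (h : Scratch M S R X s s l 0) : Work M S R X W V U s s l 0 0 :=
  ⟨fun _ _ _ _ => rfl, fun _ _ => rfl, fun _ _ => rfl, rfl, le_rfl, h⟩

theorem mono (h : Work M S R X W V U s0 s l c τ) {W' V' U' : ℕ → Prop} {τ' : ℕ}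
    (hW : ∀ a, W a → W' a) (hV : ∀ a, V a → V' a) (hU : ∀ a, U a → U' a) (hτ : τ ≤ τ') :
    Work M S R X W' V' U' s0 s l c τ' :=
  ⟨fun a h1 h2 h3 => h.nat a h1 h2 fun h' => h3 (hW a h'), fun a h1 => h.real a fun h' => h1 (hV a h'),
    fun a h1 => h.out a fun h' => h1 (hU a h'), h.copies, h.time.trans (by omega), h.ready⟩

theorem le (h : Work M S R X W V U s0 s l c τ) {τ' : ℕ} (hτ : τ ≤ τ') :
    Work M S R X W V U s0 s l c τ' := h.mono (fun _ => id) (fun _ => id) (fun _ => id) hτ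

theorem trans (h : Work M S R X W V U s0 s l c τ) {l' : List ℕ} {c' τ' : ℕ}
    (h' : Work M S R X W V U s s1 l' c' τ') : Work M S R X W V U s0 s1 l' (c + c') (τ + τ') :=
  ⟨fun a h1 h2 h3 => (h'.nat a h1 h2 h3).trans (h.nat a h1 h2 h3),
    fun a h1 => (h'.real a h1).trans (h.real a h1), fun a h1 => (h'.out a h1).trans (h.out a h1),
    by rw [h'.copies, h.copies, add_assoc], by have := h.time; have := h'.time; omega, h'.ready⟩

theorem scratch (h : Work M S R X W V U s0 s l c τ) {l' : List ℕ} {τ' : ℕ}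
    (h' : Scratch M S R X s s1 l' τ') : Work M S R X W V U s0 s1 l' c (τ + τ') :=
  h.trans (c' := 0) ⟨fun a h1 h2 _ => h'.keep.nat a h1 h2, fun a _ => by rw [h'.keep.real],
    fun a _ => by rw [h'.keep.out], h'.keep.copies, h'.time, h'.restart⟩

theorem tick (h : Work M S R X W V U s0 s l c τ) (k : ℕ) :
    Work M S R X W V U s0 (s.tick k) l c (τ + k) := by
  have := h.scratch (h.ready.tick k)
  rwa [Nat.zero_add] at this

theorem setNat (h : Work M S R X W V U s0 s l c τ) {a v : ℕ} (hW : a < 20 → W a)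
    (ha : 6 ≤ a ∧ a < 15 ∨ 20 ≤ a ∧ a < 40) (ha' : a ≠ 10) (hv : v ≤ X) :
    Work M S R X W V U s0 (s.setNat (.dir a) v) l c τ := by
  have hb := h.ready.base
  have hr := h.ready.consts
  have e : ∀ b, b ≠ a → (s.setNat (.dir a) v).natReg b = s.natReg b := fun b hb => by simp [hb]
  refine ⟨fun b h1 h2 h3 => ?_, h.real, h.out, h.copies, h.time, ⟨Keep.refl _, ?_,
    (gates_setNat s v l (by omega) (by omega)).2 h.ready.gates,
    h.ready.bdd.setNat (by omega) hv, le_rfl, h.ready.codes, hb, h.ready.top⟩⟩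
  · rw [e b (by rintro rfl; exact h3 (hW h1)), h.nat b h1 h2 h3]
  · exact ⟨(e 0 (by omega)).trans hr.num, (e 1 (by omega)).trans hr.obs, (e 2 (by omega)).trans hr.d,
      (e 3 (by omega)).trans hr.one, (e 4 (by omega)).trans hr.four, (e 5 (by omega)).trans hr.forty,
      (e 15 (by omega)).trans hr.twenty, (e 16 (by omega)).trans hr.two,
      (e 17 (by omega)).trans hr.three⟩

theorem setReal (h : Work M S R X W V U s0 s l c τ) {t : Ref} (v : ℝ) (hV : V (s.addr t))
    (ht : s.addr t < R) : Work M S R X W V U s0 (s.setReal t v) l c τ := by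
  have hr := h.ready
  refine ⟨h.nat, fun a h1 => ?_, h.out, h.copies, h.time, ⟨Keep.refl _,
    hr.consts.of_keep (s' := s.tick 0) ((Keep.refl s).tick 0) |> fun k => ⟨k.num, k.obs, k.d, k.one,
      k.four, k.forty, k.twenty, k.two, k.three⟩, hr.gates, hr.bdd.setReal ht, le_rfl, hr.codes,
    hr.base, hr.top⟩⟩
  change Function.update s.realReg (s.addr t) v a = _
  rw [Function.update_of_ne (by rintro rfl; exact h1 hV), h.real a h1]

theorem setOut (h : Work M S R X W V U s0 s l c τ) {j : ℕ} (v : ℝ) (hU : U j) :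
    Work M S R X W V U s0 (s.setOut j v) l c τ := by
  have hr := h.ready
  refine ⟨h.nat, h.real, fun a h1 => ?_, h.copies, h.time, ⟨Keep.refl _,
    ⟨hr.consts.num, hr.consts.obs, hr.consts.d, hr.consts.one, hr.consts.four, hr.consts.forty,
      hr.consts.twenty, hr.consts.two, hr.consts.three⟩, hr.gates,
      ⟨hr.bdd.nat, hr.bdd.real, hr.bdd.max⟩, le_rfl, hr.codes, hr.base, hr.top⟩⟩
  change Function.update s.out j v a = _
  rw [Function.update_of_ne (by rintro rfl; exact h1 hU), h.out a h1]

end Work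

/-- `t := a o b` for real registers. -/
def ropProg (o : RealOp) (t a b : Ref) : Prog := .instr (.realOp o t a b)

/-- `s'` has the natural-number registers `f`, the real registers `g` and the outputs of `s`. -/
structure Regs (s s' : Config n) (f : ℕ → ℕ) (g : ℕ → ℝ) : Prop where
  nat : s'.natReg = f
  real : s'.realReg = g
  out : s'.out = s.out

theorem wp_work_op (h : Work M S R X W V U s0 s l c τ) {o : NatOp} {t a b : ℕ} (hW : t < 20 → W t)
    (ht : 6 ≤ t ∧ t < 15 ∨ 20 ≤ t ∧ t < 40) (ht' : t ≠ 10)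
    (hv : o.eval (s.natReg a) (s.natReg b) ≤ X)
    (hQ : ∀ s', Work M S R X W V U s0 s' l c (τ + 1) →
      Regs s s' (Function.update s.natReg t (o.eval (s.natReg a) (s.natReg b))) s.realReg → Q s') :
    wp A ρ (opProg o t a b) Q s :=
  wp_opProg.2 (hQ _ ((h.tick 1).setNat hW ht ht' hv) ⟨rfl, rfl, rfl⟩)

theorem wp_work_const (h : Work M S R X W V U s0 s l c τ) {t v : ℕ} (hW : t < 20 → W t)
    (ht : 6 ≤ t ∧ t < 15 ∨ 20 ≤ t ∧ t < 40) (ht' : t ≠ 10) (hv : v ≤ X)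
    (hQ : ∀ s', Work M S R X W V U s0 s' l c (τ + 1) →
      Regs s s' (Function.update s.natReg t v) s.realReg → Q s') :
    wp A ρ (.instr (.natConst (.dir t) v)) Q s :=
  wp_natConst.2 (hQ _ ((h.tick 1).setNat hW ht ht' hv) ⟨rfl, rfl, rfl⟩)

theorem wp_work_log2 (h : Work M S R X W V U s0 s l c τ) {t a : ℕ} (hW : t < 20 → W t)
    (ht : 6 ≤ t ∧ t < 15 ∨ 20 ≤ t ∧ t < 40) (ht' : t ≠ 10) (hv : Nat.log 2 (s.natReg a) ≤ X)
    (hQ : ∀ s', Work M S R X W V U s0 s' l c (τ + 1) →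
      Regs s s' (Function.update s.natReg t (Nat.log 2 (s.natReg a))) s.realReg → Q s') :
    wp A ρ (.instr (.log2 (.dir t) (.dir a))) Q s :=
  wp_log2.2 (hQ _ ((h.tick 1).setNat hW ht ht' hv) ⟨rfl, rfl, rfl⟩)

theorem wp_work_ceil (h : Work M S R X W V U s0 s l c τ) {t a : ℕ} (hW : t < 20 → W t)
    (ht : 6 ≤ t ∧ t < 15 ∨ 20 ≤ t ∧ t < 40) (ht' : t ≠ 10) (hv : ⌈s.realReg a⌉₊ ≤ X)
    (hQ : ∀ s', Work M S R X W V U s0 s' l c (τ + 1) →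
      Regs s s' (Function.update s.natReg t ⌈s.realReg a⌉₊) s.realReg → Q s') :
    wp A ρ (.instr (.ceil (.dir t) (.dir a))) Q s :=
  wp_ceil.2 (hQ _ ((h.tick 1).setNat hW ht ht' hv) ⟨rfl, rfl, rfl⟩)

theorem wp_work_nop (h : Work M S R X W V U s0 s l c τ)
    (hQ : ∀ s', Work M S R X W V U s0 s' l c (τ + 1) →
      Regs s s' (Function.update s.natReg 39 0) s.realReg → Q s') : wp A ρ nopProg Q s :=
  wp_work_const h (by omega) (by omega) (by omega) (by omega) hQ

theorem wp_work_real (h : Work M S R X W V U s0 s l c τ) {o : RealOp} {t a b : Ref}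
    (hV : V (s.addr t)) (ht : s.addr t < R)
    (hQ : ∀ s', Work M S R X W V U s0 s' l c (τ + 1) →
      Regs s s' s.natReg (Function.update s.realReg (s.addr t) (o.eval (s.real a) (s.real b))) →
      Q s') : wp A ρ (ropProg o t a b) Q s :=
  wp_realOp.2 (hQ _ ((h.tick 1).setReal _ hV ht) ⟨rfl, rfl, rfl⟩)

theorem wp_work_realConst (h : Work M S R X W V U s0 s l c τ) {t : ℕ} {v : ℚ}
    (hV : V t) (ht : t < R)
    (hQ : ∀ s', Work M S R X W V U s0 s' l c (τ + 1) →
      Regs s s' s.natReg (Function.update s.realReg t v) → Q s') :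
    wp A ρ (.instr (.realConst (.dir t) v)) Q s :=
  wp_realConst.2 (hQ _ ((h.tick 1).setReal _ hV ht) ⟨rfl, rfl, rfl⟩)

theorem wp_work_ofNat (h : Work M S R X W V U s0 s l c τ) {t a : ℕ}
    (hV : V t) (ht : t < R)
    (hQ : ∀ s', Work M S R X W V U s0 s' l c (τ + 1) →
      Regs s s' s.natReg (Function.update s.realReg t (s.natReg a : ℝ)) → Q s') :
    wp A ρ (.instr (.realOfNat (.dir t) (.dir a))) Q s :=
  wp_realOfNat.2 (hQ _ ((h.tick 1).setReal _ hV ht) ⟨rfl, rfl, rfl⟩)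

theorem wp_work_label (h : Work M S R X W V U s0 s l c τ) {t i a : ℕ} {j : Fin M} {b : Bits n}
    (hj : s.natReg i = j.val) (hb : ∀ k : Fin n, (s.natReg a).testBit k = b k)
    (hV : V t) (ht : t < R)
    (hQ : ∀ s', Work M S R X W V U s0 s' l c (τ + 1) →
      Regs s s' s.natReg (Function.update s.realReg t ((A j).label b)) → Q s') :
    wp A ρ (.instr (.obsLabel (.dir t) (.dir i) (.dir a))) Q s := by
  have hjM : s.nat (.dir i) < M := by rw [Config.nat_dir, hj]; exact j.2
  rw [wp_obsLabel hjM]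
  have e1 : (⟨s.nat (.dir i), hjM⟩ : Fin M) = j := Fin.ext hj
  have e2 : (fun k : Fin n => (s.nat (.dir a)).testBit k.val) = b := funext hb
  rw [e1, e2]
  exact hQ _ ((h.tick 1).setReal _ hV ht) ⟨rfl, rfl, rfl⟩

end Work

/-! ## The program: one shot, one copy -/

/-- Sum and sum of squares of the labels of observable number `12`, in real registers `3` and
`4`. -/
def traceProg : Prog :=
  .instr (.realConst (.dir 3) 0) ;; .instr (.realConst (.dir 4) 0) ;;
  .instr (.natConst (.dir 30) 0) ;;
  .loop (.dir 2) (.instr (.obsLabel (.dir 5) (.dir 12) (.dir 30)) ;;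
    ropProg .add (.dir 3) (.dir 3) (.dir 5) ;; ropProg .mul (.dir 6) (.dir 5) (.dir 5) ;;
    ropProg .add (.dir 4) (.dir 4) (.dir 6) ;; opProg .add 30 30 3)

/-- One shot on the state that the stored gate list prepares, with observable number `12`; the label
is added to the real register to which register `11` points. -/
def shotProg : Prog :=
  .instr .loadZero ;; unapplyProg ;; circuitProg ;; measureProg ;;
  .instr (.obsLabel (.dir 5) (.dir 12) (.dir 30)) ;; ropProg .add (.ind 11) (.ind 11) (.dir 5)

/-- All shots for one copy of the unknown state; the sums of the labels are added to the real
registers from the one on to which register `13` points. -/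
def copyProg : Prog :=
  sampleProg ;; .instr .loadCopy ;; applyProg ;; measureProg ;; flipProg ;;
  .instr (.natConst (.dir 12) 0) ;; opProg .mul 11 13 3 ;;
  .loop (.dir 1) (.loop (.dir 9) shotProg ;; opProg .add 12 12 3 ;; opProg .add 11 11 3)

/-- Binary digits identify the numbers below `2^n` with the bit strings, so a loop over `d` numbers
computes traces from labels. -/
theorem sum_range_testBit {n : ℕ} (f : Bits n → ℝ) :
    ∑ k ∈ Finset.range (2 ^ n), f (fun i => k.testBit i) = ∑ b, f b := by
  let e : Fin (2 ^ n) → Bits n := fun k i => k.val.testBit i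
  have hinj : Function.Injective e := by
    intro k k' h
    refine Fin.ext (Nat.eq_of_testBit_eq fun i => ?_)
    by_cases hi : i < n
    · exact congrFun h ⟨i, hi⟩
    · have h2 : 2 ^ n ≤ 2 ^ i := Nat.pow_le_pow_right (by norm_num) (by omega)
      rw [Nat.testBit_lt_two_pow (k.2.trans_le h2), Nat.testBit_lt_two_pow (k'.2.trans_le h2)]
  have hbij : Function.Bijective e :=
    (Fintype.bijective_iff_injective_and_card e).2 ⟨hinj, by simp⟩
  rw [← hbij.sum_comp f, Finset.sum_range]

section Shots

variable {n M F : ℕ} {A : Fin M → ObsCircuit n} {O : Fin M → Op n} {ρ : Op n}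
  {Q : Config n → Prop} {s s0 : Config n} {S R X τ c : ℕ} {l : List ℕ} {W V U : ℕ → Prop}

theorem wp_traceProg (h : Work M S R X W V U s0 s l c τ) {j : Fin M} (hj : s.natReg 12 = j.val)
    (hX : 2 ^ n ≤ X) (hR : 7 ≤ R) (hV : ∀ a, 3 ≤ a → a < 7 → V a)
    (hQ : ∀ s', Work M S R X W V U s0 s' l c (τ + 6 * 2 ^ n + 4) →
      (∀ a, a < 30 → s'.natReg a = s.natReg a) → s'.out = s.out →
      (∀ a, ¬ (3 ≤ a ∧ a < 7) → s'.realReg a = s.realReg a) →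
      s'.realReg 3 = ∑ b, (A j).label b → s'.realReg 4 = ∑ b, (A j).label b ^ 2 → Q s') :
    wp A ρ traceProg Q s := by
  unfold traceProg
  refine wp_seq.2 (wp_work_realConst h (hV _ (by omega) (by omega)) (by omega) fun s1 h1 e1 => ?_)
  refine wp_seq.2 (wp_work_realConst h1 (hV _ (by omega) (by omega)) (by omega) fun s2 h2 e2 => ?_)
  refine wp_seq.2 (wp_work_const h2 (by omega) (by omega) (by omega) (by omega) fun s3 h3 e3 => ?_)
  have c2 : s3.nat (.dir 2) = 2 ^ n := h3.ready.consts.d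
  refine wp_loop (fun k s' => Work M S R X W V U s0 s' l c (τ + 6 * k + 4) ∧
    (∀ a, a < 30 → s'.natReg a = s.natReg a) ∧ s'.natReg 30 = k ∧ s'.out = s.out ∧
    (∀ a, ¬ (3 ≤ a ∧ a < 7) → s'.realReg a = s.realReg a) ∧
    s'.realReg 3 = ∑ i ∈ Finset.range k, (A j).label (fun t => i.testBit t) ∧
    s'.realReg 4 = ∑ i ∈ Finset.range k, (A j).label (fun t => i.testBit t) ^ 2) ?_ ?_ ?_
  · refine ⟨h3.tick 1, fun a ha => ?_, ?_, ?_, fun a ha => ?_, ?_, ?_⟩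
    · simp [e3.nat, e2.nat, e1.nat, show a ≠ 30 by omega]
    · simp [e3.nat]
    · simp [e3.out, e2.out, e1.out]
    · simp [e3.real, e2.real, e1.real, show a ≠ 3 by omega, show a ≠ 4 by omega]
    · simp [e3.real, e2.real, e1.real]
    · simp [e3.real, e2.real]
  · rintro k s' hk ⟨h', f, f30, fo, fr, f3, f4⟩
    rw [c2] at hk
    refine wp_seq.2 (wp_work_label (j := j) (b := fun t => k.testBit t) (h'.tick 1)
      (by simp [f 12 (by omega), hj]) (fun t => by simp [f30]) (hV _ (by omega) (by omega))
      (by omega) fun s4 h4 e4 => ?_)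
    refine wp_seq.2 (wp_work_real h4 (hV _ (by simp [Config.addr]) (by simp [Config.addr]))
      (by simp [Config.addr]; omega) fun s5 h5 e5 => ?_)
    refine wp_seq.2 (wp_work_real h5 (hV _ (by simp [Config.addr]) (by simp [Config.addr]))
      (by simp [Config.addr]; omega) fun s6 h6 e6 => ?_)
    refine wp_seq.2 (wp_work_real h6 (hV _ (by simp [Config.addr]) (by simp [Config.addr]))
      (by simp [Config.addr]; omega) fun s7 h7 e7 => ?_)
    have g30 : s7.natReg 30 = k := by rw [e7.nat, e6.nat, e5.nat, e4.nat, Config.tick_natReg, f30]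
    have g1 := h7.ready.consts.one
    refine wp_work_op h7 (by omega) (by omega) (by omega) (by simp [NatOp.eval, g30, g1]; omega)
      fun s8 h8 e8 => ?_
    refine ⟨h8.le (by omega), fun a ha => ?_, ?_, ?_, fun a ha => ?_, ?_, ?_⟩
    · rw [e8.nat, Function.update_of_ne (by omega), e7.nat, e6.nat, e5.nat, e4.nat,
        Config.tick_natReg, f a ha]
    · simp [e8.nat, NatOp.eval, g30, g1]
    · rw [e8.out, e7.out, e6.out, e5.out, e4.out, Config.tick_out, fo]
    · rw [e8.real, e7.real, e6.real, e5.real, e4.real]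
      simp [Config.addr, show a ≠ 3 by omega, show a ≠ 4 by omega, show a ≠ 5 by omega,
        show a ≠ 6 by omega, fr a ha]
    · rw [Finset.sum_range_succ]
      simp [e8.real, e7.real, e6.real, e5.real, e4.real, Config.addr, RealOp.eval, f3]
    · rw [Finset.sum_range_succ]
      simp [e8.real, e7.real, e6.real, e5.real, e4.real, Config.addr, RealOp.eval, f4]
      ring
  · rintro s' ⟨h', f, _, fo, fr, f3, f4⟩
    rw [c2] at h' f3 f4
    rw [sum_range_testBit] at f3
    rw [sum_range_testBit fun b => (A j).label b ^ 2] at f4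
    exact hQ s' h' f fo fr f3 f4

/-- Time of one shot. -/
def shotTime (n F : ℕ) : ℕ := 36 * n * n + 55 * n + 3 * F + 20

theorem coupled_shotProg (h : Work M S R X W V U s0 s l c τ) {j : Fin M} {p : ℕ} {σ : Op n}
    (hj : s.natReg 12 = j.val) (hp : s.natReg 11 = p) (h5 : V 5) (hVp : V p) (hR : 6 ≤ R)
    (hpR : p < R) (hp5 : p ≠ 5) (hX : 2 ^ n ≤ X) (hF : (A j).gates.length ≤ F) (hFX : F ≤ X)
    (hl : l.length ≤ 3 * n * n + 4 * n) (hS : 3 * n * n + 4 * n + 41 ≤ S) (hσ : IsState σ)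
    (hlσ : (listOp n l).conjTranspose * basisProj (fun _ => false) * listOp n l = σ) :
    Coupled ((A j).shot σ) (shotProg.exec A ρ s) fun x s' =>
      Work M S R X W V U s0 s' l c (τ + shotTime n F) ∧
      (∀ a, a < 20 → a ≠ 10 → s'.natReg a = s.natReg a) ∧
      s'.realReg p = s.realReg p + x ∧ ∀ a, a ≠ 5 → a ≠ p → s'.realReg a = s.realReg a := by
  unfold shotProg
  refine Coupled.seq_right (wp_loadZero.2 ?_)
  have h1 : Scratch M S R X s { s.tick (n + 1) with qreg := basisProj fun _ => false } l
      (0 + (n + 1)) := (h.ready.tick (n + 1)).setQreg _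
  have q1 : ({ s.tick (n + 1) with qreg := basisProj fun _ => false } : Config n).qreg =
    basisProj fun _ => false := rfl
  generalize ({ s.tick (n + 1) with qreg := basisProj fun _ => false } : Config n) = s1 at h1 q1
  refine Coupled.seq_right (wp_unapplyProg h1 (by omega) fun s2 h2 q2 => ?_)
  rw [q1, hlσ] at q2
  have hj2 : s2.natReg 12 = j.val := by rw [h2.keep.nat 12 (by omega) (by omega), hj]
  refine Coupled.seq_right (wp_circuitProg h2 hj2 hF hFX fun s3 h3 q3 => ?_)
  rw [q2] at q3
  have hd : DiagProb s3.qreg := by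
    rw [q3]; exact (hσ.conj (circuitOp_star_mul _)).diagProb
  rw [ObsCircuit.shot, ← q3]
  refine Coupled.map_left ?_
  refine (coupled_measureProg h3 hX hd).seq_left ?_
  rintro b s4 _ ⟨h4, hb⟩
  have w4 := h.scratch h4
  refine wp_seq.2 (wp_work_label (j := j) (b := b) w4 ?_ hb.2 h5 (by omega) fun s5 h5 e5 => ?_)
  · rw [h4.keep.nat 12 (by omega) (by omega), hj]
  have hp5' : s5.natReg 11 = p := by rw [e5.nat, h4.keep.nat 11 (by omega) (by omega), hp]
  have hadr : s5.addr (.ind 11) = p := hp5'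
  refine wp_work_real h5 (by rw [hadr]; exact hVp) (by rw [hadr]; exact hpR) fun s6 h6 e6 => ?_
  refine ⟨h6.le ?_, fun a h1 h2 => ?_, ?_, fun a h1 h2 => ?_⟩
  · unfold shotTime
    -- Undoing the stored list dominates: `12` units for each of at most `3n² + 4n` codes (sweeps
    -- and flips).
    have : 12 * l.length ≤ 12 * (3 * n * n + 4 * n) := Nat.mul_le_mul_left _ hl
    have e : 12 * (3 * n * n + 4 * n) = 36 * n * n + 48 * n := by ring
    omega
  · rw [e6.nat, e5.nat, h4.keep.nat a h1 h2]
  · simp [e6.real, hp5', Config.addr, RealOp.eval, e5.real, h4.keep.real, hp5]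
  · simp [e6.real, hp5', Config.addr, e5.real, h4.keep.real, h1, h2]

/-- Time for the shots on one copy, all observables included. -/
def copyTime (n M F : ℕ) : ℕ :=
  60 * n * n + 31 * n + 20 + M * (2 * (2 ^ n + 1) * (shotTime n F + 1) + 4)

/-- In the rescaled output, `d + 1` times the average of `2(d+1)` labels is half their sum. So the
accumulated sum is `2(Y + tr O)`, and no division is needed until the very end. -/
theorem coupled_shots (h : Work M S R X W V U s0 s l c τ) {j : Fin M} {p : ℕ} {σ : Op n}
    (hj : s.natReg 12 = j.val) (hp : s.natReg 11 = p) (hm : s.natReg 9 = 2 * (2 ^ n + 1))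
    (h5 : V 5) (hVp : V p) (hR : 6 ≤ R)
    (hpR : p < R) (hp5 : p ≠ 5) (hX : 2 ^ n ≤ X) (hF : (A j).gates.length ≤ F) (hFX : F ≤ X)
    (hl : l.length ≤ 3 * n * n + 4 * n) (hS : 3 * n * n + 4 * n + 41 ≤ S) (hσ : IsState σ)
    (hlσ : (listOp n l).conjTranspose * basisProj (fun _ => false) * listOp n l = σ) :
    Coupled (rescaledOutput (A j) (O j) σ) ((Prog.loop (.dir 9) shotProg).exec A ρ s) fun y s' =>
      Work M S R X W V U s0 s' l c (τ + 2 * (2 ^ n + 1) * (shotTime n F + 1) + 1) ∧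
      (∀ a, a < 20 → a ≠ 10 → s'.natReg a = s.natReg a) ∧
      s'.realReg p = s.realReg p + 2 * (y + (O j).trace.re) ∧
      ∀ a, a ≠ 5 → a ≠ p → s'.realReg a = s.realReg a := by
  unfold rescaledOutput
  refine Coupled.map_left ?_
  refine (Coupled.loop_indep (fun _ : Fin (2 * (2 ^ n + 1)) => (A j).shot σ) (fun xs s' =>
    Work M S R X W V U s0 s' l c (τ + xs.length * (shotTime n F + 1) + 1) ∧
    (∀ a, a < 20 → a ≠ 10 → s'.natReg a = s.natReg a) ∧
    s'.realReg p = s.realReg p + xs.sum ∧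
    ∀ a, a ≠ 5 → a ≠ p → s'.realReg a = s.realReg a) (show s.nat (.dir 9) = _ from hm) ?_ ?_).mono ?_
  · exact ⟨(h.tick 1).le (by simp), fun _ _ _ => rfl, by simp, fun _ _ _ => rfl⟩
  · rintro xs s' _ ⟨h', f, fp, fr⟩
    refine (coupled_shotProg (h'.tick 1) (j := j) (p := p) ?_ ?_ h5 hVp hR hpR hp5 hX hF hFX hl hS
      hσ hlσ).mono ?_
    · simp [f 12 (by omega) (by omega), hj]
    · simp [f 11 (by omega) (by omega), hp]
    · rintro x s'' _ ⟨h'', g, gp, gr⟩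
      refine ⟨h''.le ?_, fun a h1 h2 => (g a h1 h2).trans (f a h1 h2), ?_,
        fun a h1 h2 => (gr a h1 h2).trans (fr a h1 h2)⟩
      · rw [List.length_append, List.length_singleton, add_mul]; omega
      · rw [gp, Config.tick_realReg, fp, List.sum_append, List.sum_singleton, add_assoc]
  · rintro x s' _ ⟨h', f, fp, fr⟩
    refine ⟨h'.le (by rw [List.length_ofFn]), f, ?_, fr⟩
    rw [fp, List.sum_ofFn]
    have : ((2 : ℝ) ^ n + 1) ≠ 0 := by positivity
    field_simp
    ring

/-- The law is rewritten with `snapshot_eq_sampler`, so that the gate list is drawn first and the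
outcome second, as on the machine. Given the snapshot, the observables are measured one after the
other, independently, the `j`-th into cell `p + j`. -/
theorem coupled_copyProg (h : Work M S R X W V U s0 s l c τ) {p : ℕ} (hρ : IsState ρ)
    (hp : s.natReg 13 = p) (hm : s.natReg 9 = 2 * (2 ^ n + 1)) (h5 : V 5)
    (hVp : ∀ j, j < M → V (p + j)) (hW : W 11 ∧ W 12) (hp20 : 20 ≤ p) (hR : 6 ≤ R)
    (hpR : p + M ≤ R) (hRX : R ≤ X) (hX : 4 ^ n + 3 ≤ X) (hnX : 4 * n + 3 ≤ X)
    (hF : ∀ j, (A j).gates.length ≤ F) (hFX : F ≤ X) (hS : 3 * n * n + 4 * n + 41 ≤ S) :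
    Coupled (outputsOfCopy A O ρ) (copyProg.exec A ρ s) fun y s' =>
      (∃ l', Work M S R X W V U s0 s' l' (c + 1) (τ + copyTime n M F)) ∧
      (∀ a, a < 20 → a ≠ 10 → a ≠ 11 → a ≠ 12 → s'.natReg a = s.natReg a) ∧
      (∀ j : Fin M, s'.realReg (p + j) = s.realReg (p + j) + 2 * (y j + (O j).trace.re)) ∧
      ∀ a, a ≠ 5 → (∀ j, j < M → a ≠ p + j) → s'.realReg a = s.realReg a := by
  have hX2 : 2 ^ n ≤ X := by
    have : 2 ^ n ≤ 4 ^ n := Nat.pow_le_pow_left (by norm_num) n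
    omega
  unfold outputsOfCopy copyProg
  rw [snapshot_eq_sampler hρ, PMF.bind_bind]
  refine (coupled_sampleProg h.ready hX hnX (by omega)).seq ?_
  rintro l1 s1 - ⟨h1, hl1⟩
  rw [basisLaw, PMF.bind_map]
  refine Coupled.seq_right (wp_loadCopy.2 ?_)
  have w1 := (h.scratch h1).tick (n + 1)
  have w2 : Work M S R X W V U s0 { s1.tick (n + 1) with qreg := ρ, copies := s1.copies + 1 } l1
      (c + 1) (τ + (0 + (24 * n + 9) * n + 4) + (n + 1)) := by
    have hr := w1.ready
    refine ⟨w1.nat, w1.real, w1.out, ?_, w1.time, ⟨Keep.refl _,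
      ⟨hr.consts.num, hr.consts.obs, hr.consts.d, hr.consts.one, hr.consts.four, hr.consts.forty,
      hr.consts.twenty, hr.consts.two, hr.consts.three⟩, hr.gates,
      ⟨hr.bdd.nat, hr.bdd.real, hr.bdd.max⟩, le_rfl, hr.codes, hr.base, hr.top⟩⟩
    have := w1.copies
    simp at this ⊢
    omega
  have n2 : ∀ a, a < 20 → a ≠ 10 → ({ s1.tick (n + 1) with qreg := ρ, copies := s1.copies + 1 } :
      Config n).natReg a = s.natReg a := fun a h1' h2' => h1.keep.nat a h1' h2'
  have r2 : ({ s1.tick (n + 1) with qreg := ρ, copies := s1.copies + 1 } :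
      Config n).realReg = s.realReg := h1.keep.real
  have q2 : ({ s1.tick (n + 1) with qreg := ρ, copies := s1.copies + 1 } : Config n).qreg = ρ := rfl
  generalize ({ s1.tick (n + 1) with qreg := ρ, copies := s1.copies + 1 } : Config n) = s2
    at w2 n2 r2 q2
  refine Coupled.seq_right (wp_applyProg w2.ready (by omega) fun s3 h3 q3 => ?_)
  rw [q2] at q3
  have hst : IsState s3.qreg := by
    rw [q3]; exact hρ.conj (actsBy_listOp l1).star_mul
  rw [← q3]
  refine (coupled_measureProg h3 hX2 hst.diagProb).seq ?_
  rintro b s4 - ⟨h4, hb⟩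
  have hb30 := hb.1
  refine Coupled.seq_right (wp_flipProg h4 (by omega) hnX rfl (by omega) fun s5 h5' hl5 => ?_)
  have hσ := listOp_append_flipCodes hb l1
  have hσs : IsState ((listOp n l1).conjTranspose * basisProj b * listOp n l1) := by
    have := (basisProj_isState b).conj (U := (listOp n l1).conjTranspose)
      (by rw [Matrix.conjTranspose_conjTranspose]; exact (actsBy_listOp l1).mul_star)
    rwa [Matrix.conjTranspose_conjTranspose] at this
  simp only [Function.comp_def]
  -- From here on only the projector `σ`, which the inverse list prepares, matters; how it was
  -- obtained is forgotten.
  generalize (listOp n l1).conjTranspose * basisProj b * listOp n l1 = σ at hσ hσs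
  generalize l1 ++ flipCodes n 0 (s4.natReg 30) = l5 at h5' hl5 hσ
  have w5 := w2.scratch h5'
  have n5 : ∀ a, a < 20 → a ≠ 10 → s5.natReg a = s.natReg a := fun a h1' h2' =>
    (h5'.keep.nat a h1' h2').trans (n2 a h1' h2')
  have r5 : s5.realReg = s.realReg := h5'.keep.real.trans r2
  refine Coupled.seq_right (wp_work_const w5 (fun _ => hW.2) (by omega) (by omega) (by omega)
    fun s6 h6 e6 => ?_)
  refine Coupled.seq_right (wp_work_op h6 (fun _ => hW.1) (by omega) (by omega) ?_
    fun s7 h7 e7 => ?_)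
  · simp [NatOp.eval, e6.nat, n5 13 (by omega) (by omega), hp, w5.ready.consts.one]; omega
  have n7 : ∀ a, a < 20 → a ≠ 10 → a ≠ 11 → a ≠ 12 → s7.natReg a = s.natReg a := by
    intro a i1 i2 i3 i4
    simp [e7.nat, e6.nat, i3, i4, n5 a i1 i2]
  have f12 : s7.natReg 12 = 0 := by simp [e7.nat, e6.nat]
  have f11 : s7.natReg 11 = p := by
    simp [e7.nat, e6.nat, NatOp.eval, n5 13 (by omega) (by omega), hp, w5.ready.consts.one]
  have r7 : s7.realReg = s.realReg := by rw [e7.real, e6.real, r5]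
  set T := 2 * (2 ^ n + 1) * (shotTime n F + 1) + 4 with hT
  refine (Coupled.loop_indep (fun j => rescaledOutput (A j) (O j) σ) (fun ys s' =>
    Work M S R X W V U s0 s' l5 (c + 1) (τ + (60 * n * n + 31 * n + 20) + ys.length * T) ∧
    (∀ a, a < 20 → a ≠ 10 → a ≠ 11 → a ≠ 12 → s'.natReg a = s.natReg a) ∧
    s'.natReg 12 = ys.length ∧ s'.natReg 11 = p + ys.length ∧
    (∀ (j : Fin M) (hj : j.val < ys.length),
      s'.realReg (p + j) = s.realReg (p + j) + 2 * (ys[j.val] + (O j).trace.re)) ∧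
    ∀ a, a ≠ 5 → (∀ j, j < ys.length → a ≠ p + j) → s'.realReg a = s.realReg a)
    (show s7.nat (.dir 1) = M from h7.ready.consts.obs) ?_ ?_).mono ?_
  · refine ⟨(h7.tick 1).le ?_, fun a i1 i2 i3 i4 => n7 a i1 i2 i3 i4, f12, f11,
      fun j hj => absurd hj (by simp), fun a _ _ => by simp [r7]⟩
    have : 12 * l1.length ≤ 12 * (3 * n * n) := Nat.mul_le_mul_left _ hl1
    have e1 : (24 * n + 9) * n = 24 * n * n + 9 * n := by ring
    have e2 : 12 * (3 * n * n) = 36 * n * n := by ring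
    have e3 : 60 * n * n = 24 * n * n + 36 * n * n := by ring
    simp only [List.length_nil]
    omega
  · rintro ys s' hlt ⟨h', f, g12, g11, fd, fr⟩
    refine (coupled_shots (O := O) (h'.tick 1) (j := ⟨ys.length, hlt⟩) (p := p + ys.length) g12 g11 ?_ h5
      (hVp _ hlt) hR (by omega) (by omega) hX2 (hF _) hFX (by omega) hS hσs hσ).seq_left ?_
    · rw [Config.tick_natReg, f 9 (by omega) (by omega) (by omega) (by omega), hm]
    · rintro y s'' _ ⟨h'', g, gp, gr⟩
      have i12 := g 12 (by omega) (by omega)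
      have i11 := g 11 (by omega) (by omega)
      rw [Config.tick_natReg] at i11 i12
      have c3 := h''.ready.consts.one
      refine wp_seq.2 (wp_work_op h'' (fun _ => hW.2) (by omega) (by omega) ?_ fun t1 k1 v1 => ?_)
      · simp [NatOp.eval, i12, g12, c3]; omega
      refine wp_work_op k1 (fun _ => hW.1) (by omega) (by omega) ?_ fun t2 k2 v2 => ?_
      · simp [NatOp.eval, v1.nat, i11, g11, c3]; omega
      refine ⟨k2.le ?_, ?_, ?_, ?_, ?_, ?_⟩
      · rw [List.length_append, List.length_singleton, add_mul]; omega
      · intro a i1 i2 i3 i4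
        simp [v2.nat, v1.nat, i3, i4, g a i1 i2, f a i1 i2 i3 i4]
      · simp [v2.nat, v1.nat, NatOp.eval, i12, g12, c3]
      · simp [v2.nat, v1.nat, NatOp.eval, i11, g11, c3]; omega
      · intro j hj
        rw [v2.real, v1.real]
        by_cases hje : j.val = ys.length
        · have : j = ⟨ys.length, hlt⟩ := Fin.ext hje
          subst this
          rw [gp, Config.tick_realReg, fr _ (by omega) (by intro i hi; omega)]
          simp
        · have hj' : j.val < ys.length := by
            rw [List.length_append, List.length_singleton] at hj; omega
          rw [gr _ (by omega) (by omega), Config.tick_realReg, fd j hj',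
            List.getElem_append_left hj']
      · intro a i1 i2
        rw [v2.real, v1.real, gr a i1 (i2 _ (by simp)), Config.tick_realReg,
          fr a i1 fun j hj => i2 j (by simp; omega)]
  · rintro y s' _ ⟨h', f, _, _, fd, fr⟩
    rw [List.length_ofFn] at h'
    refine ⟨⟨l5, h'.le (by rw [copyTime, ← hT]; omega)⟩, f, fun j => ?_, fun a i1 i2 => ?_⟩
    · rw [fd j (by simp)]; simp
    · exact fr a i1 fun j hj => i2 j (by simpa using hj)

end Shots
end

/-! ### Groups of copies, medians and outputs. -/

noncomputable section

/-! ## The program: groups of copies -/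

/-- All copies: registers `6` and `7` hold the number of groups and of copies in a group. -/
def groupsProg : Prog :=
  .loop (.dir 6) (.loop (.dir 7) copyProg ;; opProg .add 13 13 1)

section Groups

variable {n M F : ℕ} {A : Fin M → ObsCircuit n} {O : Fin M → Op n} {ρ : Op n}
  {Q : Config n → Prop} {s s0 : Config n} {S R X τ c : ℕ} {l : List ℕ} {W V U : ℕ → Prop}

theorem coupled_group (h : Work M S R X W V U s0 s l c τ) {p L : ℕ} (hρ : IsState ρ)
    (hp : s.natReg 13 = p) (hm : s.natReg 9 = 2 * (2 ^ n + 1)) (hL : s.natReg 7 = L) (h5 : V 5)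
    (hVp : ∀ j, j < M → V (p + j)) (hW : W 11 ∧ W 12) (hp20 : 20 ≤ p) (hR : 6 ≤ R)
    (hpR : p + M ≤ R) (hRX : R ≤ X) (hX : 4 ^ n + 3 ≤ X) (hnX : 4 * n + 3 ≤ X)
    (hF : ∀ j, (A j).gates.length ≤ F) (hFX : F ≤ X) (hS : 3 * n * n + 4 * n + 41 ≤ S) :
    Coupled (indep fun _ : Fin L => outputsOfCopy A O ρ)
      ((Prog.loop (.dir 7) copyProg).exec A ρ s) fun y s' =>
      (∃ l', Work M S R X W V U s0 s' l' (c + L) (τ + L * (copyTime n M F + 1) + 1)) ∧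
      (∀ a, a < 20 → a ≠ 10 → a ≠ 11 → a ≠ 12 → s'.natReg a = s.natReg a) ∧
      (∀ j : Fin M, s'.realReg (p + j) = s.realReg (p + j) +
        ∑ i, 2 * (y i j + (O j).trace.re)) ∧
      ∀ a, a ≠ 5 → (∀ j, j < M → a ≠ p + j) → s'.realReg a = s.realReg a := by
  refine (Coupled.loop_indep (fun _ : Fin L => outputsOfCopy A O ρ) (fun ys s' =>
    (∃ l', Work M S R X W V U s0 s' l' (c + ys.length)
      (τ + ys.length * (copyTime n M F + 1) + 1)) ∧
    (∀ a, a < 20 → a ≠ 10 → a ≠ 11 → a ≠ 12 → s'.natReg a = s.natReg a) ∧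
    (∀ j : Fin M, s'.realReg (p + j) = s.realReg (p + j) +
      (ys.map fun y => 2 * (y j + (O j).trace.re)).sum) ∧
    ∀ a, a ≠ 5 → (∀ j, j < M → a ≠ p + j) → s'.realReg a = s.realReg a)
    (show s.nat (.dir 7) = L from hL) ?_ ?_).mono ?_
  · exact ⟨⟨l, (h.tick 1).le (by simp)⟩, fun _ _ _ _ _ => rfl, fun j => by simp, fun _ _ _ => rfl⟩
  · rintro ys s' _ ⟨⟨l', h'⟩, f, fp, fr⟩
    refine (coupled_copyProg (O := O) (F := F) (h'.tick 1) hρ (p := p) ?_ ?_ h5 hVp hW hp20 hR hpR hRX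
      hX hnX hF hFX hS).mono ?_
    · rw [Config.tick_natReg, f 13 (by omega) (by omega) (by omega) (by omega), hp]
    · rw [Config.tick_natReg, f 9 (by omega) (by omega) (by omega) (by omega), hm]
    · rintro y s'' _ ⟨⟨l'', h''⟩, g, gp, gr⟩
      refine ⟨⟨l'', ?_⟩, fun a i1 i2 i3 i4 => (g a i1 i2 i3 i4).trans (f a i1 i2 i3 i4),
        fun j => ?_, fun a i1 i2 => (gr a i1 i2).trans (fr a i1 i2)⟩
      · rw [List.length_append, List.length_singleton, add_mul, ← add_assoc c]
        exact h''.le (by omega)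
      · rw [gp, Config.tick_realReg, fp, List.map_append, List.sum_append, List.map_singleton,
          List.sum_singleton, add_assoc]
  · rintro y s' _ ⟨⟨l', h'⟩, f, fp, fr⟩
    rw [List.length_ofFn] at h'
    refine ⟨⟨l', h'⟩, f, fun j => ?_, fr⟩
    rw [fp, List.map_ofFn, List.sum_ofFn]
    rfl

/-- Group `g` and observable `j` own the cell `20 + gM + j`. The blocks are disjoint, so later
groups preserve earlier sums, and cells not yet reached still hold the initial value `0`. -/
theorem coupled_groupsProg (h : Work M S R X W V U s0 s l c τ) {K L : ℕ} (hρ : IsState ρ)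
    (hp : s.natReg 13 = 20) (hm : s.natReg 9 = 2 * (2 ^ n + 1)) (hK : s.natReg 6 = K)
    (hL : s.natReg 7 = L) (h5 : V 5) (hV : ∀ a, 20 ≤ a → V a) (hW : W 11 ∧ W 12 ∧ W 13)
    (hR : 20 + K * M ≤ R) (hRX : R ≤ X) (hX : 4 ^ n + 3 ≤ X) (hnX : 4 * n + 3 ≤ X)
    (hF : ∀ j, (A j).gates.length ≤ F) (hFX : F ≤ X) (hS : 3 * n * n + 4 * n + 41 ≤ S)
    (h0 : ∀ a, 20 ≤ a → s.realReg a = 0) :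
    Coupled (indep fun _ : Fin K => indep fun _ : Fin L => outputsOfCopy A O ρ)
      (groupsProg.exec A ρ s) fun y s' =>
      (∃ l', Work M S R X W V U s0 s' l' (c + K * L)
        (τ + K * (L * (copyTime n M F + 1) + 3) + 1)) ∧
      (∀ a, a < 20 → a ≠ 10 → a ≠ 11 → a ≠ 12 → a ≠ 13 → s'.natReg a = s.natReg a) ∧
      (∀ (g : Fin K) (j : Fin M), s'.realReg (20 + g * M + j) =
        ∑ i, 2 * (y g i j + (O j).trace.re)) ∧
      ∀ a, a ≠ 5 → a < 20 → s'.realReg a = s.realReg a := by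
  unfold groupsProg
  refine (Coupled.loop_indep (fun _ : Fin K => indep fun _ : Fin L => outputsOfCopy A O ρ)
    (fun ys s' =>
      (∃ l', Work M S R X W V U s0 s' l' (c + ys.length * L)
        (τ + ys.length * (L * (copyTime n M F + 1) + 3) + 1)) ∧
      (∀ a, a < 20 → a ≠ 10 → a ≠ 11 → a ≠ 12 → a ≠ 13 → s'.natReg a = s.natReg a) ∧
      s'.natReg 13 = 20 + ys.length * M ∧
      (∀ (g : ℕ) (hg : g < ys.length) (j : Fin M), s'.realReg (20 + g * M + j) =
        ∑ i, 2 * (ys[g] i j + (O j).trace.re)) ∧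
      (∀ a, 20 + ys.length * M ≤ a → s'.realReg a = 0) ∧
      ∀ a, a ≠ 5 → a < 20 → s'.realReg a = s.realReg a)
    (show s.nat (.dir 6) = K from hK) ?_ ?_).mono ?_
  · exact ⟨⟨l, by simpa using (h.tick 1)⟩, fun _ _ _ _ _ _ => rfl, by simpa using hp,
      fun g hg => absurd hg (by simp), by simpa using h0, fun _ _ _ => rfl⟩
  · rintro ys s' hlt ⟨⟨l', h'⟩, f, f13, fp, f0, fr⟩
    have hKM : ys.length * M + M ≤ K * M := by
      rw [← Nat.succ_mul]; exact Nat.mul_le_mul_right _ hlt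
    refine (coupled_group (O := O) (F := F) (h'.tick 1) hρ (p := 20 + ys.length * M) (L := L) f13 ?_ ?_
      h5 (fun j _ => hV _ (by omega)) ⟨hW.1, hW.2.1⟩ (by omega) (by omega) (by omega) hRX hX hnX hF
      hFX hS).seq_left ?_
    · rw [Config.tick_natReg, f 9 (by omega) (by omega) (by omega) (by omega) (by omega), hm]
    · rw [Config.tick_natReg, f 7 (by omega) (by omega) (by omega) (by omega) (by omega), hL]
    · rintro y s'' _ ⟨⟨l'', h''⟩, g, gp, gr⟩
      have g13 := g 13 (by omega) (by omega) (by omega) (by omega)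
      rw [Config.tick_natReg, f13] at g13
      have gM := h''.ready.consts.obs
      refine wp_work_op h'' (fun _ => hW.2.2) (by omega) (by omega) ?_ fun t1 k1 v1 => ?_
      · simp [NatOp.eval, g13, gM]; omega
      have hlen : (ys ++ [y]).length = ys.length + 1 := by simp
      refine ⟨⟨l'', ?_⟩, ?_, ?_, ?_, ?_, ?_⟩
      · rw [hlen, add_mul, add_mul, one_mul, ← add_assoc c, one_mul]
        exact k1.le (by omega)
      · intro a i1 i2 i3 i4 i5
        rw [v1.nat, Function.update_of_ne i5, g a i1 i2 i3 i4]
        exact f a i1 i2 i3 i4 i5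
      · simp [v1.nat, NatOp.eval, g13, gM]; ring
      · intro i hi j
        rw [v1.real]
        by_cases hie : i = ys.length
        · subst hie
          rw [gp, Config.tick_realReg, f0 _ (by omega), zero_add]
          simp
        · have hi' : i < ys.length := by omega
          have : i * M + M ≤ ys.length * M := by
            rw [← Nat.succ_mul]; exact Nat.mul_le_mul_right _ hi'
          have := j.2
          rw [gr _ (by omega) (fun j' _ => by omega), Config.tick_realReg, fp i hi' j,
            List.getElem_append_left hi']
      · intro a ha
        rw [hlen, add_mul, one_mul] at ha
        rw [v1.real, gr a (by omega) (fun j' _ => by omega), Config.tick_realReg, f0 a (by omega)]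
      · intro a i1 i2
        rw [v1.real, gr a i1 (fun j' _ => by omega), Config.tick_realReg, fr a i1 i2]
  · rintro y s' _ ⟨⟨l', h'⟩, f, _, fp, _, fr⟩
    rw [List.length_ofFn] at h'
    refine ⟨⟨l', h'⟩, f, fun g j => ?_, fr⟩
    rw [fp g (by simp) j]; simp

end Groups

/-! ## The program: medians and outputs -/

/-- Numbers of cells that are less and at most the cell to which register `20` points. -/
def countProg : Prog :=
  .instr (.natConst (.dir 21) 0) ;; .instr (.natConst (.dir 22) 0) ;; opProg .add 23 15 12 ;;
  .loop (.dir 6)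
    (.ifRealLt (.ind 23) (.ind 20) (opProg .add 21 21 3) nopProg ;;
      -- `≤` is tested as the failure of the reversed strict inequality.
      .ifRealLt (.ind 20) (.ind 23) nopProg (opProg .add 22 22 3) ;; opProg .add 23 23 1)

/-- Median over the groups for observable number `12`, in real register `7`. -/
def medianProg : Prog :=
  opProg .add 20 15 12 ;;
  .loop (.dir 6)
    (countProg ;;
      .ifNatLt (.dir 8) (.dir 21) nopProg
        -- Real register `19` stays zero throughout, so adding it copies a real number.
        (.ifNatLt (.dir 8) (.dir 22) (ropProg .add (.dir 7) (.ind 20) (.dir 19)) nopProg) ;;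
      opProg .add 20 20 1)

/-- Outputs. -/
def outputProg : Prog :=
  .instr (.natConst (.dir 12) 0) ;;
  .loop (.dir 1)
    (medianProg ;; traceProg ;; .instr (.realOfNat (.dir 8) (.dir 7)) ;;
      -- Real register `8` becomes `2L`; the square of the accuracy it held is no longer needed.
      ropProg .add (.dir 8) (.dir 8) (.dir 8) ;; ropProg .div (.dir 7) (.dir 7) (.dir 8) ;;
      ropProg .sub (.dir 7) (.dir 7) (.dir 3) ;; .instr (.output (.dir 12) (.dir 7)) ;;
      opProg .add 12 12 3)

section Outputs

variable {n M : ℕ} {A : Fin M → ObsCircuit n} {ρ : Op n}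
  {Q : Config n → Prop} {s s0 : Config n} {S R X τ c : ℕ} {l : List ℕ} {W V U : ℕ → Prop}

theorem wp_countProg (h : Work M S R X W V U s0 s l c τ) {K j p : ℕ} (hK : s.natReg 6 = K)
    (hj : s.natReg 12 = j) (hp : s.natReg 20 = p) (hX : 20 + j + K * M ≤ X) (hKX : K ≤ X)
    (hQ : ∀ s', Work M S R X W V U s0 s' l c (τ + 6 * K + 4) →
      (∀ a, a ≤ 20 → s'.natReg a = s.natReg a) → s'.out = s.out → s'.realReg = s.realReg →
      s'.natReg 21 = Nat.count (fun g => s.realReg (20 + j + g * M) < s.realReg p) K →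
      s'.natReg 22 = Nat.count (fun g => s.realReg (20 + j + g * M) ≤ s.realReg p) K → Q s') :
    wp A ρ countProg Q s := by
  have c15 := h.ready.consts.twenty
  unfold countProg
  refine wp_seq.2 (wp_work_const h (by omega) (by omega) (by omega) (by omega) fun s1 h1 e1 => ?_)
  refine wp_seq.2 (wp_work_const h1 (by omega) (by omega) (by omega) (by omega) fun s2 h2 e2 => ?_)
  refine wp_seq.2 (wp_work_op h2 (by omega) (by omega) (by omega) ?_ fun s3 h3 e3 => ?_)
  · simp [NatOp.eval, e2.nat, e1.nat, c15, hj]; omega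
  have hK3 : s3.nat (.dir 6) = K := by simp [e3.nat, e2.nat, e1.nat, hK]
  refine wp_loop (fun k s' => Work M S R X W V U s0 s' l c (τ + 6 * k + 4) ∧
    (∀ a, a ≤ 20 → s'.natReg a = s.natReg a) ∧ s'.out = s.out ∧ s'.realReg = s.realReg ∧
    s'.natReg 21 = Nat.count (fun g => s.realReg (20 + j + g * M) < s.realReg p) k ∧
    s'.natReg 22 = Nat.count (fun g => s.realReg (20 + j + g * M) ≤ s.realReg p) k ∧
    s'.natReg 23 = 20 + j + k * M) ?_ ?_ ?_
  · refine ⟨h3.tick 1, fun a ha => ?_, ?_, ?_, ?_, ?_, ?_⟩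
    · simp [e3.nat, e2.nat, e1.nat, show a ≠ 21 by omega, show a ≠ 22 by omega,
        show a ≠ 23 by omega]
    · simp [e3.out, e2.out, e1.out]
    · simp [e3.real, e2.real, e1.real]
    · simp [e3.nat, e2.nat, e1.nat]
    · simp [e3.nat, e2.nat]
    · simp [e3.nat, e2.nat, e1.nat, NatOp.eval, c15, hj]
  · rintro k s' hk ⟨h', f, fo, fr, f21, f22, f23⟩
    rw [hK3] at hk
    have hkM : k * M + M ≤ K * M := by
      rw [← Nat.succ_mul]; exact Nat.mul_le_mul_right _ hk
    have b21 := Nat.count_le (p := fun g => s.realReg (20 + j + g * M) < s.realReg p) (n := k)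
    have b22 := Nat.count_le (p := fun g => s.realReg (20 + j + g * M) ≤ s.realReg p) (n := k)
    have first : ∀ Q' : Config n → Prop, (∀ t, Work M S R X W V U s0 t l c (τ + 6 * k + 4 + 3) →
        (∀ a, a ≤ 20 ∨ a = 22 ∨ a = 23 → t.natReg a = s'.natReg a) → t.out = s.out →
        t.realReg = s.realReg → t.natReg 21 =
          Nat.count (fun g => s.realReg (20 + j + g * M) < s.realReg p) (k + 1) → Q' t) →
        wp A ρ (.ifRealLt (.ind 23) (.ind 20) (opProg .add 21 21 3) nopProg) Q' (s'.tick 1) := by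
      intro Q' hQ'
      rw [wp_ifRealLt]
      have ex : ((s'.tick 1).real (.ind 23) < (s'.tick 1).real (.ind 20)) ↔
          s.realReg (20 + j + k * M) < s.realReg p := by
        simp [fr, f23, f 20 le_rfl, hp]
      rw [ex]
      refine ⟨fun hlt => ?_, fun hlt => ?_⟩
      · refine wp_work_op ((h'.tick 1).tick 1) (by omega) (by omega) (by omega) ?_ fun t ht et => ?_
        · simp [NatOp.eval, f21, h'.ready.consts.one]; omega
        · refine hQ' t ht (fun a ha => ?_) (by rw [et.out]; exact fo) (by rw [et.real]; exact fr) ?_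
          · simp [et.nat, show a ≠ 21 by omega]
          · rw [Nat.count_succ, if_pos hlt]
            simp [et.nat, NatOp.eval, f21, h'.ready.consts.one]
      · refine wp_work_nop ((h'.tick 1).tick 1) fun t ht et => ?_
        refine hQ' t ht (fun a ha => ?_) (by rw [et.out]; exact fo) (by rw [et.real]; exact fr) ?_
        · simp [et.nat, show a ≠ 39 by omega]
        · rw [Nat.count_succ, if_neg hlt]
          simp [et.nat, f21]
    refine wp_seq.2 (first _ fun t1 k1 g1 o1 r1 c1 => ?_)
    have second : ∀ Q' : Config n → Prop, (∀ t, Work M S R X W V U s0 t l c (τ + 6 * k + 4 + 5) →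
        (∀ a, a ≤ 21 ∨ a = 23 → t.natReg a = t1.natReg a) → t.out = s.out →
        t.realReg = s.realReg → t.natReg 22 =
          Nat.count (fun g => s.realReg (20 + j + g * M) ≤ s.realReg p) (k + 1) → Q' t) →
        wp A ρ (.ifRealLt (.ind 20) (.ind 23) nopProg (opProg .add 22 22 3)) Q' t1 := by
      intro Q' hQ'
      rw [wp_ifRealLt]
      have ex : (t1.real (.ind 20) < t1.real (.ind 23)) ↔
          ¬ s.realReg (20 + j + k * M) ≤ s.realReg p := by
        simp [r1, g1 23 (by omega), f23, g1 20 (by omega), f 20 le_rfl, hp]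
      have t22 : t1.natReg 22 = Nat.count (fun g => s.realReg (20 + j + g * M) ≤ s.realReg p) k := by
        rw [g1 22 (by omega), f22]
      rw [ex]
      refine ⟨fun hlt => ?_, fun hlt => ?_⟩
      · refine wp_work_nop (k1.tick 1) fun t ht et => ?_
        refine hQ' t ht (fun a ha => ?_) (by rw [et.out]; exact o1) (by rw [et.real]; exact r1) ?_
        · simp [et.nat, show a ≠ 39 by omega]
        · rw [Nat.count_succ, if_neg hlt]
          simp [et.nat, t22]
      · rw [not_not] at hlt
        refine wp_work_op (k1.tick 1) (by omega) (by omega) (by omega) ?_ fun t ht et => ?_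
        · simp [NatOp.eval, t22, k1.ready.consts.one]; omega
        · refine hQ' t ht (fun a ha => ?_) (by rw [et.out]; exact o1) (by rw [et.real]; exact r1) ?_
          · simp [et.nat, show a ≠ 22 by omega]
          · rw [Nat.count_succ, if_pos hlt]
            simp [et.nat, NatOp.eval, t22, k1.ready.consts.one]
    refine wp_seq.2 (second _ fun t2 k2 g2 o2 r2 c2 => ?_)
    have u23 : t2.natReg 23 = 20 + j + k * M := by rw [g2 23 (by omega), g1 23 (by omega), f23]
    have uM := k2.ready.consts.obs
    refine wp_work_op k2 (by omega) (by omega) (by omega) ?_ fun t3 k3 v3 => ?_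
    · simp [NatOp.eval, u23, uM]; omega
    refine ⟨k3.le (by omega), fun a ha => ?_, by rw [v3.out, o2], by rw [v3.real, r2], ?_, ?_, ?_⟩
    · rw [v3.nat, Function.update_of_ne (by omega), g2 a (by omega), g1 a (by omega), f a ha]
    · rw [v3.nat, Function.update_of_ne (by omega), g2 21 (by omega), c1]
    · rw [v3.nat, Function.update_of_ne (by omega), c2]
    · simp [v3.nat, NatOp.eval, u23, uM]; ring
  · rintro s' ⟨h', f, fo, fr, f21, f22, _⟩
    rw [hK3] at h' f21 f22
    exact hQ s' h' f fo fr f21 f22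

theorem count_eq_card_univ {K : ℕ} (p : ℕ → Prop) [DecidablePred p] :
    Nat.count p K = (Finset.univ.filter fun i : Fin K => p i).card := by
  rw [Nat.count_eq_card_filter_range, Finset.card_filter, Finset.card_filter, Finset.sum_range]

/-- A cell passes the two count tests only if it holds the median (`median_unique`), and some cell
does (`median_spec`). Compared with sorting, this costs time quadratic in the number of groups but
no additional array of cells. -/
theorem wp_medianProg (h : Work M S R X W V U s0 s l c τ) {t j : ℕ} (hK : s.natReg 6 = 2 * t + 1)
    (ht : s.natReg 8 = t) (hj : s.natReg 12 = j) (hX : 20 + j + (2 * t + 1) * M ≤ X)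
    (hKX : 2 * t + 1 ≤ X) (h7 : V 7) (hR : 8 ≤ R) (h19 : s.realReg 19 = 0)
    (hQ : ∀ s', Work M S R X W V U s0 s' l c (τ + (2 * t + 1) * (6 * (2 * t + 1) + 9) + 2) →
      (∀ a, a < 20 → s'.natReg a = s.natReg a) → s'.out = s.out →
      (∀ a, a ≠ 7 → s'.realReg a = s.realReg a) →
      s'.realReg 7 = median (fun g : Fin (2 * t + 1) => s.realReg (20 + j + g * M)) → Q s') :
    wp A ρ medianProg Q s := by
  have c15 := h.ready.consts.twenty
  set K := 2 * t + 1 with hKdef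
  set v : ℕ → ℝ := fun g => s.realReg (20 + j + g * M) with hv
  unfold medianProg
  refine wp_seq.2 (wp_work_op h (by omega) (by omega) (by omega) ?_ fun s1 h1 e1 => ?_)
  · simp [NatOp.eval, c15, hj]; omega
  have hK1 : s1.nat (.dir 6) = K := by simp [e1.nat, hK]
  obtain ⟨m1, m2, m3⟩ := median_spec (fun g : Fin (2 * t + 1) => v g)
  set med := median (fun g : Fin (2 * t + 1) => v g) with hmed
  refine wp_loop (fun k s' => Work M S R X W V U s0 s' l c (τ + k * (6 * K + 9) + 2) ∧
    (∀ a, a < 20 → s'.natReg a = s.natReg a) ∧ s'.out = s.out ∧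
    (∀ a, a ≠ 7 → s'.realReg a = s.realReg a) ∧ s'.natReg 20 = 20 + j + k * M ∧
    ((∃ g, g < k ∧ v g = med) → s'.realReg 7 = med)) ?_ ?_ ?_
  · refine ⟨(h1.tick 1).le (by omega), fun a ha => ?_, e1.out, fun a _ => by simp [e1.real], ?_, ?_⟩
    · simp [e1.nat, show a ≠ 20 by omega]
    · simp [e1.nat, NatOp.eval, c15, hj]
    · rintro ⟨g, hg, _⟩; omega
  · rintro k s' hk ⟨h', f, fo, fr, f20, fm⟩
    rw [hK1] at hk
    have hkM : k * M + M ≤ K * M := by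
      rw [← Nat.succ_mul]; exact Nat.mul_le_mul_right _ hk
    refine wp_seq.2 (wp_countProg (h'.tick 1) (K := K) (j := j) (p := 20 + j + k * M) ?_ ?_ f20 hX
      hKX fun s2 h2 g2 o2 r2 c21 c22 => ?_)
    · rw [Config.tick_natReg, f 6 (by omega), hK]
    · rw [Config.tick_natReg, f 12 (by omega), hj]
    have hv' : ∀ g : ℕ, (s'.tick 1).realReg (20 + j + g * M) = v g := fun g => fr _ (by omega)
    simp only [hv'] at c21 c22
    rw [count_eq_card_univ] at c21 c22
    have d21 : s2.natReg 21 = (Finset.univ.filter fun i : Fin (2 * t + 1) => v i < v k).card := c21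
    have d22 : s2.natReg 22 = (Finset.univ.filter fun i : Fin (2 * t + 1) => v i ≤ v k).card := c22
    have c8 : s2.natReg 8 = t := by
      rw [g2 8 (by omega), Config.tick_natReg, f 8 (by omega), ht]
    have fin : ∀ s3, Work M S R X W V U s0 s3 l c (τ + k * (6 * K + 9) + 2 + (6 * K + 8)) →
        (∀ a, a ≤ 20 → s3.natReg a = s2.natReg a) → s3.out = s.out →
        (∀ a, a ≠ 7 → s3.realReg a = s.realReg a) →
        ((∃ g, g < k + 1 ∧ v g = med) → s3.realReg 7 = med) →
        wp A ρ (opProg .add 20 20 1) (fun s' =>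
          Work M S R X W V U s0 s' l c (τ + (k + 1) * (6 * K + 9) + 2) ∧
          (∀ a, a < 20 → s'.natReg a = s.natReg a) ∧ s'.out = s.out ∧
          (∀ a, a ≠ 7 → s'.realReg a = s.realReg a) ∧ s'.natReg 20 = 20 + j + (k + 1) * M ∧
          ((∃ g, g < k + 1 ∧ v g = med) → s'.realReg 7 = med)) s3 := by
      intro s3 h3 g3 o3 r3 m3
      have u20 : s3.natReg 20 = 20 + j + k * M := by
        rw [g3 20 le_rfl, g2 20 le_rfl, Config.tick_natReg, f20]
      have uM := h3.ready.consts.obs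
      refine wp_work_op h3 (by omega) (by omega) (by omega) ?_ fun t3 k3 v3 => ?_
      · simp [NatOp.eval, u20, uM]; omega
      refine ⟨k3.le (by rw [add_mul]; omega), fun a ha => ?_, by rw [v3.out, o3],
        fun a ha => by rw [v3.real, r3 a ha], ?_, fun hg => by rw [v3.real, m3 hg]⟩
      · rw [v3.nat, Function.update_of_ne (by omega), g3 a (by omega), g2 a (by omega),
          Config.tick_natReg, f a ha]
      · simp [v3.nat, NatOp.eval, u20, uM]; ring
    have o2' : s2.out = s.out := by rw [o2, Config.tick_out, fo]
    have r2' : ∀ a, a ≠ 7 → s2.realReg a = s.realReg a := fun a ha => by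
      rw [r2, Config.tick_realReg, fr a ha]
    have r27 : s2.realReg 7 = s'.realReg 7 := by rw [r2]; rfl
    have skip : v k ≠ med → ((∃ g, g < k + 1 ∧ v g = med) → s2.realReg 7 = med) := by
      rintro hne ⟨g, hg, hgm⟩
      rw [r27]
      refine fm ⟨g, ?_, hgm⟩
      rcases Nat.lt_succ_iff_lt_or_eq.1 hg with h' | h'
      · exact h'
      · subst h'; exact absurd hgm hne
    have nop : v k ≠ med → ∀ k', k' ≤ 2 → wp A ρ nopProg (wp A ρ (opProg .add 20 20 1) (fun s' =>
          Work M S R X W V U s0 s' l c (τ + (k + 1) * (6 * K + 9) + 2) ∧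
          (∀ a, a < 20 → s'.natReg a = s.natReg a) ∧ s'.out = s.out ∧
          (∀ a, a ≠ 7 → s'.realReg a = s.realReg a) ∧ s'.natReg 20 = 20 + j + (k + 1) * M ∧
          ((∃ g, g < k + 1 ∧ v g = med) → s'.realReg 7 = med))) (s2.tick k') := by
      intro hne k' hk'
      refine wp_work_nop (h2.tick k') fun t3 k3 v3 => fin t3 (k3.le (by omega)) (fun a ha => ?_)
        (by rw [v3.out]; exact o2') (fun a ha => by rw [v3.real]; exact r2' a ha)
        (fun hg => by rw [v3.real]; exact skip hne hg)
      rw [v3.nat, Function.update_of_ne (by omega)]; rfl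
    refine wp_seq.2 (wp_ifNatLt.2 ⟨fun hlt => nop ?_ 1 (by omega), fun hlt => wp_ifNatLt.2
      ⟨fun hlt2 => ?_, fun hlt2 => nop ?_ 2 (by omega)⟩⟩)
    · intro he
      change s2.natReg 8 < s2.natReg 21 at hlt
      rw [c8, d21, he] at hlt
      exact absurd m1 (not_le.2 hlt)
    · change ¬ s2.natReg 8 < s2.natReg 21 at hlt
      change s2.natReg 8 < s2.natReg 22 at hlt2
      rw [c8, d21] at hlt
      rw [c8, d22] at hlt2
      have he : v k = med :=
        median_unique (fun g : Fin (2 * t + 1) => v g) (not_lt.1 hlt) hlt2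
      refine wp_work_real ((h2.tick 1).tick 1) (by exact h7) (by exact hR) fun t3 k3 v3 => ?_
      refine fin t3 (k3.le (by omega)) (fun a ha => by rw [v3.nat]; rfl)
        (by rw [v3.out]; exact o2') (fun a ha => ?_) (fun _ => ?_)
      · rw [v3.real]
        change Function.update s2.realReg 7 _ a = _
        rw [Function.update_of_ne ha, r2' a ha]
      · rw [v3.real]
        change Function.update s2.realReg 7 (s2.realReg (s2.natReg 20) + s2.realReg 19) 7 = _
        rw [Function.update_self, r2' 19 (by omega), h19, add_zero, g2 20 le_rfl,
          Config.tick_natReg, f20, r2' _ (by omega), ← he]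
    · intro he
      change ¬ s2.natReg 8 < s2.natReg 22 at hlt2
      rw [c8, d22, he] at hlt2
      exact hlt2 m2
  · rintro s' ⟨h', f, fo, fr, _, fm⟩
    rw [hK1] at h' fm
    obtain ⟨g, hg⟩ := m3
    exact hQ s' h' f fo fr (fm ⟨g, g.2, hg⟩)

/-- Time for the outputs. -/
def outputTime (n M t : ℕ) : ℕ := M * ((2 * t + 1) * (6 * (2 * t + 1) + 9) + 6 * 2 ^ n + 13) + 2

theorem wp_outputProg (h : Work M S R X W V U s0 s l c τ) {t L : ℕ} (hK : s.natReg 6 = 2 * t + 1)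
    (ht : s.natReg 8 = t) (hL : s.natReg 7 = L) (hX : 20 + M + (2 * t + 1) * M ≤ X)
    (hKX : 2 * t + 1 ≤ X) (h2X : 2 ^ n ≤ X) (hV : ∀ a, 3 ≤ a → a < 9 → V a) (hW : W 12)
    (hU : ∀ j, j < M → U j) (hR : 9 ≤ R) (h19 : s.realReg 19 = 0)
    (hQ : ∀ s', Work M S R X W V U s0 s' l c (τ + outputTime n M t) →
      (∀ j : Fin M, s'.out j = median (fun g : Fin (2 * t + 1) => s.realReg (20 + j + g * M)) /
        (L + L) - ∑ b, (A j).label b) → Q s') :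
    wp A ρ outputProg Q s := by
  unfold outputProg
  set T := (2 * t + 1) * (6 * (2 * t + 1) + 9) + 6 * 2 ^ n + 13 with hT
  refine wp_seq.2 (wp_work_const h (fun _ => hW) (by omega) (by omega) (by omega)
    fun s1 h1 e1 => ?_)
  have hM1 : s1.nat (.dir 1) = M := h1.ready.consts.obs
  refine wp_loop (fun k s' => Work M S R X W V U s0 s' l c (τ + k * T + 2) ∧
    (∀ a, a < 20 → a ≠ 12 → s'.natReg a = s.natReg a) ∧ s'.natReg 12 = k ∧
    (∀ a, ¬ (3 ≤ a ∧ a < 9) → s'.realReg a = s.realReg a) ∧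
    ∀ j : Fin M, j.val < k → s'.out j =
      median (fun g : Fin (2 * t + 1) => s.realReg (20 + j + g * M)) / (L + L) -
        ∑ b, (A j).label b) ?_ ?_ ?_
  · refine ⟨(h1.tick 1).le (by omega), fun a ha ha' => ?_, by simp [e1.nat],
      fun a _ => by simp [e1.real], fun j hj => absurd hj (by omega)⟩
    simp [e1.nat, ha']
  · rintro k s' hk ⟨h', f, f12, fr, fo⟩
    rw [hM1] at hk
    have hkX : 20 + k + (2 * t + 1) * M ≤ X := by omega
    refine wp_seq.2 (wp_medianProg (h'.tick 1) (t := t) (j := k) ?_ ?_ f12 hkX hKX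
      (hV _ (by omega) (by omega)) (by omega) ?_ fun s2 h2 g2 o2 r2 m2 => ?_)
    · rw [Config.tick_natReg, f 6 (by omega) (by omega), hK]
    · rw [Config.tick_natReg, f 8 (by omega) (by omega), ht]
    · rw [Config.tick_realReg, fr 19 (by omega), h19]
    have m2' : s2.realReg 7 = median (fun g : Fin (2 * t + 1) => s.realReg (20 + k + g * M)) := by
      rw [m2]; congr 1; funext g; exact fr _ (by omega)
    have i12 : s2.natReg 12 = k := by rw [g2 12 (by omega)]; exact f12
    refine wp_seq.2 (wp_traceProg h2 (j := ⟨k, hk⟩) i12 h2X (by omega)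
      (fun a i1 i2 => hV a i1 (by omega)) fun s3 h3 g3 o3 r3 t3 _ => ?_)
    have i7 : s3.natReg 7 = L := by
      rw [g3 7 (by omega), g2 7 (by omega), Config.tick_natReg, f 7 (by omega) (by omega), hL]
    refine wp_seq.2 (wp_work_ofNat h3 (hV _ (by omega) (by omega)) (by omega) fun s4 h4 e4 => ?_)
    refine wp_seq.2 (wp_work_real h4 (hV _ (by simp [Config.addr]) (by simp [Config.addr]))
      (by simp [Config.addr]; omega) fun s5 h5 e5 => ?_)
    refine wp_seq.2 (wp_work_real h5 (hV _ (by simp [Config.addr]) (by simp [Config.addr]))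
      (by simp [Config.addr]; omega) fun s6 h6 e6 => ?_)
    refine wp_seq.2 (wp_work_real h6 (hV _ (by simp [Config.addr]) (by simp [Config.addr]))
      (by simp [Config.addr]; omega) fun s7 h7 e7 => ?_)
    have j12 : s7.natReg 12 = k := by
      rw [e7.nat, e6.nat, e5.nat, e4.nat, g3 12 (by omega), i12]
    have v7 : s7.realReg 7 = median (fun g : Fin (2 * t + 1) => s.realReg (20 + k + g * M)) /
        (L + L) - ∑ b, (A ⟨k, hk⟩).label b := by
      simp [e7.real, e6.real, e5.real, e4.real, Config.addr, RealOp.eval, i7, t3, r3 7 (by omega),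
        m2']
    refine wp_seq.2 (wp_output.2 ?_)
    have ho : s7.nat (.dir 12) = k := j12
    have hv : s7.real (.dir 7) = s7.realReg 7 := rfl
    rw [ho, hv, v7]
    have h8 := (h7.tick 1).setOut (j := k) (median (fun g : Fin (2 * t + 1) =>
      s.realReg (20 + k + g * M)) / (L + L) - ∑ b, (A ⟨k, hk⟩).label b) (hU k hk)
    refine wp_work_op h8 (fun _ => hW) (by omega) (by omega) ?_ fun s9 h9 e9 => ?_
    · change s7.natReg 12 + s7.natReg 3 ≤ X
      rw [j12, h7.ready.consts.one]; omega
    have hkT : (k + 1) * T = k * T + T := by ring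
    refine ⟨h9.le (by omega), fun a ha ha' => ?_, ?_, fun a ha => ?_,
      fun j hj => ?_⟩
    · rw [e9.nat, Function.update_of_ne ha']
      change s7.natReg a = _
      rw [e7.nat, e6.nat, e5.nat, e4.nat, g3 a (by omega), g2 a ha]
      exact f a ha ha'
    · rw [e9.nat, Function.update_self]
      change s7.natReg 12 + s7.natReg 3 = _
      rw [j12, h7.ready.consts.one]
    · rw [e9.real]
      change s7.realReg a = _
      rw [e7.real, e6.real, e5.real, e4.real]
      simp [Config.addr, show a ≠ 7 by omega, show a ≠ 8 by omega]
      rw [r3 a (by omega), r2 a (by omega)]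
      exact fr a ha
    · rw [e9.out]
      change Function.update s7.out k _ j.val = _
      by_cases hjk : j.val = k
      · have : j = ⟨k, hk⟩ := Fin.ext hjk
        subst this
        rw [Function.update_self]
      · rw [Function.update_of_ne hjk, e7.out, e6.out, e5.out, e4.out, o3, o2, Config.tick_out,
          fo j (by omega)]
  · rintro s' ⟨h', _, _, _, fo⟩
    rw [hM1] at h' fo
    exact hQ s' (h'.le (by rw [outputTime, ← hT]; omega)) fun j => fo j j.2

end Outputs
end

/-! ### The whole program and its coupling with the estimator. -/

noncomputable section

/-! ## The complete program -/

/-- Constants and the dimension. -/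
def initProg : Prog :=
  .instr (.natConst (.dir 2) 1) ;; .instr (.natConst (.dir 3) 1) ;;
  .instr (.natConst (.dir 4) 4) ;; .instr (.natConst (.dir 5) 40) ;;
  .instr (.natConst (.dir 15) 20) ;; .instr (.natConst (.dir 16) 2) ;;
  .instr (.natConst (.dir 17) 3) ;; .instr (.natConst (.dir 10) 40) ;;
  .loop (.dir 0) (opProg .add 2 2 2)

/-- The largest sum of squares of labels, in real register `2`. -/
def boundProg : Prog :=
  .instr (.natConst (.dir 12) 0) ;;
  .loop (.dir 1) (traceProg ;;
    .ifRealLt (.dir 2) (.dir 4) (ropProg .add (.dir 2) (.dir 4) (.dir 19)) nopProg ;;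
    opProg .add 12 12 3)

/-- The estimator, with its parameters computed from the input. -/
def estimatorProg : Prog :=
  -- Computes `L = ⌈64B/ε²⌉`, `t = ⌊log₂⌈M/δ⌉⌋`, the number `2t + 1` of groups, the number `2(d+1)`
  -- of shots, and the address `20` of the first cell.
  .instr (.realConst (.dir 7) 64) ;; ropProg .mul (.dir 7) (.dir 7) (.dir 2) ;;
  ropProg .div (.dir 7) (.dir 7) (.dir 8) ;; .instr (.ceil (.dir 7) (.dir 7)) ;;
  .instr (.realOfNat (.dir 7) (.dir 1)) ;; ropProg .div (.dir 7) (.dir 7) (.dir 1) ;;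
  .instr (.ceil (.dir 20) (.dir 7)) ;; .instr (.log2 (.dir 8) (.dir 20)) ;;
  opProg .add 6 8 8 ;; opProg .add 6 6 3 ;; opProg .add 9 2 3 ;; opProg .add 9 9 9 ;;
  opProg .mul 13 15 3 ;; groupsProg ;; outputProg

/-- Constants, `B`, and the square of the accuracy in real register `8`. -/
def prepareProg : Prog :=
  initProg ;; boundProg ;; ropProg .mul (.dir 8) (.dir 0) (.dir 0)

/-- The complete program. -/
def qcqcProg : Prog :=
  -- If `B ≤ ε²`, the outputs keep their initial value `0`.
  prepareProg ;; .ifRealLt (.dir 8) (.dir 2) estimatorProg nopProg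

section Complete

variable {n M F : ℕ} {A : Fin M → ObsCircuit n} {O : Fin M → Op n} {ρ : Op n}
  {Q : Config n → Prop} {s s0 : Config n} {S R X τ c : ℕ} {l : List ℕ} {W V U : ℕ → Prop}

theorem wp_initProg {ε δ : ℝ} (hS : 40 ≤ S) (hSX : S ≤ X) (hR : 2 ≤ R) (hnX : n ≤ X)
    (hMX : M ≤ X) (hX : 2 ^ n ≤ X)
    (hQ : ∀ s', Scratch M S R X s' s' [] 0 → s'.realReg = (initialConfig n M ε δ).realReg →
      (∀ a, s'.out a = 0) → s'.copies = 0 → s'.time ≤ 2 * n + 9 → Q s') :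
    wp A ρ initProg Q (initialConfig n M ε δ) := by
  unfold initProg
  simp only [wp_seq, wp_natConst]
  have hb : Bdd S R X (initialConfig n M ε δ) :=
    ⟨by change 2 ≤ S; omega, hR, max_le hnX hMX⟩
  have h8 := ((((((((((((((((hb.tick 1).setNat (a := 2) (v := 1) (by omega) (by omega)).tick
    1).setNat (a := 3) (v := 1) (by omega) (by omega)).tick 1).setNat (a := 4) (v := 4)
    (by omega) (by omega)).tick 1).setNat (a := 5) (v := 40) (by omega) (by omega)).tick 1).setNat
    (a := 15) (v := 20) (by omega) (by omega)).tick 1).setNat (a := 16) (v := 2) (by omega)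
    (by omega)).tick 1).setNat (a := 17) (v := 3) (by omega) (by omega)).tick 1).setNat
    (a := 10) (v := 40) (by omega) (by omega))
  set s8 := (((((((((((((((((initialConfig n M ε δ).tick 1).setNat (.dir 2) 1).tick 1).setNat
    (.dir 3) 1).tick 1).setNat (.dir 4) 4).tick 1).setNat (.dir 5) 40).tick 1).setNat
    (.dir 15) 20).tick 1).setNat (.dir 16) 2).tick 1).setNat (.dir 17) 3).tick 1).setNat
    (.dir 10) 40) with hs8
  have e0 : s8.natReg 0 = n := by simp [hs8, initialConfig]
  have e1 : s8.natReg 1 = M := by simp [hs8, initialConfig]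
  have e2 : s8.natReg 2 = 1 := by simp [hs8]
  have e3 : s8.natReg 3 = 1 := by simp [hs8]
  have e4 : s8.natReg 4 = 4 := by simp [hs8]
  have e5 : s8.natReg 5 = 40 := by simp [hs8]
  have e15 : s8.natReg 15 = 20 := by simp [hs8]
  have e16 : s8.natReg 16 = 2 := by simp [hs8]
  have e17 : s8.natReg 17 = 3 := by simp [hs8]
  have e10 : s8.natReg 10 = 40 := by simp [hs8]
  have er : s8.realReg = (initialConfig n M ε δ).realReg := by simp [hs8]
  have eo : ∀ a, s8.out a = 0 := by intro a; simp [hs8, initialConfig]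
  have ec : s8.copies = 0 := by simp [hs8, initialConfig]
  have et : s8.time = 8 := by simp [hs8, initialConfig]
  clear_value s8
  clear hs8
  refine wp_loop (fun k s' => s'.natReg = Function.update s8.natReg 2 (2 ^ k) ∧
    s'.realReg = (initialConfig n M ε δ).realReg ∧ (∀ a, s'.out a = 0) ∧ s'.copies = 0 ∧
    s'.time ≤ 2 * k + 9 ∧ Bdd S R X s') ?_ ?_ ?_
  · exact ⟨by simp [← e2], er, eo, ec, by simp [et], h8.tick 1⟩
  · rintro k s' hk ⟨f, fr, fo, fc, ft, fb⟩
    rw [show s8.nat (.dir 0) = n from e0] at hk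
    refine wp_opProg.2 ⟨?_, fr, fo, fc, by simp; omega, ?_⟩
    · simp [f, NatOp.eval, pow_succ, mul_two]
    · refine ((fb.tick 1).tick 1).setNat (by omega) ?_
      have : 2 ^ (k + 1) ≤ 2 ^ n := Nat.pow_le_pow_right (by norm_num) hk
      simp [f, NatOp.eval]
      rw [pow_succ] at this
      omega
  · rintro s' ⟨f, fr, fo, fc, ft, fb⟩
    rw [show s8.nat (.dir 0) = n from e0] at f ft
    refine hQ s' ⟨Keep.refl _, ⟨?_, ?_, ?_, ?_, ?_, ?_, ?_, ?_, ?_⟩, ⟨?_, ?_⟩, fb, le_rfl, by simp,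
      hS, hSX⟩ fr fo fc ft <;>
      simp [f, e0, e1, e3, e4, e5, e15, e16, e17, e10]

/-- A running maximum started at `0`. The start value does no harm because sums of squares are
non-negative, so their maximum `B` is too. -/
theorem wp_boundProg {B : ℝ} (h : Work M S R X W V U s0 s l c τ) (hX : 2 ^ n ≤ X) (hR : 9 ≤ R)
    (hMX : M ≤ X) (hV : ∀ a, 2 ≤ a → a < 7 → V a) (hW : W 12) (h2 : s.realReg 2 = 0)
    (h19 : s.realReg 19 = 0)
    (hB : IsGreatest (Set.range fun j : Fin M => ∑ b, (A j).label b ^ 2) B)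
    (hQ : ∀ s', Work M S R X W V U s0 s' l c (τ + M * (6 * 2 ^ n + 8) + 2) →
      (∀ a, ¬ (2 ≤ a ∧ a < 7) → s'.realReg a = s.realReg a) →
      s'.realReg 2 = B → Q s') :
    wp A ρ boundProg Q s := by
  unfold boundProg
  set T := 6 * 2 ^ n + 8 with hT
  refine wp_seq.2 (wp_work_const h (fun _ => hW) (by omega) (by omega) (by omega)
    fun s1 h1 e1 => ?_)
  have hM1 : s1.nat (.dir 1) = M := h1.ready.consts.obs
  refine wp_loop (fun k s' => Work M S R X W V U s0 s' l c (τ + k * T + 2) ∧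
    s'.natReg 12 = k ∧ (∀ a, ¬ (2 ≤ a ∧ a < 7) → s'.realReg a = s.realReg a) ∧
    (∀ j : Fin M, j.val < k → ∑ b, (A j).label b ^ 2 ≤ s'.realReg 2) ∧
    (s'.realReg 2 = 0 ∨ ∃ j : Fin M, s'.realReg 2 = ∑ b, (A j).label b ^ 2)) ?_ ?_ ?_
  · exact ⟨(h1.tick 1).le (by omega), by simp [e1.nat], fun a _ => by simp [e1.real],
      fun j hj => absurd hj (by omega), Or.inl (by simp [e1.real, h2])⟩
  · rintro k s' hk ⟨h', f12, fr, fu, fe⟩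
    rw [hM1] at hk
    have hkT : (k + 1) * T = k * T + T := by ring
    refine wp_seq.2 (wp_traceProg (h'.tick 1) (j := ⟨k, hk⟩) f12 hX (by omega)
      (fun a i1 i2 => hV a (by omega) i2) fun s2 k2 g2 o2 r2 _ t2 => ?_)
    have i2 : s2.realReg 2 = s'.realReg 2 := r2 2 (by omega)
    have i12 : s2.natReg 12 = k := by rw [g2 12 (by omega)]; exact f12
    have i19 : s2.realReg 19 = 0 := by
      rw [r2 19 (by omega), Config.tick_realReg, fr 19 (by omega), h19]
    have hr : ∀ a, ¬ (2 ≤ a ∧ a < 7) → s2.realReg a = s.realReg a := fun a ha => by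
      rw [r2 a (by omega)]; exact fr a ha
    have fin : ∀ s3, Work M S R X W V U s0 s3 l c (τ + k * T + 2 + 6 * 2 ^ n + 7) →
        s3.natReg 12 = k → (∀ a, ¬ (2 ≤ a ∧ a < 7) → s3.realReg a = s.realReg a) →
        s'.realReg 2 ≤ s3.realReg 2 → ∑ b, (A ⟨k, hk⟩).label b ^ 2 ≤ s3.realReg 2 →
        (s3.realReg 2 = 0 ∨ ∃ j : Fin M, s3.realReg 2 = ∑ b, (A j).label b ^ 2) →
        wp A ρ (opProg .add 12 12 3) (fun s' =>
          Work M S R X W V U s0 s' l c (τ + (k + 1) * T + 2) ∧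
          s'.natReg 12 = k + 1 ∧ (∀ a, ¬ (2 ≤ a ∧ a < 7) → s'.realReg a = s.realReg a) ∧
          (∀ j : Fin M, j.val < k + 1 → ∑ b, (A j).label b ^ 2 ≤ s'.realReg 2) ∧
          (s'.realReg 2 = 0 ∨ ∃ j : Fin M, s'.realReg 2 = ∑ b, (A j).label b ^ 2)) s3 := by
      intro s3 h3 j12 r3 u1 u2 u3
      have c3 := h3.ready.consts.one
      refine wp_work_op h3 (fun _ => hW) (by omega) (by omega) ?_ fun s4 h4 e4 => ?_
      · simp [NatOp.eval, j12, c3]; omega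
      refine ⟨h4.le (by omega), by simp [e4.nat, NatOp.eval, j12, c3], by rw [e4.real]; exact r3,
        fun j hj => ?_, by rw [e4.real]; exact u3⟩
      rw [e4.real]
      by_cases hjk : j.val = k
      · have : j = ⟨k, hk⟩ := Fin.ext hjk
        rw [this]; exact u2
      · exact (fu j (by omega)).trans u1
    refine wp_seq.2 (wp_ifRealLt.2 ⟨fun hlt => ?_, fun hlt => ?_⟩)
    · simp only [Config.real_dir, i2, t2] at hlt
      refine wp_work_real (k2.tick 1) (by exact hV 2 (by omega) (by omega)) (by change 2 < R; omega)
        fun s3 k3 v3 => ?_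
      have j2 : s3.realReg 2 = ∑ b, (A ⟨k, hk⟩).label b ^ 2 := by
        simp [v3.real, Config.addr, RealOp.eval, i19, t2]
      refine fin s3 (k3.le (by omega)) ?_ (fun a ha => ?_) ?_ j2.ge (Or.inr ⟨_, j2⟩)
      · rw [v3.nat]; exact i12
      · rw [v3.real]
        change Function.update s2.realReg 2 _ a = _
        rw [Function.update_of_ne (by omega), hr a ha]
      · rw [j2]; exact hlt.le
    · simp only [Config.real_dir, i2, t2, not_lt] at hlt
      refine wp_work_nop (k2.tick 1) fun s3 k3 v3 => ?_
      have j2 : s3.realReg 2 = s'.realReg 2 := by rw [v3.real]; exact i2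
      refine fin s3 (k3.le (by omega)) ?_ (fun a ha => ?_) j2.ge (by rw [j2]; exact hlt)
        (by rw [j2]; exact fe)
      · rw [v3.nat]; simpa using i12
      · rw [v3.real]; exact hr a ha
  · rintro s' ⟨h', _, fr, fu, fe⟩
    rw [hM1] at h' fu
    refine hQ s' h' fr ?_
    obtain ⟨⟨j, hj⟩, hub⟩ := hB
    have h0 : 0 ≤ B := by
      rw [← hj]; exact Finset.sum_nonneg fun b _ => sq_nonneg _
    refine le_antisymm ?_ ?_
    · rcases fe with fe | ⟨i, fe⟩
      · rw [fe]; exact h0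
      · rw [fe]; exact hub ⟨i, rfl⟩
    · rw [← hj]; exact fu j j.2

/-- Time of the estimator. -/
def estimatorTime (n M F t L : ℕ) : ℕ :=
  (2 * t + 1) * (L * (copyTime n M F + 1) + 3) + outputTime n M t + 14

theorem coupled_estimatorProg {B ε δ : ℝ} {t L : ℕ} (h : Work M S R X W V U s0 s l c τ)
    (hρ : IsState ρ) (hA : ∀ j, (A j).Implements (O j)) (hF : ∀ j, (A j).gates.length ≤ F)
    (hδ : s.realReg 1 = δ) (hB : s.realReg 2 = B) (hε : s.realReg 8 = ε * ε)
    (hL : ⌈64 * B / (ε * ε)⌉₊ = L) (hL0 : 0 < L) (ht : Nat.log 2 ⌈M / δ⌉₊ = t)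
    (h19 : s.realReg 19 = 0) (h20 : ∀ a, 20 ≤ a → s.realReg a = 0)
    (hW : ∀ a, 6 ≤ a → a < 14 → W a) (hV : ∀ a, 3 ≤ a ∧ a < 9 ∨ 20 ≤ a → V a)
    (hU : ∀ j, j < M → U j) (hS : 3 * n * n + 4 * n + 41 ≤ S) (hR : 20 + (2 * t + 1) * M ≤ R)
    (hRX : R + M ≤ X) (hKX : 2 * t + 1 ≤ X) (hX : 4 ^ n + 3 ≤ X) (hmX : 2 * (2 ^ n + 1) ≤ X)
    (hnX : 4 * n + 3 ≤ X) (hFX : F ≤ X) (hLX : L ≤ X) (hMδ : ⌈M / δ⌉₊ ≤ X) :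
    Coupled (qcqcLaw A O ρ (2 * t + 1) L) (estimatorProg.exec A ρ s) fun o s' =>
      (∃ l', Work M S R X W V U s0 s' l' (c + (2 * t + 1) * L) (τ + estimatorTime n M F t L)) ∧
      ∀ j : Fin M, s'.out j = o j := by
  have c1 := h.ready.consts.obs
  have c2 := h.ready.consts.d
  have c3 := h.ready.consts.one
  have c15 := h.ready.consts.twenty
  unfold estimatorProg
  have hV7 : V 7 := hV 7 (by omega)
  have hR7 : 7 < R := by omega
  refine Coupled.seq_right (wp_work_realConst h hV7 hR7 fun s1 h1 e1 => ?_)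
  refine Coupled.seq_right (wp_work_real h1 (by exact hV7) (by exact hR7) fun s2 h2 e2 => ?_)
  refine Coupled.seq_right (wp_work_real h2 (by exact hV7) (by exact hR7) fun s3 h3 e3 => ?_)
  have v3 : s3.realReg 7 = 64 * B / (ε * ε) := by
    simp [e3.real, e2.real, e1.real, Config.addr, RealOp.eval, hB, hε]
  refine Coupled.seq_right (wp_work_ceil h3 (fun _ => hW 7 (by omega) (by omega)) (by omega)
    (by omega) (by rw [v3, hL]; exact hLX) fun s4 h4 e4 => ?_)
  rw [v3, hL] at e4
  refine Coupled.seq_right (wp_work_ofNat h4 hV7 hR7 fun s5 h5 e5 => ?_)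
  refine Coupled.seq_right (wp_work_real h5 (by exact hV7) (by exact hR7) fun s6 h6 e6 => ?_)
  have v6 : s6.realReg 7 = M / δ := by
    simp [e6.real, e5.real, e4.real, e4.nat, e3.nat, e2.nat, e1.nat, e3.real, e2.real, e1.real,
      Config.addr, RealOp.eval, hδ, c1]
  have r6 : ∀ a, a ≠ 7 → s6.realReg a = s.realReg a := fun a ha => by
    simp [e6.real, e5.real, e4.real, e3.real, e2.real, e1.real, Config.addr, ha]
  have n6 : s6.natReg = Function.update s.natReg 7 L := by
    rw [e6.nat, e5.nat, e4.nat, e3.nat, e2.nat, e1.nat]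
  refine Coupled.seq_right (wp_work_ceil h6 (by omega) (by omega) (by omega)
    (by rw [v6]; exact hMδ) fun s7 h7 e7 => ?_)
  rw [v6, n6] at e7
  have v7 : s7.natReg 20 = ⌈M / δ⌉₊ := by simp [e7.nat]
  refine Coupled.seq_right (wp_work_log2 h7 (fun _ => hW 8 (by omega) (by omega)) (by omega)
    (by omega) (by rw [v7, ht]; omega) fun s8 h8 e8 => ?_)
  rw [v7, ht, e7.nat] at e8
  refine Coupled.seq_right (wp_work_op h8 (fun _ => hW 6 (by omega) (by omega)) (by omega)
    (by omega) ?_ fun s9 h9 e9 => ?_)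
  · simp [NatOp.eval, e8.nat]; omega
  refine Coupled.seq_right (wp_work_op h9 (fun _ => hW 6 (by omega) (by omega)) (by omega)
    (by omega) ?_ fun s10 h10 e10 => ?_)
  · simp [NatOp.eval, e9.nat, e8.nat, c3]; omega
  refine Coupled.seq_right (wp_work_op h10 (fun _ => hW 9 (by omega) (by omega)) (by omega)
    (by omega) ?_ fun s11 h11 e11 => ?_)
  · simp [NatOp.eval, e10.nat, e9.nat, e8.nat, c3, c2]; omega
  refine Coupled.seq_right (wp_work_op h11 (fun _ => hW 9 (by omega) (by omega)) (by omega)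
    (by omega) ?_ fun s12 h12 e12 => ?_)
  · simp [NatOp.eval, e11.nat, e10.nat, e9.nat, e8.nat, c3, c2]; omega
  refine Coupled.seq_right (wp_work_op h12 (fun _ => hW 13 (by omega) (by omega)) (by omega)
    (by omega) ?_ fun s13 h13 e13 => ?_)
  · simp [NatOp.eval, e12.nat, e11.nat, e10.nat, e9.nat, e8.nat, c3, c15]; omega
  have w6 : s13.natReg 6 = 2 * t + 1 := by
    simp [e13.nat, e12.nat, e11.nat, e10.nat, e9.nat, e8.nat, NatOp.eval, c3]; omega
  have w7 : s13.natReg 7 = L := by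
    simp [e13.nat, e12.nat, e11.nat, e10.nat, e9.nat, e8.nat]
  have w8 : s13.natReg 8 = t := by
    simp [e13.nat, e12.nat, e11.nat, e10.nat, e9.nat, e8.nat]
  have w9 : s13.natReg 9 = 2 * (2 ^ n + 1) := by
    simp [e13.nat, e12.nat, e11.nat, e10.nat, e9.nat, e8.nat, NatOp.eval, c3, c2]; omega
  have w13 : s13.natReg 13 = 20 := by
    simp [e13.nat, e12.nat, e11.nat, e10.nat, e9.nat, e8.nat, NatOp.eval, c3, c15]
  have r13 : ∀ a, a ≠ 7 → s13.realReg a = s.realReg a := fun a ha => by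
    rw [e13.real, e12.real, e11.real, e10.real, e9.real, e8.real, e7.real, r6 a ha]
  unfold qcqcLaw
  refine Coupled.map_left ?_
  refine (coupled_groupsProg (O := O) (F := F) h13 hρ w13 w9 w6 w7 (hV 5 (by omega))
    (fun a ha => hV a (by omega)) ⟨hW 11 (by omega) (by omega), hW 12 (by omega) (by omega),
      hW 13 (by omega) (by omega)⟩ hR (by omega) hX hnX hF hFX hS
    (fun a ha => by rw [r13 a (by omega), h20 a ha])).seq_left ?_
  rintro y s14 - ⟨⟨l', h14⟩, g14, p14, q14⟩
  refine wp_outputProg h14 (t := t) (L := L) ?_ ?_ ?_ (by omega) hKX (by omega)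
    (fun a i1 i2 => hV a (by omega)) (hW 12 (by omega) (by omega)) hU (by omega) ?_
    fun s' h' ho => ⟨⟨l', h'.le ?_⟩, fun j => ?_⟩
  · rw [g14 6 (by omega) (by omega) (by omega) (by omega) (by omega), w6]
  · rw [g14 8 (by omega) (by omega) (by omega) (by omega) (by omega), w8]
  · rw [g14 7 (by omega) (by omega) (by omega) (by omega) (by omega), w7]
  · rw [q14 19 (by omega) (by omega), r13 19 (by omega), h19]
  · rw [estimatorTime]; omega
  · have hLr : (0 : ℝ) < L := by exact_mod_cast hL0
    -- A group average of rescaled outputs is the raw sum over `2L` minus `tr O`: an increasing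
    -- affine map, the same for all groups, which commutes with the median.
    have cell : ∀ g : Fin (2 * t + 1), (∑ i, y g i j) / (L : ℝ) =
        (1 / (L + L)) * s14.realReg (20 + j + g * M) + -(O j).trace.re := by
      intro g
      rw [show 20 + j.val + g * M = 20 + g * M + j.val by omega, p14 g j, ← Finset.mul_sum,
        Finset.sum_add_distrib]
      simp only [Finset.sum_const, Finset.card_univ, Fintype.card_fin, nsmul_eq_mul]
      field_simp
      ring
    simp only [cell]
    rw [median_affine _ (by positivity), ho j, (hA j).trace_re]
    ring

/-- Time of the program. -/
def totalTime (n M F t L : ℕ) : ℕ :=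
  2 * n + M * (6 * 2 ^ n + 8) + 14 + estimatorTime n M F t L

/-- `S` and `R` bound the numbers of natural-number and of real registers that the program needs for
`2 t + 1` groups of `L` copies, and `X` the numbers that it stores. -/
structure Bounds (n M F : ℕ) (A : Fin M → ObsCircuit n) (t L S R X : ℕ) : Prop where
  gates : ∀ j, (A j).gates.length ≤ F
  space : 3 * n * n + 4 * n + 41 ≤ S
  reals : 20 + (2 * t + 1) * M ≤ R
  nats : S ≤ X
  array : R + M ≤ X
  groups : 2 * t + 1 ≤ X
  sq : 4 ^ n + 3 ≤ X
  shots : 2 * (2 ^ n + 1) ≤ X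
  codes : 4 * n + 3 ≤ X
  length : F ≤ X
  copies : L ≤ X

theorem wp_prepareProg {B ε δ : ℝ} {t L : ℕ} (b : Bounds n M F A t L S R X)
    (hB : IsGreatest (Set.range fun j : Fin M => ∑ b, (A j).label b ^ 2) B)
    (hQ : ∀ s0 s, Work M S R X (fun a => 6 ≤ a ∧ a < 14) (fun a => 2 ≤ a ∧ a < 9 ∨ 20 ≤ a)
      (fun _ => False) s0 s [] 0 (M * (6 * 2 ^ n + 8) + 3) → (∀ a, s0.out a = 0) →
      s0.copies = 0 → s0.time ≤ 2 * n + 9 → s.realReg 1 = δ → s.realReg 2 = B →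
      s.realReg 8 = ε * ε → s.realReg 19 = 0 → (∀ a, 20 ≤ a → s.realReg a = 0) → Q s) :
    wp A ρ prepareProg Q (initialConfig n M ε δ) := by
  have := b.space
  have := b.reals
  have := b.array
  have := b.shots
  have := b.codes
  have hM1 : 1 ≤ M := by
    obtain ⟨⟨j, _⟩, _⟩ := hB
    have := j.2; omega
  have hKM : 1 ≤ (2 * t + 1) * M := Nat.mul_pos (by omega) hM1
  refine wp_seq.2 (wp_initProg (S := S) (R := R) (X := X) (by omega) b.nats (by omega) (by omega) (by omega) (by omega)
    fun s1 h1 r1 o1 k1 t1 => ?_)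
  have w1 : Work M S R X (fun a => 6 ≤ a ∧ a < 14) (fun a => 2 ≤ a ∧ a < 9 ∨ 20 ≤ a)
      (fun _ => False) s1 s1 [] 0 0 := Work.start h1
  refine wp_seq.2 (wp_boundProg w1 (by omega) (by omega)
    (by omega) (fun a i1 i2 => Or.inl ⟨i1, by omega⟩) ⟨by norm_num, by norm_num⟩
    (by rw [r1]; simp [initialConfig])
    (by rw [r1]; simp [initialConfig]) hB fun s2 h2 r2 v2 => ?_)
  refine wp_work_real h2 (by simp [Config.addr]) (by change 8 < R; omega) fun s3 h3 e3 => ?_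
  have hr : ∀ a, a ≠ 8 → s3.realReg a = s2.realReg a := fun a ha => by
    rw [e3.real]; exact Function.update_of_ne ha _ _
  refine hQ s1 s3 (h3.le (le_of_eq (by omega))) o1 k1 t1 ?_ ?_ ?_ ?_ ?_
  · rw [hr 1 (by omega), r2 1 (by omega), r1]; simp [initialConfig]
  · rw [hr 2 (by omega), v2]
  · rw [e3.real]
    change Function.update s2.realReg 8 (s2.realReg 0 * s2.realReg 0) 8 = _
    rw [Function.update_self, r2 0 (by omega), r1]; simp [initialConfig]
  · rw [hr 19 (by omega), r2 19 (by omega), r1]; simp [initialConfig]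
  · intro a ha
    rw [hr a (by omega), r2 a (by omega), r1]
    simp [initialConfig, show a ≠ 0 by omega, show a ≠ 1 by omega]

theorem coupled_qcqcProg {B ε δ : ℝ} {t L : ℕ} (hρ : IsState ρ)
    (hA : ∀ j, (A j).Implements (O j)) (b : Bounds n M F A t L S R X)
    (hB : IsGreatest (Set.range fun j : Fin M => ∑ b, (A j).label b ^ 2) B)
    (hL : ⌈64 * B / (ε * ε)⌉₊ = L) (hL0 : 0 < L) (ht : Nat.log 2 ⌈M / δ⌉₊ = t)
    (hMδ : ⌈M / δ⌉₊ ≤ X) (hεB : ε * ε < B) :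
    Coupled (qcqcLaw A O ρ (2 * t + 1) L) (qcqcProg.exec A ρ (initialConfig n M ε δ)) fun o s =>
      (∀ j : Fin M, s.out j = o j) ∧ s.copies = (2 * t + 1) * L ∧ Bdd S R X s ∧
        s.time ≤ totalTime n M F t L := by
  refine Coupled.seq_right (wp_prepareProg b hB fun s0 s h _ hc hτ h1 h2 h8 h19 h20 => ?_)
  rw [Prog.exec, if_pos (show s.real (.dir 8) < s.real (.dir 2) by
    rw [Config.real_dir, Config.real_dir, h8, h2]; exact hεB)]
  have h' := (h.mono (U' := fun _ => True) (fun _ => id) (fun _ => id) (fun _ _ => trivial)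
    le_rfl).tick 1
  refine (coupled_estimatorProg (F := F) h' hρ hA b.gates h1 h2 h8 hL hL0 ht h19 h20
    (fun a i1 i2 => ⟨i1, i2⟩) (fun a ha => ?_) (fun _ _ => trivial) b.space b.reals b.array b.groups
    b.sq b.shots b.codes b.length b.copies hMδ).mono ?_
  · rcases ha with ha | ha
    · exact Or.inl ⟨by omega, ha.2⟩
    · exact Or.inr ha
  · rintro o s' - ⟨⟨l', w⟩, ho⟩
    refine ⟨ho, ?_, w.ready.bdd, ?_⟩
    · rw [w.copies, hc, zero_add, zero_add]
    · have := w.time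
      rw [totalTime]; omega

theorem wp_qcqcProg_zero {B ε δ : ℝ} {t L : ℕ} (b : Bounds n M F A t L S R X)
    (hB : IsGreatest (Set.range fun j : Fin M => ∑ b, (A j).label b ^ 2) B) (hεB : B ≤ ε * ε) :
    wp A ρ qcqcProg (fun s => (∀ j : Fin M, s.out j = 0) ∧ s.copies = 0 ∧ Bdd S R X s ∧
        s.time ≤ totalTime n M F t L) (initialConfig n M ε δ) := by
  refine wp_seq.2 (wp_prepareProg b hB fun s0 s h ho hc hτ h1 h2 h8 h19 h20 => ?_)
  refine wp_ifRealLt.2 ⟨fun hlt => ?_, fun _ => ?_⟩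
  · rw [Config.real_dir, Config.real_dir, h8, h2] at hlt
    exact absurd hlt (not_lt.2 hεB)
  · refine wp_work_nop (h.tick 1) fun s' w e => ?_
    refine ⟨fun j => (w.out j fun h => h).trans (ho j), by rw [w.copies, hc], w.ready.bdd, ?_⟩
    have := w.time
    rw [totalTime, estimatorTime]; omega

end Complete
end

/-! ### Arithmetic of the resource bounds. -/

noncomputable section

/-! ## Resource bounds -/

section Resources

/-- A shot costs `O(n² + F)`, at most a multiple of `F Λ²`; there are `2(d+1)` shots for each of `M`
observables, `L = O(β)` copies and `O(Λ)` groups. Working from the inside out, every lower-order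
term is absorbed into the current product, because all factors are at least `1`. -/
theorem totalTime_le {n M F t L : ℕ} {Λ β : ℝ} (hΛ : 1 ≤ Λ) (hβ : 1 ≤ β)
    (hn : (n : ℝ) ≤ 3 / 2 * Λ) (hK : 2 * (t : ℝ) + 1 ≤ 3 * Λ) (hL : (L : ℝ) ≤ 65 * β)
    (hM : 1 ≤ M) (hF : 1 ≤ F) :
    (totalTime n M F t L : ℝ) ≤ 200000 * (2 ^ n * β * F * M) * Λ ^ 3 := by
  have hm : (1 : ℝ) ≤ M := by exact_mod_cast hM
  have hf : (1 : ℝ) ≤ F := by exact_mod_cast hF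
  have hD : (1 : ℝ) ≤ 2 ^ n := one_le_pow₀ (by norm_num)
  have hn0 : (0 : ℝ) ≤ n := by positivity
  have hy0 : (0 : ℝ) ≤ L := by positivity
  have ht0 : (0 : ℝ) ≤ 2 * (t : ℝ) + 1 := by positivity
  simp only [totalTime, estimatorTime, outputTime, copyTime, shotTime]
  push_cast
  generalize (2 : ℝ) ^ n = D at *
  generalize (M : ℝ) = m at *
  generalize (F : ℝ) = f at *
  generalize (n : ℝ) = x at *
  generalize (L : ℝ) = y at *
  generalize hk : 2 * (t : ℝ) + 1 = k at *
  have hΛ2 : Λ ≤ Λ ^ 2 := by nlinarith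
  have hΛ3 : Λ ^ 2 ≤ Λ ^ 3 := by nlinarith [sq_nonneg Λ]
  have hx2 : x * x ≤ 9 / 4 * Λ ^ 2 := by nlinarith
  have hP : Λ ^ 2 ≤ f * Λ ^ 2 := le_mul_of_one_le_left (by positivity) hf
  have hPf : f ≤ f * Λ ^ 2 := le_mul_of_one_le_right (by linarith) (by linarith)
  -- With `x ≤ 3/2 Λ`: `81 + 82.5 + 3 + 21 ≤ 188`. The later constants arise likewise: `756 = 4 ·
  -- 188 + 4`, `959` bounds `135 + 46.5 + 21 + 756`, `62338 = 65 · 959 + 3`, and `187014` is three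
  -- times that.
  have h1 : 36 * x * x + 55 * x + 3 * f + 20 + 1 ≤ 188 * (f * Λ ^ 2) := by nlinarith
  have hshot : 0 ≤ 36 * x * x + 55 * x + 3 * f + 20 + 1 := by positivity
  generalize 36 * x * x + 55 * x + 3 * f + 20 + 1 = u at h1 hshot ⊢
  generalize hPdef : f * Λ ^ 2 = P at *
  have hP1 : 1 ≤ P := by linarith
  have hDP : P ≤ D * P := le_mul_of_one_le_left (by linarith) hD
  have h2 : 2 * (D + 1) * u + 4 ≤ 756 * (D * P) := by
    have : (D + 1) * u ≤ (2 * D) * (188 * P) := by gcongr; linarith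
    nlinarith
  have h2' : 0 ≤ 2 * (D + 1) * u + 4 := by positivity
  generalize 2 * (D + 1) * u + 4 = v at h2 h2' ⊢
  have hmDP : D * P ≤ m * (D * P) := le_mul_of_one_le_left (by linarith) hm
  have h3 : 60 * x * x + 31 * x + 20 + m * v + 1 ≤ 959 * (m * (D * P)) := by
    have : m * v ≤ m * (756 * (D * P)) := by gcongr
    nlinarith
  have h3' : 0 ≤ 60 * x * x + 31 * x + 20 + m * v + 1 := by positivity
  generalize 60 * x * x + 31 * x + 20 + m * v + 1 = w at h3 h3' ⊢
  have hG : m * (D * P) ≤ β * (m * (D * P)) := le_mul_of_one_le_left (by linarith) hβ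
  have h4 : y * w + 3 ≤ 62338 * (β * (m * (D * P))) := by
    have : y * w ≤ (65 * β) * (959 * (m * (D * P))) := by gcongr
    nlinarith
  have hGe : D * β * f * m * Λ ^ 3 = Λ * (β * (m * (D * P))) := by rw [← hPdef]; ring
  have hG0 : 0 ≤ β * (m * (D * P)) := by linarith
  have h5 : k * (y * w + 3) ≤ 187014 * (D * β * f * m * Λ ^ 3) := by
    calc k * (y * w + 3) ≤ (3 * Λ) * (62338 * (β * (m * (D * P)))) := by
          gcongr
      _ = _ := by rw [hGe]; ring
  have h6 : k * (6 * k + 9) ≤ 81 * Λ ^ 2 := by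
    have : k * (6 * k + 9) ≤ (3 * Λ) * (6 * (3 * Λ) + 9) := by gcongr
    nlinarith
  have hfβ : 1 ≤ f * β := one_le_mul_of_one_le_of_one_le hf hβ
  have hDm : 1 ≤ D * m := one_le_mul_of_one_le_of_one_le hD hm
  have hall : 1 ≤ (D * m) * (f * β) := one_le_mul_of_one_le_of_one_le hDm hfβ
  have hGΛ : D * β * f * m * Λ ^ 3 = (D * m) * (f * β) * Λ ^ 3 := by ring
  have hL3 : (1 : ℝ) ≤ Λ ^ 3 := by linarith
  have g1 : Λ ^ 3 ≤ D * β * f * m * Λ ^ 3 := by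
    rw [hGΛ]; exact le_mul_of_one_le_left (by linarith) hall
  have g2 : D * m ≤ D * β * f * m * Λ ^ 3 := by
    rw [hGΛ, mul_assoc]
    exact le_mul_of_one_le_right (by linarith) (one_le_mul_of_one_le_of_one_le hfβ hL3)
  have g3 : m * Λ ^ 2 ≤ D * β * f * m * Λ ^ 3 := by
    calc m * Λ ^ 2 ≤ m * Λ ^ 3 := by gcongr
      _ ≤ (D * (f * β)) * (m * Λ ^ 3) := le_mul_of_one_le_left (by positivity)
        (one_le_mul_of_one_le_of_one_le hD hfβ)
      _ = _ := by ring
  have g4 : m ≤ D * m := le_mul_of_one_le_left (by linarith) hD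
  have h7 : m * (k * (6 * k + 9)) ≤ 81 * (m * Λ ^ 2) := by
    calc m * (k * (6 * k + 9)) ≤ m * (81 * Λ ^ 2) := by gcongr
      _ = _ := by ring
  have e1 : m * (k * (6 * k + 9) + 6 * D + 13) = m * (k * (6 * k + 9)) + 6 * (D * m) + 13 * m := by
    ring
  have e2 : m * (6 * D + 8) = 6 * (D * m) + 8 * m := by ring
  have e3 : 200000 * (D * β * f * m) * Λ ^ 3 = 200000 * (D * β * f * m * Λ ^ 3) := by ring
  rw [e1, e2, e3]
  linarith

theorem two_thirds_le_log_two : 2 / 3 ≤ Real.log 2 := by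
  have := Real.log_two_gt_d9
  norm_num at this ⊢
  linarith

theorem natCast_le_log_two_pow (n : ℕ) : (n : ℝ) ≤ 3 / 2 * Real.log (2 ^ n) := by
  rw [Real.log_pow]
  have := mul_le_mul_of_nonneg_left two_thirds_le_log_two (Nat.cast_nonneg (α := ℝ) n)
  linarith

/-- From `2^t ≤ ⌈z⌉ ≤ 2z` follows `(t - 1) log 2 ≤ log z`. With `log 2 ≥ 2/3` this gives `t - 1 ≤
3/2 log z`; the case `t ≤ 1` is separate because that replacement needs `t - 1 ≥ 0`. -/
theorem log_ceil_le {z : ℝ} (hz : 1 ≤ z) :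
    2 * (Nat.log 2 ⌈z⌉₊ : ℝ) + 1 ≤ 3 * (1 + Real.log z) := by
  have hpos : ⌈z⌉₊ ≠ 0 := (Nat.ceil_pos.2 (by linarith)).ne'
  have h1 : ((2 ^ Nat.log 2 ⌈z⌉₊ : ℕ) : ℝ) ≤ ⌈z⌉₊ := by
    exact_mod_cast Nat.pow_log_le_self 2 hpos
  have h2 : (⌈z⌉₊ : ℝ) ≤ 2 * z := by
    have := Nat.ceil_lt_add_one (a := z) (by linarith)
    linarith
  push_cast at h1
  generalize Nat.log 2 ⌈z⌉₊ = t at *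
  have h3 : Real.log (2 ^ t) ≤ Real.log (2 * z) :=
    Real.log_le_log (by positivity) (h1.trans h2)
  rw [Real.log_mul (by norm_num) (by linarith), Real.log_pow] at h3
  have h4 := two_thirds_le_log_two
  have h5 : 0 ≤ Real.log z := Real.log_nonneg hz
  have h6 : (t : ℝ) - 1 ≤ 3 / 2 * Real.log z := by
    by_cases ht : (t : ℝ) ≤ 1
    · linarith
    · have : 2 / 3 * ((t : ℝ) - 1) ≤ Real.log 2 * ((t : ℝ) - 1) :=
        mul_le_mul_of_nonneg_right h4 (by linarith)
      linarith
  linarith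

/-- A bound for the numbers that the program stores. -/
theorem bounds_floor {n M F t L : ℕ} {A : Fin M → ObsCircuit n} {β δ : ℝ} (hβ : 1 ≤ β)
    (hδ : 0 < δ) (hδ1 : δ < 1) (hF : ∀ j, (A j).gates.length ≤ F) (hF1 : 1 ≤ F) (hM : 1 ≤ M)
    (hL : (L : ℝ) ≤ 65 * β) (ht : Nat.log 2 ⌈M / δ⌉₊ = t) :
    Bounds n M F A t L (3 * n * n + 4 * n + 41) (20 + (2 * t + 1) * M)
      ⌊(2 * (2 ^ n * β * F * M) / δ) ^ 10⌋₊ ∧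
    ⌈M / δ⌉₊ ≤ ⌊(2 * (2 ^ n * β * F * M) / δ) ^ 10⌋₊ := by
  have hm : (1 : ℝ) ≤ M := by exact_mod_cast hM
  have hf : (1 : ℝ) ≤ F := by exact_mod_cast hF1
  have hD : (1 : ℝ) ≤ 2 ^ n := one_le_pow₀ (by norm_num)
  have hnD : (n : ℝ) ≤ 2 ^ n := by exact_mod_cast (Nat.lt_two_pow_self (n := n)).le
  have h4 : ((4 : ℝ) ^ n) = 2 ^ n * 2 ^ n := by rw [← mul_pow]; norm_num
  have hδi : 1 ≤ 1 / δ := by rw [le_div_iff₀ hδ]; linarith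
  have hY : 2 * (2 ^ n * β * F * M) / δ = 2 * (2 ^ n * β * F * M * (1 / δ)) := by ring
  have q1 : 1 ≤ 2 ^ n * β * F * M * (1 / δ) :=
    one_le_mul_of_one_le_of_one_le (one_le_mul_of_one_le_of_one_le (one_le_mul_of_one_le_of_one_le
      (one_le_mul_of_one_le_of_one_le hD hβ) hf) hm) hδi
  have hβfm : 1 ≤ β * F * M * (1 / δ) := one_le_mul_of_one_le_of_one_le
    (one_le_mul_of_one_le_of_one_le (one_le_mul_of_one_le_of_one_le hβ hf) hm) hδi
  have hDfm : 1 ≤ 2 ^ n * F * M * (1 / δ) := one_le_mul_of_one_le_of_one_le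
    (one_le_mul_of_one_le_of_one_le (one_le_mul_of_one_le_of_one_le hD hf) hm) hδi
  have hDβm : 1 ≤ 2 ^ n * β * M * (1 / δ) := one_le_mul_of_one_le_of_one_le
    (one_le_mul_of_one_le_of_one_le (one_le_mul_of_one_le_of_one_le hD hβ) hm) hδi
  have hDβf : 1 ≤ 2 ^ n * β * F := one_le_mul_of_one_le_of_one_le
    (one_le_mul_of_one_le_of_one_le hD hβ) hf
  have bD : 2 ^ n ≤ 2 ^ n * β * F * M * (1 / δ) := by
    calc (2 : ℝ) ^ n ≤ 2 ^ n * (β * F * M * (1 / δ)) := le_mul_of_one_le_right (by linarith) hβfm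
      _ = _ := by ring
  have bβ : β ≤ 2 ^ n * β * F * M * (1 / δ) := by
    calc β ≤ β * (2 ^ n * F * M * (1 / δ)) := le_mul_of_one_le_right (by linarith) hDfm
      _ = _ := by ring
  have bF : (F : ℝ) ≤ 2 ^ n * β * F * M * (1 / δ) := by
    calc (F : ℝ) ≤ F * (2 ^ n * β * M * (1 / δ)) := le_mul_of_one_le_right (by linarith) hDβm
      _ = _ := by ring
  have bM : (M : ℝ) / δ ≤ 2 ^ n * β * F * M * (1 / δ) := by
    calc (M : ℝ) / δ ≤ (2 ^ n * β * F) * (M / δ) :=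
          le_mul_of_one_le_left (by positivity) hDβf
      _ = _ := by ring
  have hMδ : (M : ℝ) ≤ M / δ := by
    rw [le_div_iff₀ hδ]; nlinarith
  have hceil : (⌈(M : ℝ) / δ⌉₊ : ℝ) ≤ 2 * (M / δ) := by
    have := Nat.ceil_lt_add_one (a := (M : ℝ) / δ) (by positivity)
    linarith
  have htc : (t : ℝ) ≤ ⌈(M : ℝ) / δ⌉₊ := by
    rw [← ht]; exact_mod_cast Nat.log_le_self 2 _
  rw [hY]
  -- Every quantity to be bounded is at most a small multiple of `Z²`, where `Z ≥ 1`; the factor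
  -- `2^10 = 1024` in `(2Z)^10` absorbs the constants.
  generalize 2 ^ n * β * F * M * (1 / δ) = Z at *
  have hZ : ∀ i j : ℕ, i ≤ j → Z ^ i ≤ Z ^ j := fun i j h => pow_le_pow_right₀ q1 h
  have hZ1 : Z ≤ Z ^ 10 := by simpa using hZ 1 10 (by norm_num)
  have hZ2 : Z * Z ≤ Z ^ 10 := by rw [← sq]; exact hZ 2 10 (by norm_num)
  have hX : (2 * Z) ^ 10 = 1024 * Z ^ 10 := by ring
  have hZ0 : 1 ≤ Z ^ 10 := q1.trans hZ1
  have toX : ∀ q : ℕ, (q : ℝ) ≤ 1024 * Z ^ 10 → q ≤ ⌊(2 * Z) ^ 10⌋₊ := fun q hq =>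
    Nat.le_floor (by rw [hX]; exact hq)
  have hn0 : (0 : ℝ) ≤ n := by positivity
  have hnZ : (n : ℝ) ≤ Z := hnD.trans bD
  have hn2 : (n : ℝ) * n ≤ Z * Z := by gcongr
  have hD2 : (2 : ℝ) ^ n * 2 ^ n ≤ Z * Z := by gcongr
  have htM : (t : ℝ) * M ≤ (2 * Z) * Z := by
    gcongr
    · linarith
    · linarith
  refine ⟨⟨hF, le_rfl, le_rfl, toX _ ?_, toX _ ?_, toX _ ?_, toX _ ?_, toX _ ?_, toX _ ?_, toX _ ?_,
    toX _ ?_⟩, toX _ ?_⟩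
  · push_cast; nlinarith
  · push_cast; nlinarith
  · push_cast; linarith
  · push_cast; rw [h4]; linarith
  · push_cast; linarith
  · push_cast; linarith
  · linarith
  · linarith
  · linarith

end Resources
end

theorem theorem1 :
    ∃ (P : Prog) (C : ℝ) (k : ℕ), ∀ (n M F : ℕ) (ε δ B : ℝ)
      (O : Fin M → Op n) (A : Fin M → ObsCircuit n),
      0 < ε → 0 < δ → δ < 1 → 1 ≤ F →
      (∀ j, (A j).Implements (O j)) →
      (∀ j, (A j).gates.length ≤ F) →
      IsGreatest (Set.range fun j => (O j * O j).trace.re) B →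
      -- the estimates are correct with probability at least `1 - δ`
      (∀ ρ : Op n, IsState ρ →
        ENNReal.ofReal (1 - δ) ≤ (P.run A ε δ ρ).toOuterMeasure
          {s | ∀ j : Fin M, |(O j * ρ).trace.re - s.out j| ≤ ε}) ∧
      -- resources, in every possible run
      (∀ ρ : Op n, IsState ρ → ∀ s ∈ (P.run A ε δ ρ).support,
        (s.copies : ℝ) ≤ C * (B / ε ^ 2) * (1 + Real.log (M / δ)) ∧
        (s.time : ℝ) ≤ C * (2 ^ n * max 1 (B / ε ^ 2) * F * M) *
          (1 + Real.log (2 ^ n * M / δ)) ^ k ∧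
        (s.space : ℝ) ≤ C * ((1 + Real.log (2 ^ n) + Real.log M) ^ k +
          M * (1 + Real.log (M / δ))) ∧
        -- natural-number registers are words of logarithmic length
        (s.maxNat : ℝ) ≤ (2 * (2 ^ n * max 1 (B / ε ^ 2) * F * M) / δ) ^ k) ∧
      -- unless the constant estimate `0` is good enough, the procedure is the median of means over
      -- the rescaled outputs of Clifford snapshots, with `K` groups of `L` copies
      (ε ^ 2 < B → ∃ K L : ℕ, 1 ≤ K ∧ 1 ≤ L ∧ ∀ ρ : Op n, IsState ρ →
        (∀ s ∈ (P.run A ε δ ρ).support, s.copies = K * L) ∧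
        (P.run A ε δ ρ).map (fun s (j : Fin M) => s.out j) = qcqcLaw A O ρ K L) := by
  -- The constant comes from the time bound. The exponent `10` is chosen for the size of the stored
  -- numbers; time needs only the power `3`, space only the power `2`.
  refine ⟨qcqcProg, 200000, 10, fun n M F ε δ B O A hε hδ hδ1 hF1 hA hF hB => ?_⟩
  have hB' : IsGreatest (Set.range fun j : Fin M => ∑ b, (A j).label b ^ 2) B := by
    have : (fun j : Fin M => ∑ b, (A j).label b ^ 2) = fun j => (O j * O j).trace.re :=
      funext fun j => ((hA j).trace_sq).symm
    rw [this]; exact hB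
  have hM : 1 ≤ M := by
    obtain ⟨⟨j, _⟩, _⟩ := hB
    have := j.2; omega
  have hB0 : 0 ≤ B := by
    obtain ⟨⟨j, hj⟩, _⟩ := hB'
    rw [← hj]; exact Finset.sum_nonneg fun b _ => sq_nonneg _
  have hm : (1 : ℝ) ≤ M := by exact_mod_cast hM
  have hz : 1 ≤ (M : ℝ) / δ := by rw [le_div_iff₀ hδ]; linarith
  have hlog0 : 0 ≤ Real.log (M / δ) := Real.log_nonneg hz
  have hlogM : 0 ≤ Real.log M := Real.log_nonneg hm
  have hD : (1 : ℝ) ≤ 2 ^ n := one_le_pow₀ (by norm_num)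
  have hlogD : 0 ≤ Real.log (2 ^ n) := Real.log_nonneg hD
  have hεε : ε * ε = ε ^ 2 := (sq ε).symm
  obtain ⟨t, ht⟩ : ∃ t, Nat.log 2 ⌈(M : ℝ) / δ⌉₊ = t := ⟨_, rfl⟩
  obtain ⟨L, hL⟩ : ∃ L, ⌈64 * B / (ε * ε)⌉₊ = L := ⟨_, rfl⟩
  have hK : 2 * (t : ℝ) + 1 ≤ 3 * (1 + Real.log (M / δ)) := by
    rw [← ht]; exact log_ceil_le hz
  have hL65 : (L : ℝ) ≤ 64 * (B / ε ^ 2) + 1 := by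
    have := Nat.ceil_lt_add_one (a := 64 * B / (ε * ε)) (by positivity)
    rw [hL, hεε, mul_div_assoc] at this
    exact this.le
  have hβ : 1 ≤ max 1 (B / ε ^ 2) := le_max_left _ _
  have hLβ : (L : ℝ) ≤ 65 * max 1 (B / ε ^ 2) := by
    have := le_max_right 1 (B / ε ^ 2)
    linarith
  obtain ⟨b, hMδ⟩ := bounds_floor (A := A) hβ hδ hδ1 hF hF1 hM hLβ ht
  have resources : ∀ s : Config n,
      Bdd (3 * n * n + 4 * n + 41) (20 + (2 * t + 1) * M)
        ⌊(2 * (2 ^ n * max 1 (B / ε ^ 2) * F * M) / δ) ^ 10⌋₊ s →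
      s.time ≤ totalTime n M F t L →
      (s.time : ℝ) ≤ 200000 * (2 ^ n * max 1 (B / ε ^ 2) * F * M) *
          (1 + Real.log (2 ^ n * M / δ)) ^ 10 ∧
        (s.space : ℝ) ≤ 200000 * ((1 + Real.log (2 ^ n) + Real.log M) ^ 10 +
          M * (1 + Real.log (M / δ))) ∧
        (s.maxNat : ℝ) ≤ (2 * (2 ^ n * max 1 (B / ε ^ 2) * F * M) / δ) ^ 10 := by
    intro s hs hτ
    refine ⟨?_, ?_, ?_⟩
    · have hΛ : Real.log (2 ^ n * M / δ) = Real.log (2 ^ n) + Real.log (M / δ) := by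
        rw [mul_div_assoc, Real.log_mul (by positivity) (by positivity)]
      have hn := natCast_le_log_two_pow n
      have hT := totalTime_le (n := n) (M := M) (F := F) (t := t) (L := L)
        (Λ := 1 + Real.log (2 ^ n * M / δ)) (by rw [hΛ]; linarith) hβ (by rw [hΛ]; linarith)
        (by rw [hΛ]; linarith) hLβ hM hF1
      calc (s.time : ℝ) ≤ totalTime n M F t L := by exact_mod_cast hτ
        _ ≤ _ := hT
        _ ≤ _ := by
          refine mul_le_mul_of_nonneg_left ?_ (by positivity)
          exact pow_le_pow_right₀ (by rw [hΛ]; linarith) (by norm_num)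
    -- The natural-number registers are the gate list plus a fixed layout, polylogarithmic in `d`;
    -- the real registers are `2t + 1` cells for each observable.
    · have hsp : (s.space : ℝ) ≤ (3 * n * n + 4 * n + 41) + (20 + (2 * t + 1) * M) := by
        have : s.space ≤ (3 * n * n + 4 * n + 41) + (20 + (2 * t + 1) * M) :=
          Nat.add_le_add hs.nat hs.real
        exact_mod_cast this
      have hn := natCast_le_log_two_pow n
      have hq : 1 ≤ 1 + Real.log (2 ^ n) + Real.log M := by linarith
      have hnq : (n : ℝ) ≤ 3 / 2 * (1 + Real.log (2 ^ n) + Real.log M) := by linarith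
      generalize 1 + Real.log (2 ^ n) + Real.log M = q at hq hnq ⊢
      have hq2 : q ^ 2 ≤ q ^ 10 := pow_le_pow_right₀ hq (by norm_num)
      have hq1 : q ≤ q ^ 2 := by nlinarith
      have hn2 : (n : ℝ) * n ≤ 9 / 4 * q ^ 2 := by
        have : (n : ℝ) * n ≤ (3 / 2 * q) * (3 / 2 * q) := by gcongr
        linarith
      have hKM : (2 * (t : ℝ) + 1) * M ≤ 3 * (M * (1 + Real.log (M / δ))) := by
        calc (2 * (t : ℝ) + 1) * M ≤ 3 * (1 + Real.log (M / δ)) * M := by gcongr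
          _ = _ := by ring
      have hKM0 : 0 ≤ (M : ℝ) * (1 + Real.log (M / δ)) := by positivity
      nlinarith
    · have : (s.maxNat : ℝ) ≤ ⌊(2 * (2 ^ n * max 1 (B / ε ^ 2) * F * M) / δ) ^ 10⌋₊ := by
        exact_mod_cast hs.max
      exact this.trans (Nat.floor_le (by positivity))
  rcases lt_or_ge (ε ^ 2) B with hεB | hεB
  · have hr1 : 1 < B / ε ^ 2 := by rw [lt_div_iff₀ (by positivity)]; linarith
    have hBpos : 0 < B := (pow_pos hε 2).trans hεB
    have hL0 : 0 < L := by
      rw [← hL]; exact Nat.ceil_pos.2 (by positivity)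
    have main : ∀ ρ : Op n, IsState ρ → _ := fun ρ hρ =>
      coupled_qcqcProg (δ := δ) hρ hA b hB' hL hL0 ht hMδ (by rw [hεε]; exact hεB)
    have law : ∀ ρ : Op n, IsState ρ → (qcqcProg.run A ε δ ρ).map (fun s (j : Fin M) => s.out j) =
        qcqcLaw A O ρ (2 * t + 1) L := fun ρ hρ =>
      ((main ρ hρ).mono fun o s _ h => funext h.1).map_eq
    refine ⟨fun ρ hρ => ?_, fun ρ hρ s hs => ?_, fun _ => ⟨2 * t + 1, L, by omega, hL0,
      fun ρ hρ => ⟨fun s hs => ?_, law ρ hρ⟩⟩⟩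
    · have hacc := qcqcLaw_accurate hA hρ hε hδ (B := B) (t := t) (L := L)
        (fun j => hB.2 ⟨j, rfl⟩) hL0 ?_ ?_
      · rw [← law ρ hρ, PMF.toOuterMeasure_map_apply] at hacc
        exact hacc
      · rw [← hεε, ← hL]; exact Nat.le_ceil _
      -- The logarithm is rounded down, so `t + 1` is the first exponent sure to reach `M/δ`.
      · have h1 : (⌈(M : ℝ) / δ⌉₊ : ℝ) ≤ 2 ^ (t + 1) := by
          rw [← ht]
          exact_mod_cast (Nat.lt_pow_succ_log_self (by norm_num) _).le
        exact (Nat.le_ceil _).trans h1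
    · obtain ⟨o, _, _, hc, hbd, hτ⟩ := (main ρ hρ).exists_of_mem_support hs
      refine ⟨?_, resources s hbd hτ⟩
      rw [hc]
      push_cast
      -- The rounding error `1` is absorbed because `B/ε² > 1` in this case.
      have hL' : (L : ℝ) ≤ 65 * (B / ε ^ 2) := by linarith
      calc (2 * (t : ℝ) + 1) * L ≤ 3 * (1 + Real.log (M / δ)) * (65 * (B / ε ^ 2)) := by
            gcongr
        _ = 195 * ((B / ε ^ 2) * (1 + Real.log (M / δ))) := by ring
        _ ≤ 200000 * ((B / ε ^ 2) * (1 + Real.log (M / δ))) := by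
            have : 0 ≤ (B / ε ^ 2) * (1 + Real.log (M / δ)) := by positivity
            linarith
        _ = _ := by ring
    · obtain ⟨o, _, _, hc, _⟩ := (main ρ hρ).exists_of_mem_support hs
      exact hc
  -- No copy is used and the estimate is `0` in every run, so success is certain rather than merely
  -- likely.
  · have main : ∀ ρ : Op n, wp A ρ qcqcProg _ (initialConfig n M ε δ) := fun ρ =>
      wp_qcqcProg_zero (ρ := ρ) (ε := ε) (δ := δ) b hB' (by rw [hεε]; exact hεB)
    refine ⟨fun ρ hρ => ?_, fun ρ hρ s hs => ?_, fun h => absurd h (not_lt.2 hεB)⟩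
    · have h1 : (qcqcProg.run A ε δ ρ).toOuterMeasure
          {s | ∀ j : Fin M, |(O j * ρ).trace.re - s.out j| ≤ ε} = 1 := by
        rw [PMF.toOuterMeasure_apply_eq_one_iff]
        intro s hs j
        rw [(main ρ s hs).1 j, sub_zero]
        exact (hA j).abs_trace_mul_le hρ hε.le ((hB.2 ⟨j, rfl⟩).trans hεB)
      rw [h1]
      exact ENNReal.ofReal_le_one.2 (by linarith)
    · obtain ⟨_, hc, hbd, hτ⟩ := main ρ s hs
      refine ⟨?_, resources s hbd hτ⟩
      rw [hc, Nat.cast_zero]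
      positivity
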